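/- **Model.** A RAM has registers $R_0,R_1,\dots$ holding unbounded natural numbers, indirect addressing, the arithmetic instructions comparison, addition, (truncated) subtraction and multiplication, and an instruction that outputs the word $R_iR_{i+1}\cdots R_j$ formed by a block of consecutive registers, where the positions $i,j$ are themselves read from registers. An arithmetic instruction on $u,v$ takes time $1+\lfloor\log_2(u+v)\rfloor$ (time $1$ if $u+v=0$); every other instruction takes time $1$. An input word is given one letter per register, together with its length; all other registers are initially $0$. **Enumeration problems.** Fix a finite alphabet $\Sigma$ with at least two letters. An enumeration problem $A$ associates to each $x\in\Sigma^*$ a set $A(x)\subseteq\Sigma^*$ of solutions. It is in $\mathrm{EnumP}$ if there is a polynomial $p$ with $|y|\le p(|x|)$ for all $x$ and all $y\in A(x)$, and "given $x,y$, is $y\in A(x)$?" can be decided in time polynomial in $|x|+|y|$. A machine $M$ solves $A$ if on every input $x$ it halts, having output every element of $A(x)$ exactly once and nothing else, and it stops as soon as the last solution has been output. $T(x,k)$ denotes the time at which the $k$-th output on input $x$ is executed; if $A(x)=\emptyset$, $T(x,1)$ denotes the total running time. For a real $a\ge 1$, $\mathrm{IncP}_a$ is the class of all $A\in\mathrm{EnumP}$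 for which there are a machine $M$ solving $A$, a polynomial $p$ and constants $b,C$ such that for all $x$, with $n=|x|$, $$T(x,1)\le p(n),\qquad T(x,k)-T(x,1)\le C\,k^a\,(n+1)^b\quad\text{for all }1\le k\le|A(x)|.$$ **Exponential Time Hypothesis (ETH).** There is $\varepsilon>0$ such that no RAM decides the satisfiability of 3-CNF formulas with $n$ variables (and pairwise distinct clauses) in time $2^{\varepsilon n}n^{O(1)}$ (that is, in time at most $C\,2^{\varepsilon n}(n+1)^d$ for constants $C,d$). **Theorem.** If ETH holds, then $\mathrm{IncP}_a\subsetneq\mathrm{IncP}_b$ for all real numbers $1\le a<b$. -/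

import Mathlib

namespace EnumComplexity

/-! ### The random access machine

Registers `R_0, R_1, …` hold unbounded natural numbers (so subtraction is cut off at `0`).
There are the arithmetic instructions comparison, addition, subtraction and multiplication,
indirect addressing, and an instruction that outputs a block of consecutive registers. -/

/-- The instructions; the arguments `d`, `s`, `t` are register numbers, `l` is a program line. -/
inductive Instr : Type
  /-- `R_d := n` -/
  | const (d n : ℕ)
  /-- `R_d := R_s` -/
  | copy (d s : ℕ)
  /-- `R_d := R_{R_s}` -/
  | load (d s : ℕ)
  /-- `R_{R_d} := R_s` -/
  | store (d s : ℕ)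
  /-- `R_d := R_s + R_t` -/
  | add (d s t : ℕ)
  /-- `R_d := R_s - R_t` -/
  | sub (d s t : ℕ)
  /-- `R_d := R_s * R_t` -/
  | mul (d s t : ℕ)
  /-- go to line `l` -/
  | jump (l : ℕ)
  /-- go to line `l` if `R_s < R_t` -/
  | jlt (s t l : ℕ)
  /-- output the word `R_i, R_{i+1}, …, R_j` where `i = R_s` and `j = R_t` (empty if `j < i`) -/
  | output (s t : ℕ)
  /-- stop -/
  | halt

/-- A program: a finite list of instructions, with lines numbered from `0`. -/
abbrev Program : Type := List Instr

/-- The configuration of a machine, together with the time consumed so far and the list of the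
words output so far, in order, each with the time at which its output was executed. -/
structure Config : Type where
  pc : ℕ
  reg : ℕ → ℕ
  time : ℕ
  log : List (List ℕ × ℕ)

/-- The time of an arithmetic instruction called on `u` and `v`: logarithmic in `u + v`. -/
def logCost (u v : ℕ) : ℕ := 1 + Nat.log 2 (u + v)

/-- The word `R_i, R_{i+1}, …, R_j`. -/
def block (reg : ℕ → ℕ) (i j : ℕ) : List ℕ := (List.range' i (j + 1 - i)).map reg

/-- Write `v` in register `d`, spend time `t`, and go to the next line. -/
def Config.write (c : Config) (d v t : ℕ) : Config :=
  { c with pc := c.pc + 1, reg := Function.update c.reg d v, time := c.time + t }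

/-- One instruction. All instructions take time `1`, except that the arithmetic instructions take
logarithmic time. The result is `none` if the machine has stopped, which is the case at an
instruction `halt` and at a line number outside the program. -/
def step (P : Program) (c : Config) : Option Config :=
  match P[c.pc]? with
  | none => none
  | some .halt => none
  | some (.const d n) => some (c.write d n 1)
  | some (.copy d s) => some (c.write d (c.reg s) 1)
  | some (.load d s) => some (c.write d (c.reg (c.reg s)) 1)
  | some (.store d s) => some (c.write (c.reg d) (c.reg s) 1)
  | some (.add d s t) => some (c.write d (c.reg s + c.reg t) (logCost (c.reg s) (c.reg t)))
  | some (.sub d s t) => some (c.write d (c.reg s - c.reg t) (logCost (c.reg s) (c.reg t)))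
  | some (.mul d s t) => some (c.write d (c.reg s * c.reg t) (logCost (c.reg s) (c.reg t)))
  | some (.jump l) => some { c with pc := l, time := c.time + 1 }
  | some (.jlt s t l) =>
      some { c with
        pc := if c.reg s < c.reg t then l else c.pc + 1
        time := c.time + logCost (c.reg s) (c.reg t) }
  | some (.output s t) =>
      some { c with
        pc := c.pc + 1
        time := c.time + 1
        log := c.log ++ [(block c.reg (c.reg s) (c.reg t), c.time + 1)] }

/-- The initial configuration on the input `w`: register `R_0` holds the length of `w`, the
registers `R_1, R_2, …` hold the letters of `w`, and all other registers hold `0`. -/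
def init (w : List ℕ) : Config where
  pc := 0
  reg := fun i => if i = 0 then w.length else w.getD (i - 1) 0
  time := 0
  log := []

/-- On input `w`, the program `P` stops, and `c` is its (unique) final configuration. -/
def HaltsWith (P : Program) (w : List ℕ) (c : Config) : Prop :=
  StateTransition.Reaches (step P) (init w) c ∧ step P c = none

/-- For the final configuration `c` of a run, the time `T(x, k)` at which the `k`-th output
(counted from `1`) is executed; if there are fewer than `k` outputs, the time of the whole run. -/
def outTime (c : Config) (k : ℕ) : ℕ := ((c.log.map Prod.snd)[k - 1]?).getD c.time

/-! ### Enumeration problems -/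

/-- Words over the alphabet with the `q` letters `0, …, q - 1`. -/
abbrev Word (q : ℕ) : Type := List (Fin q)

/-- A word as a sequence of numbers: one register per letter. -/
def Word.code {q : ℕ} (x : Word q) : List ℕ := x.map Fin.val

/-- The enumeration problem of a binary predicate: it sends `x` to its set of solutions. -/
abbrev EnumProblem (q : ℕ) : Type := Word q → Set (Word q)

/-- The sizes of the solutions are bounded by a polynomial in the size of the instance. -/
def PolyBalanced {q : ℕ} (A : EnumProblem q) : Prop :=
  ∃ p : Polynomial ℕ, ∀ x, ∀ y ∈ A x, y.length ≤ p.eval x.length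

/-- The input of a machine for a pair of words: the length of `x`, then `x`, then `y`. -/
def pairCode {q : ℕ} (x y : Word q) : List ℕ := x.length :: (Word.code x ++ Word.code y)

/-- Deciding, given `x` and `y`, whether `y ∈ A x` is possible in polynomial time. A machine
accepts if `R_0` is not `0` when it stops. -/
def TestInP {q : ℕ} (A : EnumProblem q) : Prop :=
  ∃ (P : Program) (p : Polynomial ℕ), ∀ x y : Word q, ∃ c : Config,
    HaltsWith P (pairCode x y) c ∧ (c.reg 0 ≠ 0 ↔ y ∈ A x) ∧
      c.time ≤ p.eval (x.length + y.length)

/-- The class `EnumP`. -/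
def EnumP (q : ℕ) : Set (EnumProblem q) := {A | PolyBalanced A ∧ TestInP A}

/-- The program `P` solves `A`: on every input `x` it stops, having output every solution
exactly once and nothing else, and it stops as soon as the last solution is output. -/
def Solves {q : ℕ} (P : Program) (A : EnumProblem q) : Prop :=
  ∀ x : Word q, ∃ (c : Config) (ys : List (Word q)),
    HaltsWith P (Word.code x) c ∧
    c.log.map Prod.fst = ys.map Word.code ∧
    ys.Nodup ∧ (∀ y, y ∈ ys ↔ y ∈ A x) ∧
    ∀ e ∈ c.log.getLast?, e.2 = c.time

/-- The class `IncP_a`: preprocessing in polynomial time, and incremental time `O(k ^ a * n ^ b)`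
for a constant `b`. (The factor is `(n + 1) ^ b` for the sake of the empty instance.) -/
def IncP (q : ℕ) (a : ℝ) : Set (EnumProblem q) :=
  {A | A ∈ EnumP q ∧ ∃ (P : Program) (p : Polynomial ℕ) (C b : ℕ), Solves P A ∧
    ∀ (x : Word q) (c : Config), HaltsWith P (Word.code x) c →
      outTime c 1 ≤ p.eval x.length ∧
      ∀ k : ℕ, 1 ≤ k → k ≤ c.log.length →
        (outTime c k : ℝ) - (outTime c 1 : ℝ) ≤ C * (k : ℝ) ^ a * ((x.length : ℝ) + 1) ^ b}

/-! ### The Exponential Time Hypothesis -/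

/-- A literal over `n` variables: `(i, true)` is the `i`-th variable, `(i, false)` its negation. -/
abbrev Literal (n : ℕ) : Type := Fin n × Bool

/-- A clause of three literals; they may coincide, so that shorter clauses are covered. -/
abbrev Clause3 (n : ℕ) : Type := Literal n × Literal n × Literal n

/-- The assignment `v` satisfies the clause. -/
def Clause3.Holds {n : ℕ} (v : Fin n → Bool) (C : Clause3 n) : Prop :=
  v C.1.1 = C.1.2 ∨ v C.2.1.1 = C.2.1.2 ∨ v C.2.2.1 = C.2.2.2

/-- The 3-CNF formula with the given clauses is satisfiable. -/
def Satisfiable {n : ℕ} (φ : List (Clause3 n)) : Prop :=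
  ∃ v : Fin n → Bool, ∀ C ∈ φ, Clause3.Holds v C

/-- The number of a literal: `2 i + 1` for the `i`-th variable and `2 i` for its negation. -/
def Literal.code {n : ℕ} (l : Literal n) : ℕ := 2 * l.1.val + l.2.toNat

/-- The input of a machine for a formula: the number of variables, then the literals. -/
def cnfCode {n : ℕ} (φ : List (Clause3 n)) : List ℕ :=
  n :: φ.flatMap fun C => [Literal.code C.1, Literal.code C.2.1, Literal.code C.2.2]

/-- 3-SAT can be decided in time `2 ^ (ε n) * n ^ O(1)`, where `n` is the number of variables. The
clauses of a formula are pairwise distinct, so that its size is polynomial in `n`. -/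
def Sat3InTime (ε : ℝ) : Prop :=
  ∃ (P : Program) (C d : ℕ), ∀ (n : ℕ) (φ : List (Clause3 n)), φ.Nodup → ∃ c : Config,
    HaltsWith P (cnfCode φ) c ∧ (c.reg 0 ≠ 0 ↔ Satisfiable φ) ∧
      (c.time : ℝ) ≤ C * (2 : ℝ) ^ (ε * n) * ((n : ℝ) + 1) ^ d

/-- The Exponential Time Hypothesis. -/
def ETH : Prop := ∃ ε : ℝ, 0 < ε ∧ ¬ Sat3InTime ε

end EnumComplexity

/-!
The separating problems are versions of 3-SAT that are padded with trivial solutions. Let `Search δ`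
mean that a machine finds a satisfying assignment of a 3-CNF formula with `n` variables, if there is
one, in time `2 ^ (δ n)` up to polynomial factors. Exhaustive search shows `Search 1`, and
`Search δ` implies `Sat3InTime δ` (`Search.sat3InTime`); so the Exponential Time Hypothesis says that
the infimum `s` of all these `δ` is positive.

For natural numbers `u` and `v`, an instance of the problem `padded q u v` encodes, in unary, a number
`ρ` and a formula with `n = v ρ` variables. Its solutions are all words `0 t` with `t` of length
`u ρ`, and all words `1 a z`, where `a` is a satisfying assignment and `z` is an arbitrary word of
length `n`, both words being binary. Two facts link this problem to `Search`.

* If the problem is in `IncP q a`, then `Search (a u / v)` (`search_of_mem_incP`): at most `2 ^ (u ρ)`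
  solutions are trivial, so if the formula is satisfiable, one of the first `2 ^ (u ρ) + 1` solutions
  shows a satisfying assignment, and it appears in time about `2 ^ (a u ρ) = 2 ^ ((a u / v) n)`. The
  search algorithm simulates the given enumeration algorithm until then.

* If `Search δ` and `δ v ≤ b u`, then the problem is in `IncP q b` (`padded_mem_incP`): first all
  trivial solutions but one are output, then a satisfying assignment is searched, in time
  `2 ^ (δ n) ≤ (2 ^ (u ρ)) ^ b`, which is allowed at this point. If there is one, `V`, then the
  assignments `V xor j` are tested for `j = 0, 1, …, 2 ^ n - 1`. The first of them is `V` itself, and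
  its `2 ^ n` solutions pay for all the tests to come; therefore the words `z` are part of the
  solutions. The last trivial solution is output at the very end.

For `a < b`, there are `δ < s b / a` with `Search δ` and a rational number `u / v` between `δ / b` and
`s / a`. Then `padded q u v` is in `IncP q b`, but not in `IncP q a`, for `a u / v < s`.

The machines are composed of program fragments (`Frag`), which may be put at any position of a program
(`Frag.Exec`, `Frag.Quiet`). By convention the registers from `R_0` to `R_9` are for temporary use, those
from `R_10` to `R_31` hold addresses, sizes and flags, and tables start at `R_32` or later. The
simulation (`Frag.sim`) needs no lookup table: all registers behind the tables still hold `0`, and the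
value `k > 0` is represented by `k + B`, also when it serves as an address, so that one instruction takes
a bounded number of steps.
-/

set_option linter.unusedSimpArgs false
set_option linter.unusedVariables false

namespace EnumComplexity

/-! ### Position-independent program fragments -/

/-- The contents of a machine apart from the program counter. -/
structure Store : Type where
  reg : ℕ → ℕ
  time : ℕ
  log : List (List ℕ × ℕ)

/-- The configuration with the given store and program counter. -/
def Store.config (σ : Store) (pc : ℕ) : Config := ⟨pc, σ.reg, σ.time, σ.log⟩

/-- Let time pass. -/
def Store.tick (σ : Store) (t : ℕ) : Store := { σ with time := σ.time + t }

/-- The program `P` contains the instructions `l` from line `o` on. -/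
def CodeAt (P : Program) (o : ℕ) (l : List Instr) : Prop := ∀ i < l.length, P[o + i]? = l[i]?

theorem CodeAt.append {P : Program} {o : ℕ} {l m : List Instr} (h : CodeAt P o (l ++ m)) :
    CodeAt P o l ∧ CodeAt P (o + l.length) m := by
  constructor
  · intro i hi
    rw [h i (by simp; omega), List.getElem?_append_left hi]
  · intro i hi
    rw [add_assoc, h (l.length + i) (by simp; omega), List.getElem?_append_right (by omega)]
    simp

theorem CodeAt.head {P : Program} {o : ℕ} {a : Instr} {l : List Instr} (h : CodeAt P o (a :: l)) :
    P[o]? = some a := by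
  simpa using h 0 (by simp)

theorem CodeAt.tail {P : Program} {o : ℕ} {a : Instr} {l : List Instr} (h : CodeAt P o (a :: l)) :
    CodeAt P (o + 1) l := by
  intro i hi
  have := h (i + 1) (by simpa using hi)
  rw [show o + 1 + i = o + (i + 1) by ring, this]
  simp

/-- A piece of code that can be put at any position of a program. Control enters it at its first
line and leaves it at the line after its last one; jump targets depend on the position. -/
structure Frag : Type where
  len : ℕ
  code : ℕ → List Instr
  length_code : ∀ o, (code o).length = len

/-- Wherever the fragment occurs in a program, it leads from the store `σ` to the store `σ'`. -/
def Frag.Exec (F : Frag) (σ σ' : Store) : Prop :=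
  ∀ (P : Program) (o : ℕ), CodeAt P o (F.code o) →
    StateTransition.Reaches (step P) (σ.config o) (σ'.config (o + F.len))

/-- The fragment leads from the registers `r` to the registers `r'`, takes time at most `t`, and
outputs nothing. -/
def Frag.Quiet (F : Frag) (r : ℕ → ℕ) (t : ℕ) (r' : ℕ → ℕ) : Prop :=
  ∀ T g, ∃ t' ≤ t, F.Exec ⟨r, T, g⟩ ⟨r', T + t', g⟩

/-- Concatenation of fragments. -/
instance : Append Frag where
  append F G :=
    { len := F.len + G.len
      code := fun o => F.code o ++ G.code (o + F.len)
      length_code := fun o => by simp [F.length_code, G.length_code] }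

theorem Frag.Exec.append {F G : Frag} {σ₁ σ₂ σ₃ : Store} (h₁ : F.Exec σ₁ σ₂) (h₂ : G.Exec σ₂ σ₃) :
    (F ++ G).Exec σ₁ σ₃ := by
  intro P o h
  obtain ⟨hF, hG⟩ := CodeAt.append (show CodeAt P o (F.code o ++ G.code (o + F.len)) from h)
  rw [F.length_code] at hG
  have := (h₁ P o hF).trans (h₂ P _ hG)
  rwa [add_assoc] at this

theorem Frag.Quiet.append {F G : Frag} {r₁ r₂ r₃ : ℕ → ℕ} {t₁ t₂ : ℕ} (h₁ : F.Quiet r₁ t₁ r₂)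
    (h₂ : G.Quiet r₂ t₂ r₃) : (F ++ G).Quiet r₁ (t₁ + t₂) r₃ := by
  intro T g
  obtain ⟨s₁, hs₁, e₁⟩ := h₁ T g
  obtain ⟨s₂, hs₂, e₂⟩ := h₂ (T + s₁) g
  exact ⟨s₁ + s₂, by omega, by rw [← add_assoc]; exact e₁.append e₂⟩

theorem Frag.Quiet.mono {F : Frag} {r r' : ℕ → ℕ} {t t' : ℕ} (h : F.Quiet r t r') (ht : t ≤ t') :
    F.Quiet r t' r' := by
  intro T g
  obtain ⟨s, hs, e⟩ := h T g
  exact ⟨s, hs.trans ht, e⟩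

theorem Frag.Quiet.exec {F : Frag} {r r' : ℕ → ℕ} {t : ℕ} (h : F.Quiet r t r') {σ : Store}
    (hr : σ.reg = r) : ∃ t' ≤ t, F.Exec σ ⟨r', σ.time + t', σ.log⟩ := by
  subst hr
  exact h σ.time σ.log

/-! ### Straight-line code -/

/-- The effect of an instruction on the registers, if it is not a jump. -/
def Instr.eval (r : ℕ → ℕ) : Instr → ℕ → ℕ
  | .const d n => Function.update r d n
  | .copy d s => Function.update r d (r s)
  | .load d s => Function.update r d (r (r s))
  | .store d s => Function.update r (r d) (r s)
  | .add d s t => Function.update r d (r s + r t)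
  | .sub d s t => Function.update r d (r s - r t)
  | .mul d s t => Function.update r d (r s * r t)
  | _ => r

/-- The time of an instruction that is not a jump. -/
def Instr.cost (r : ℕ → ℕ) : Instr → ℕ
  | .add _ s t => logCost (r s) (r t)
  | .sub _ s t => logCost (r s) (r t)
  | .mul _ s t => logCost (r s) (r t)
  | _ => 1

/-- The instruction writes to a register and continues at the next line. -/
def Instr.Writes : Instr → Bool
  | .jump _ => false
  | .jlt _ _ _ => false
  | .output _ _ => false
  | .halt => false
  | _ => true

/-- The effect of a list of writing instructions on the registers. -/
def evalOps : List Instr → (ℕ → ℕ) → ℕ → ℕ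
  | [], r => r
  | i :: l, r => evalOps l (i.eval r)

/-- The time of a list of writing instructions. -/
def costOps : List Instr → (ℕ → ℕ) → ℕ
  | [], _ => 0
  | i :: l, r => i.cost r + costOps l (i.eval r)

/-- The fragment given by a list of instructions without jumps. -/
def Frag.ops (l : List Instr) : Frag := ⟨l.length, fun _ => l, fun _ => rfl⟩

theorem reaches_ops {P : Program} (l : List Instr) (hl : ∀ i ∈ l, i.Writes) :
    ∀ (o : ℕ) (r : ℕ → ℕ) (T : ℕ) (g : List (List ℕ × ℕ)), CodeAt P o l →
    StateTransition.Reaches (step P) ⟨o, r, T, g⟩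
      ⟨o + l.length, evalOps l r, T + costOps l r, g⟩ := by
  induction l with
  | nil => intro o r T g _; exact Relation.ReflTransGen.refl
  | cons i l ih =>
    intro o r T g h
    refine Relation.ReflTransGen.head (b := ⟨o + 1, i.eval r, T + i.cost r, g⟩) ?_ ?_
    · have hi := hl i (by simp)
      have hP := h.head
      cases i <;> simp_all [step, Config.write, Instr.eval, Instr.cost, Instr.Writes]
    · have := ih (fun j hj => hl j (by simp [hj])) (o + 1) (i.eval r) (T + i.cost r) g h.tail
      rw [add_assoc T] at this
      rwa [List.length_cons, show o + (l.length + 1) = o + 1 + l.length by ring]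

theorem Frag.quiet_ops (l : List Instr) (hl : ∀ i ∈ l, i.Writes) (r : ℕ → ℕ) :
    (Frag.ops l).Quiet r (costOps l r) (evalOps l r) := by
  intro T g
  exact ⟨_, le_rfl, fun P o h => reaches_ops l hl o r T g h⟩

theorem logCost_le (u v : ℕ) : logCost u v ≤ 1 + u + v := by
  have := Nat.log_le_self 2 (u + v)
  unfold logCost
  omega

/-- A coarse bound on the time of a list of writing instructions. -/
def boundOps : List Instr → (ℕ → ℕ) → ℕ
  | [], _ => 0
  | i :: l, r =>
    (match i with
      | .add _ s t => 1 + r s + r t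
      | .sub _ s t => 1 + r s + r t
      | .mul _ s t => 1 + r s + r t
      | _ => 1) + boundOps l (i.eval r)

theorem costOps_le (l : List Instr) : ∀ r, costOps l r ≤ boundOps l r := by
  induction l with
  | nil => intro r; exact le_rfl
  | cons i l ih =>
    intro r
    have := ih (i.eval r)
    cases i with
    | add d s t | sub d s t | mul d s t =>
      have := logCost_le (r s) (r t)
      simp only [costOps, boundOps, Instr.cost]
      omega
    | _ => simp only [costOps, boundOps, Instr.cost]; omega

theorem Frag.quiet_ops_bound (l : List Instr) (hl : ∀ i ∈ l, i.Writes) (r : ℕ → ℕ) (t : ℕ)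
    (ht : boundOps l r ≤ t) : (Frag.ops l).Quiet r t (evalOps l r) :=
  (Frag.quiet_ops l hl r).mono ((costOps_le l r).trans ht)

/-! ### Branches and loops -/

/-- `if R_s < R_t then F else G` -/
def Frag.ifLt (s t : ℕ) (F G : Frag) : Frag where
  len := 1 + G.len + 1 + F.len
  code := fun o =>
    ([.jlt s t (o + 1 + G.len + 1)] ++ G.code (o + 1)) ++
      ([.jump (o + 1 + G.len + 1 + F.len)] ++ F.code (o + 1 + G.len + 1))
  length_code := fun o => by simp [F.length_code, G.length_code]; ring

/-- `while R_s < R_t do F` -/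
def Frag.whileLt (s t : ℕ) (F : Frag) : Frag where
  len := 1 + F.len + 1
  code := fun o => ([.jump (o + 1 + F.len)] ++ F.code (o + 1)) ++ [.jlt s t (o + 1)]
  length_code := fun o => by simp [F.length_code]; ring

theorem Frag.exec_ifLt_true {s t : ℕ} {F G : Frag} {σ σ' : Store} (h : σ.reg s < σ.reg t)
    (hF : F.Exec (σ.tick (logCost (σ.reg s) (σ.reg t))) σ') : (Frag.ifLt s t F G).Exec σ σ' := by
  intro P o hP
  obtain ⟨h₁, h₂⟩ := CodeAt.append hP
  obtain ⟨h₃, h₄⟩ := CodeAt.append h₁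
  obtain ⟨h₅, h₆⟩ := CodeAt.append h₂
  simp only [List.length_append, List.length_cons, List.length_nil, G.length_code, zero_add,
    ← add_assoc] at h₅ h₆
  have h₇ := hF P _ h₆
  refine Relation.ReflTransGen.head (b := (σ.tick (logCost (σ.reg s) (σ.reg t))).config (o + 1 + G.len + 1)) ?_ ?_
  · have := h₃.head
    simp [step, Store.config, this, h, Store.tick]
  · rwa [show o + (Frag.ifLt s t F G).len = o + 1 + G.len + 1 + F.len by
      simp only [Frag.ifLt]; ring]

theorem Frag.exec_ifLt_false {s t : ℕ} {F G : Frag} {σ σ' : Store} (h : ¬ σ.reg s < σ.reg t)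
    (hG : G.Exec (σ.tick (logCost (σ.reg s) (σ.reg t))) σ') :
    (Frag.ifLt s t F G).Exec σ (σ'.tick 1) := by
  intro P o hP
  obtain ⟨h₁, h₂⟩ := CodeAt.append hP
  obtain ⟨h₃, h₄⟩ := CodeAt.append h₁
  obtain ⟨h₅, h₆⟩ := CodeAt.append h₂
  simp only [List.length_append, List.length_cons, List.length_nil, G.length_code, zero_add,
    ← add_assoc] at h₄ h₅ h₆
  refine Relation.ReflTransGen.head (b := (σ.tick (logCost (σ.reg s) (σ.reg t))).config (o + 1))
    ?_ ?_
  · have := h₃.head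
    simp [step, Store.config, this, h, Store.tick]
  · refine (hG P _ h₄).trans (Relation.ReflTransGen.single ?_)
    have := h₅.head
    simp [step, Store.config, this, Store.tick, Frag.ifLt]
    ring

theorem Frag.quiet_ifLt_true {s t : ℕ} {F G : Frag} {r r' : ℕ → ℕ} {c : ℕ} (h : r s < r t)
    (hF : F.Quiet r c r') : (Frag.ifLt s t F G).Quiet r (c + r s + r t + 2) r' := by
  intro T g
  obtain ⟨c', hc, e⟩ := hF (T + logCost (r s) (r t)) g
  have := logCost_le (r s) (r t)
  refine ⟨logCost (r s) (r t) + c', by omega, Frag.exec_ifLt_true (σ := ⟨r, T, g⟩) h ?_⟩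
  rw [← add_assoc]
  exact e

theorem Frag.quiet_ifLt_false {s t : ℕ} {F G : Frag} {r r' : ℕ → ℕ} {c : ℕ} (h : ¬ r s < r t)
    (hG : G.Quiet r c r') : (Frag.ifLt s t F G).Quiet r (c + r s + r t + 2) r' := by
  intro T g
  obtain ⟨c', hc, e⟩ := hG (T + logCost (r s) (r t)) g
  have := logCost_le (r s) (r t)
  refine ⟨logCost (r s) (r t) + c' + 1, by omega, ?_⟩
  have := Frag.exec_ifLt_false (σ := ⟨r, T, g⟩) (F := F) h e
  simpa only [Store.tick, add_assoc] using this

/-- The rule for loops. The stores `σ` in the invariant are those at the moment when the condition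
is evaluated. -/
theorem Frag.exec_whileLt {s t : ℕ} {F : Frag} (N : ℕ) (Inv : ℕ → Store → Prop)
    (hN : ∀ k σ, Inv k σ → σ.reg s < σ.reg t → k < N)
    (hF : ∀ k σ, Inv k σ → σ.reg s < σ.reg t →
      ∃ σ', F.Exec (σ.tick (logCost (σ.reg s) (σ.reg t))) σ' ∧ Inv (k + 1) σ')
    (σ : Store) (hσ : Inv 0 (σ.tick 1)) :
    ∃ k σ', Inv k σ' ∧ ¬ σ'.reg s < σ'.reg t ∧
      (Frag.whileLt s t F).Exec σ (σ'.tick (logCost (σ'.reg s) (σ'.reg t))) := by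
  have key : ∀ d k σ, N ≤ k + d → Inv k σ →
      ∃ k' σ', Inv k' σ' ∧ ¬ σ'.reg s < σ'.reg t ∧ ∀ P o,
        CodeAt P o ((Frag.whileLt s t F).code o) →
        StateTransition.Reaches (step P) (σ.config (o + 1 + F.len))
          ((σ'.tick (logCost (σ'.reg s) (σ'.reg t))).config (o + (1 + F.len + 1))) := by
    intro d
    induction d with
    | zero =>
      intro k σ hk hI
      refine ⟨k, σ, hI, fun h => by have := hN k σ hI h; omega, fun P o hP => ?_⟩
      obtain ⟨h₁, h₂⟩ := CodeAt.append hP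
      simp only [List.length_append, List.length_cons, List.length_nil, F.length_code, zero_add,
        ← add_assoc] at h₂
      have hc : ¬ σ.reg s < σ.reg t := fun h => by have := hN k σ hI h; omega
      refine Relation.ReflTransGen.single ?_
      have := h₂.head
      simp [step, Store.config, this, hc, Store.tick, ← add_assoc]
    | succ d ih =>
      intro k σ hk hI
      by_cases hc : σ.reg s < σ.reg t
      · obtain ⟨σ₁, e₁, hI₁⟩ := hF k σ hI hc
        obtain ⟨k', σ', hI', hc', hR⟩ := ih (k + 1) σ₁ (by omega) hI₁
        refine ⟨k', σ', hI', hc', fun P o hP => ?_⟩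
        have hR' := hR P o hP
        obtain ⟨h₁, h₂⟩ := CodeAt.append hP
        obtain ⟨h₃, h₄⟩ := CodeAt.append h₁
        simp only [List.length_append, List.length_cons, List.length_nil, F.length_code, zero_add,
          ← add_assoc] at h₂ h₄
        refine Relation.ReflTransGen.head
          (b := (σ.tick (logCost (σ.reg s) (σ.reg t))).config (o + 1)) ?_ ((e₁ P _ h₄).trans hR')
        have := h₂.head
        simp [step, Store.config, this, hc, Store.tick]
      · refine ⟨k, σ, hI, hc, fun P o hP => ?_⟩
        obtain ⟨h₁, h₂⟩ := CodeAt.append hP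
        simp only [List.length_append, List.length_cons, List.length_nil, F.length_code, zero_add,
          ← add_assoc] at h₂
        refine Relation.ReflTransGen.single ?_
        have := h₂.head
        simp [step, Store.config, this, hc, Store.tick, ← add_assoc]
  obtain ⟨k, σ', hI, hc, hR⟩ := key N 0 (σ.tick 1) (by omega) hσ
  refine ⟨k, σ', hI, hc, fun P o hP => ?_⟩
  refine Relation.ReflTransGen.head ?_ (hR P o hP)
  obtain ⟨h₁, h₂⟩ := CodeAt.append hP
  have := (CodeAt.append h₁).1.head
  simp [step, Store.config, this, Store.tick]

/-- The rule for loops without output: `N` bounds the number of rounds, `T` the time of a round,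
and `c` the numbers compared. -/
theorem Frag.quiet_whileLt {s t : ℕ} {F : Frag} (N T c : ℕ) (Inv : ℕ → (ℕ → ℕ) → Prop)
    (hN : ∀ k r, Inv k r → r s < r t → k < N) (hc : ∀ k r, Inv k r → r s + r t ≤ c)
    (hF : ∀ k r, Inv k r → r s < r t → ∃ r', F.Quiet r T r' ∧ Inv (k + 1) r')
    (r : ℕ → ℕ) (hr : Inv 0 r) :
    ∃ k r', k ≤ N ∧ Inv k r' ∧ ¬ r' s < r' t ∧
      (Frag.whileLt s t F).Quiet r (N * (T + c + 1) + c + 2) r' := by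
  have key : ∀ d k r, N ≤ k + d → k ≤ N → Inv k r → ∃ k' r', k' ≤ N ∧ Inv k' r' ∧
      ¬ r' s < r' t ∧
      ∀ T₀ g, ∃ t' ≤ (N - k) * (T + c + 1), ∀ P o,
        CodeAt P o ((Frag.whileLt s t F).code o) →
        StateTransition.Reaches (step P) ⟨o + 1 + F.len, r, T₀, g⟩
          ⟨o + 1 + F.len, r', T₀ + t', g⟩ := by
    intro d
    induction d with
    | zero =>
      intro k r hk hk' hI
      exact ⟨k, r, hk', hI, fun h => by have := hN k r hI h; omega, fun T₀ g =>
        ⟨0, by omega, fun P o _ => Relation.ReflTransGen.refl⟩⟩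
    | succ d ih =>
      intro k r hk hk' hI
      by_cases hlt : r s < r t
      · have hkN := hN k r hI hlt
        obtain ⟨r₁, e₁, hI₁⟩ := hF k r hI hlt
        obtain ⟨k', r', hkk, hI', hc', hR⟩ := ih (k + 1) r₁ (by omega) hkN hI₁
        refine ⟨k', r', hkk, hI', hc', fun T₀ g => ?_⟩
        obtain ⟨t₁, ht₁, e₁⟩ := e₁ (T₀ + logCost (r s) (r t)) g
        obtain ⟨t₂, ht₂, e₂⟩ := hR (T₀ + logCost (r s) (r t) + t₁) g
        refine ⟨logCost (r s) (r t) + t₁ + t₂, ?_, fun P o hP => ?_⟩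
        · have h1 := logCost_le (r s) (r t)
          have h2 := hc k r hI
          obtain ⟨e, he⟩ : ∃ e, N - k = e + 1 := ⟨N - k - 1, by omega⟩
          rw [show N - (k + 1) = e by omega] at ht₂
          rw [he, add_mul]
          omega
        · have hR' := e₂ P o hP
          obtain ⟨h₁, h₂⟩ := CodeAt.append hP
          obtain ⟨h₃, h₄⟩ := CodeAt.append h₁
          simp only [List.length_append, List.length_cons, List.length_nil, F.length_code,
            zero_add, ← add_assoc] at h₂ h₄
          have hE := e₁ P _ h₄
          simp only [Store.config] at hE
          refine Relation.ReflTransGen.head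
            (b := ⟨o + 1, r, T₀ + logCost (r s) (r t), g⟩) ?_ ?_
          · have := h₂.head
            simp [step, this, hlt]
          · simp only [← add_assoc]
            exact hE.trans hR'
      · exact ⟨k, r, hk', hI, hlt, fun T₀ g => ⟨0, by omega, fun P o _ => Relation.ReflTransGen.refl⟩⟩
  obtain ⟨k, r', hkN, hI, hlt, hR⟩ := key N 0 r (by omega) (by omega) hr
  refine ⟨k, r', hkN, hI, hlt, fun T₀ g => ?_⟩
  obtain ⟨t', ht', hR⟩ := hR (T₀ + 1) g
  refine ⟨1 + t' + logCost (r' s) (r' t), ?_, fun P o hP => ?_⟩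
  · have h1 := logCost_le (r' s) (r' t)
    have h2 := hc k r' hI
    simp only [tsub_zero] at ht'
    omega
  · have hR' := hR P o hP
    obtain ⟨h₁, h₂⟩ := CodeAt.append hP
    simp only [List.length_append, List.length_cons, List.length_nil, F.length_code,
            zero_add, ← add_assoc] at h₂
    refine Relation.ReflTransGen.head ?_ (hR'.tail ?_)
    · have := (CodeAt.append h₁).1.head
      simp [step, Store.config, this]
    · have := h₂.head
      simp [step, this, hlt, Store.config, Frag.whileLt, ← add_assoc]

/-- The rule for a counting loop with straight-line body: the register `i` counts the rounds. -/
theorem Frag.quiet_forLt' {i n : ℕ} {l : List Instr} (hl : ∀ i ∈ l, i.Writes) (N T : ℕ)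
    (Inv : ℕ → (ℕ → ℕ) → Prop) (hi : ∀ k r, Inv k r → r i = k ∧ r n = N)
    (hstep : ∀ k r, k < N → Inv k r → costOps l r ≤ T ∧ Inv (k + 1) (evalOps l r))
    (r : ℕ → ℕ) (hr : Inv 0 r) :
    ∃ r', Inv N r' ∧ (Frag.whileLt i n (Frag.ops l)).Quiet r (N * (T + 2 * N + 1) + 2 * N + 2) r' := by
  obtain ⟨k, r', hk, ⟨hkN, hI⟩, hlt, hQ⟩ := Frag.quiet_whileLt (F := Frag.ops l) (s := i) (t := n) N T (2 * N)
    (fun k r => k ≤ N ∧ Inv k r)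
    (fun k r h hlt => by have := hi k r h.2; omega)
    (fun k r h => by have := hi k r h.2; omega)
    (fun k r h hlt => by
      have h1 := hi k r h.2
      have h2 := hstep k r (by omega) h.2
      exact ⟨_, (Frag.quiet_ops l hl r).mono h2.1, by omega, h2.2⟩) r ⟨by omega, hr⟩
  have h1 := hi k r' hI
  obtain rfl : k = N := by omega
  exact ⟨r', hI, hQ⟩

theorem Frag.quiet_forLt {i n : ℕ} {l : List Instr} (hl : ∀ i ∈ l, i.Writes) (N T : ℕ)
    (Inv : ℕ → (ℕ → ℕ) → Prop) (hi : ∀ k r, Inv k r → r i = k ∧ r n = N)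
    (hstep : ∀ k r, k < N → Inv k r → boundOps l r ≤ T ∧ Inv (k + 1) (evalOps l r))
    (r : ℕ → ℕ) (hr : Inv 0 r) :
    ∃ r', Inv N r' ∧ (Frag.whileLt i n (Frag.ops l)).Quiet r (N * (T + 2 * N + 1) + 2 * N + 2) r' :=
  Frag.quiet_forLt' hl N T Inv hi (fun k r hk h =>
    ⟨(costOps_le l r).trans (hstep k r hk h).1, (hstep k r hk h).2⟩) r hr

/-! ### Loops over blocks of registers -/

/-- An address beyond the registers below `b` differs from them. -/
theorem addr_ne {a b : ℕ} (h : b ≤ a) :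
    (∀ c < b, (a = c) = False) ∧ ∀ c < b, (c = a) = False := by
  constructor <;> intro c hc <;> simp only [eq_iff_iff, iff_false] <;> omega

/-- The time of a loop with `N ≤ M` rounds of linear time, as bounded by `Frag.quiet_forLt`. -/
theorem loop_time {N M T a : ℕ} (hN : N ≤ M) (hT : T ≤ a * (M + 1)) :
    N * (T + 2 * N + 1) + 2 * N + 2 ≤ (a + 5) * (M + 1) ^ 2 := by
  have h1 : N * (T + 2 * N + 1) ≤ M * (a * (M + 1) + 2 * M + 1) := by gcongr
  nlinarith

/-- Division by repeated addition: the stride in `R_2` is added to `R_1` until `R_3` is reached;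
`R_4` counts the additions. -/
def Frag.divide : Frag :=
  Frag.ops [.const 4 0, .const 5 1] ++ Frag.whileLt 1 3 (Frag.ops [.add 1 1 2, .add 4 4 5])

/-- The result in `R_4` is the least `k` with `R_3 ≤ R_1 + k R_2`. -/
theorem Frag.quiet_divide (r : ℕ → ℕ) (M : ℕ) (h1 : r 1 ≤ M) (h2 : r 2 ≤ M) (h3 : r 3 ≤ M)
    (hs : 0 < r 2) :
    ∃ r', Frag.divide.Quiet r (20 * (M + 1) ^ 2) r' ∧ (∀ j, 6 ≤ j → r' j = r j) ∧
      r' 1 = r 1 + r' 4 * r 2 ∧ r 3 ≤ r 1 + r' 4 * r 2 ∧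
      ∀ k < r' 4, r 1 + k * r 2 < r 3 := by
  have hA := Frag.quiet_ops_bound [.const 4 0, .const 5 1] (by simp [Instr.Writes]) r 2
    (by simp [boundOps])
  obtain ⟨k, r', hk, ⟨hI1, hI4, hI5, hI2, hI3, hF, hlast⟩, hlt, hQ⟩ :=
    Frag.quiet_whileLt (s := 1) (t := 3)
    (F := Frag.ops [.add 1 1 2, .add 4 4 5]) M (4 * M + 4) (4 * M)
    (fun k r' => r' 1 = r 1 + k * r 2 ∧ r' 4 = k ∧ r' 5 = 1 ∧ r' 2 = r 2 ∧ r' 3 = r 3 ∧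
      (∀ j, 6 ≤ j → r' j = r j) ∧ ∀ k' < k, r 1 + k' * r 2 < r 3)
    (by
      rintro k r' ⟨e1, e4, e5, e2, e3, hF, hl⟩ hlt
      have := Nat.le_mul_of_pos_right k hs
      omega)
    (by
      rintro k r' ⟨e1, e4, e5, e2, e3, hF, hl⟩
      rcases k with _ | k
      · omega
      · have := hl k (by omega)
        rw [add_mul, one_mul] at e1
        omega)
    (by
      rintro k r' ⟨e1, e4, e5, e2, e3, hF, hl⟩ hlt
      have := Nat.le_mul_of_pos_right k hs
      refine ⟨_, Frag.quiet_ops_bound _ (by simp [Instr.Writes]) r' _ ?_, ?_⟩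
      · simp [boundOps, Instr.eval]
        omega
      · simp only [evalOps, Instr.eval, Function.update_apply, reduceIte, Nat.reduceEqDiff,
          Nat.reduceLT]
        refine ⟨by rw [add_mul]; omega, by omega, e5, e2, e3, fun j hj => ?_, fun k' hk' => ?_⟩
        · simp only [Function.update_apply, reduceIte, Nat.reduceEqDiff, Nat.reduceLT, addr_ne hj]
          exact hF j hj
        · rcases Nat.lt_succ_iff_lt_or_eq.1 hk' with h | rfl
          · exact hl k' h
          · omega)
    (evalOps [.const 4 0, .const 5 1] r)
    (by
      simp only [evalOps, Instr.eval, Function.update_apply, reduceIte, Nat.reduceEqDiff,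
        Nat.reduceLT]
      refine ⟨by simp, trivial, trivial, trivial, trivial, fun j hj => ?_, by simp⟩
      simp only [Function.update_apply, reduceIte, Nat.reduceEqDiff, Nat.reduceLT, addr_ne hj])
  refine ⟨r', (hA.append hQ).mono (by nlinarith), hF, by rw [hI1, hI4], by rw [hI4]; omega, ?_⟩
  rw [hI4]
  exact hlast

theorem min_one_sub (x : ℕ) : 1 - (1 - x) = if x = 0 then 0 else 1 := by
  split <;> omega

/-- Look for registers among the `R_3` registers starting at `R_1` that hold numbers not below
`R_5`; `R_6` counts them. The summand for the number `x` is `1 - (1 - (x + 1 - R_5))`. -/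
def Frag.countGe : Frag :=
  Frag.ops [.const 2 0, .const 4 1, .const 6 0] ++
    Frag.whileLt 2 3 (Frag.ops [.load 7 1, .add 7 7 4, .sub 7 7 5, .sub 7 4 7, .sub 7 4 7,
      .add 6 6 7, .add 1 1 4, .add 2 2 4])

theorem Frag.quiet_countGe (r : ℕ → ℕ) (M S N : ℕ) (h1 : r 1 = S) (hS : 10 ≤ S) (h3 : r 3 = N)
    (hM : S + N ≤ M) (h5 : r 5 ≤ M) (hval : ∀ i < N, r (S + i) ≤ M) :
    ∃ r', Frag.countGe.Quiet r (100 * (M + 1) ^ 2) r' ∧ (∀ j, 10 ≤ j → r' j = r j) ∧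
      r' 6 ≤ N ∧ (r' 6 = 0 ↔ ∀ i < N, r (S + i) < r 5) := by
  have hA := Frag.quiet_ops_bound [.const 2 0, .const 4 1, .const 6 0] (by simp [Instr.Writes]) r 3
    (by simp [boundOps])
  obtain ⟨r', ⟨e1, e2, e3, e4, e5, hF, h6, h6'⟩, hQ⟩ := Frag.quiet_forLt (i := 2) (n := 3)
    (l := [.load 7 1, .add 7 7 4, .sub 7 7 5, .sub 7 4 7, .sub 7 4 7,
      .add 6 6 7, .add 1 1 4, .add 2 2 4]) (by simp [Instr.Writes]) N (20 * (M + 1))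
    (fun k r' => r' 1 = S + k ∧ r' 2 = k ∧ r' 3 = N ∧ r' 4 = 1 ∧ r' 5 = r 5 ∧
      (∀ j, 10 ≤ j → r' j = r j) ∧ r' 6 ≤ k ∧ (r' 6 = 0 ↔ ∀ i < k, r (S + i) < r 5))
    (by rintro k r' ⟨e1, e2, e3, -⟩; exact ⟨e2, e3⟩)
    (by
      rintro k r' hk ⟨e1, e2, e3, e4, e5, hF, h6, h6'⟩
      have hv := hval k hk
      have hl : r' (S + k) = r (S + k) := hF _ (by omega)
      constructor
      · simp only [boundOps, Instr.eval, Function.update_apply, reduceIte, Nat.reduceEqDiff,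
          Nat.reduceLT, e1, e2, e4, e5, hl]
        omega
      · simp only [evalOps, Instr.eval, Function.update_apply, reduceIte, Nat.reduceEqDiff,
          Nat.reduceLT, e1, e2, e3, e4, e5, hl, min_one_sub]
        refine ⟨by omega, trivial, trivial, trivial, trivial, fun j hj => ?_, by split <;> omega, ?_⟩
        · simp only [Function.update_apply, reduceIte, Nat.reduceEqDiff, Nat.reduceLT, addr_ne hj]
          exact hF j hj
        · constructor
          · intro h i hi
            rcases Nat.lt_succ_iff_lt_or_eq.1 hi with h' | rfl
            · exact h6'.1 (by omega) i h'
            · split at h <;> omega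
          · intro h
            have := h6'.2 fun i hi => h i (by omega)
            have := h k (by omega)
            split <;> omega)
    (evalOps [.const 2 0, .const 4 1, .const 6 0] r)
    (by
      simp only [evalOps, Instr.eval, Function.update_apply, reduceIte, Nat.reduceEqDiff,
        Nat.reduceLT]
      refine ⟨by simpa using h1, trivial, h3, trivial, trivial, fun j hj => ?_, le_rfl, by simp⟩
      simp only [Function.update_apply, reduceIte, Nat.reduceEqDiff, Nat.reduceLT, addr_ne hj])
  refine ⟨r', (hA.append hQ).mono ?_, hF, h6, h6'⟩
  have := loop_time (N := N) (M := M) (by omega) le_rfl (T := 20 * (M + 1))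
  nlinarith

/-! ### Run lengths -/

/-- One step of the computation of run lengths: a letter `0` prolongs the current run, all other
letters end it. -/
def runStep (p : List ℕ × ℕ) (a : ℕ) : List ℕ × ℕ :=
  if a = 0 then (p.1, p.2 + 1) else (p.1 ++ [p.2], 0)

/-- The lengths of the runs of the letter `0` in a word, where each run is ended by another letter;
an unfinished run at the end of the word does not count. -/
def runLengths (w : List ℕ) : List ℕ := (w.foldl runStep ([], 0)).1

/-- The word with the given run lengths. -/
def ofRunLengths (l : List ℕ) : List ℕ := l.flatMap fun k => List.replicate k 0 ++ [1]

theorem foldl_runStep_replicate (k : ℕ) : ∀ p : List ℕ × ℕ,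
    (List.replicate k 0).foldl runStep p = (p.1, p.2 + k) := by
  induction k with
  | zero => simp
  | succ k ih => intro p; simp [List.replicate_succ, ih, runStep]; ring

theorem runLengths_ofRunLengths (l : List ℕ) : runLengths (ofRunLengths l) = l := by
  have : ∀ (l : List ℕ) (a : List ℕ), (ofRunLengths l).foldl runStep (a, 0) = (a ++ l, 0) := by
    intro l
    induction l with
    | nil => simp [ofRunLengths]
    | cons k l ih =>
      intro a
      have := ih (a ++ [k])
      simp only [ofRunLengths] at this ⊢
      simp [List.foldl_append, foldl_runStep_replicate, runStep, this]
  simp [runLengths, this]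

theorem runLengths_append_zeros (w : List ℕ) (k : ℕ) :
    runLengths (w ++ List.replicate k 0) = runLengths w := by
  simp [runLengths, List.foldl_append, foldl_runStep_replicate]

theorem foldl_runStep_bounds (w : List ℕ) :
    (w.foldl runStep ([], 0)).1.length ≤ w.length ∧ (w.foldl runStep ([], 0)).2 ≤ w.length ∧
      ∀ a ∈ (w.foldl runStep ([], 0)).1, a ≤ w.length := by
  induction w using List.reverseRecOn with
  | nil => simp
  | append_singleton w a ih =>
    obtain ⟨h1, h2, h3⟩ := ih
    rw [List.foldl_append, List.foldl_cons, List.foldl_nil, runStep]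
    split
    · simp only [List.length_append, List.length_singleton]
      exact ⟨by omega, by omega, fun a ha => by have := h3 a ha; omega⟩
    · simp only [List.length_append, List.length_singleton, List.mem_append, List.mem_singleton]
      refine ⟨by omega, by omega, fun a ha => ?_⟩
      rcases ha with ha | rfl
      · have := h3 a ha; omega
      · omega

/-- Compute the run lengths of the word formed by the `R_5` registers starting at `R_1`, and store
them from `R_2` on. The length `R_3` of the current run is stored at every letter, but the address
`R_2` advances only at the end of a run; the last store removes an unfinished run. -/
def Frag.decode : Frag :=
  Frag.ops [.const 3 0, .const 4 0, .const 6 1] ++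
    Frag.whileLt 4 5 (Frag.ops [.load 7 1, .sub 7 6 7, .store 2 3, .add 3 3 6, .mul 3 3 7,
      .sub 7 6 7, .add 2 2 7, .add 1 1 6, .add 4 4 6]) ++
    Frag.ops [.const 7 0, .store 2 7]

theorem Frag.quiet_decode (r : ℕ → ℕ) (M S D N : ℕ) (h1 : r 1 = S) (h2 : r 2 = D) (hS : 10 ≤ S)
    (h5 : r 5 = N) (hSD : S + N ≤ D) (hM : D + N ≤ M) (hval : ∀ i < N, r (S + i) ≤ M)
    (hD : ∀ j, D ≤ j → r j = 0) :
    ∃ r', Frag.decode.Quiet r (100 * (M + 1) ^ 2) r' ∧ (∀ j, 10 ≤ j → j < D → r' j = r j) ∧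
      ∀ j, r' (D + j) = (runLengths ((List.range N).map fun i => r (S + i))).getD j 0 := by
  have hA := Frag.quiet_ops_bound [.const 3 0, .const 4 0, .const 6 1] (by simp [Instr.Writes]) r 3
    (by simp [boundOps])
  obtain ⟨st, hst⟩ : ∃ st : ℕ → List ℕ × ℕ, st = fun k =>
    ((List.range k).map fun i => r (S + i)).foldl runStep ([], 0) := ⟨_, rfl⟩
  have hsucc : ∀ k, st (k + 1) = runStep (st k) (r (S + k)) := by
    intro k
    simp [hst, List.range_succ, List.foldl_append]
  have hb : ∀ k, (st k).1.length ≤ k ∧ (st k).2 ≤ k := by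
    intro k
    have := foldl_runStep_bounds ((List.range k).map fun i => r (S + i))
    simp only [List.length_map, List.length_range] at this
    rw [hst]
    exact ⟨this.1, this.2.1⟩
  obtain ⟨r₁, ⟨e1, e2, e3, e4, e5, e6, hF, hL, hZ⟩, hQ⟩ := Frag.quiet_forLt (i := 4) (n := 5)
    (l := [.load 7 1, .sub 7 6 7, .store 2 3, .add 3 3 6, .mul 3 3 7,
      .sub 7 6 7, .add 2 2 7, .add 1 1 6, .add 4 4 6]) (by simp [Instr.Writes]) N (30 * (M + 1))
    (fun k r' => r' 1 = S + k ∧ r' 2 = D + (st k).1.length ∧ r' 3 = (st k).2 ∧ r' 4 = k ∧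
      r' 5 = N ∧ r' 6 = 1 ∧
      (∀ j, 10 ≤ j → j < D → r' j = r j) ∧ (∀ j, j < (st k).1.length → r' (D + j) = (st k).1.getD j 0)
      ∧ ∀ j, (st k).1.length < j → r' (D + j) = 0)
    (by rintro k r' ⟨e1, e2, e3, e4, e5, -⟩; exact ⟨e4, e5⟩)
    (by
      rintro k r' hk ⟨e1, e2, e3, e4, e5, e6, hF, hL, hZ⟩
      have hv := hval k hk
      have hl : r' (S + k) = r (S + k) := hF _ (by omega) (by omega)
      obtain ⟨hb1, hb2⟩ := hb k
      have a1 := addr_ne (a := D + (st k).1.length) (b := 10) (by omega)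
      constructor
      · simp only [boundOps, Instr.eval, Function.update_apply, reduceIte, Nat.reduceEqDiff,
          Nat.reduceLT, a1, e1, e2, e3, e4, e6, hl]
        omega
      · have hs := hsucc k
        simp only [evalOps, Instr.eval, Function.update_apply, reduceIte, Nat.reduceEqDiff,
          Nat.reduceLT, a1, e1, e2, e3, e4, e5, e6, hl, min_one_sub]
        have hlen : (st (k + 1)).1.length = (st k).1.length + if r (S + k) = 0 then 0 else 1 := by
          rw [hs, runStep]; split <;> simp
        refine ⟨by omega, by rw [hlen]; omega, ?_, trivial, trivial, trivial, fun j hj hjD => ?_,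
          fun j hj => ?_, fun j hj => ?_⟩
        · rw [hs, runStep]; split
          · next h => simp [h]
          · next h => simp [show 1 - r (S + k) = 0 by omega]
        · simp only [addr_ne hj, reduceIte, Nat.reduceLT]
          rw [if_neg (by omega)]
          exact hF j hj hjD
        · simp only [addr_ne (show 10 ≤ D + j by omega), reduceIte, Nat.reduceLT]
          by_cases hj' : j < (st k).1.length
          · rw [if_neg (by omega), hL j hj', hs, runStep]
            split
            · rfl
            · rw [List.getD_append _ _ _ _ hj']
          · have hj2 : j = (st k).1.length := by split at hlen <;> omega
            have hr : r (S + k) ≠ 0 := by intro h; simp [h] at hlen; omega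
            rw [hs, runStep, if_neg hr, hj2, if_pos rfl]
            simp
        · simp only [addr_ne (show 10 ≤ D + j by omega), reduceIte, Nat.reduceLT]
          rw [if_neg (by omega)]
          exact hZ j (by omega))
    (evalOps [.const 3 0, .const 4 0, .const 6 1] r)
    (by
      simp only [evalOps, Instr.eval, Function.update_apply, reduceIte, Nat.reduceEqDiff,
        Nat.reduceLT]
      refine ⟨by simpa using h1, by simpa [hst] using h2, by simp [hst], trivial, h5, trivial,
        fun j hj _ => ?_, by simp [hst], fun j _ => ?_⟩
      · simp only [addr_ne hj, reduceIte, Nat.reduceLT]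
      · simp only [addr_ne (show 10 ≤ D + j by omega), reduceIte, Nat.reduceLT]
        exact hD _ (by omega))
  have hB := Frag.quiet_ops_bound [.const 7 0, .store 2 7] (by simp [Instr.Writes]) r₁ 2
    (by simp [boundOps])
  refine ⟨_, ((hA.append hQ).append hB).mono ?_, fun j hj hjD => ?_, fun j => ?_⟩
  · have := loop_time (N := N) (M := M) (by omega) le_rfl (T := 30 * (M + 1))
    nlinarith
  · simp only [evalOps, Instr.eval, Function.update_apply, reduceIte, Nat.reduceEqDiff,
      Nat.reduceLT, e2, addr_ne hj]
    rw [if_neg (by omega)]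
    exact hF j hj hjD
  · rw [show runLengths ((List.range N).map fun i => r (S + i)) = (st N).1 by rw [hst]; rfl]
    simp only [evalOps, Instr.eval, Function.update_apply, reduceIte, Nat.reduceEqDiff,
      Nat.reduceLT, e2, addr_ne (show 10 ≤ D + j by omega)]
    rcases lt_trichotomy j (st N).1.length with h | h | h
    · rw [if_neg (by omega)]
      exact hL j h
    · subst h
      simp
    · rw [if_neg (by omega), hZ j h, List.getD_eq_default _ _ h.le]

/-! ### Checking an assignment -/

/-- The literal with number `l` holds if the variables that satisfy `p` are true. -/
def LitHolds (p : ℕ → Prop) (l : ℕ) : Prop := if l % 2 = 1 then p (l / 2) else ¬ p (l / 2)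

/-- The formula with `m` clauses, the `k`-th of which consists of the literals with the numbers
`l (3 k)`, `l (3 k + 1)`, `l (3 k + 2)`, holds if the variables that satisfy `p` are true. -/
def SatBy (m : ℕ) (l : ℕ → ℕ) (p : ℕ → Prop) : Prop :=
  ∀ k < m, LitHolds p (l (3 * k)) ∨ LitHolds p (l (3 * k + 1)) ∨ LitHolds p (l (3 * k + 2))

/-- Compute the truth values of all literals over `R_10` variables under the assignment that starts
at `R_16`, and store them from `R_13` on. -/
def Frag.literals : Frag :=
  Frag.ops [.copy 1 16, .const 2 0, .copy 3 13, .const 4 1] ++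
    Frag.whileLt 2 10 (Frag.ops [.load 5 1, .sub 6 4 5, .store 3 6, .add 3 3 4, .store 3 5,
      .add 3 3 4, .add 1 1 4, .add 2 2 4])

theorem Frag.quiet_literals (r : ℕ → ℕ) (M n A B : ℕ) (h10 : r 10 = n) (h16 : r 16 = A)
    (h13 : r 13 = B) (hA : 17 ≤ A) (hAB : A + n ≤ B) (hM : B + 2 * n ≤ M)
    (hbit : ∀ i < n, r (A + i) ≤ 1) :
    ∃ r', Frag.literals.Quiet r (100 * (M + 1) ^ 2) r' ∧
      (∀ j, 10 ≤ j → (j < B ∨ B + 2 * n ≤ j) → r' j = r j) ∧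
      ∀ i < n, r' (B + 2 * i) = 1 - r (A + i) ∧ r' (B + (2 * i + 1)) = r (A + i) := by
  have hQ₀ := Frag.quiet_ops_bound [.copy 1 16, .const 2 0, .copy 3 13, .const 4 1]
    (by simp [Instr.Writes]) r 4 (by simp [boundOps])
  obtain ⟨r₁, ⟨e1, e2, e3, e4, hF, hL⟩, hQ⟩ := Frag.quiet_forLt (i := 2) (n := 10)
    (l := [.load 5 1, .sub 6 4 5, .store 3 6, .add 3 3 4, .store 3 5,
      .add 3 3 4, .add 1 1 4, .add 2 2 4]) (by simp [Instr.Writes]) n (30 * (M + 1))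
    (fun k r' => r' 1 = A + k ∧ r' 2 = k ∧ r' 3 = B + 2 * k ∧ r' 4 = 1 ∧
      (∀ j, 10 ≤ j → (j < B ∨ B + 2 * n ≤ j) → r' j = r j) ∧
      ∀ i < k, r' (B + 2 * i) = 1 - r (A + i) ∧ r' (B + (2 * i + 1)) = r (A + i))
    (by rintro k r' ⟨e1, e2, e3, e4, hF, hL⟩; exact ⟨e2, (hF 10 (by omega) (by omega)).trans h10⟩)
    (by
      rintro k r' hk ⟨e1, e2, e3, e4, hF, hL⟩
      have hv := hbit k hk
      have hl : r' (A + k) = r (A + k) := hF _ (by omega) (by omega)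
      have a1 := addr_ne (a := B + 2 * k) (b := 11) (by omega)
      have a2 := addr_ne (a := B + 2 * k + 1) (b := 11) (by omega)
      constructor
      · simp only [boundOps, Instr.eval, Function.update_apply, reduceIte, Nat.reduceEqDiff,
          Nat.reduceLT, a1, a2, e1, e2, e3, e4, hl]
        omega
      · simp only [evalOps, Instr.eval, Function.update_apply, reduceIte, Nat.reduceEqDiff,
          Nat.reduceLT, a1, a2, e1, e2, e3, e4, hl]
        refine ⟨by omega, trivial, by omega, trivial, fun j hj hjB => ?_, fun i hi => ?_⟩
        · simp only [addr_ne hj, reduceIte, Nat.reduceLT]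
          rw [if_neg (by omega), if_neg (by omega)]
          exact hF j hj hjB
        · simp only [addr_ne (show 10 ≤ B + 2 * i by omega),
            addr_ne (show 10 ≤ B + (2 * i + 1) by omega), reduceIte, Nat.reduceLT]
          rcases Nat.lt_succ_iff_lt_or_eq.1 hi with h | rfl
          · rw [if_neg (by omega), if_neg (by omega), if_neg (by omega), if_neg (by omega)]
            exact hL i h
          · rw [if_neg (by omega), if_pos rfl, if_pos (by omega)]
            exact ⟨rfl, rfl⟩)
    (evalOps [.copy 1 16, .const 2 0, .copy 3 13, .const 4 1] r)
    (by
      simp only [evalOps, Instr.eval, Function.update_apply, reduceIte, Nat.reduceEqDiff,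
        Nat.reduceLT]
      refine ⟨by simpa using h16, trivial, by simpa using h13, trivial, fun j hj _ => ?_, by simp⟩
      simp only [addr_ne hj, reduceIte, Nat.reduceLT])
  refine ⟨r₁, (hQ₀.append hQ).mono ?_, hF, hL⟩
  have := loop_time (N := n) (M := M) (by omega) le_rfl (T := 30 * (M + 1))
  nlinarith

/-- Count the clauses that are false under the assignment that starts at `R_16`; the result is in
`R_6`. There are `R_10` variables and `R_12` clauses, whose literals start at `R_11`, and the
registers from `R_13` on are used as working space. -/
def Frag.check : Frag :=
  Frag.literals ++ Frag.ops [.copy 1 11, .const 2 0, .const 4 1, .const 6 0] ++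
    Frag.whileLt 2 12 (Frag.ops [.load 5 1, .add 5 5 13, .load 3 5, .add 1 1 4,
      .load 5 1, .add 5 5 13, .load 5 5, .add 3 3 5, .add 1 1 4,
      .load 5 1, .add 5 5 13, .load 5 5, .add 3 3 5, .add 1 1 4,
      .sub 3 4 3, .add 6 6 3, .add 2 2 4])

theorem Frag.quiet_check (r : ℕ → ℕ) (M n L m A B : ℕ) (h10 : r 10 = n) (h11 : r 11 = L)
    (h12 : r 12 = m) (h13 : r 13 = B) (h16 : r 16 = A) (hL : 17 ≤ L) (hLB : L + 3 * m ≤ B)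
    (hA : 17 ≤ A) (hAB : A + n ≤ B) (hM : B + 2 * n ≤ M)
    (hlit : ∀ k < 3 * m, r (L + k) < 2 * n) (hbit : ∀ i < n, r (A + i) ≤ 1) :
    ∃ r', Frag.check.Quiet r (300 * (M + 1) ^ 2) r' ∧
      (∀ j, 10 ≤ j → (j < B ∨ B + 2 * n ≤ j) → r' j = r j) ∧
      r' 6 ≤ m ∧ (r' 6 = 0 ↔ SatBy m (fun k => r (L + k)) fun i => r (A + i) ≠ 0) := by
  obtain ⟨r₁, hQ₁, hF₁, hV⟩ := Frag.quiet_literals r M n A B h10 h16 h13 hA hAB hM hbit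
  have hval : ∀ l < 2 * n, r₁ (B + l) ≤ 1 ∧
      (r₁ (B + l) ≠ 0 ↔ LitHolds (fun i => r (A + i) ≠ 0) l) := by
    intro l hl
    have hb := hbit (l / 2) (by omega)
    obtain ⟨v1, v2⟩ := hV (l / 2) (by omega)
    unfold LitHolds
    split
    · rw [show 2 * (l / 2) + 1 = l by omega] at v2
      rw [v2]
      exact ⟨hb, Iff.rfl⟩
    · rw [show 2 * (l / 2) = l by omega] at v1
      rw [v1]
      constructor <;> omega
  have hQ₂ := Frag.quiet_ops_bound [.copy 1 11, .const 2 0, .const 4 1, .const 6 0]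
    (by simp [Instr.Writes]) r₁ 4 (by simp [boundOps])
  obtain ⟨r₂, ⟨e1, e2, e4, h6, hF, hS⟩, hQ₃⟩ := Frag.quiet_forLt (i := 2) (n := 12)
    (l := [.load 5 1, .add 5 5 13, .load 3 5, .add 1 1 4,
      .load 5 1, .add 5 5 13, .load 5 5, .add 3 3 5, .add 1 1 4,
      .load 5 1, .add 5 5 13, .load 5 5, .add 3 3 5, .add 1 1 4,
      .sub 3 4 3, .add 6 6 3, .add 2 2 4]) (by simp [Instr.Writes]) m (60 * (M + 1))
    (fun k r' => r' 1 = L + 3 * k ∧ r' 2 = k ∧ r' 4 = 1 ∧ r' 6 ≤ k ∧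
      (∀ j, 10 ≤ j → r' j = r₁ j) ∧
      (r' 6 = 0 ↔ SatBy k (fun k => r (L + k)) fun i => r (A + i) ≠ 0))
    (by
      rintro k r' ⟨e1, e2, e4, h6, hF, hS⟩
      exact ⟨e2, by rw [hF 12 (by omega), hF₁ 12 (by omega) (by omega), h12]⟩)
    (by
      rintro k r' hk ⟨e1, e2, e4, h6, hF, hS⟩
      have e13 : r' 13 = B := by rw [hF 13 (by omega), hF₁ 13 (by omega) (by omega), h13]
      have l0 : r' (L + 3 * k) = r (L + 3 * k) := by
        rw [hF _ (by omega), hF₁ _ (by omega) (by omega)]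
      have l1 : r' (L + 3 * k + 1) = r (L + 3 * k + 1) := by
        rw [hF _ (by omega), hF₁ _ (by omega) (by omega)]
      have l2 : r' (L + 3 * k + 1 + 1) = r (L + 3 * k + 2) := by
        rw [hF _ (by omega), hF₁ _ (by omega) (by omega)]
      have b0 := hlit (3 * k) (by omega)
      have b1 := hlit (3 * k + 1) (by omega)
      have b2 := hlit (3 * k + 2) (by omega)
      rw [← add_assoc] at b1 b2
      obtain ⟨v0, w0⟩ := hval _ b0
      obtain ⟨v1, w1⟩ := hval _ b1
      obtain ⟨v2, w2⟩ := hval _ b2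
      have f0 : r' (r (L + 3 * k) + B) = r₁ (B + r (L + 3 * k)) := by
        rw [hF _ (by omega), add_comm]
      have f1 : r' (r (L + 3 * k + 1) + B) = r₁ (B + r (L + 3 * k + 1)) := by
        rw [hF _ (by omega), add_comm]
      have f2 : r' (r (L + 3 * k + 2) + B) = r₁ (B + r (L + 3 * k + 2)) := by
        rw [hF _ (by omega), add_comm]
      have hc : SatBy (k + 1) (fun k => r (L + k)) (fun i => r (A + i) ≠ 0) ↔
          SatBy k (fun k => r (L + k)) (fun i => r (A + i) ≠ 0) ∧
          (r₁ (B + r (L + 3 * k)) ≠ 0 ∨ r₁ (B + r (L + 3 * k + 1)) ≠ 0 ∨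
            r₁ (B + r (L + 3 * k + 2)) ≠ 0) := by
        rw [w0, w1, w2]
        constructor
        · intro h
          exact ⟨fun i hi => h i (by omega), h k (by omega)⟩
        · rintro ⟨h, h'⟩ i hi
          rcases Nat.lt_succ_iff_lt_or_eq.1 hi with h'' | rfl
          · exact h i h''
          · exact h'
      clear w0 w1 w2
      generalize r (L + 3 * k) = x0 at *
      generalize r (L + 3 * k + 1) = x1 at *
      generalize r (L + 3 * k + 2) = x2 at *
      generalize r₁ (B + x0) = y0 at *
      generalize r₁ (B + x1) = y1 at *
      generalize r₁ (B + x2) = y2 at *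
      have a0 := addr_ne (a := L + 3 * k) (b := 14) (by omega)
      have a1 := addr_ne (a := L + 3 * k + 1) (b := 14) (by omega)
      have a2 := addr_ne (a := L + 3 * k + 1 + 1) (b := 14) (by omega)
      have c0 := addr_ne (a := x0 + B) (b := 14) (by omega)
      have c1 := addr_ne (a := x1 + B) (b := 14) (by omega)
      have c2 := addr_ne (a := x2 + B) (b := 14) (by omega)
      constructor
      · simp only [boundOps, Instr.eval, Function.update_apply, reduceIte, Nat.reduceEqDiff,
          Nat.reduceLT, a0, a1, a2, c0, c1, c2, e1, e2, e4, e13, l0, l1, l2,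
          f0, f1, f2]
        have := Nat.sub_le 1 (y0 + y1 + y2)
        linarith
      · simp only [evalOps, Instr.eval, Function.update_apply, reduceIte, Nat.reduceEqDiff,
          Nat.reduceLT, a0, a1, a2, c0, c1, c2, e1, e2, e4, e13, l0, l1, l2,
          f0, f1, f2]
        refine ⟨by omega, trivial, trivial, by omega, fun j hj => ?_, ?_⟩
        · simp only [addr_ne hj, reduceIte, Nat.reduceLT]
          exact hF j hj
        · rw [hc, ← hS]
          clear hS hc
          omega)
    (evalOps [.copy 1 11, .const 2 0, .const 4 1, .const 6 0] r₁)
    (by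
      simp only [evalOps, Instr.eval, Function.update_apply, reduceIte, Nat.reduceEqDiff,
        Nat.reduceLT]
      refine ⟨by rw [hF₁ 11 (by omega) (by omega), h11]; rfl, trivial, trivial, le_rfl,
        fun j hj => ?_, by simp [SatBy]⟩
      simp only [addr_ne hj, reduceIte, Nat.reduceLT])
  refine ⟨r₂, ((hQ₁.append hQ₂).append hQ₃).mono ?_, fun j hj hj' => ?_, h6, hS⟩
  · have := loop_time (N := m) (M := M) (by omega) le_rfl (T := 60 * (M + 1))
    nlinarith
  · rw [hF j hj, hF₁ j hj hj']

/-! ### Binary counters, bitwise addition, and copying -/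

/-- The number with the binary digits `f 0, …, f (n - 1)`, least significant digit first. -/
def binVal (f : ℕ → ℕ) (n : ℕ) : ℕ := ∑ i ∈ Finset.range n, f i * 2 ^ i

/-- Increment the binary counter of length `R_18` that starts at `R_17`; the carry is left in
`R_6`. With the carry `c`, a digit `x` becomes `x + c - 2 c'`, where `c' = x + c - 1` is the new
carry. -/
def Frag.inc : Frag :=
  Frag.ops [.copy 1 17, .const 2 0, .const 4 1, .const 6 1] ++
    Frag.whileLt 2 18 (Frag.ops [.load 3 1, .add 3 3 6, .sub 6 3 4, .sub 3 3 6, .sub 3 3 6,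
      .store 1 3, .add 1 1 4, .add 2 2 4])

theorem Frag.quiet_inc (r : ℕ → ℕ) (M A n : ℕ) (h17 : r 17 = A) (h18 : r 18 = n) (hA : 19 ≤ A)
    (hM : A + n ≤ M) (hbit : ∀ i < n, r (A + i) ≤ 1) :
    ∃ r', Frag.inc.Quiet r (100 * (M + 1) ^ 2) r' ∧
      (∀ j, 10 ≤ j → (j < A ∨ A + n ≤ j) → r' j = r j) ∧
      (∀ i < n, r' (A + i) ≤ 1) ∧ r' 6 ≤ 1 ∧
      binVal (fun i => r' (A + i)) n + r' 6 * 2 ^ n = binVal (fun i => r (A + i)) n + 1 := by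
  have hQ₀ := Frag.quiet_ops_bound [.copy 1 17, .const 2 0, .const 4 1, .const 6 1]
    (by simp [Instr.Writes]) r 4 (by simp [boundOps])
  obtain ⟨r₁, ⟨e1, e2, e4, h6, hF, -, hL, hV⟩, hQ⟩ := Frag.quiet_forLt (i := 2) (n := 18)
    (l := [.load 3 1, .add 3 3 6, .sub 6 3 4, .sub 3 3 6, .sub 3 3 6,
      .store 1 3, .add 1 1 4, .add 2 2 4]) (by simp [Instr.Writes]) n (30 * (M + 1))
    (fun k r' => r' 1 = A + k ∧ r' 2 = k ∧ r' 4 = 1 ∧ r' 6 ≤ 1 ∧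
      (∀ j, 10 ≤ j → (j < A ∨ A + n ≤ j) → r' j = r j) ∧
      (∀ i, k ≤ i → r' (A + i) = r (A + i)) ∧
      (∀ i < k, r' (A + i) ≤ 1) ∧
      binVal (fun i => r' (A + i)) k + r' 6 * 2 ^ k = binVal (fun i => r (A + i)) k + 1)
    (by rintro k r' ⟨e1, e2, e4, h6, hF, -⟩; exact ⟨e2, (hF 18 (by omega) (by omega)).trans h18⟩)
    (by
      rintro k r' hk ⟨e1, e2, e4, h6, hF, hR, hL, hV⟩
      have hv := hbit k hk
      have hl : r' (A + k) = r (A + k) := hR _ le_rfl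
      have a1 := addr_ne (a := A + k) (b := 10) (by omega)
      constructor
      · simp only [boundOps, Instr.eval, Function.update_apply, reduceIte, Nat.reduceEqDiff,
          Nat.reduceLT, a1, e1, e2, e4, hl]
        generalize r (A + k) = x at *
        omega
      · simp only [evalOps, Instr.eval, Function.update_apply, reduceIte, Nat.reduceEqDiff,
          Nat.reduceLT, a1, e1, e2, e4, hl]
        refine ⟨by omega, trivial, trivial, by omega, fun j hj hj' => ?_, fun i hi => ?_,
          fun i hi => ?_, ?_⟩
        · simp only [addr_ne hj, reduceIte, Nat.reduceLT]
          rw [if_neg (by omega)]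
          exact hF j hj hj'
        · simp only [addr_ne (show 10 ≤ A + i by omega), reduceIte, Nat.reduceLT]
          rw [if_neg (by omega)]
          exact hR i (by omega)
        · simp only [addr_ne (show 10 ≤ A + i by omega), reduceIte, Nat.reduceLT]
          rcases Nat.lt_succ_iff_lt_or_eq.1 hi with h | rfl
          · rw [if_neg (by omega)]
            exact hL i h
          · rw [if_pos rfl]
            omega
        · unfold binVal at hV ⊢
          rw [Finset.sum_range_succ, Finset.sum_range_succ]
          simp only [fun i => addr_ne (show 10 ≤ A + i by omega), reduceIte, Nat.reduceLT]
          rw [Finset.sum_congr rfl (g := fun i => r' (A + i) * 2 ^ i) (fun i hi => by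
            rw [if_neg (by have := Finset.mem_range.1 hi; omega)])]
          have e : r (A + k) + r' 6 = (r (A + k) + r' 6 - (r (A + k) + r' 6 - 1) -
              (r (A + k) + r' 6 - 1)) + (r (A + k) + r' 6 - 1) * 2 := by omega
          generalize r (A + k) + r' 6 - 1 = c at *
          generalize r (A + k) + r' 6 - c - c = d at *
          rw [pow_succ]
          linear_combination hV + 2 ^ k * e.symm)
    (evalOps [.copy 1 17, .const 2 0, .const 4 1, .const 6 1] r)
    (by
      simp only [evalOps, Instr.eval, Function.update_apply, reduceIte, Nat.reduceEqDiff,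
        Nat.reduceLT]
      refine ⟨by simpa using h17, trivial, trivial, le_rfl, fun j hj _ => ?_, fun i _ => ?_,
        by simp, by simp [binVal]⟩
      · simp only [addr_ne hj, reduceIte, Nat.reduceLT]
      · simp only [addr_ne (show 10 ≤ A + i by omega), reduceIte, Nat.reduceLT])
  refine ⟨r₁, (hQ₀.append hQ).mono ?_, hF, hL, h6, hV⟩
  have := loop_time (N := n) (M := M) (by omega) le_rfl (T := 30 * (M + 1))
  nlinarith

/-- The sum without carry of the two binary words of length `R_10` that start at `R_3` and `R_5`,
stored from `R_1` on. -/
def Frag.xor : Frag :=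
  Frag.ops [.const 2 0, .const 4 1] ++
    Frag.whileLt 2 10 (Frag.ops [.load 7 3, .load 8 5, .sub 9 7 8, .sub 8 8 7, .add 9 9 8,
      .store 1 9, .add 1 1 4, .add 3 3 4, .add 5 5 4, .add 2 2 4])

theorem Frag.quiet_xor (r : ℕ → ℕ) (M D X Y n : ℕ) (h10 : r 10 = n) (h1 : r 1 = D) (h3 : r 3 = X)
    (h5 : r 5 = Y) (hD : 11 ≤ D) (hX : 11 ≤ X) (hY : 11 ≤ Y) (hDM : D + n ≤ M) (hXM : X + n ≤ M)
    (hYM : Y + n ≤ M) (hDX : D + n ≤ X ∨ X + n ≤ D) (hDY : D + n ≤ Y ∨ Y + n ≤ D)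
    (hXb : ∀ i < n, r (X + i) ≤ 1) (hYb : ∀ i < n, r (Y + i) ≤ 1) :
    ∃ r', Frag.xor.Quiet r (100 * (M + 1) ^ 2) r' ∧
      (∀ j, 10 ≤ j → (j < D ∨ D + n ≤ j) → r' j = r j) ∧
      ∀ i < n, r' (D + i) = r (X + i) - r (Y + i) + (r (Y + i) - r (X + i)) := by
  have hQ₀ := Frag.quiet_ops_bound [.const 2 0, .const 4 1]
    (by simp [Instr.Writes]) r 2 (by simp [boundOps])
  obtain ⟨r₁, ⟨e1, e2, e3, e4, e5, hF, hL⟩, hQ⟩ := Frag.quiet_forLt (i := 2) (n := 10)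
    (l := [.load 7 3, .load 8 5, .sub 9 7 8, .sub 8 8 7, .add 9 9 8,
      .store 1 9, .add 1 1 4, .add 3 3 4, .add 5 5 4, .add 2 2 4])
    (by simp [Instr.Writes]) n (40 * (M + 1))
    (fun k r' => r' 1 = D + k ∧ r' 2 = k ∧ r' 3 = X + k ∧ r' 4 = 1 ∧ r' 5 = Y + k ∧
      (∀ j, 10 ≤ j → (j < D ∨ D + n ≤ j) → r' j = r j) ∧
      ∀ i < k, r' (D + i) = r (X + i) - r (Y + i) + (r (Y + i) - r (X + i)))
    (by rintro k r' ⟨e1, e2, e3, e4, e5, hF, hL⟩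
        exact ⟨e2, (hF 10 (by omega) (by omega)).trans h10⟩)
    (by
      rintro k r' hk ⟨e1, e2, e3, e4, e5, hF, hL⟩
      have hv := hXb k hk
      have hv' := hYb k hk
      have hl : r' (X + k) = r (X + k) := hF _ (by omega) (by omega)
      have hl' : r' (Y + k) = r (Y + k) := hF _ (by omega) (by omega)
      have a1 := addr_ne (a := D + k) (b := 11) (by omega)
      have a2 := addr_ne (a := X + k) (b := 11) (by omega)
      have a3 := addr_ne (a := Y + k) (b := 11) (by omega)
      constructor
      · simp only [boundOps, Instr.eval, Function.update_apply, reduceIte, Nat.reduceEqDiff,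
          Nat.reduceLT, a1, a2, a3, e1, e2, e3, e4, e5, hl, hl']
        generalize r (X + k) = x at *
        generalize r (Y + k) = y at *
        have := Nat.sub_le x y
        have := Nat.sub_le y x
        linarith
      · simp only [evalOps, Instr.eval, Function.update_apply, reduceIte, Nat.reduceEqDiff,
          Nat.reduceLT, a1, a2, a3, e1, e2, e3, e4, e5, hl, hl']
        refine ⟨by omega, trivial, by omega, trivial, by omega, fun j hj hj' => ?_, fun i hi => ?_⟩
        · simp only [addr_ne hj, reduceIte, Nat.reduceLT]
          rw [if_neg (by omega)]
          exact hF j hj hj'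
        · simp only [addr_ne (show 10 ≤ D + i by omega), reduceIte, Nat.reduceLT]
          rcases Nat.lt_succ_iff_lt_or_eq.1 hi with h | rfl
          · rw [if_neg (by omega)]
            exact hL i h
          · rw [if_pos rfl])
    (evalOps [.const 2 0, .const 4 1] r)
    (by
      simp only [evalOps, Instr.eval, Function.update_apply, reduceIte, Nat.reduceEqDiff,
        Nat.reduceLT]
      refine ⟨by simpa using h1, trivial, by simpa using h3, trivial, by simpa using h5,
        fun j hj _ => ?_, by simp⟩
      simp only [addr_ne hj, reduceIte, Nat.reduceLT])
  refine ⟨r₁, (hQ₀.append hQ).mono ?_, hF, hL⟩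
  have := loop_time (N := n) (M := M) (by omega) le_rfl (T := 40 * (M + 1))
  nlinarith

/-- Subtract `R_8` from the contents of the `R_5` registers starting at `R_1`, and store the results
from `R_3` on. -/
def Frag.copySub : Frag :=
  Frag.ops [.const 2 0, .const 4 1] ++
    Frag.whileLt 2 5 (Frag.ops [.load 7 1, .sub 7 7 8, .store 3 7, .add 1 1 4, .add 3 3 4,
      .add 2 2 4])

theorem Frag.quiet_copySub (r : ℕ → ℕ) (M D X n c : ℕ) (h5 : r 5 = n) (h1 : r 1 = X) (h3 : r 3 = D)
    (h8 : r 8 = c) (hD : 10 ≤ D) (hX : 10 ≤ X) (hDM : D + n ≤ M) (hXM : X + n < 2 ^ M) (hc : c ≤ M)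
    (hDX : D + n ≤ X ∨ X + n ≤ D) (hXb : ∀ i < n, r (X + i) ≤ M) :
    ∃ r', Frag.copySub.Quiet r (100 * (n + 1) * (M + 1)) r' ∧
      (∀ j, 10 ≤ j → (j < D ∨ D + n ≤ j) → r' j = r j) ∧
      ∀ i < n, r' (D + i) = r (X + i) - c := by
  have hQ₀ := Frag.quiet_ops_bound [.const 2 0, .const 4 1]
    (by simp [Instr.Writes]) r 2 (by simp [boundOps])
  obtain ⟨r₁, ⟨e1, e2, e3, e4, e5, e8, hF, hL⟩, hQ⟩ := Frag.quiet_forLt' (i := 2) (n := 5)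
    (l := [.load 7 1, .sub 7 7 8, .store 3 7, .add 1 1 4, .add 3 3 4, .add 2 2 4])
    (by simp [Instr.Writes]) n (40 * (M + 1))
    (fun k r' => r' 1 = X + k ∧ r' 2 = k ∧ r' 3 = D + k ∧ r' 4 = 1 ∧ r' 5 = n ∧ r' 8 = c ∧
      (∀ j, 10 ≤ j → (j < D ∨ D + n ≤ j) → r' j = r j) ∧
      ∀ i < k, r' (D + i) = r (X + i) - c)
    (by rintro k r' ⟨e1, e2, e3, e4, e5, -⟩; exact ⟨e2, e5⟩)
    (by
      rintro k r' hk ⟨e1, e2, e3, e4, e5, e8, hF, hL⟩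
      have hv := hXb k hk
      have hl : r' (X + k) = r (X + k) := hF _ (by omega) (by omega)
      have a1 := addr_ne (a := D + k) (b := 10) (by omega)
      have a2 := addr_ne (a := X + k) (b := 10) (by omega)
      constructor
      · simp only [costOps, Instr.cost, Instr.eval, Function.update_apply, reduceIte,
          Nat.reduceEqDiff, Nat.reduceLT, a1, a2, e1, e2, e3, e4, e5, e8, hl]
        have c1 : logCost (X + k) 1 ≤ 1 + M := by
          have : Nat.log 2 (X + k + 1) < M := Nat.log_lt_of_lt_pow (by omega) (by omega)
          unfold logCost
          omega
        have c2 := logCost_le (r (X + k)) c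
        have c3 := logCost_le (D + k) 1
        have c4 := logCost_le k 1
        generalize r (X + k) = x at *
        linarith
      · simp only [evalOps, Instr.eval, Function.update_apply, reduceIte, Nat.reduceEqDiff,
          Nat.reduceLT, a1, a2, e1, e2, e3, e4, e5, e8, hl]
        refine ⟨by omega, trivial, by omega, trivial, trivial, trivial, fun j hj hj' => ?_,
          fun i hi => ?_⟩
        · simp only [addr_ne hj, reduceIte, Nat.reduceLT]
          rw [if_neg (by omega)]
          exact hF j hj hj'
        · simp only [addr_ne (show 10 ≤ D + i by omega), reduceIte, Nat.reduceLT]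
          rcases Nat.lt_succ_iff_lt_or_eq.1 hi with h | rfl
          · rw [if_neg (by omega)]
            exact hL i h
          · rw [if_pos rfl])
    (evalOps [.const 2 0, .const 4 1] r)
    (by
      simp only [evalOps, Instr.eval, Function.update_apply, reduceIte, Nat.reduceEqDiff,
        Nat.reduceLT]
      refine ⟨by simpa using h1, trivial, by simpa using h3, trivial, h5, h8,
        fun j hj _ => ?_, by simp⟩
      simp only [addr_ne hj, reduceIte, Nat.reduceLT])
  refine ⟨r₁, (hQ₀.append hQ).mono ?_, hF, hL⟩
  have : n ≤ M := by omega
  nlinarith [Nat.mul_le_mul_left n this]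

/-! ### Moving the input out of the way -/

/-- Save the `c` registers from `R_i` on behind the register that `R_0` points to, if `R_1 = 1`. -/
def saveOps : ℕ → ℕ → List Instr
  | 0, _ => []
  | c + 1, i => .add 0 0 1 :: .store 0 i :: saveOps c (i + 1)

theorem saveOps_writes (c : ℕ) : ∀ i, ∀ a ∈ saveOps c i, a.Writes := by
  induction c with
  | zero => simp [saveOps]
  | succ c ih => intro i; simpa [saveOps, Instr.Writes] using ih (i + 1)

theorem eval_saveOps (c : ℕ) : ∀ (i : ℕ) (r : ℕ → ℕ), r 1 = 1 → 2 ≤ i → i + c ≤ r 0 →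
    boundOps (saveOps c i) r ≤ c * (r 0 + c + 3) ∧ evalOps (saveOps c i) r 0 = r 0 + c ∧
    (∀ k < c, evalOps (saveOps c i) r (r 0 + 1 + k) = r (i + k)) ∧
    ∀ j, j ≠ 0 → (j ≤ r 0 ∨ r 0 + c < j) → evalOps (saveOps c i) r j = r j := by
  induction c with
  | zero => intro i r h1 hi hc; simp [saveOps, evalOps, boundOps]
  | succ c ih =>
    intro i r h1 hi hc
    obtain ⟨r₁, hr₁⟩ : ∃ r₁, r₁ = (Instr.store 0 i).eval ((Instr.add 0 0 1).eval r) := ⟨_, rfl⟩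
    have e0 : r₁ 0 = r 0 + 1 := by simp [hr₁, Instr.eval, Function.update_apply, h1]
    have ej : ∀ j, j ≠ 0 → r₁ j = if j = r 0 + 1 then r i else r j := by
      intro j hj
      simp [hr₁, Instr.eval, Function.update_apply, h1, hj, show i ≠ 0 by omega]
    obtain ⟨b, b0, bk, bj⟩ := ih (i + 1) r₁ (by rw [ej 1 (by omega), if_neg (by omega), h1])
      (by omega) (by omega)
    simp only [saveOps, boundOps, evalOps, ← hr₁]
    refine ⟨?_, by omega, fun k hk => ?_, fun j hj hj' => ?_⟩
    · rw [e0] at b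
      rw [h1]
      nlinarith
    · rcases k with _ | k
      · rw [bj _ (by omega) (by omega), ej _ (by omega), if_pos rfl]; rfl
      · rw [show r 0 + 1 + (k + 1) = r₁ 0 + 1 + k by omega, bk k (by omega), ej _ (by omega),
          if_neg (by omega), show i + 1 + k = i + (k + 1) by omega]
    · rw [bj j hj (by omega), ej j hj, if_neg (by omega)]

/-- Move an input of `R_0` numbers in `R_1, R_2, …` to the registers from `P = 32 R_0` on, leave `P`
in `R_20`, and thereby free the first `32` registers. The address `P` is computed by doubling; then
the registers up to `R_31` are saved in a row, since only `R_0` and `R_1` are at disposal before, and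
the remaining ones follow in a loop. -/
def Frag.relocate : Frag :=
  Frag.ops [.add 0 0 0, .add 0 0 0, .add 0 0 0, .add 0 0 0, .add 0 0 0, .store 0 1, .const 1 1] ++
    Frag.ops (saveOps 30 2) ++
    Frag.ops [.const 2 30, .sub 20 0 2, .const 1 32, .const 3 31, .add 3 3 20, .const 8 32,
      .sub 5 20 8, .const 8 0] ++ Frag.copySub

theorem Frag.quiet_relocate (r : ℕ → ℕ) (M P : ℕ) (h0 : 1 ≤ r 0) (hP : P = 32 * r 0)
    (hz : ∀ i, r 0 < i → r i = 0) (hM : 2 * P ≤ M) (hval : ∀ i, 1 ≤ i → r i ≤ M) :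
    ∃ r', Frag.relocate.Quiet r (2000 * (M + 1) ^ 2) r' ∧ r' 20 = P ∧
      ∀ i, r' (P + i) = r (1 + i) := by
  have hQ₀ := Frag.quiet_ops_bound [.add 0 0 0, .add 0 0 0, .add 0 0 0, .add 0 0 0, .add 0 0 0,
    .store 0 1, .const 1 1] (by simp [Instr.Writes]) r (10 * (M + 1)) (by
      simp only [boundOps, Instr.eval, Function.update_apply, reduceIte, Nat.reduceEqDiff,
        Nat.reduceLT]
      omega)
  obtain ⟨r₁, hr₁⟩ : ∃ r₁, r₁ = evalOps [.add 0 0 0, .add 0 0 0, .add 0 0 0, .add 0 0 0, .add 0 0 0,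
    .store 0 1, .const 1 1] r := ⟨_, rfl⟩
  rw [← hr₁] at hQ₀
  have hdbl : r 0 + r 0 + (r 0 + r 0) + (r 0 + r 0 + (r 0 + r 0)) +
      (r 0 + r 0 + (r 0 + r 0) + (r 0 + r 0 + (r 0 + r 0))) +
      (r 0 + r 0 + (r 0 + r 0) + (r 0 + r 0 + (r 0 + r 0)) +
      (r 0 + r 0 + (r 0 + r 0) + (r 0 + r 0 + (r 0 + r 0)))) = P := by omega
  have aP := addr_ne (a := P) (b := 32) (by omega)
  have e0 : r₁ 0 = P := by
    rw [hr₁]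
    simp only [evalOps, Instr.eval, Function.update_apply, reduceIte, Nat.reduceEqDiff,
      Nat.reduceLT, hdbl, aP]
  have e1 : r₁ 1 = 1 := by
    rw [hr₁]
    simp only [evalOps, Instr.eval, Function.update_apply, reduceIte, Nat.reduceEqDiff,
      Nat.reduceLT]
  have eP : r₁ P = r 1 := by
    rw [hr₁]
    simp only [evalOps, Instr.eval, Function.update_apply, reduceIte, Nat.reduceEqDiff,
      Nat.reduceLT, hdbl, aP]
  have ej : ∀ j, 2 ≤ j → j ≠ P → r₁ j = r j := by
    intro j hj hjP
    rw [hr₁]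
    simp only [evalOps, Instr.eval, Function.update_apply, reduceIte, Nat.reduceEqDiff,
      Nat.reduceLT, hdbl, addr_ne hj, hjP]
  obtain ⟨b, b0, bk, bj⟩ := eval_saveOps 30 2 r₁ e1 le_rfl (by omega)
  have hQ₁ := Frag.quiet_ops_bound _ (saveOps_writes 30 2) r₁ _ b
  obtain ⟨r₂, hr₂⟩ : ∃ r₂, r₂ = evalOps (saveOps 30 2) r₁ := ⟨_, rfl⟩
  rw [← hr₂] at hQ₁ b0 bk bj
  rw [e0] at b0 bk bj
  have hQ₂ := Frag.quiet_ops_bound [.const 2 30, .sub 20 0 2, .const 1 32, .const 3 31, .add 3 3 20,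
    .const 8 32, .sub 5 20 8, .const 8 0] (by simp [Instr.Writes]) r₂ (200 * (M + 1)) (by
      simp only [boundOps, Instr.eval, Function.update_apply, reduceIte, Nat.reduceEqDiff,
        Nat.reduceLT, b0]
      omega)
  obtain ⟨r₃, hr₃⟩ : ∃ r₃, r₃ = evalOps [.const 2 30, .sub 20 0 2, .const 1 32, .const 3 31,
    .add 3 3 20, .const 8 32, .sub 5 20 8, .const 8 0] r₂ := ⟨_, rfl⟩
  rw [← hr₃] at hQ₂
  have f1 : r₃ 1 = 32 := by rw [hr₃]; simp only [evalOps, Instr.eval, Function.update_apply,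
    reduceIte, Nat.reduceEqDiff, Nat.reduceLT]
  have f3 : r₃ 3 = 31 + (P + 30 - 30) := by
    rw [hr₃]; simp only [evalOps, Instr.eval, Function.update_apply, reduceIte, Nat.reduceEqDiff,
      Nat.reduceLT, b0]
  have f5 : r₃ 5 = P + 30 - 30 - 32 := by rw [hr₃]; simp only [evalOps, Instr.eval,
    Function.update_apply, reduceIte, Nat.reduceEqDiff, Nat.reduceLT, b0]
  have f8 : r₃ 8 = 0 := by rw [hr₃]; simp only [evalOps, Instr.eval, Function.update_apply,
    reduceIte, Nat.reduceEqDiff, Nat.reduceLT]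
  have f20 : r₃ 20 = P + 30 - 30 := by rw [hr₃]; simp only [evalOps, Instr.eval,
    Function.update_apply, reduceIte, Nat.reduceEqDiff, Nat.reduceLT, b0]
  have fj : ∀ j, 32 ≤ j → r₃ j = r₂ j := by
    intro j hj
    rw [hr₃]
    simp only [evalOps, Instr.eval, Function.update_apply, reduceIte, Nat.reduceEqDiff,
      Nat.reduceLT, addr_ne hj]
  have hlow : ∀ j, 32 ≤ j → j < P → r₃ j = r j := by
    intro j hj hjP
    rw [fj j hj, bj j (by omega) (by omega), ej j (by omega) (by omega)]
  obtain ⟨r₄, hQ₃, hF, hC⟩ := Frag.quiet_copySub r₃ M (P + 31) 32 (P - 32) 0 (by omega) f1 (by omega)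
    f8 (by omega) (by omega) (by omega)
    ((by omega : 32 + (P - 32) ≤ M).trans_lt Nat.lt_two_pow_self) (by omega) (by omega) (by
      intro i hi
      rw [hlow _ (by omega) (by omega)]
      exact hval _ (by omega))
  refine ⟨r₄, (((hQ₀.append hQ₁).append hQ₂).append hQ₃).mono ?_, ?_, fun i => ?_⟩
  · rw [e0]
    have h1 : 100 * (P - 32 + 1) * (M + 1) ≤ 100 * (M + 1) * (M + 1) :=
      Nat.mul_le_mul_right _ (by omega)
    nlinarith
  · rw [hF 20 (by omega) (by omega), f20]
    omega
  · by_cases h1 : i < 31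
    · rw [hF _ (by omega) (by omega), fj _ (by omega)]
      rcases i with _ | i
      · rw [add_zero, bj _ (by omega) (by omega), eP]
      · rw [show P + (i + 1) = P + 1 + i by ring, bk i (by omega), ej _ (by omega) (by omega)]
        congr 1
        omega
    · by_cases h2 : i < P - 1
      · rw [show P + i = P + 31 + (i - 31) by omega, hC _ (by omega), hlow _ (by omega) (by omega)]
        rw [show 32 + (i - 31) = 1 + i by omega]
        rfl
      · rw [hF _ (by omega) (by omega), fj _ (by omega), bj _ (by omega) (by omega),
          ej _ (by omega) (by omega), hz _ (by omega), hz _ (by omega)]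

/-! ### Simulating a program in the upper part of the memory -/

/-- The representation of the number `v` in a simulation above the register `B`. Since it is also
the address of the register that represents the simulated register `v`, indirect addressing needs
no arithmetic, whose cost would not be bounded by the cost of the simulated instruction. The number
`0` represents itself because untouched registers contain it. -/
def rep (B v : ℕ) : ℕ := if v = 0 then 0 else v + B

theorem rep_sub (B v : ℕ) : rep B v - B = v := by
  unfold rep; split <;> omega

theorem rep_lt {B u v : ℕ} : rep B u < rep B v ↔ u < v := by
  unfold rep; split <;> split <;> omega

theorem rep_inj {B u v : ℕ} : rep B u = rep B v ↔ u = v := by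
  unfold rep; split <;> split <;> omega

theorem rep_le (B v : ℕ) : rep B v ≤ v + B := by
  unfold rep; split <;> omega

theorem rep_cases (B v : ℕ) : rep B v = 0 ∨ B < rep B v := by
  unfold rep; split <;> omega

theorem evalOps_append (l m : List Instr) (r : ℕ → ℕ) :
    evalOps (l ++ m) r = evalOps m (evalOps l r) := by
  induction l generalizing r with
  | nil => rfl
  | cons i l ih => exact ih _

theorem costOps_append (l m : List Instr) (r : ℕ → ℕ) :
    costOps (l ++ m) r = costOps l r + costOps m (evalOps l r) := by
  induction l generalizing r with
  | nil => simp [costOps, evalOps]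
  | cons i l ih => simp only [List.cons_append, costOps, evalOps, ih]; ring

/-- `R_t := rep B d`, where `B = R_13`. -/
def addrOps (t d : ℕ) : List Instr :=
  if d = 0 then [.const t 0] else [.const t d, .add t t 13]

/-- Read the simulated register `d` into `R_t`. -/
def getOps (t d : ℕ) : List Instr := addrOps t d ++ [.load t t]

/-- Write `R_t` into the simulated register `d`. -/
def setOps (d t : ℕ) : List Instr := addrOps 9 d ++ [.store 9 t]

/-- Replace the number `v` in `R_1` by its representation `v + (1 - (1 - v)) B`. -/
def repOps : List Instr :=
  [.const 3 1, .sub 4 3 1, .sub 4 3 4, .mul 4 4 13, .add 1 1 4]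

/-- The straight-line part of the simulation of an instruction. -/
def simOps : Instr → List Instr
  | .const d n => addrOps 1 n ++ setOps d 1
  | .copy d s => getOps 1 s ++ setOps d 1
  | .load d s => getOps 1 s ++ ([.load 1 1] ++ setOps d 1)
  | .store d s => getOps 1 d ++ (getOps 2 s ++ [.store 1 2])
  | .add d s t => getOps 1 s ++ (getOps 2 t ++
      ([.sub 1 1 13, .sub 2 2 13, .add 1 1 2] ++ (repOps ++ setOps d 1)))
  | .sub d s t => getOps 1 s ++ (getOps 2 t ++
      ([.sub 1 1 13, .sub 2 2 13, .sub 1 1 2] ++ (repOps ++ setOps d 1)))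
  | .mul d s t => getOps 1 s ++ (getOps 2 t ++
      ([.sub 1 1 13, .sub 2 2 13, .mul 1 1 2] ++ (repOps ++ setOps d 1)))
  | .jump _ => []
  | .jlt s t _ => getOps 1 s ++ getOps 2 t
  | .output s _ => getOps 1 s ++ [.load 2 1, .const 3 0]
  | .halt => []

/-- The registers `r` represent the simulated registers `c`, and agree below `B` with `r₀` apart from
scratch registers. -/
structure SimRel (B : ℕ) (r₀ c r : ℕ → ℕ) : Prop where
  val : ∀ i, r (rep B i) = rep B (c i)
  base : r 13 = B
  frame : ∀ j, 10 ≤ j → j < B → r j = r₀ j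

section

variable {B : ℕ} {r₀ c r : ℕ → ℕ}

theorem SimRel.scratch (h : SimRel B r₀ c r) (hB : 16 ≤ B) {t : ℕ} (ht : 1 ≤ t) (ht' : t < 10)
    (v : ℕ) : SimRel B r₀ c (Function.update r t v) := by
  refine ⟨fun i => ?_, ?_, fun j hj hj' => ?_⟩
  · have := rep_cases B i
    rw [Function.update_apply, if_neg (by omega), h.val]
  · rw [Function.update_apply, if_neg (by omega), h.base]
  · rw [Function.update_apply, if_neg (by omega), h.frame j hj hj']

theorem SimRel.set (h : SimRel B r₀ c r) (hB : 16 ≤ B) (d v : ℕ) :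
    SimRel B r₀ (Function.update c d v) (Function.update r (rep B d) (rep B v)) := by
  have := rep_cases B d
  refine ⟨fun i => ?_, ?_, fun j hj hj' => ?_⟩
  · simp only [Function.update_apply, rep_inj]
    split
    · rfl
    · exact h.val i
  · rw [Function.update_apply, if_neg (by omega), h.base]
  · rw [Function.update_apply, if_neg (by omega), h.frame j hj hj']

theorem eval_addrOps {t : ℕ} (d : ℕ) (hr : r 13 = B) (ht : t < 10) :
    evalOps (addrOps t d) r = Function.update r t (rep B d) ∧
      costOps (addrOps t d) r ≤ 2 + d + B := by
  have := logCost_le d B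
  unfold addrOps rep
  split
  · simp [evalOps, Instr.eval, costOps, Instr.cost]
    omega
  · simp [evalOps, Instr.eval, costOps, Instr.cost, Function.update_apply, hr,
      show 13 ≠ t by omega]
    omega

theorem eval_getOps (h : SimRel B r₀ c r) (hB : 16 ≤ B) {t : ℕ} (ht : 1 ≤ t) (ht' : t < 10)
    (d : ℕ) : evalOps (getOps t d) r = Function.update r t (rep B (c d)) ∧
      costOps (getOps t d) r ≤ 3 + d + B := by
  obtain ⟨h1, h2⟩ := eval_addrOps (t := t) d h.base ht'
  have := rep_cases B d
  have hv := h.val d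
  unfold getOps
  rw [evalOps_append, costOps_append, h1]
  constructor
  · simp only [evalOps, Instr.eval, Function.update_self]
    rw [Function.update_idem, Function.update_apply, if_neg (by omega), hv]
  · simp only [costOps, Instr.cost]
    omega

theorem eval_setOps (h : SimRel B r₀ c r) (hB : 16 ≤ B) {t v : ℕ} (ht' : t < 9)
    (d : ℕ) (hv : r t = rep B v) :
    SimRel B r₀ (Function.update c d v) (evalOps (setOps d t) r) ∧
      costOps (setOps d t) r ≤ 3 + d + B := by
  obtain ⟨h1, h2⟩ := eval_addrOps (t := 9) d h.base (by omega)
  unfold setOps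
  rw [evalOps_append, costOps_append, h1]
  constructor
  · simp only [evalOps, Instr.eval, Function.update_self]
    rw [Function.update_apply, if_neg (by omega), hv]
    exact (h.scratch hB (by omega) (by omega) _).set hB d v
  · simp only [costOps, Instr.cost]
    omega

theorem log_add_le (x y : ℕ) : Nat.log 2 (x + y) ≤ Nat.log 2 x + y := by
  rcases Nat.eq_zero_or_pos (x + y) with h | h
  · rw [h]; simp
  · rw [← Nat.lt_succ_iff]
    apply Nat.log_lt_of_lt_pow (by omega)
    have h1 := Nat.lt_pow_succ_log_self (b := 2) (by omega) x
    have h2 : y + 1 ≤ 2 ^ y := Nat.lt_two_pow_self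
    rw [show (Nat.log 2 x + y).succ = Nat.log 2 x + 1 + y by omega, pow_add]
    have h3 := Nat.mul_le_mul (Nat.succ_le_of_lt h1) h2
    refine lt_of_lt_of_le ?_ h3
    nlinarith

theorem eval_repOps (h : SimRel B r₀ c r) (hB : 16 ≤ B) :
    SimRel B r₀ c (evalOps repOps r) ∧ evalOps repOps r 1 = rep B (r 1) ∧
      costOps repOps r ≤ 10 + 2 * Nat.log 2 (r 1) + 3 * B := by
  have hb := h.base
  have hz : (1 - (1 - r 1)) * B + r 1 = rep B (r 1) := by
    unfold rep; rw [min_one_sub]; split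
    · simp [*]
    · ring
  have hle : (1 - (1 - r 1)) * B ≤ B := by rw [min_one_sub]; split <;> simp
  refine ⟨?_, ?_, ?_⟩
  · simp only [repOps, evalOps, Instr.eval]
    repeat refine SimRel.scratch ?_ hB (by omega) (by omega) _
    exact h
  · simp only [repOps, evalOps, Instr.eval, Function.update_apply, reduceIte, Nat.reduceEqDiff,
      Nat.reduceLT, hb]
    rw [add_comm, hz]
  · simp only [repOps, costOps, Instr.eval, Instr.cost, Function.update_apply, reduceIte,
      Nat.reduceEqDiff, Nat.reduceLT, hb, logCost]
    have h1 := log_add_le (r 1) 1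
    rw [add_comm (r 1) 1] at h1
    have h2 := Nat.log_le_self 2 (1 + (1 - r 1))
    have h3 := Nat.log_le_self 2 (1 - (1 - r 1) + B)
    have h4 := log_add_le (r 1) ((1 - (1 - r 1)) * B)
    omega

/-- The numbers that occur in an instruction are at most `S`. -/
def Instr.ArgsLe (S : ℕ) : Instr → Prop
  | .const d n => d ≤ S ∧ n ≤ S
  | .copy d s => d ≤ S ∧ s ≤ S
  | .load d s => d ≤ S ∧ s ≤ S
  | .store d s => d ≤ S ∧ s ≤ S
  | .add d s t => d ≤ S ∧ s ≤ S ∧ t ≤ S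
  | .sub d s t => d ≤ S ∧ s ≤ S ∧ t ≤ S
  | .mul d s t => d ≤ S ∧ s ≤ S ∧ t ≤ S
  | .jump _ => True
  | .jlt s t _ => s ≤ S ∧ t ≤ S
  | .output s t => s ≤ S ∧ t ≤ S
  | .halt => True

theorem Instr.ArgsLe.mono {S S' : ℕ} (h : S ≤ S') {i : Instr} (hi : i.ArgsLe S) :
    i.ArgsLe S' := by
  cases i <;> simp only [Instr.ArgsLe] at hi ⊢ <;> omega

theorem exists_argsLe (Q : Program) : ∃ S, ∀ i ∈ Q, i.ArgsLe S := by
  induction Q with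
  | nil => exact ⟨0, by simp⟩
  | cons i Q ih =>
    obtain ⟨S, hS⟩ := ih
    have : ∃ S', i.ArgsLe S' := by
      cases i with
      | const d n => exact ⟨d + n, by simp [Instr.ArgsLe]⟩
      | copy d n => exact ⟨d + n, by simp [Instr.ArgsLe]⟩
      | load d n => exact ⟨d + n, by simp [Instr.ArgsLe]⟩
      | store d n => exact ⟨d + n, by simp [Instr.ArgsLe]⟩
      | add d s t => exact ⟨d + s + t, by simp only [Instr.ArgsLe]; omega⟩
      | sub d s t => exact ⟨d + s + t, by simp only [Instr.ArgsLe]; omega⟩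
      | mul d s t => exact ⟨d + s + t, by simp only [Instr.ArgsLe]; omega⟩
      | jlt d s t => exact ⟨d + s, by simp [Instr.ArgsLe]⟩
      | output d s => exact ⟨d + s, by simp [Instr.ArgsLe]⟩
      | jump l => exact ⟨0, trivial⟩
      | halt => exact ⟨0, trivial⟩
    obtain ⟨S', hS'⟩ := this
    refine ⟨S + S', fun j hj => ?_⟩
    rcases List.mem_cons.1 hj with rfl | hj
    · exact hS'.mono (by omega)
    · exact (hS j hj).mono (by omega)

/-- The simulation of an arithmetic instruction, where `f` is the operation. -/
theorem simRel_arith (h : SimRel B r₀ c r) (hB : 16 ≤ B) {S d s t : ℕ} (hd : d ≤ S) (hs : s ≤ S)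
    (ht : t ≤ S) {i : Instr} {z : ℕ} (hz : z ≤ (c s + c t) ^ 2 + (c s + c t))
    (hi : ∀ r' : ℕ → ℕ, r' 1 = c s → r' 2 = c t →
      i.eval r' = Function.update r' 1 z ∧ i.cost r' = logCost (c s) (c t)) :
    SimRel B r₀ (Function.update c d z) (evalOps (getOps 1 s ++ (getOps 2 t ++
      ([.sub 1 1 13, .sub 2 2 13, i] ++ (repOps ++ setOps d 1)))) r) ∧
    costOps (getOps 1 s ++ (getOps 2 t ++
      ([.sub 1 1 13, .sub 2 2 13, i] ++ (repOps ++ setOps d 1)))) r + 5 ≤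
      40 * (B + S + 1) * logCost (c s) (c t) := by
  obtain ⟨g1, k1⟩ := eval_getOps h hB (t := 1) (by omega) (by omega) s
  have h1 := h.scratch hB (t := 1) (by omega) (by omega) (rep B (c s))
  obtain ⟨g2, k2⟩ := eval_getOps h1 hB (t := 2) (by omega) (by omega) t
  have h2 := h1.scratch hB (t := 2) (by omega) (by omega) (rep B (c t))
  obtain ⟨r₂, hr₂⟩ : ∃ r₂, r₂ = Function.update (Function.update r 1 (rep B (c s))) 2
    (rep B (c t)) := ⟨_, rfl⟩
  rw [← hr₂] at g2 h2
  have e1 : r₂ 1 = rep B (c s) := by rw [hr₂]; simp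
  have e2 : r₂ 2 = rep B (c t) := by rw [hr₂]; simp
  have h3 := (h2.scratch hB (t := 1) (by omega) (by omega) (c s)).scratch hB (t := 2) (by omega)
    (by omega) (c t)
  obtain ⟨r₃, hr₃⟩ : ∃ r₃, r₃ = Function.update (Function.update r₂ 1 (c s)) 2 (c t) := ⟨_, rfl⟩
  rw [← hr₃] at h3
  have g3 : evalOps [.sub 1 1 13, .sub 2 2 13, i] r₂ = Function.update r₃ 1 z ∧
      costOps [.sub 1 1 13, .sub 2 2 13, i] r₂ = logCost (rep B (c s)) B + (logCost (rep B (c t)) B +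
        logCost (c s) (c t)) := by
    obtain ⟨hi1, hi2⟩ := hi r₃ (by rw [hr₃]; simp) (by rw [hr₃]; simp)
    have he : evalOps [.sub 1 1 13, .sub 2 2 13] r₂ = r₃ := by
      simp [evalOps, Instr.eval, Function.update_apply, e1, e2, h2.base, rep_sub, hr₃]
    have hk : costOps [.sub 1 1 13, .sub 2 2 13] r₂ =
        logCost (rep B (c s)) B + logCost (rep B (c t)) B := by
      simp [costOps, Instr.eval, Instr.cost, Function.update_apply, e1, e2, h2.base]
    rw [show [Instr.sub 1 1 13, .sub 2 2 13, i] = [.sub 1 1 13, .sub 2 2 13] ++ [i] from rfl,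
      evalOps_append, costOps_append, he, hk]
    simp only [evalOps, costOps, hi1, hi2, add_zero, add_assoc, and_self]
  have h4 := h3.scratch hB (t := 1) (by omega) (by omega) z
  obtain ⟨g4, v4, k4⟩ := eval_repOps h4 hB
  rw [Function.update_self] at v4 k4
  obtain ⟨g5, k5⟩ := eval_setOps g4 hB (t := 1) (by omega) d v4
  simp only [evalOps_append, costOps_append, g1, g2, g3.1, g3.2]
  refine ⟨g5, ?_⟩
  -- Even a product has only about twice as many digits as the sum of the operands, so that the
  -- conversion of the result costs no more than a multiple of the instruction.
  have hlog : Nat.log 2 z ≤ 2 * Nat.log 2 (c s + c t) + 3 := by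
    rw [← Nat.lt_succ_iff]
    apply Nat.log_lt_of_lt_pow' (by omega)
    have h1 := Nat.lt_pow_succ_log_self (b := 2) (by omega) (c s + c t)
    generalize c s + c t = x at *
    generalize Nat.log 2 x = y at *
    have h2 := Nat.mul_le_mul (Nat.succ_le_of_lt h1) (Nat.succ_le_of_lt h1)
    rw [show y.succ = y + 1 from rfl] at h2
    rw [show (2 * y + 3).succ = (y + 1) + (y + 1) + 2 by omega, pow_add, pow_add]
    nlinarith
  have l1 : Nat.log 2 (rep B (c s) + B) ≤ Nat.log 2 (c s + c t) + 2 * B :=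
    (Nat.log_mono_right (show rep B (c s) + B ≤ c s + c t + 2 * B by
      have := rep_le B (c s); omega)).trans (log_add_le _ _)
  have l2 : Nat.log 2 (rep B (c t) + B) ≤ Nat.log 2 (c s + c t) + 2 * B :=
    (Nat.log_mono_right (show rep B (c t) + B ≤ c s + c t + 2 * B by
      have := rep_le B (c t); omega)).trans (log_add_le _ _)
  simp only [logCost] at *
  nlinarith

theorem simRel_simOps (h : SimRel B r₀ c r) (hB : 16 ≤ B) {S : ℕ} {i : Instr} (hi : i.ArgsLe S)
    (hw : i.Writes) :
    SimRel B r₀ (i.eval c) (evalOps (simOps i) r) ∧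
      costOps (simOps i) r + 5 ≤ 40 * (B + S + 1) * i.cost c := by
  cases i with
  | const d n =>
    obtain ⟨g1, k1⟩ := eval_addrOps (t := 1) n h.base (by omega)
    obtain ⟨g2, k2⟩ := eval_setOps (h.scratch hB (t := 1) (by omega) (by omega) (rep B n)) hB
      (t := 1) (v := n) (by omega) d (by simp)
    obtain ⟨hd, hn⟩ := hi
    simp only [simOps, evalOps_append, costOps_append, g1, Instr.cost]
    exact ⟨g2, by omega⟩
  | copy d s =>
    obtain ⟨g1, k1⟩ := eval_getOps h hB (t := 1) (by omega) (by omega) s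
    obtain ⟨g2, k2⟩ := eval_setOps (h.scratch hB (t := 1) (by omega) (by omega) (rep B (c s))) hB
      (t := 1) (v := c s) (by omega) d (by simp)
    obtain ⟨hd, hn⟩ := hi
    simp only [simOps, evalOps_append, costOps_append, g1, Instr.cost]
    exact ⟨g2, by omega⟩
  | load d s =>
    obtain ⟨g1, k1⟩ := eval_getOps h hB (t := 1) (by omega) (by omega) s
    have h1 := h.scratch hB (t := 1) (by omega) (by omega) (rep B (c s))
    have h2 := h1.scratch hB (t := 1) (by omega) (by omega) (rep B (c (c s)))
    obtain ⟨g2, k2⟩ := eval_setOps h2 hB (t := 1) (v := c (c s)) (by omega) d (by simp)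
    obtain ⟨hd, hn⟩ := hi
    have hv := h1.val (c s)
    simp only [simOps, evalOps_append, costOps_append, g1, Instr.cost]
    simp only [evalOps, costOps, Instr.eval, Instr.cost, Function.update_self]
    rw [hv]
    exact ⟨g2, by omega⟩
  | store d s =>
    obtain ⟨g1, k1⟩ := eval_getOps h hB (t := 1) (by omega) (by omega) d
    have h1 := h.scratch hB (t := 1) (by omega) (by omega) (rep B (c d))
    obtain ⟨g2, k2⟩ := eval_getOps h1 hB (t := 2) (by omega) (by omega) s
    have h2 := h1.scratch hB (t := 2) (by omega) (by omega) (rep B (c s))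
    obtain ⟨hd, hn⟩ := hi
    simp only [simOps, evalOps_append, costOps_append, g1, g2, Instr.cost]
    simp only [evalOps, costOps, Instr.eval, Instr.cost, Function.update_self]
    simp only [Function.update_apply _ 2 _ 1, Nat.reduceEqDiff, reduceIte, Function.update_self]
    exact ⟨h2.set hB _ _, by omega⟩
  | add d s t =>
    obtain ⟨hd, hs, ht⟩ := hi
    exact simRel_arith h hB hd hs ht (z := c s + c t) (by nlinarith) (by
      intro r' h1 h2; simp [Instr.eval, Instr.cost, h1, h2])
  | sub d s t =>
    obtain ⟨hd, hs, ht⟩ := hi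
    exact simRel_arith h hB hd hs ht (z := c s - c t)
      (by have := Nat.sub_le (c s) (c t); nlinarith) (by
      intro r' h1 h2; simp [Instr.eval, Instr.cost, h1, h2])
  | mul d s t =>
    obtain ⟨hd, hs, ht⟩ := hi
    exact simRel_arith h hB hd hs ht (z := c s * c t) (by nlinarith) (by
      intro r' h1 h2; simp [Instr.eval, Instr.cost, h1, h2])
  | _ => simp [Instr.Writes] at hw

end

/-- The jumps at the end of the simulation of an instruction: `pos l` is the line where the
simulation of line `l` starts, `out` is the line to go to at a halt, `found` the line to go to at an
output whose first letter is not `0`, and `next` is the line to go to otherwise. -/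
def simJumps (pos : ℕ → ℕ) (out found next : ℕ) : Instr → List Instr
  | .jump l => [.jump (pos l)]
  | .jlt _ _ l => [.jlt 1 2 (pos l), .jump next]
  | .output _ _ => [.jlt 3 2 found, .jump next]
  | .halt => [.jump out]
  | _ => [.jump next]

theorem length_simOps_le (i : Instr) (pos : ℕ → ℕ) (out found next : ℕ) :
    (simOps i ++ simJumps pos out found next i).length ≤ 20 := by
  have h : ∀ t d, (addrOps t d).length ≤ 2 := by
    intro t d; unfold addrOps; split <;> simp
  cases i <;> simp only [simOps, simJumps, getOps, setOps, repOps, List.length_append,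
    List.length_cons, List.length_nil]
  case const d n => have := h 1 n; have := h 9 d; omega
  case copy d s => have := h 1 s; have := h 9 d; omega
  case load d s => have := h 1 s; have := h 9 d; omega
  case store d s => have := h 1 d; have := h 2 s; omega
  case add d s t => have := h 1 s; have := h 2 t; have := h 9 d; omega
  case sub d s t => have := h 1 s; have := h 2 t; have := h 9 d; omega
  case mul d s t => have := h 1 s; have := h 2 t; have := h 9 d; omega
  case jump l => omega
  case jlt s t l => have := h 1 s; have := h 2 t; omega
  case output s t => have := h 1 s; omega
  case halt => omega

theorem simOps_writes (i : Instr) : ∀ a ∈ simOps i, a.Writes := by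
  have h : ∀ t d, (addrOps t d).all Instr.Writes := by
    intro t d; unfold addrOps; split <;> simp [Instr.Writes]
  rw [← List.all_eq_true]
  cases i <;> simp [simOps, getOps, setOps, repOps, List.all_append, h, Instr.Writes]

/-- The line where the simulation of line `l` of `Q` starts; each line gets `20` lines. -/
def simPos (Q : Program) (o l : ℕ) : ℕ := o + 20 * min l Q.length

/-- The simulation of line `l` of `Q`, without padding. -/
def simBlock (Q : Program) (o l : ℕ) : List Instr :=
  match Q[l]? with
  | none => []
  | some i => simOps i ++ simJumps (simPos Q o) (o + 20 * Q.length) (o + 20 * Q.length + 2)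
      (simPos Q o (l + 1)) i

/-- Simulate `Q` behind the register `B = R_13` until an output whose first letter is not `0`. If
there is one, then `R_15 := 1`, and `R_1` represents the address of the word; otherwise `R_15 := 0`.
The code for a line of `Q` is filled up to `20` lines, so that jump targets are easy to compute. -/
def Frag.sim (Q : Program) : Frag where
  len := 20 * Q.length + 3
  code := fun o =>
    (List.ofFn fun k : Fin (20 * Q.length) => (simBlock Q o (k / 20)).getD (k % 20) .halt) ++
      [.const 15 0, .jump (o + 20 * Q.length + 3), .const 15 1]
  length_code := fun o => by simp

theorem codeAt_simBlock {P Q : Program} {o : ℕ} (h : CodeAt P o ((Frag.sim Q).code o)) {l : ℕ}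
    (hl : l < Q.length) : CodeAt P (simPos Q o l) (simBlock Q o l) := by
  intro i hi
  have hlen : (simBlock Q o l).length ≤ 20 := by
    unfold simBlock
    rw [List.getElem?_eq_getElem hl]
    exact length_simOps_le _ _ _ _ _
  have h' := (CodeAt.append h).1 (20 * l + i) (by simp; omega)
  rw [simPos, min_eq_left hl.le, add_assoc, h', List.getElem?_ofFn, dif_pos (by omega)]
  simp only
  rw [show (20 * l + i) / 20 = l by omega, show (20 * l + i) % 20 = i by omega,
    List.getD_eq_getElem _ _ hi, List.getElem?_eq_getElem hi]

theorem reaches_step {P : Program} {a b : Config} (h : step P a = some b) :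
    StateTransition.Reaches (step P) a b :=
  Relation.ReflTransGen.single h

theorem reaches_jlt_false {P : Program} {o s t l : ℕ} {r : ℕ → ℕ} (hP : P[o]? = some (.jlt s t l))
    (h : ¬ r s < r t) (T : ℕ) (g : List (List ℕ × ℕ)) :
    StateTransition.Reaches (step P) ⟨o, r, T, g⟩ ⟨o + 1, r, T + logCost (r s) (r t), g⟩ :=
  reaches_step (by simp [step, hP, h])

theorem reaches_jlt_true {P : Program} {o s t l : ℕ} {r : ℕ → ℕ} (hP : P[o]? = some (.jlt s t l))
    (h : r s < r t) (T : ℕ) (g : List (List ℕ × ℕ)) :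
    StateTransition.Reaches (step P) ⟨o, r, T, g⟩ ⟨l, r, T + logCost (r s) (r t), g⟩ :=
  reaches_step (by simp [step, hP, h])

theorem reaches_jump {P : Program} {o l : ℕ} {r : ℕ → ℕ} (hP : P[o]? = some (.jump l))
    (T : ℕ) (g : List (List ℕ × ℕ)) :
    StateTransition.Reaches (step P) ⟨o, r, T, g⟩ ⟨l, r, T + 1, g⟩ :=
  reaches_step (by simp [step, hP])

/-- The word output by the machine starts with the register `R_i`. -/
theorem block_eq_cons {reg : ℕ → ℕ} {i j a : ℕ} {l : List ℕ} (h : block reg i j = a :: l) :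
    reg i = a := by
  unfold block at h
  cases hn : j + 1 - i with
  | zero => simp [hn] at h
  | succ n =>
    rw [hn, List.range'_succ, List.map_cons] at h
    exact (List.cons.inj h).1

/-- All words in the list start with the letter `0`. -/
def NoHit (g : List (List ℕ × ℕ)) : Prop := ∀ e ∈ g, ∃ l, e.1 = 0 :: l

theorem log_prefix_of_step {P : Program} {c c' : Config} (h : step P c = some c') :
    c.log <+: c'.log := by
  unfold step at h
  split at h <;> simp only [Option.some.injEq, reduceCtorEq] at h <;> subst h <;>
    simp [Config.write]

theorem log_prefix_of_reaches {P : Program} {c c' : Config}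
    (h : StateTransition.Reaches (step P) c c') : c.log <+: c'.log := by
  induction h with
  | refl => exact List.prefix_rfl
  | tail _ hs ih => exact ih.trans (log_prefix_of_step hs)

/-- The simulation of one step that is not an output whose first letter differs from `0`. -/
theorem sim_step {Q : Program} {S B : ℕ} (hS : ∀ i ∈ Q, i.ArgsLe S) (hB : 16 ≤ B) {r₀ r : ℕ → ℕ}
    {c c' : Config} (h : SimRel B r₀ c.reg r) (hs : step Q c = some c')
    (ho : ∀ s t, Q[c.pc]? = some (.output s t) → c.reg (c.reg s) = 0) :
    ∃ r' t, SimRel B r₀ c'.reg r' ∧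
      t + 40 * (B + S + 1) * c.time ≤ 40 * (B + S + 1) * c'.time ∧
      ∀ P o T g, CodeAt P o ((Frag.sim Q).code o) →
        StateTransition.Reaches (step P) ⟨simPos Q o c.pc, r, T, g⟩
          ⟨simPos Q o c'.pc, r', T + t, g⟩ := by
  cases hi : Q[c.pc]? with
  | none => simp [step, hi] at hs
  | some i =>
    have hpc : c.pc < Q.length := by
      by_contra hn
      rw [List.getElem?_eq_none (by omega)] at hi
      simp at hi
    have hmem : i ∈ Q := List.mem_of_getElem? hi
    have hargs := hS i hmem
    have hblock : ∀ P o, CodeAt P o ((Frag.sim Q).code o) →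
        CodeAt P (simPos Q o c.pc) (simOps i ++ simJumps (simPos Q o) (o + 20 * Q.length)
          (o + 20 * Q.length + 2) (simPos Q o (c.pc + 1)) i) := by
      intro P o hP
      have := codeAt_simBlock hP hpc
      rwa [simBlock, hi] at this
    by_cases hw : i.Writes
    · obtain ⟨g1, k1⟩ := simRel_simOps h hB hargs hw
      have hc' : c' = ⟨c.pc + 1, i.eval c.reg, c.time + i.cost c.reg, c.log⟩ := by
        cases i <;> simp_all [step, Config.write, Instr.eval, Instr.cost, Instr.Writes]
      refine ⟨_, costOps (simOps i) r + 1, by rw [hc']; exact g1, ?_, fun P o T g hP => ?_⟩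
      · rw [hc']; dsimp only; rw [mul_add _ c.time]; omega
      · obtain ⟨h1, h2⟩ := CodeAt.append (hblock P o hP)
        have e1 := reaches_ops _ (simOps_writes i) _ r T g h1
        have hj : simJumps (simPos Q o) (o + 20 * Q.length)
          (o + 20 * Q.length + 2) (simPos Q o (c.pc + 1)) i = [.jump (simPos Q o (c.pc + 1))] := by
          cases i <;> simp_all [simJumps, Instr.Writes]
        rw [hj] at h2
        refine e1.trans (reaches_step ?_)
        have := h2.head
        simp [step, this, hc', add_assoc]
    · have hR := h
      cases i with
      | jump l =>
        have hc' : c' = ⟨l, c.reg, c.time + 1, c.log⟩ := by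
          simpa [step, hi] using hs.symm
        refine ⟨r, 1, by rw [hc']; exact h, ?_, fun P o T g hP => reaches_step ?_⟩
        · rw [hc']; dsimp only; rw [mul_add _ c.time]; omega
        · have := (hblock P o hP).head
          simp [step, this, hc']
      | jlt s t l =>
        have hc' : c' = ⟨if c.reg s < c.reg t then l else c.pc + 1, c.reg,
            c.time + logCost (c.reg s) (c.reg t), c.log⟩ := by
          simpa [step, hi] using hs.symm
        obtain ⟨g1, k1⟩ := eval_getOps h hB (t := 1) (by omega) (by omega) s
        have h1 := h.scratch hB (t := 1) (by omega) (by omega) (rep B (c.reg s))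
        obtain ⟨g2, k2⟩ := eval_getOps h1 hB (t := 2) (by omega) (by omega) t
        have h2 := h1.scratch hB (t := 2) (by omega) (by omega) (rep B (c.reg t))
        obtain ⟨r₂, hr₂⟩ : ∃ r₂, r₂ = Function.update (Function.update r 1 (rep B (c.reg s))) 2
          (rep B (c.reg t)) := ⟨_, rfl⟩
        rw [← hr₂] at g2 h2
        have e1 : r₂ 1 = rep B (c.reg s) := by rw [hr₂]; simp
        have e2 : r₂ 2 = rep B (c.reg t) := by rw [hr₂]; simp
        obtain ⟨ha1, ha2⟩ := hargs
        have hlog : logCost (rep B (c.reg s)) (rep B (c.reg t)) ≤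
            logCost (c.reg s) (c.reg t) + 2 * B := by
          have : Nat.log 2 (rep B (c.reg s) + rep B (c.reg t)) ≤
            Nat.log 2 (c.reg s + c.reg t) + 2 * B :=
            (Nat.log_mono_right (show _ ≤ c.reg s + c.reg t + 2 * B by
              have := rep_le B (c.reg t); have := rep_le B (c.reg s); omega)).trans (log_add_le _ _)
          unfold logCost
          omega
        have hcost : costOps (simOps (.jlt s t l)) r + logCost (rep B (c.reg s)) (rep B (c.reg t)) + 1
            ≤ 40 * (B + S + 1) * logCost (c.reg s) (c.reg t) := by
          simp only [simOps, costOps_append, g1]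
          have : 1 ≤ logCost (c.reg s) (c.reg t) := by unfold logCost; omega
          nlinarith
        have heval : evalOps (simOps (.jlt s t l)) r = r₂ := by
          simp only [simOps, evalOps_append, g1, g2]
        by_cases hlt : c.reg s < c.reg t
        · refine ⟨r₂, costOps (simOps (.jlt s t l)) r + logCost (rep B (c.reg s)) (rep B (c.reg t)),
            by rw [hc']; exact h2, ?_, fun P o T g hP => ?_⟩
          · rw [hc']; dsimp only; rw [mul_add _ c.time]; omega
          · obtain ⟨p1, p2⟩ := CodeAt.append (hblock P o hP)
            have q1 := reaches_ops _ (simOps_writes _) _ r T g p1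
            rw [heval] at q1
            refine q1.trans (reaches_step ?_)
            have := p2.head
            simp [step, this, hc', e1, e2, rep_lt, hlt, add_assoc]
        · refine ⟨r₂, costOps (simOps (.jlt s t l)) r +
            logCost (rep B (c.reg s)) (rep B (c.reg t)) + 1, by rw [hc']; exact h2, ?_, fun P o T g hP => ?_⟩
          · rw [hc']; dsimp only; rw [mul_add _ c.time]; omega
          · obtain ⟨p1, p2⟩ := CodeAt.append (hblock P o hP)
            have q1 := reaches_ops _ (simOps_writes _) _ r T g p1
            rw [heval] at q1
            have q2 : StateTransition.Reaches (step P) _ _ := (q1.trans (reaches_jlt_false p2.head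
              (by rw [e1, e2, rep_lt]; exact hlt) _ g)).trans (reaches_jump p2.tail.head _ g)
            rw [e1, e2] at q2
            simpa only [hc', hlt, if_false, add_assoc] using q2
      | output s t =>
        have hc' : c' = ⟨c.pc + 1, c.reg, c.time + 1,
            c.log ++ [(block c.reg (c.reg s) (c.reg t), c.time + 1)]⟩ := by
          simpa [step, hi] using hs.symm
        have h0 := ho s t hi
        obtain ⟨g1, k1⟩ := eval_getOps h hB (t := 1) (by omega) (by omega) s
        have h1 := h.scratch hB (t := 1) (by omega) (by omega) (rep B (c.reg s))
        obtain ⟨r₁, hr₁⟩ : ∃ r₁, r₁ = Function.update r 1 (rep B (c.reg s)) := ⟨_, rfl⟩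
        rw [← hr₁] at g1 h1
        have e1 : r₁ 1 = rep B (c.reg s) := by rw [hr₁]; simp
        have e2 := (h1.val (c.reg s)).trans (congrArg (rep B) h0)
        rw [show rep B 0 = 0 from rfl] at e2
        have h2 := (h1.scratch hB (t := 2) (by omega) (by omega) 0).scratch hB (t := 3) (by omega)
          (by omega) 0
        obtain ⟨r₂, hr₂⟩ : ∃ r₂, r₂ = Function.update (Function.update r₁ 2 0) 3 0 := ⟨_, rfl⟩
        rw [← hr₂] at h2
        have f2 : r₂ 2 = 0 := by rw [hr₂]; simp
        have f3 : r₂ 3 = 0 := by rw [hr₂]; simp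
        have heval : evalOps (simOps (.output s t)) r = r₂ := by
          simp only [simOps, evalOps_append, g1, evalOps, Instr.eval, e1, e2, hr₂]
        obtain ⟨ha1, ha2⟩ := hargs
        have hcost : costOps (simOps (.output s t)) r ≤ 5 + S + B := by
          simp only [simOps, costOps_append, costOps, Instr.cost]
          omega
        refine ⟨r₂, costOps (simOps (.output s t)) r + 1 + 1, by rw [hc']; exact h2, ?_, fun P o T g hP => ?_⟩
        · rw [hc']; dsimp only; rw [mul_add _ c.time]; omega
        · obtain ⟨p1, p2⟩ := CodeAt.append (hblock P o hP)
          have q1 := reaches_ops _ (simOps_writes _) _ r T g p1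
          rw [heval] at q1
          have q2 : StateTransition.Reaches (step P) _ _ := (q1.trans (reaches_jlt_false p2.head
            (by rw [f2, f3]; exact lt_irrefl 0) _ g)).trans (reaches_jump p2.tail.head _ g)
          rw [f2, f3] at q2
          simpa only [hc', add_assoc, show logCost 0 0 = 1 from rfl] using q2
      | halt => simp [step, hi] at hs
      | _ => simp [Instr.Writes] at hw

/-- The simulation of an output whose first letter differs from `0`. -/
theorem sim_hit {Q : Program} {S B : ℕ} (hS : ∀ i ∈ Q, i.ArgsLe S) (hB : 16 ≤ B) {r₀ r : ℕ → ℕ}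
    {c : Config} (h : SimRel B r₀ c.reg r) {s t : ℕ} (hi : Q[c.pc]? = some (.output s t))
    (h0 : c.reg (c.reg s) ≠ 0) (hle : c.reg (c.reg s) ≤ S) :
    ∃ r' t, SimRel B r₀ c.reg r' ∧ r' 1 = rep B (c.reg s) ∧ t ≤ 40 * (B + S + 1) ∧
      ∀ P o T g, CodeAt P o ((Frag.sim Q).code o) →
        StateTransition.Reaches (step P) ⟨simPos Q o c.pc, r, T, g⟩
          ⟨o + 20 * Q.length + 2, r', T + t, g⟩ := by
  have hpc : c.pc < Q.length := by
    by_contra hn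
    rw [List.getElem?_eq_none (by omega)] at hi
    simp at hi
  obtain ⟨ha1, ha2⟩ := hS _ (List.mem_of_getElem? hi)
  obtain ⟨g1, k1⟩ := eval_getOps h hB (t := 1) (by omega) (by omega) s
  have h1 := h.scratch hB (t := 1) (by omega) (by omega) (rep B (c.reg s))
  obtain ⟨r₁, hr₁⟩ : ∃ r₁, r₁ = Function.update r 1 (rep B (c.reg s)) := ⟨_, rfl⟩
  rw [← hr₁] at g1 h1
  have e1 : r₁ 1 = rep B (c.reg s) := by rw [hr₁]; simp
  have e2 := h1.val (c.reg s)
  have h2 := (h1.scratch hB (t := 2) (by omega) (by omega) (rep B (c.reg (c.reg s)))).scratch hB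
    (t := 3) (by omega) (by omega) 0
  obtain ⟨r₂, hr₂⟩ : ∃ r₂, r₂ = Function.update (Function.update r₁ 2
    (rep B (c.reg (c.reg s)))) 3 0 := ⟨_, rfl⟩
  rw [← hr₂] at h2
  have f1 : r₂ 1 = rep B (c.reg s) := by rw [hr₂]; simp [e1]
  have f2 : r₂ 2 = rep B (c.reg (c.reg s)) := by rw [hr₂]; simp
  have f3 : r₂ 3 = 0 := by rw [hr₂]; simp
  have heval : evalOps (simOps (.output s t)) r = r₂ := by
    simp only [simOps, evalOps_append, g1, evalOps, Instr.eval, e1, e2, hr₂]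
  have hcost : costOps (simOps (.output s t)) r ≤ 5 + S + B := by
    simp only [simOps, costOps_append, costOps, Instr.cost]
    omega
  have hlog := logCost_le (r₂ 3) (r₂ 2)
  have hrep := rep_le B (c.reg (c.reg s))
  refine ⟨r₂, costOps (simOps (.output s t)) r + logCost (r₂ 3) (r₂ 2), h2, f1, by omega,
    fun P o T g hP => ?_⟩
  have hb := codeAt_simBlock hP hpc
  rw [simBlock, hi] at hb
  obtain ⟨p1, p2⟩ := CodeAt.append hb
  have q1 := reaches_ops _ (simOps_writes _) _ r T g p1
  rw [heval] at q1
  have q2 : StateTransition.Reaches (step P) _ _ := q1.trans (reaches_jlt_true p2.head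
    (by rw [f2, f3]; have := rep_le B 0; unfold rep; split <;> omega) _ g)
  simpa only [add_assoc] using q2

/-- The simulation of a halt. -/
theorem sim_halt {Q : Program} {c : Config} (hs : step Q c = none) (r : ℕ → ℕ) :
    ∃ t ≤ 1, ∀ P o T g, CodeAt P o ((Frag.sim Q).code o) →
        StateTransition.Reaches (step P) ⟨simPos Q o c.pc, r, T, g⟩
          ⟨o + 20 * Q.length, r, T + t, g⟩ := by
  by_cases hpc : c.pc < Q.length
  · have hi : Q[c.pc]? = some .halt := by
      rw [List.getElem?_eq_getElem hpc]
      unfold step at hs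
      rw [List.getElem?_eq_getElem hpc] at hs
      cases h : Q[c.pc] <;> simp_all
    refine ⟨1, le_rfl, fun P o T g hP => ?_⟩
    have hb := codeAt_simBlock hP hpc
    rw [simBlock, hi] at hb
    exact reaches_jump hb.head T g
  · refine ⟨0, by omega, fun P o T g hP => ?_⟩
    rw [simPos, min_eq_right (by omega)]
    exact Relation.ReflTransGen.refl

/-- The whole simulation, from any configuration `c` on. -/
theorem sim_run {Q : Program} {S B : ℕ} (hS : ∀ i ∈ Q, i.ArgsLe S) (hB : 16 ≤ B) {r₀ : ℕ → ℕ}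
    {c e : Config} (hce : StateTransition.Reaches (step Q) c e) (he : step Q e = none)
    (hlog : ∀ w ∈ e.log, ∃ a l, w.1 = a :: l ∧ a ≤ S) :
    ∀ r, SimRel B r₀ c.reg r → NoHit c.log →
    (∃ c₁ s t r' k, StateTransition.Reaches (step Q) c c₁ ∧
      StateTransition.Reaches (step Q) c₁ e ∧ Q[c₁.pc]? = some (.output s t) ∧
      c₁.reg (c₁.reg s) ≠ 0 ∧ NoHit c₁.log ∧ SimRel B r₀ c₁.reg r' ∧ r' 1 = rep B (c₁.reg s) ∧
      k + 40 * (B + S + 1) * c.time ≤ 40 * (B + S + 1) * (c₁.time + 1) ∧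
      ∀ P o T g, CodeAt P o ((Frag.sim Q).code o) →
        StateTransition.Reaches (step P) ⟨simPos Q o c.pc, r, T, g⟩
          ⟨o + 20 * Q.length + 2, r', T + k, g⟩) ∨
    (NoHit e.log ∧ ∃ r' k, SimRel B r₀ e.reg r' ∧
      k + 40 * (B + S + 1) * c.time ≤ 40 * (B + S + 1) * (e.time + 1) ∧
      ∀ P o T g, CodeAt P o ((Frag.sim Q).code o) →
        StateTransition.Reaches (step P) ⟨simPos Q o c.pc, r, T, g⟩
          ⟨o + 20 * Q.length, r', T + k, g⟩) := by
  refine Relation.ReflTransGen.head_induction_on hce ?_ ?_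
  · intro r hr hn
    obtain ⟨k, hk, hR⟩ := sim_halt he r
    exact Or.inr ⟨hn, r, k, hr, by rw [mul_add _ e.time]; omega, hR⟩
  · intro c c' hs hce' ih r hr hn
    have hs' : step Q c = some c' := hs
    by_cases hit : ∃ s t, Q[c.pc]? = some (.output s t) ∧ c.reg (c.reg s) ≠ 0
    · obtain ⟨s, t, hi, h0⟩ := hit
      left
      have hle : c.reg (c.reg s) ≤ S := by
        have hc' : c' = ⟨c.pc + 1, c.reg, c.time + 1,
            c.log ++ [(block c.reg (c.reg s) (c.reg t), c.time + 1)]⟩ := by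
          simpa [step, hi] using hs'.symm
        obtain ⟨a, l, h1, h2⟩ := hlog (block c.reg (c.reg s) (c.reg t), c.time + 1)
          ((log_prefix_of_reaches hce').subset (by simp [hc']))
        rwa [block_eq_cons h1]
      obtain ⟨r', k, h1, h2, h3, h4⟩ := sim_hit hS hB hr hi h0 hle
      exact ⟨c, s, t, r', k, Relation.ReflTransGen.refl, Relation.ReflTransGen.head hs hce', hi, h0,
        hn, h1, h2, by rw [mul_add _ c.time]; omega, h4⟩
    · have ho : ∀ s t, Q[c.pc]? = some (.output s t) → c.reg (c.reg s) = 0 := by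
        intro s t hi
        by_contra h0
        exact hit ⟨s, t, hi, h0⟩
      have hn' : NoHit c'.log := by
        cases hi : Q[c.pc]? with
        | none => simp [step, hi] at hs'
        | some i =>
          cases i with
          | output s t =>
            have hc' : c' = ⟨c.pc + 1, c.reg, c.time + 1,
                c.log ++ [(block c.reg (c.reg s) (c.reg t), c.time + 1)]⟩ := by
              simpa [step, hi] using hs'.symm
            obtain ⟨a, l, h1, -⟩ := hlog (block c.reg (c.reg s) (c.reg t), c.time + 1)
              ((log_prefix_of_reaches hce').subset (by simp [hc']))
            intro w hw
            rw [hc'] at hw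
            rcases List.mem_append.1 hw with hw | hw
            · exact hn w hw
            · rw [List.mem_singleton.1 hw]
              refine ⟨l, ?_⟩
              rw [h1, ← block_eq_cons h1, ho s t hi]
          | _ =>
            have : c'.log = c.log := by
              simp only [step, hi, Option.some.injEq, reduceCtorEq] at hs'
              all_goals rw [← hs']
              all_goals rfl
            rwa [this]
      obtain ⟨r₁, t₁, hr₁, ht₁, hR₁⟩ := sim_step hS hB hr hs' ho
      rcases ih r₁ hr₁ hn' with ⟨c₁, s, t, r', k, h1, h2, h3, h4, h5, h6, h7, h8, h9⟩ |
        ⟨h1, r', k, h2, h3, h4⟩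
      · refine Or.inl ⟨c₁, s, t, r', t₁ + k, Relation.ReflTransGen.head hs h1, h2, h3, h4, h5, h6,
          h7, by omega, fun P o T g hP => ?_⟩
        rw [← add_assoc]
        exact (hR₁ P o T g hP).trans (h9 P o _ g hP)
      · refine Or.inr ⟨h1, r', t₁ + k, h2, by omega, fun P o T g hP => ?_⟩
        rw [← add_assoc]
        exact (hR₁ P o T g hP).trans (h4 P o _ g hP)

/-- The simulation takes time proportional to that of `Q` up to the output in question. The bound on
the first letters of the words is needed because the machine compares these letters with `0`. -/
theorem Frag.quiet_sim {Q : Program} {S B : ℕ} (hS : ∀ i ∈ Q, i.ArgsLe S) (hB : 16 ≤ B)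
    {w : List ℕ} {e : Config} (he : HaltsWith Q w e)
    (hlog : ∀ w ∈ e.log, ∃ a l, w.1 = a :: l ∧ a ≤ S) (r : ℕ → ℕ)
    (hr : ∀ i, r (rep B i) = rep B ((init w).reg i)) (h13 : r 13 = B) :
    ∃ r' t, (Frag.sim Q).Quiet r t r' ∧ (∀ j, 10 ≤ j → j < B → j ≠ 15 → r' j = r j) ∧
      ((r' 15 = 1 ∧ ∃ c s k, StateTransition.Reaches (step Q) (init w) c ∧
          StateTransition.Reaches (step Q) c e ∧ Q[c.pc]? = some (.output s k) ∧
          c.reg (c.reg s) ≠ 0 ∧ NoHit c.log ∧ r' 1 = rep B (c.reg s) ∧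
          (∀ i, r' (rep B i) = rep B (c.reg i)) ∧ t ≤ 40 * (B + S + 1) * (c.time + 1) + 2) ∨
        (r' 15 = 0 ∧ NoHit e.log ∧ t ≤ 40 * (B + S + 1) * (e.time + 1) + 2)) := by
  have h15 : ∀ i, rep B i ≠ 15 := fun i => by have := rep_cases B i; omega
  rcases sim_run hS hB he.1 he.2 hlog r ⟨hr, h13, fun _ _ _ => rfl⟩ (by simp [NoHit, init]) with
    ⟨c₁, s, t, r', k, h1, h2, h3, h4, h5, h6, h7, h8, h9⟩ | ⟨h1, r', k, h2, h3, h4⟩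
  · refine ⟨Function.update r' 15 1, k + 1, ?_, fun j hj hjB hj15 => ?_, Or.inl ⟨?_, c₁, s, t, h1, h2,
      h3, h4, h5, ?_, fun i => ?_, ?_⟩⟩
    · intro T g
      refine ⟨_, le_rfl, fun P o hP => (h9 P o T g hP).trans (reaches_step ?_)⟩
      have hc := (CodeAt.append hP).2
      rw [List.length_ofFn] at hc
      have := hc.tail.tail.head
      simp only [step, this, Config.write]
      simp only [Store.config, Frag.sim]
      rfl
    · rw [Function.update_of_ne hj15, h6.frame j hj hjB]
    · simp
    · simpa using h7
    · rw [Function.update_of_ne (h15 i), h6.val i]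
    · simp only [init, mul_zero, add_zero] at h8
      omega
  · refine ⟨Function.update r' 15 0, k + 2, ?_, fun j hj hjB hj15 => ?_, Or.inr ⟨?_, h1, ?_⟩⟩
    · intro T g
      refine ⟨_, le_rfl, fun P o hP => (h4 P o T g hP).trans ((reaches_step
        (b := ⟨o + 20 * Q.length + 1, Function.update r' 15 0, T + k + 1, g⟩) ?_).trans
          (reaches_jump ?_ _ g))⟩
      · have hc := (CodeAt.append hP).2
        rw [List.length_ofFn] at hc
        have := hc.head
        simp only [step, this, Config.write]
      · have hc := (CodeAt.append hP).2
        rw [List.length_ofFn] at hc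
        exact hc.tail.head
    · rw [Function.update_of_ne hj15, h2.frame j hj hjB]
    · simp
    · simp only [init, mul_zero, add_zero] at h3
      omega

theorem litHolds_congr {p p' : ℕ → Prop} {l n : ℕ} (hl : l < 2 * n) (h : ∀ i < n, (p i ↔ p' i)) :
    LitHolds p l ↔ LitHolds p' l := by
  unfold LitHolds
  have := h (l / 2) (by omega)
  split <;> simp only [this]

theorem satBy_congr {p p' : ℕ → Prop} {l l' : ℕ → ℕ} {m n : ℕ} (hl : ∀ k < 3 * m, l k < 2 * n)
    (hl' : ∀ k < 3 * m, l k = l' k)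
    (h : ∀ i < n, (p i ↔ p' i)) : SatBy m l p ↔ SatBy m l' p' := by
  unfold SatBy
  refine forall_congr' fun k => forall_congr' fun hk => ?_
  rw [← hl' _ (by omega), ← hl' _ (by omega), ← hl' _ (by omega),
    litHolds_congr (hl (3 * k) (by omega)) h, litHolds_congr (hl (3 * k + 1) (by omega)) h,
    litHolds_congr (hl (3 * k + 2) (by omega)) h]

theorem binVal_succ (f : ℕ → ℕ) (n : ℕ) : binVal f (n + 1) = binVal f n + f n * 2 ^ n :=
  Finset.sum_range_succ _ _

theorem binVal_lt {f : ℕ → ℕ} {n : ℕ} (h : ∀ i < n, f i ≤ 1) : binVal f n < 2 ^ n := by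
  induction n with
  | zero => simp [binVal]
  | succ n ih =>
    have h1 := ih fun i hi => h i (by omega)
    have h2 := Nat.mul_le_mul_right (2 ^ n) (h n (by omega))
    rw [binVal_succ, pow_succ]
    omega

theorem binVal_inj {f g : ℕ → ℕ} {n : ℕ} (hf : ∀ i < n, f i ≤ 1) (hg : ∀ i < n, g i ≤ 1)
    (h : binVal f n = binVal g n) : ∀ i < n, f i = g i := by
  induction n with
  | zero => simp
  | succ n ih =>
    have h1 := binVal_lt fun i hi => hf i (Nat.lt_succ_of_lt hi)
    have h2 := binVal_lt fun i hi => hg i (Nat.lt_succ_of_lt hi)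
    have h3 := hf n (by omega)
    have h4 := hg n (by omega)
    rw [binVal_succ, binVal_succ] at h
    have h5 : f n = g n := by
      rcases Nat.le_one_iff_eq_zero_or_eq_one.1 h3 with h3 | h3 <;>
        rcases Nat.le_one_iff_eq_zero_or_eq_one.1 h4 with h4 | h4 <;> rw [h3, h4] at h ⊢ <;>
        rw [zero_mul, one_mul] at h <;> omega
    rw [h5] at h
    intro i hi
    rcases Nat.lt_succ_iff_lt_or_eq.1 hi with hi | rfl
    · exact ih (fun i hi => hf i (by omega)) (fun i hi => hg i (by omega)) (by omega) i hi
    · exact h5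

theorem binVal_eq_zero {f : ℕ → ℕ} {n : ℕ} (h : ∀ i < n, f i = 0) : binVal f n = 0 :=
  Finset.sum_eq_zero fun i hi => by rw [h i (Finset.mem_range.1 hi), zero_mul]

/-! ### Search fragments -/

/-- The fragment `F` finds a satisfying assignment, if there is one, in time
`C * 2 ^ (δ * n) * (B + 1) ^ d`. The formula has `n = R_10` variables and `m = R_12` clauses, whose
literals start at `L = R_11`; the assignment is written from `W = R_14` on, and the registers from
`B = R_13` on are free and contain `0`. Whether an assignment was found is left in `R_15`. -/
def Frag.Searches (F : Frag) (δ : ℝ) (C d : ℕ) : Prop :=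
  ∀ (r : ℕ → ℕ) (n L m B W : ℕ), r 10 = n → r 11 = L → r 12 = m → r 13 = B → r 14 = W →
    32 ≤ L → L + 3 * m ≤ W → W + n ≤ B → (∀ j, B ≤ j → r j = 0) →
    (∀ k < 3 * m, r (L + k) < 2 * n) → (∀ i < n, r (W + i) = 0) →
    ∃ r' t, F.Quiet r t r' ∧ (t : ℝ) ≤ C * (2 : ℝ) ^ (δ * n) * ((B : ℝ) + 1) ^ d ∧
      (∀ j, 10 ≤ j → j < B → (j < 15 ∨ 20 ≤ j) → (j < W ∨ W + n ≤ j) → r' j = r j) ∧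
      ((r' 15 = 1 ∧ (∀ i < n, r' (W + i) ≤ 1) ∧
          SatBy m (fun k => r (L + k)) fun i => r' (W + i) ≠ 0) ∨
        (r' 15 = 0 ∧ ∀ p, ¬ SatBy m (fun k => r (L + k)) p))

/-- Satisfying assignments can be found in time `2 ^ (δ * n)` up to polynomial factors. -/
def Search (δ : ℝ) : Prop := ∃ (F : Frag) (C d : ℕ), F.Searches δ C d

theorem Search.mono {δ δ' : ℝ} (h : Search δ) (hδ : δ ≤ δ') : Search δ' := by
  obtain ⟨F, C, d, hF⟩ := h
  refine ⟨F, C, d, fun r n L m B W h1 h2 h3 h4 h5 h6 h7 h8 h9 h10 h11 => ?_⟩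
  obtain ⟨r', t, hQ, ht, h⟩ := hF r n L m B W h1 h2 h3 h4 h5 h6 h7 h8 h9 h10 h11
  refine ⟨r', t, hQ, ht.trans ?_, h⟩
  gcongr
  norm_num

/-- Exhaustive search. In the loop, `R_15` becomes `1` when a satisfying assignment has been found, and
`R_19` becomes `0` when the counter overflows; either ends the loop, since it runs while `R_15 < R_19`. -/
def Frag.bruteForce : Frag :=
  Frag.ops [.copy 16 14, .copy 17 14, .copy 18 10, .const 15 0, .const 19 1] ++
    Frag.whileLt 15 19 (Frag.check ++ Frag.ops [.const 1 1, .sub 15 1 6] ++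
      Frag.ifLt 15 19 (Frag.inc ++ Frag.ops [.const 1 1, .sub 19 1 6]) (Frag.ops []))

theorem Frag.searches_bruteForce : Frag.bruteForce.Searches 1 20000 2 := by
  intro r n L m B W h10 h11 h12 h13 h14 hL hLW hWB hz hlit hW0
  have hQ₀ := Frag.quiet_ops_bound [.copy 16 14, .copy 17 14, .copy 18 10, .const 15 0, .const 19 1]
    (by simp [Instr.Writes]) r 5 (by simp [boundOps])
  set l : ℕ → ℕ := fun k => r (L + k) with hl
  obtain ⟨k, r', hk, ⟨e16, e17, e18, hF, hbit, hI⟩, hlt, hQ⟩ := Frag.quiet_whileLt (s := 15) (t := 19)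
    (F := Frag.check ++ Frag.ops [.const 1 1, .sub 15 1 6] ++
      Frag.ifLt 15 19 (Frag.inc ++ Frag.ops [.const 1 1, .sub 19 1 6]) (Frag.ops []))
    (2 ^ n) (500 * (3 * B + 1) ^ 2) 2
    (fun k r' => r' 16 = W ∧ r' 17 = W ∧ r' 18 = n ∧
      (∀ j, 10 ≤ j → j < B → (j < 15 ∨ 20 ≤ j) → (j < W ∨ W + n ≤ j) → r' j = r j) ∧
      (∀ i < n, r' (W + i) ≤ 1) ∧
      ((r' 15 = 0 ∧ r' 19 = 1 ∧ binVal (fun i => r' (W + i)) n = k ∧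
          ∀ f : ℕ → ℕ, (∀ i < n, f i ≤ 1) → binVal f n < k → ¬ SatBy m l fun i => f i ≠ 0) ∨
        (r' 15 = 1 ∧ r' 19 = 1 ∧ SatBy m l fun i => r' (W + i) ≠ 0) ∨
        (r' 15 = 0 ∧ r' 19 = 0 ∧
          ∀ f : ℕ → ℕ, (∀ i < n, f i ≤ 1) → ¬ SatBy m l fun i => f i ≠ 0)))
    (by
      rintro k r' ⟨e16, e17, e18, hF, hbit, hI⟩ hlt
      rcases hI with ⟨h1, h2, h3, -⟩ | ⟨h1, h2, -⟩ | ⟨h1, h2, -⟩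
      · rw [← h3]; exact binVal_lt hbit
      · omega
      · omega)
    (by
      rintro k r' ⟨e16, e17, e18, hF, hbit, hI⟩
      omega)
    (by
      rintro k r₁ ⟨e16, e17, e18, hF, hbit, hI⟩ hlt
      obtain ⟨e15, e19, hval, hall⟩ : r₁ 15 = 0 ∧ r₁ 19 = 1 ∧ binVal (fun i => r₁ (W + i)) n = k ∧
          ∀ f : ℕ → ℕ, (∀ i < n, f i ≤ 1) → binVal f n < k → ¬ SatBy m l fun i => f i ≠ 0 := by
        rcases hI with h | h | h
        · exact h
        · omega
        · omega
      have hlr : ∀ k < 3 * m, r₁ (L + k) = r (L + k) := fun k hk =>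
        hF _ (by omega) (by omega) (by omega) (by omega)
      obtain ⟨r₂, hQ₂, hF₂, h6, hS⟩ := Frag.quiet_check r₁ (3 * B) n L m W B
        (by rw [hF 10 (by omega) (by omega) (by omega) (by omega), h10])
        (by rw [hF 11 (by omega) (by omega) (by omega) (by omega), h11])
        (by rw [hF 12 (by omega) (by omega) (by omega) (by omega), h12])
        (by rw [hF 13 (by omega) (by omega) (by omega) (by omega), h13])
        e16 (by omega) (by omega) (by omega) (by omega) (by omega)
        (fun k hk => by rw [hlr k hk]; exact hlit k hk) hbit
      have hS' : r₂ 6 = 0 ↔ SatBy m l fun i => r₁ (W + i) ≠ 0 := by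
        rw [hS]
        exact satBy_congr (n := n) (fun k hk => by rw [hlr k hk]; exact hlit k hk) hlr
          fun _ _ => Iff.rfl
      have hQ₃ := Frag.quiet_ops_bound [.const 1 1, .sub 15 1 6] (by simp [Instr.Writes]) r₂
        (3 + m) (by simp [boundOps, Instr.eval]; omega)
      obtain ⟨r₃, hr₃⟩ : ∃ r₃, r₃ = evalOps [.const 1 1, .sub 15 1 6] r₂ := ⟨_, rfl⟩
      rw [← hr₃] at hQ₃
      have e3 : r₃ 15 = 1 - r₂ 6 := by rw [hr₃]; simp [evalOps, Instr.eval]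
      have hF₃ : ∀ j, 10 ≤ j → j < B → j ≠ 15 → r₃ j = r₁ j := by
        intro j hj hjB hj15
        rw [hr₃]
        simp only [evalOps, Instr.eval, Function.update_apply, reduceIte, Nat.reduceEqDiff,
          Nat.reduceLT, addr_ne hj, hj15]
        exact hF₂ j hj (by omega)
      have e319 : r₃ 19 = 1 := by rw [hF₃ 19 (by omega) (by omega) (by omega), e19]
      have hsq : 3 * B + 1 ≤ (3 * B + 1) ^ 2 := Nat.le_self_pow two_ne_zero _
      by_cases h0 : r₂ 6 = 0
      · have hlt' : ¬ r₃ 15 < r₃ 19 := by omega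
        have hQ₄ := Frag.quiet_ifLt_false (s := 15) (t := 19)
          (F := Frag.inc ++ Frag.ops [.const 1 1, .sub 19 1 6]) hlt'
          (Frag.quiet_ops_bound [] (by simp) r₃ 0 le_rfl)
        refine ⟨r₃, ((hQ₂.append hQ₃).append hQ₄).mono (by omega),
          by rw [hF₃ 16 (by omega) (by omega) (by omega), e16],
          by rw [hF₃ 17 (by omega) (by omega) (by omega), e17],
          by rw [hF₃ 18 (by omega) (by omega) (by omega), e18],
          fun j hj hjB hj' hjW => by rw [hF₃ j hj hjB (by omega), hF j hj hjB hj' hjW],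
          fun i hi => by rw [hF₃ _ (by omega) (by omega) (by omega)]; exact hbit i hi,
          Or.inr (Or.inl ⟨by omega, e319, ?_⟩)⟩
        refine (satBy_congr hlit (fun _ _ => rfl) fun i hi => ?_).1 (hS'.1 h0)
        rw [hF₃ _ (by omega) (by omega) (by omega)]
      · have hlt' : r₃ 15 < r₃ 19 := by omega
        obtain ⟨r₄, hQ₄, hF₄, hbit₄, h64, hV₄⟩ := Frag.quiet_inc r₃ (3 * B) W n
          (by rw [hF₃ 17 (by omega) (by omega) (by omega), e17])
          (by rw [hF₃ 18 (by omega) (by omega) (by omega), e18]) (by omega) (by omega)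
          (fun i hi => by rw [hF₃ _ (by omega) (by omega) (by omega)]; exact hbit i hi)
        have hQ₅ := Frag.quiet_ops_bound [.const 1 1, .sub 19 1 6] (by simp [Instr.Writes]) r₄
          4 (by simp [boundOps, Instr.eval]; omega)
        obtain ⟨r₅, hr₅⟩ : ∃ r₅, r₅ = evalOps [.const 1 1, .sub 19 1 6] r₄ := ⟨_, rfl⟩
        rw [← hr₅] at hQ₅
        have e519 : r₅ 19 = 1 - r₄ 6 := by rw [hr₅]; simp [evalOps, Instr.eval]
        have hF₅ : ∀ j, 10 ≤ j → j ≠ 19 → r₅ j = r₄ j := by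
          intro j hj hj19
          rw [hr₅]
          simp only [evalOps, Instr.eval, Function.update_apply, reduceIte, Nat.reduceEqDiff,
            Nat.reduceLT, addr_ne hj, hj19]
        have hF₆ : ∀ j, 10 ≤ j → j < B → j ≠ 15 → j ≠ 19 → (j < W ∨ W + n ≤ j) → r₅ j = r₁ j := by
          intro j hj hjB h15 h19 hjW
          rw [hF₅ j hj h19, hF₄ j hj hjW, hF₃ j hj hjB h15]
        have hV : binVal (fun i => r₃ (W + i)) n = k := by
          rw [← hval]
          exact Finset.sum_congr rfl fun i hi => by
            have := Finset.mem_range.1 hi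
            simp only
            rw [hF₃ _ (by omega) (by omega) (by omega)]
        have hV₅ : binVal (fun i => r₅ (W + i)) n = binVal (fun i => r₄ (W + i)) n :=
          Finset.sum_congr rfl fun i hi => by
            have := Finset.mem_range.1 hi
            simp only
            rw [hF₅ _ (by omega) (by omega)]
        have hall' : ∀ f : ℕ → ℕ, (∀ i < n, f i ≤ 1) → binVal f n < k + 1 →
            ¬ SatBy m l fun i => f i ≠ 0 := by
          intro f hf hfk
          rcases Nat.lt_succ_iff_lt_or_eq.1 hfk with h | h
          · exact hall f hf h
          · intro hs
            have hfe := binVal_inj hf hbit (h.trans hval.symm)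
            exact h0 (hS'.2 ((satBy_congr hlit (fun _ _ => rfl) fun i hi => by rw [hfe i hi]).1 hs))
        refine ⟨r₅, ((hQ₂.append hQ₃).append (Frag.quiet_ifLt_true hlt'
          (hQ₄.append hQ₅))).mono (by omega),
          by rw [hF₆ 16 (by omega) (by omega) (by omega) (by omega) (by omega), e16],
          by rw [hF₆ 17 (by omega) (by omega) (by omega) (by omega) (by omega), e17],
          by rw [hF₆ 18 (by omega) (by omega) (by omega) (by omega) (by omega), e18],
          fun j hj hjB hj' hjW => by
            rw [hF₆ j hj hjB (by omega) (by omega) hjW, hF j hj hjB hj' hjW],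
          fun i hi => by rw [hF₅ _ (by omega) (by omega)]; exact hbit₄ i hi, ?_⟩
        have e515 : r₅ 15 = 0 := by
          rw [hF₅ 15 (by omega) (by omega), hF₄ 15 (by omega) (by omega), e3]
          omega
        have hlt₄ := binVal_lt hbit₄
        rcases Nat.le_one_iff_eq_zero_or_eq_one.1 h64 with h64 | h64
        · left
          refine ⟨e515, by omega, ?_, hall'⟩
          rw [hV₅]
          rw [h64] at hV₄
          omega
        · right; right
          refine ⟨e515, by omega, fun f hf => hall' f hf ?_⟩
          have := binVal_lt hf
          rw [h64] at hV₄
          omega)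
    (evalOps [.copy 16 14, .copy 17 14, .copy 18 10, .const 15 0, .const 19 1] r)
    (by
      have hF' : ∀ j, 10 ≤ j → (j < 15 ∨ 20 ≤ j) →
          evalOps [.copy 16 14, .copy 17 14, .copy 18 10, .const 15 0, .const 19 1] r j = r j := by
        intro j hj hj'
        simp only [evalOps, Instr.eval, Function.update_apply, reduceIte, Nat.reduceEqDiff,
          Nat.reduceLT, show j ≠ 15 by omega, show j ≠ 16 by omega,
          show j ≠ 17 by omega, show j ≠ 18 by omega, show j ≠ 19 by omega]
      have hW' : ∀ i < n,
          evalOps [.copy 16 14, .copy 17 14, .copy 18 10, .const 15 0, .const 19 1] r (W + i) = 0 :=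
        fun i hi => by rw [hF' _ (by omega) (by omega), hW0 i hi]
      refine ⟨?_, ?_, ?_, fun j hj _ hj' _ => hF' j hj hj', fun i hi => by rw [hW' i hi]; omega,
        Or.inl ⟨?_, ?_, binVal_eq_zero hW', by simp⟩⟩ <;>
      simp [evalOps, Instr.eval, Function.update_apply, h10, h14])
  refine ⟨r', _, hQ₀.append hQ, ?_, hF, ?_⟩
  · rw [one_mul, Real.rpow_natCast]
    have h2 : 1 ≤ 2 ^ n := Nat.one_le_two_pow
    have : 5 + (2 ^ n * (500 * (3 * B + 1) ^ 2 + 2 + 1) + 2 + 2) ≤ 20000 * 2 ^ n * (B + 1) ^ 2 := by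
      generalize 2 ^ n = N at *
      nlinarith [Nat.zero_le (N * B), Nat.zero_le (N * B * B)]
    exact_mod_cast this
  · rcases hI with ⟨h1, h2, -⟩ | ⟨h1, h2, h3⟩ | ⟨h1, h2, h3⟩
    · omega
    · exact Or.inl ⟨by omega, hbit, h3⟩
    · refine Or.inr ⟨h1, fun p hp => ?_⟩
      classical
      refine h3 (fun i => if p i then 1 else 0) (fun i _ => by split <;> omega) ?_
      refine (satBy_congr hlit (fun _ _ => rfl) fun i hi => ?_).1 hp
      split <;> simp_all

/-! ### Search algorithms decide satisfiability -/

theorem Frag.Exec.haltsWith {F : Frag} {w : List ℕ} {σ : Store}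
    (h : F.Exec ⟨(init w).reg, 0, []⟩ σ) : HaltsWith (F.code 0) w (σ.config F.len) := by
  have := h (F.code 0) 0 (fun i _ => by rw [zero_add])
  rw [zero_add] at this
  refine ⟨this, ?_⟩
  simp [step, Store.config, F.length_code]

theorem Frag.Quiet.haltsWith {F : Frag} {w : List ℕ} {r' : ℕ → ℕ} {t : ℕ}
    (h : F.Quiet (init w).reg t r') :
    ∃ c, HaltsWith (F.code 0) w c ∧ c.reg = r' ∧ c.time ≤ t := by
  obtain ⟨t', ht, e⟩ := h 0 []
  exact ⟨_, e.haltsWith, rfl, by simpa [Store.config] using ht⟩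

theorem init_reg_zero (w : List ℕ) : (init w).reg 0 = w.length := rfl

theorem init_reg_succ (w : List ℕ) (i : ℕ) : (init w).reg (1 + i) = w.getD i 0 := by
  simp [init]

theorem init_reg_eq_zero (w : List ℕ) {i : ℕ} (h : w.length < i) : (init w).reg i = 0 := by
  obtain ⟨j, rfl⟩ : ∃ j, i = 1 + j := ⟨i - 1, by omega⟩
  rw [init_reg_succ, List.getD_eq_default _ _ (by omega)]

theorem litHolds_code {n : ℕ} (p : ℕ → Prop) (l : Literal n) :
    LitHolds p l.code ↔ (p l.1 ↔ l.2 = true) := by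
  obtain ⟨i, b⟩ := l
  unfold LitHolds Literal.code
  cases b
  · rw [if_neg (by simp), show (2 * i.val + false.toNat) / 2 = i.val by simp]
    simp
  · rw [if_pos (by simp), show (2 * i.val + true.toNat) / 2 = i.val by simp; omega]
    simp

theorem getD_flatMap_three {α : Type*} (f g h : α → ℕ) (φ : List α) : ∀ (k : ℕ) (hk : k < φ.length),
    (φ.flatMap fun C => [f C, g C, h C]).getD (3 * k) 0 = f φ[k] ∧
    (φ.flatMap fun C => [f C, g C, h C]).getD (3 * k + 1) 0 = g φ[k] ∧
    (φ.flatMap fun C => [f C, g C, h C]).getD (3 * k + 2) 0 = h φ[k] := by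
  induction φ with
  | nil => intro k hk; simp at hk
  | cons C φ ih =>
    intro k hk
    cases k with
    | zero => simp
    | succ k => simpa [mul_add, add_right_comm _ 3] using ih k (by simpa using hk)

theorem length_flatMap_three {α : Type*} (f g h : α → ℕ) (φ : List α) :
    (φ.flatMap fun C => [f C, g C, h C]).length = 3 * φ.length := by
  simp [mul_comm]

theorem satisfiable_iff_satBy {n : ℕ} (φ : List (Clause3 n)) :
    Satisfiable φ ↔ ∃ p, SatBy φ.length (fun k => (cnfCode φ).getD (1 + k) 0) p := by
  have key : ∀ p, SatBy φ.length (fun k => (cnfCode φ).getD (1 + k) 0) p ↔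
      ∀ C ∈ φ, LitHolds p (Literal.code C.1) ∨ LitHolds p (Literal.code C.2.1) ∨
        LitHolds p (Literal.code C.2.2) := by
    intro p
    rw [List.forall_mem_iff_getElem]
    refine forall_congr' fun k => forall_congr' fun hk => ?_
    obtain ⟨h1, h2, h3⟩ := getD_flatMap_three (fun C : Clause3 n => Literal.code C.1)
      (fun C => Literal.code C.2.1) (fun C => Literal.code C.2.2) φ k hk
    simp only [cnfCode, add_comm 1, List.getD_cons_succ, h1, h2, h3]
  constructor
  · rintro ⟨v, hv⟩
    refine ⟨fun i => ∃ h : i < n, v ⟨i, h⟩ = true, (key _).2 fun C hC => ?_⟩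
    have h : ∀ l : Literal n, LitHolds (fun i => ∃ h : i < n, v ⟨i, h⟩ = true) l.code ↔
        v l.1 = l.2 := by
      intro l
      rw [litHolds_code, Bool.eq_iff_iff]
      simp
    rw [h, h, h]
    exact hv C hC
  · rintro ⟨p, hp⟩
    classical
    refine ⟨fun i => decide (p i), fun C hC => ?_⟩
    have h : ∀ l : Literal n, LitHolds p l.code ↔ decide (p l.1) = l.2 := by
      intro l
      rw [litHolds_code]
      cases l.2 <;> simp
    have := (key p).1 hp C hC
    rw [h, h, h] at this
    exact this

theorem cnfCode_lt {n : ℕ} (φ : List (Clause3 n)) {k : ℕ} (hk : k < 3 * φ.length) :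
    (cnfCode φ).getD (1 + k) 0 < 2 * n := by
  have hl : ∀ l : Literal n, l.code < 2 * n := by
    rintro ⟨i, b⟩
    have := i.2
    simp only [Literal.code]; cases b <;> simp only [Bool.toNat_false, Bool.toNat_true] <;> omega
  obtain ⟨h1, h2, h3⟩ := getD_flatMap_three (fun C : Clause3 n => Literal.code C.1)
      (fun C => Literal.code C.2.1) (fun C => Literal.code C.2.2) φ (k / 3) (by omega)
  simp only [cnfCode, add_comm 1, List.getD_cons_succ]
  have := Nat.div_add_mod k 3
  have hm : k % 3 = 0 ∨ k % 3 = 1 ∨ k % 3 = 2 := by omega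
  rcases hm with hm | hm | hm <;> rw [hm] at this
  · rw [← this, add_zero, h1]; exact hl _
  · rw [← this, h2]; exact hl _
  · rw [← this, h3]; exact hl _

/-- The program that decides satisfiability with the help of the search algorithm `F`. The number `m`
of clauses is not part of the input; it is recovered by division from `P = 32 (1 + 3 m)`. -/
def Frag.decideSat (F : Frag) : Frag :=
  Frag.relocate ++ Frag.ops [.load 10 20, .const 1 1, .add 11 20 1, .const 1 32, .const 2 96,
    .copy 3 20] ++ Frag.divide ++ Frag.ops [.copy 12 4, .add 14 20 20, .add 13 14 10] ++ F ++
    Frag.ops [.copy 0 15]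

theorem Frag.quiet_decideSat {F : Frag} {δ : ℝ} {C d : ℕ} (hF : F.Searches δ C d) {n : ℕ}
    (φ : List (Clause3 n)) :
    ∃ r' t₁ t₂, (Frag.decideSat F).Quiet (init (cnfCode φ)).reg (t₁ + t₂) r' ∧
      (r' 0 ≠ 0 ↔ Satisfiable φ) ∧ t₁ ≤ 90000000 * (φ.length + n + 1) ^ 2 ∧
      (t₂ : ℝ) ≤ C * (2 : ℝ) ^ (δ * n) * ((64 * (1 + 3 * φ.length) + n : ℕ) + 1 : ℝ) ^ d := by
  obtain ⟨m, hm⟩ : ∃ m, m = φ.length := ⟨_, rfl⟩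
  obtain ⟨P, hP⟩ : ∃ P, P = 32 * (1 + 3 * m) := ⟨_, rfl⟩
  obtain ⟨M, hM⟩ : ∃ M, M = 2 * P + 2 * n := ⟨_, rfl⟩
  obtain ⟨l, hl⟩ : ∃ l : ℕ → ℕ, l = fun k => (cnfCode φ).getD (1 + k) 0 := ⟨_, rfl⟩
  obtain ⟨r, hr⟩ : ∃ r, r = (init (cnfCode φ)).reg := ⟨_, rfl⟩
  have hlen : (cnfCode φ).length = 1 + 3 * m := by
    rw [cnfCode, List.length_cons, length_flatMap_three, hm, add_comm]
  have hl2 : ∀ k < 3 * m, l k < 2 * n := fun k hk => by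
    rw [hl]; exact cnfCode_lt φ (by rw [← hm]; exact hk)
  have hr1 : r 1 = n := by rw [hr]; exact init_reg_succ _ 0
  have hrl : ∀ k, r (1 + (1 + k)) = l k := fun k => by rw [hr, hl]; exact init_reg_succ _ _
  have hz : ∀ i, 1 + 3 * m < i → r i = 0 := fun i hi => by
    rw [hr]; exact init_reg_eq_zero _ (by rw [hlen]; exact hi)
  have hr0 : r 0 = 1 + 3 * m := by rw [hr, init_reg_zero, hlen]
  rw [← hr, ← hm]
  obtain ⟨r₁, hQ₁, e20, hmv⟩ := Frag.quiet_relocate r M P (by omega) (by omega)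
    (by intro i hi; exact hz i (by omega)) (by omega) (by
      intro i hi
      rcases Nat.lt_or_ge (1 + 3 * m) i with h | h
      · rw [hz i h]; omega
      rcases Nat.lt_or_ge i 2 with h' | h'
      · rw [show i = 1 by omega, hr1]; omega
      · obtain ⟨k, rfl⟩ : ∃ k, i = 1 + (1 + k) := ⟨i - 2, by omega⟩
        rw [hrl]
        have := hl2 k (by omega)
        omega)
  have hPn : r₁ P = n := by simpa [hr1] using hmv 0
  have hQ₂ := Frag.quiet_ops_bound [.load 10 20, .const 1 1, .add 11 20 1, .const 1 32, .const 2 96,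
    .copy 3 20] (by simp [Instr.Writes]) r₁ (7 + P) (by
      simp only [boundOps, Instr.eval, Function.update_apply, reduceIte, Nat.reduceEqDiff,
        Nat.reduceLT]; omega)
  obtain ⟨r₂, hr₂⟩ : ∃ r₂, r₂ = evalOps [.load 10 20, .const 1 1, .add 11 20 1, .const 1 32,
    .const 2 96, .copy 3 20] r₁ := ⟨_, rfl⟩
  rw [← hr₂] at hQ₂
  have e2 : r₂ 10 = n ∧ r₂ 11 = P + 1 ∧ r₂ 1 = 32 ∧ r₂ 2 = 96 ∧ r₂ 3 = P ∧ r₂ 20 = P := by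
    rw [hr₂]
    simp only [evalOps, Instr.eval, Function.update_apply, reduceIte, Nat.reduceEqDiff,
      Nat.reduceLT, e20, hPn, and_self]
  have hF₂ : ∀ j, 12 ≤ j → r₂ j = r₁ j := by
    intro j hj
    rw [hr₂]
    simp only [evalOps, Instr.eval, Function.update_apply, reduceIte, Nat.reduceEqDiff,
      Nat.reduceLT, addr_ne hj]
  obtain ⟨r₃, hQ₃, hF₃, hd1, hd2, hd3⟩ := Frag.quiet_divide r₂ (P + 96) (by omega) (by omega)
    (by omega) (by omega)
  have e4 : r₃ 4 = m := by
    by_contra hne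
    rw [e2.2.2.1, e2.2.2.2.1] at hd2 hd3
    rw [e2.2.2.2.2.1] at hd2 hd3
    rcases Nat.lt_or_gt_of_ne hne with h | h
    · omega
    · have := hd3 m h; omega
  have hQ₄ := Frag.quiet_ops_bound [.copy 12 4, .add 14 20 20, .add 13 14 10]
    (by simp [Instr.Writes]) r₃ (3 + 4 * P + n) (by
      simp only [boundOps, Instr.eval, Function.update_apply, reduceIte, Nat.reduceEqDiff,
        Nat.reduceLT, hF₃ 20 (by omega), hF₃ 10 (by omega), e2]; omega)
  obtain ⟨r₄, hr₄⟩ : ∃ r₄, r₄ = evalOps [.copy 12 4, .add 14 20 20, .add 13 14 10] r₃ := ⟨_, rfl⟩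
  rw [← hr₄] at hQ₄
  have e5 : r₄ 10 = n ∧ r₄ 11 = P + 1 ∧ r₄ 12 = m ∧ r₄ 14 = 2 * P ∧ r₄ 13 = 2 * P + n := by
    rw [hr₄]
    simp only [evalOps, Instr.eval, Function.update_apply, reduceIte, Nat.reduceEqDiff,
      Nat.reduceLT, hF₃ 20 (by omega), hF₃ 10 (by omega),
      hF₃ 11 (by omega), e2, e4, true_and]
    omega
  have hF₄ : ∀ i, r₄ (P + i) = r (1 + i) := by
    intro i
    have h15 : 15 ≤ P + i := by omega
    rw [hr₄]
    simp only [evalOps, Instr.eval, Function.update_apply, reduceIte, Nat.reduceEqDiff,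
      Nat.reduceLT, addr_ne h15]
    rw [hF₃ _ (by omega), hF₂ _ (by omega), hmv]
  have hF₄l : ∀ k, r₄ (P + 1 + k) = l k := fun k => by rw [add_assoc, hF₄, hrl]
  have hF₄z : ∀ j, 2 * P ≤ j → r₄ j = 0 := fun j hj => by
    obtain ⟨i, rfl⟩ : ∃ i, j = P + i := ⟨j - P, by omega⟩
    rw [hF₄]
    exact hz _ (by omega)
  obtain ⟨r₅, t, hQ₅, ht, -, h⟩ := hF r₄ n (P + 1) m (2 * P + n) (2 * P) e5.1 e5.2.1 e5.2.2.1
    e5.2.2.2.2 e5.2.2.2.1 (by omega) (by omega) (by omega) (fun j hj => hF₄z j (by omega))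
    (fun k hk => by rw [hF₄l]; exact hl2 k hk) (fun i hi => hF₄z _ (by omega))
  have hQ₆ := Frag.quiet_ops_bound [.copy 0 15] (by simp [Instr.Writes]) r₅ 1 (by simp [boundOps])
  refine ⟨_, 2000 * (M + 1) ^ 2 + (7 + P) + 20 * (P + 96 + 1) ^ 2 + (3 + 4 * P + n) + 1, t,
    (((((hQ₁.append hQ₂).append hQ₃).append hQ₄).append hQ₅).append hQ₆).mono (by omega), ?_, ?_, ?_⟩
  · rw [satisfiable_iff_satBy, ← hm]
    simp only [evalOps, Instr.eval, Function.update_self]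
    have hle : (fun k => r₄ (P + 1 + k)) = l := funext hF₄l
    rw [hle] at h
    rw [← hl]
    rcases h with ⟨h, -, hs⟩ | ⟨h, hs⟩
    · exact ⟨fun _ => ⟨_, hs⟩, fun _ => by rw [h]; exact one_ne_zero⟩
    · exact ⟨fun h' => absurd h h', fun ⟨p, hp⟩ => absurd hp (hs p)⟩
  · have h1 : M + 1 ≤ 200 * (m + n + 1) := by omega
    have h2 : P + 96 + 1 ≤ 200 * (m + n + 1) := by omega
    have h3 : 11 + 5 * P + n ≤ 1000 * (m + n + 1) := by omega
    have h4 : m + n + 1 ≤ (m + n + 1) ^ 2 := Nat.le_self_pow two_ne_zero _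
    have h5 := Nat.pow_le_pow_left h1 2
    have h6 := Nat.pow_le_pow_left h2 2
    rw [mul_pow] at h5 h6
    omega
  · rw [show 64 * (1 + 3 * m) + n = 2 * P + n by omega]
    exact ht

theorem Search.sat3InTime {δ : ℝ} (hδ : 0 ≤ δ) (h : Search δ) : Sat3InTime δ := by
  obtain ⟨F, C, d, hF⟩ := h
  refine ⟨(Frag.decideSat F).code 0, 90000000 * 81 + C * 2000 ^ d, 6 + 3 * d, fun n φ hφ => ?_⟩
  obtain ⟨r', t₁, t₂, hQ, h0, ht₁, ht₂⟩ := Frag.quiet_decideSat hF φ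
  obtain ⟨c, hc, rfl, ht⟩ := hQ.haltsWith
  refine ⟨c, hc, h0, ?_⟩
  -- The clauses are pairwise distinct, so their number is bounded by a polynomial in `n`.
  have hm : φ.length ≤ 8 * n ^ 3 := by
    refine hφ.length_le_card.trans_eq ?_
    simp [Clause3, Literal, Fintype.card_prod]
    ring
  have hn : n ≤ (n + 1) ^ 3 := by nlinarith [Nat.zero_le (n ^ 3)]
  have hn1 : n ^ 3 ≤ (n + 1) ^ 3 := Nat.pow_le_pow_left (by omega) 3
  have hn2 : 1 ≤ (n + 1) ^ 3 := Nat.one_le_pow _ _ (by omega)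
  have h1 : (t₁ : ℝ) ≤ 90000000 * 81 * ((n : ℝ) + 1) ^ 6 := by
    have : t₁ ≤ 90000000 * 81 * (n + 1) ^ 6 := by
      refine ht₁.trans ?_
      calc _ ≤ 90000000 * (9 * (n + 1) ^ 3) ^ 2 := Nat.mul_le_mul_left _ (Nat.pow_le_pow_left ?_ 2)
        _ = _ := by ring
      have : n + 1 ≤ (n + 1) ^ 3 := Nat.le_self_pow (by norm_num) _
      omega
    exact_mod_cast this
  have h2 : (t₂ : ℝ) ≤ C * (2 : ℝ) ^ (δ * n) * (2000 ^ d * ((n : ℝ) + 1) ^ (3 * d)) := by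
    refine ht₂.trans ?_
    rw [pow_mul, ← mul_pow]
    gcongr
    have : 64 * (1 + 3 * φ.length) + n + 1 ≤ 2000 * (n + 1) ^ 3 := by omega
    exact_mod_cast this
  have h3 : (1 : ℝ) ≤ 2 ^ (δ * n) := Real.one_le_rpow (by norm_num) (by positivity)
  have h4 : (1 : ℝ) ≤ (n : ℝ) + 1 := by linarith [Nat.cast_nonneg (α := ℝ) n]
  have h5 : ((n : ℝ) + 1) ^ 6 ≤ ((n : ℝ) + 1) ^ (6 + 3 * d) := pow_le_pow_right₀ h4 (by omega)
  have h6 : ((n : ℝ) + 1) ^ (3 * d) ≤ ((n : ℝ) + 1) ^ (6 + 3 * d) := pow_le_pow_right₀ h4 (by omega)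
  have h7 : (c.time : ℝ) ≤ t₁ + t₂ := by exact_mod_cast ht
  push_cast
  calc (c.time : ℝ) ≤ 90000000 * 81 * 1 * ((n : ℝ) + 1) ^ 6 +
        C * (2 : ℝ) ^ (δ * n) * (2000 ^ d * ((n : ℝ) + 1) ^ (3 * d)) := by linarith
    _ ≤ 90000000 * 81 * 2 ^ (δ * n) * ((n : ℝ) + 1) ^ (6 + 3 * d) +
        C * (2 : ℝ) ^ (δ * n) * (2000 ^ d * ((n : ℝ) + 1) ^ (6 + 3 * d)) := by gcongr
    _ = _ := by ring

/-! ### The padded satisfiability problem -/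

/-- The `j`-th number encoded by the word `w` in unary. -/
def numAt (w : List ℕ) (j : ℕ) : ℕ := (runLengths w).getD j 0

theorem numAt_le (w : List ℕ) (j : ℕ) : numAt w j ≤ w.length := by
  unfold numAt
  rcases Nat.lt_or_ge j (runLengths w).length with h | h
  · rw [List.getD_eq_getElem _ _ h]
    exact (foldl_runStep_bounds w).2.2 _ (List.getElem_mem h)
  · rw [List.getD_eq_default _ _ h]
    exact Nat.zero_le _

theorem numAt_eq_zero {w : List ℕ} {j : ℕ} (h : w.length ≤ j) : numAt w j = 0 :=
  List.getD_eq_default _ _ ((foldl_runStep_bounds w).1.trans h)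

/-- The formula encoded by `w` has `numAt w 1` clauses, whose literals are the numbers from
`numAt w 2` on, and `v * numAt w 0` variables; all literals must belong to these variables. -/
def ValidFormula (v : ℕ) (w : List ℕ) : Prop :=
  ∀ k < 3 * numAt w 1, numAt w (2 + k) < 2 * (v * numAt w 0)

/-- The solutions of the instance whose letters after the first one are `w`. There are
`2 ^ (u * numAt w 0)` trivial ones, which start with `0`; the other ones consist of the letter `1`,
a satisfying assignment to the `n = v * numAt w 0` variables of the formula, and `n` arbitrary
bits. All letters are `0` or `1`, also over a larger alphabet. -/
def IsSolution (u v : ℕ) (w y : List ℕ) : Prop :=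
  (∀ i < y.length, y.getD i 0 < 2) ∧
  ((y.length = u * numAt w 0 + 1 ∧ y.getD 0 0 = 0) ∨
    (y.length = 2 * (v * numAt w 0) + 1 ∧ y.getD 0 0 = 1 ∧ ValidFormula v w ∧
      SatBy (numAt w 1) (fun k => numAt w (2 + k)) fun i => y.getD (1 + i) 0 ≠ 0))

/-- The padded satisfiability problem. The first letter of an instance is ignored. -/
def padded (q u v : ℕ) : EnumProblem q :=
  fun x => {y | IsSolution u v (Word.code x).tail (Word.code y)}

/-- Decode the `R_5` letters from `R_1` on to the registers from `2 P` on, where `P = R_20`, compute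
the sizes of the formula, and check its literals. -/
def Frag.parse (u v : ℕ) : Frag :=
  Frag.ops [.add 2 20 20, .copy 24 2] ++ Frag.decode ++
    Frag.ops [.const 1 1, .load 5 24, .add 25 24 1, .load 12 25, .add 11 25 1, .const 2 v,
      .mul 10 2 5, .const 2 u, .mul 26 2 5, .add 27 10 10, .const 2 6, .mul 14 2 20, .copy 1 11,
      .const 2 3, .mul 3 2 12, .copy 5 27] ++ Frag.countGe ++ Frag.ops [.copy 18 6]

theorem sq_le_of_le_mul {a K M : ℕ} (h : M + 1 ≤ a * (K + 1)) :
    (M + 1) ^ 2 ≤ a ^ 2 * (K + 1) ^ 2 := by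
  rw [← mul_pow]
  exact Nat.pow_le_pow_left h 2

/-- Here `w` is the word that is decoded. Its numbers are found from `2 P` on, so the literals start at
`2 P + 2`, and the registers from `6 P` on are free; `R_18` counts the invalid literals. -/
theorem Frag.quiet_parse (u v : ℕ) (r : ℕ → ℕ) (K P S N : ℕ) (w : List ℕ) (h20 : r 20 = P)
    (h1 : r 1 = S) (h5 : r 5 = N) (hw : (List.range N).map (fun i => r (S + i)) = w) (hP : 32 ≤ P)
    (hS : P ≤ S) (hSN : S + N ≤ 2 * P) (hz : ∀ j, 2 * P ≤ j → r j = 0) (hPK : P ≤ K) (hu : u ≤ K)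
    (hv : v ≤ K) (huP : u * P ≤ K) (hvP : v * P ≤ K) (hval : ∀ i < N, r (S + i) ≤ K) :
    ∃ r', (Frag.parse u v).Quiet r (6000 * (K + 1) ^ 2) r' ∧
      (∀ j, (19 ≤ j ∧ j ≤ 23 ∨ 28 ≤ j) → j < 2 * P → r' j = r j) ∧
      (∀ j, r' (2 * P + j) = numAt w j) ∧ r' 10 = v * numAt w 0 ∧ r' 11 = 2 * P + 2 ∧
      r' 12 = numAt w 1 ∧ r' 14 = 6 * P ∧ r' 26 = u * numAt w 0 ∧ r' 27 = 2 * (v * numAt w 0) ∧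
      r' 18 ≤ 3 * numAt w 1 ∧ (r' 18 = 0 ↔ ValidFormula v w) := by
  have hwl : w.length = N := by rw [← hw]; simp
  have hnP : ∀ j, numAt w j ≤ P := fun j => (numAt_le w j).trans (by omega)
  have hQ₁ := Frag.quiet_ops_bound [.add 2 20 20, .copy 24 2] (by simp [Instr.Writes]) r
    (2 + 2 * K) (by simp only [boundOps, Instr.eval, Function.update_apply, reduceIte,
      Nat.reduceEqDiff, Nat.reduceLT]; omega)
  obtain ⟨r₁, hr₁⟩ : ∃ r₁, r₁ = evalOps [.add 2 20 20, .copy 24 2] r := ⟨_, rfl⟩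
  rw [← hr₁] at hQ₁
  have hF₁ : ∀ j, j ≠ 2 → j ≠ 24 → r₁ j = r j := by
    intro j h2 h24
    rw [hr₁]
    simp only [evalOps, Instr.eval, Function.update_apply, reduceIte, Nat.reduceEqDiff,
      Nat.reduceLT, h2, h24]
  have e1 : r₁ 2 = 2 * P ∧ r₁ 24 = 2 * P := by
    rw [hr₁]
    simp only [evalOps, Instr.eval, Function.update_apply, reduceIte, Nat.reduceEqDiff,
      Nat.reduceLT]
    omega
  have hF₁' : ∀ i, r₁ (S + i) = r (S + i) := fun i => hF₁ _ (by omega) (by omega)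
  obtain ⟨r₂, hQ₂, hF₂, hD⟩ := Frag.quiet_decode r₁ (3 * K) S (2 * P) N
    (by rw [hF₁ 1 (by omega) (by omega), h1]) e1.1 (by omega)
    (by rw [hF₁ 5 (by omega) (by omega), h5]) hSN (by omega)
    (fun i hi => by rw [hF₁']; have := hval i hi; omega)
    (fun j hj => by rw [hF₁ _ (by omega) (by omega), hz j hj])
  have hD' : ∀ j, r₂ (2 * P + j) = numAt w j := by
    intro j
    rw [hD, numAt, ← hw]
    simp only [hF₁']
  have f24 : r₂ 24 = 2 * P := by rw [hF₂ 24 (by omega) (by omega)]; exact e1.2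
  have f20 : r₂ 20 = P := by
    rw [hF₂ 20 (by omega) (by omega), hF₁ 20 (by omega) (by omega), h20]
  have f0 : r₂ (2 * P) = numAt w 0 := hD' 0
  have f1 : r₂ (2 * P + 1) = numAt w 1 := hD' 1
  have hn0 := hnP 0
  have hn1 := hnP 1
  have hn : v * numAt w 0 ≤ K := (Nat.mul_le_mul_left _ hn0).trans hvP
  have ht : u * numAt w 0 ≤ K := (Nat.mul_le_mul_left _ hn0).trans huP
  have n25 : (2 * P + 1 = 25) = False := by simp; omega
  have hQ₃ := Frag.quiet_ops_bound [.const 1 1, .load 5 24, .add 25 24 1, .load 12 25, .add 11 25 1,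
    .const 2 v, .mul 10 2 5, .const 2 u, .mul 26 2 5, .add 27 10 10, .const 2 6, .mul 14 2 20,
    .copy 1 11, .const 2 3, .mul 3 2 12, .copy 5 27] (by simp [Instr.Writes]) r₂ (100 * (K + 1)) (by
      have h30 : 30 ≤ 2 * P := by omega
      have h30' : 30 ≤ 2 * P + 1 := by omega
      simp only [boundOps, Instr.eval, Function.update_apply, reduceIte, Nat.reduceEqDiff,
        Nat.reduceLT, f24, f20, f0, f1, addr_ne h30, addr_ne h30']
      linarith)
  obtain ⟨r₃, hr₃⟩ : ∃ r₃, r₃ = evalOps [.const 1 1, .load 5 24, .add 25 24 1, .load 12 25,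
    .add 11 25 1, .const 2 v, .mul 10 2 5, .const 2 u, .mul 26 2 5, .add 27 10 10, .const 2 6,
    .mul 14 2 20, .copy 1 11, .const 2 3, .mul 3 2 12, .copy 5 27] r₂ := ⟨_, rfl⟩
  rw [← hr₃] at hQ₃
  have e3 : r₃ 10 = v * numAt w 0 ∧ r₃ 11 = 2 * P + 2 ∧ r₃ 12 = numAt w 1 ∧ r₃ 14 = 6 * P ∧
      r₃ 26 = u * numAt w 0 ∧ r₃ 27 = 2 * (v * numAt w 0) ∧ r₃ 1 = 2 * P + 2 ∧
      r₃ 3 = 3 * numAt w 1 ∧ r₃ 5 = 2 * (v * numAt w 0) := by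
    have h30 : 30 ≤ 2 * P := by omega
    have h30' : 30 ≤ 2 * P + 1 := by omega
    rw [hr₃]
    simp only [evalOps, Instr.eval, Function.update_apply, reduceIte, Nat.reduceEqDiff,
      Nat.reduceLT, f24, f20, f0, f1, addr_ne h30, addr_ne h30', true_and]
    omega
  have hF₃ : ∀ j, (15 ≤ j ∧ j ≤ 24 ∨ 28 ≤ j) → r₃ j = r₂ j := by
    intro j hj
    rw [hr₃]
    simp only [evalOps, Instr.eval, Function.update_apply, reduceIte, Nat.reduceEqDiff,
      Nat.reduceLT, show j ≠ 1 by omega, show j ≠ 2 by omega,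
      show j ≠ 3 by omega, show j ≠ 5 by omega, show j ≠ 10 by omega, show j ≠ 11 by omega,
      show j ≠ 12 by omega, show j ≠ 14 by omega, show j ≠ 25 by omega, show j ≠ 26 by omega,
      show j ≠ 27 by omega]
  have hD₃ : ∀ j, r₃ (2 * P + j) = numAt w j := fun j => by rw [hF₃ _ (by omega), hD']
  have hD₃' : ∀ j, r₃ (2 * P + 2 + j) = numAt w (2 + j) := fun j => by rw [add_assoc, hD₃]
  obtain ⟨r₄, hQ₄, hF₄, h6, h6'⟩ := Frag.quiet_countGe r₃ (6 * K) (2 * P + 2) (3 * numAt w 1)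
    e3.2.2.2.2.2.2.1 (by omega) e3.2.2.2.2.2.2.2.1 (by omega) (by omega)
    (fun i hi => by rw [hD₃']; have := hnP (2 + i); omega)
  have hQ₅ := Frag.quiet_ops_bound [.copy 18 6] (by simp [Instr.Writes]) r₄ 1 (by simp [boundOps])
  have hF₅ : ∀ j, 10 ≤ j → j ≠ 18 → evalOps [.copy 18 6] r₄ j = r₃ j := by
    intro j hj h18
    simp only [evalOps, Instr.eval, Function.update_apply, reduceIte, Nat.reduceEqDiff,
      Nat.reduceLT, h18]
    exact hF₄ j hj
  have e18 : evalOps [.copy 18 6] r₄ 18 = r₄ 6 := rfl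
  refine ⟨_, ((((hQ₁.append hQ₂).append hQ₃).append hQ₄).append hQ₅).mono ?_, ?_, ?_, ?_, ?_, ?_, ?_,
    ?_, ?_, ?_, ?_⟩
  · have h1 : (3 * K + 1) ^ 2 ≤ _ := sq_le_of_le_mul (a := 3) (K := K) (by omega)
    have h2 : (6 * K + 1) ^ 2 ≤ _ := sq_le_of_le_mul (a := 6) (K := K) (by omega)
    have h3 : K + 1 ≤ (K + 1) ^ 2 := Nat.le_self_pow two_ne_zero _
    linarith
  · intro j hj hjP
    rw [hF₅ j (by omega) (by omega), hF₃ j (by omega), hF₂ j (by omega) hjP,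
      hF₁ j (by omega) (by omega)]
  · intro j
    rw [hF₅ _ (by omega) (by omega), hD₃]
  · rw [hF₅ 10 (by omega) (by omega), e3.1]
  · rw [hF₅ 11 (by omega) (by omega), e3.2.1]
  · rw [hF₅ 12 (by omega) (by omega), e3.2.2.1]
  · rw [hF₅ 14 (by omega) (by omega), e3.2.2.2.1]
  · rw [hF₅ 26 (by omega) (by omega), e3.2.2.2.2.1]
  · rw [hF₅ 27 (by omega) (by omega), e3.2.2.2.2.2.1]
  · rw [e18]; exact h6
  · rw [e18, h6', ValidFormula, e3.2.2.2.2.2.2.2.2]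
    simp only [hD₃']

theorem dist_eq_zero_iff (x y a c : ℕ) :
    x - y + (y - x) + a + c = 0 ↔ x = y ∧ a = 0 ∧ c = 0 := by omega

theorem dist_eq_zero_iff' (x y a c c' : ℕ) :
    (x - y + (y - x) + (a - 1) + (1 - a) + c + c' = 0 ↔ x = y ∧ a = 1 ∧ c = 0 ∧ c' = 0) ∧
    x - y + (y - x) + (a - 1) + (1 - a) + c + c' ≤ x + y + a + 1 + c + c' := by omega

/-- Given the sizes computed by `Frag.parse`, test whether the word of length `R_21` at `R_23` is a
solution. For both kinds of solutions, the deviations of the length and of the first letter from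
what is required are added to the number of letters above `1`, in `R_2`, and for the second kind also
the number of literals that are out of range; the formula is checked only if this last sum is `0`. -/
def Frag.judge : Frag :=
  Frag.ops [.const 1 1, .add 28 27 1, .add 29 26 1, .load 30 23, .copy 13 14, .add 16 23 1,
      .copy 1 23, .copy 3 21, .const 5 2] ++ Frag.countGe ++
    Frag.ops [.const 1 1, .sub 2 21 29, .sub 3 29 21, .add 2 2 3, .add 2 2 30, .add 2 2 6,
      .sub 15 1 2, .sub 2 21 28, .sub 3 28 21, .add 2 2 3, .sub 3 30 1, .add 2 2 3, .sub 3 1 30,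
      .add 2 2 3, .add 2 2 6, .add 2 2 18, .const 3 1] ++
    Frag.ifLt 2 3 (Frag.check ++ Frag.ops [.const 1 1, .sub 15 1 6]) (Frag.ops []) ++
    Frag.ops [.copy 0 15]

theorem Frag.quiet_judge (r : ℕ → ℕ) (K Z Y L m n tt B c' : ℕ) (l y : ℕ → ℕ) (g10 : r 10 = n)
    (g11 : r 11 = L) (g12 : r 12 = m) (g14 : r 14 = B) (g18 : r 18 = c') (g21 : r 21 = Y)
    (g23 : r 23 = Z) (g26 : r 26 = tt) (g27 : r 27 = 2 * n) (hZ : 32 ≤ Z) (hZL : Z + Y ≤ L)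
    (hLB : L + 3 * m ≤ B) (hBK : B ≤ 6 * K) (hnK : n ≤ K) (htK : tt ≤ K) (hYK : Y ≤ K) (hcm : c' ≤ 3 * m)
    (hl : ∀ k < 3 * m, r (L + k) = l k) (hy : ∀ i ≤ Y, r (Z + i) = y i) (hyK : ∀ i, y i ≤ K)
    (hlit : c' = 0 → ∀ k < 3 * m, l k < 2 * n) :
    ∃ r', Frag.judge.Quiet r (100000 * (K + 1) ^ 2) r' ∧
      (r' 0 ≠ 0 ↔ (∀ i < Y, y i < 2) ∧ ((Y = tt + 1 ∧ y 0 = 0) ∨ (Y = 2 * n + 1 ∧ y 0 = 1 ∧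
        c' = 0 ∧ SatBy m l fun i => y (1 + i) ≠ 0))) := by
  have hy0 : r Z = y 0 := hy 0 (by omega)
  have hQ₆ := Frag.quiet_ops_bound [.const 1 1, .add 28 27 1, .add 29 26 1, .load 30 23, .copy 13 14,
    .add 16 23 1, .copy 1 23, .copy 3 21, .const 5 2] (by simp [Instr.Writes]) r (100 * (K + 1)) (by
      simp only [boundOps, Instr.eval, Function.update_apply, reduceIte, Nat.reduceEqDiff,
        Nat.reduceLT, g23, g26, g27]
      have := hyK 0
      linarith)
  obtain ⟨r₆, hr₆⟩ : ∃ r₆, r₆ = evalOps [.const 1 1, .add 28 27 1, .add 29 26 1, .load 30 23,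
    .copy 13 14, .add 16 23 1, .copy 1 23, .copy 3 21, .const 5 2] r := ⟨_, rfl⟩
  rw [← hr₆] at hQ₆
  have e6 : r₆ 28 = 2 * n + 1 ∧ r₆ 29 = tt + 1 ∧ r₆ 30 = y 0 ∧ r₆ 13 = B ∧
      r₆ 16 = Z + 1 ∧ r₆ 1 = Z ∧ r₆ 3 = Y ∧ r₆ 5 = 2 ∧ r₆ 10 = n ∧
      r₆ 11 = L ∧ r₆ 12 = m ∧ r₆ 18 = c' ∧ r₆ 21 = Y := by
    have h30 : 31 ≤ Z := by omega
    rw [hr₆]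
    simp only [evalOps, Instr.eval, Function.update_apply, reduceIte, Nat.reduceEqDiff,
      Nat.reduceLT, g21, g23, g26, g27, hy0, g14, g10, g11, g12, g18,
      addr_ne h30, and_self]
  have hF₆ : ∀ j, 32 ≤ j → r₆ j = r j := by
    intro j hj
    rw [hr₆]
    simp only [evalOps, Instr.eval, Function.update_apply, reduceIte, Nat.reduceEqDiff,
      Nat.reduceLT, addr_ne hj]
  obtain ⟨r₇, hQ₇, hF₇, h6, h6'⟩ := Frag.quiet_countGe r₆ (6 * K) (Z) Y
    e6.2.2.2.2.2.1 (by omega) e6.2.2.2.2.2.2.1 (by omega) (by omega)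
    (fun i hi => by
      rw [hF₆ _ (by omega), hy i hi.le]; have := hyK i; omega)
  obtain ⟨c, hc⟩ : ∃ c, c = r₇ 6 := ⟨_, rfl⟩
  obtain ⟨a, ha⟩ : ∃ a, a = y 0 := ⟨_, rfl⟩
  have hbits : c = 0 ↔ ∀ i < Y, y i < 2 := by
    rw [hc, h6', e6.2.2.2.2.2.2.2.1]
    exact forall_congr' fun i => forall_congr' fun hi => by rw [hF₆ _ (by omega), hy i hi.le]
  rw [← ha] at e6
  have hyq : a ≤ K := by rw [ha]; exact hyK 0
  rw [← hc] at h6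
  have f7 : r₇ 28 = 2 * n + 1 ∧ r₇ 29 = tt + 1 ∧ r₇ 30 = a ∧ r₇ 18 = c' ∧ r₇ 21 = Y := by
    rw [hF₇ 28 (by omega), hF₇ 29 (by omega), hF₇ 30 (by omega), hF₇ 18 (by omega),
      hF₇ 21 (by omega)]
    exact ⟨e6.1, e6.2.1, e6.2.2.1, e6.2.2.2.2.2.2.2.2.2.2.2.1, e6.2.2.2.2.2.2.2.2.2.2.2.2⟩
  obtain ⟨E₁, hE₁⟩ : ∃ E, E = Y - (tt + 1) + (tt + 1 - Y) + a + c := ⟨_, rfl⟩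
  obtain ⟨E₂, hE₂⟩ : ∃ E, E = Y - (2 * n + 1) + (2 * n + 1 - Y) + (a - 1) + (1 - a) + c + c' :=
    ⟨_, rfl⟩
  have hE₁0 := dist_eq_zero_iff Y (tt + 1) a c
  obtain ⟨hE₂0, hE₂K⟩ := dist_eq_zero_iff' Y (2 * n + 1) a c c'
  rw [← hE₁] at hE₁0
  rw [← hE₂] at hE₂0 hE₂K
  have hQ₈ := Frag.quiet_ops_bound [.const 1 1, .sub 2 21 29, .sub 3 29 21, .add 2 2 3, .add 2 2 30,
    .add 2 2 6, .sub 15 1 2, .sub 2 21 28, .sub 3 28 21, .add 2 2 3, .sub 3 30 1, .add 2 2 3,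
    .sub 3 1 30, .add 2 2 3, .add 2 2 6, .add 2 2 18, .const 3 1] (by simp [Instr.Writes]) r₇
    (1000 * (K + 1)) (by
      simp only [boundOps, Instr.eval, Function.update_apply, reduceIte, Nat.reduceEqDiff,
        Nat.reduceLT, f7, ← hc]
      have h1 := Nat.sub_le Y (tt + 1)
      have h2 := Nat.sub_le (tt + 1) Y
      have h3 := Nat.sub_le Y (2 * n + 1)
      have h4 := Nat.sub_le (2 * n + 1) Y
      have h5 := Nat.sub_le a 1
      have h6 := Nat.sub_le 1 a
      have h8 : c' ≤ 6 * K := by omega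
      linarith)
  obtain ⟨r₈, hr₈⟩ : ∃ r₈, r₈ = evalOps [.const 1 1, .sub 2 21 29, .sub 3 29 21, .add 2 2 3,
    .add 2 2 30, .add 2 2 6, .sub 15 1 2, .sub 2 21 28, .sub 3 28 21, .add 2 2 3, .sub 3 30 1,
    .add 2 2 3, .sub 3 1 30, .add 2 2 3, .add 2 2 6, .add 2 2 18, .const 3 1] r₇ := ⟨_, rfl⟩
  rw [← hr₈] at hQ₈
  have e8 : r₈ 2 = E₂ ∧ r₈ 3 = 1 ∧ r₈ 15 = 1 - E₁ := by
    rw [hr₈, hE₁, hE₂]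
    simp only [evalOps, Instr.eval, Function.update_apply, reduceIte, Nat.reduceEqDiff,
      Nat.reduceLT, f7, ← hc, and_self]
  clear hE₁ hE₂
  have hF₈ : ∀ j, 10 ≤ j → j ≠ 15 → r₈ j = r₆ j := by
    intro j hj h15
    rw [hr₈]
    simp only [evalOps, Instr.eval, Function.update_apply, reduceIte, Nat.reduceEqDiff,
      Nat.reduceLT, addr_ne hj, h15]
    exact hF₇ j hj
  obtain ⟨r₉, hQ₉, h9⟩ : ∃ r₉, (Frag.ifLt 2 3 (Frag.check ++ Frag.ops [.const 1 1, .sub 15 1 6])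
      (Frag.ops [])).Quiet r₈ (300 * (8 * K + 1) ^ 2 + 100 * (K + 1)) r₉ ∧
      (r₉ 15 ≠ 0 ↔ c = 0 ∧ ((Y = tt + 1 ∧ a = 0) ∨ (Y = 2 * n + 1 ∧ a = 1 ∧
        c' = 0 ∧ SatBy m l fun i => y (1 + i) ≠ 0))) := by
    by_cases h0 : E₂ = 0
    · obtain ⟨h1, h2, h3, h4⟩ : Y = 2 * n + 1 ∧ a = 1 ∧ c = 0 ∧ c' = 0 := hE₂0.1 h0
      have hV := hlit h4
      have hlits : ∀ k < 3 * m, r₈ (L + k) = l k := fun k hk => by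
        rw [hF₈ _ (by omega) (by omega), hF₆ _ (by omega), hl k hk]
      have hbs : ∀ i < n, r₈ (Z + 1 + i) = y (1 + i) := fun i hi => by
        rw [hF₈ _ (by omega) (by omega), hF₆ _ (by omega), add_assoc, hy _ (by omega)]
      obtain ⟨r', hQ, -, hm', hS⟩ := Frag.quiet_check r₈ (8 * K) n (L) m (Z + 1) (B)
        (by rw [hF₈ 10 (by omega) (by omega)]; exact e6.2.2.2.2.2.2.2.2.1)
        (by rw [hF₈ 11 (by omega) (by omega)]; exact e6.2.2.2.2.2.2.2.2.2.1)
        (by rw [hF₈ 12 (by omega) (by omega)]; exact e6.2.2.2.2.2.2.2.2.2.2.1)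
        (by rw [hF₈ 13 (by omega) (by omega)]; exact e6.2.2.2.1)
        (by rw [hF₈ 16 (by omega) (by omega)]; exact e6.2.2.2.2.1)
        (by omega) (by omega) (by omega) (by omega) (by omega)
        (fun k hk => by rw [hlits k hk]; exact hV k hk)
        (fun i hi => by rw [hbs i hi]; have := hbits.1 h3 (1 + i) (by omega); omega)
      have hQ' := Frag.quiet_ops_bound [.const 1 1, .sub 15 1 6] (by simp [Instr.Writes]) r'
        (3 + m) (by simp only [boundOps, Instr.eval, Function.update_apply, reduceIte,
          Nat.reduceEqDiff, Nat.reduceLT]; omega)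
      refine ⟨_, (Frag.quiet_ifLt_true (by omega) (hQ.append hQ')).mono (by omega), ?_⟩
      have e15 : evalOps [.const 1 1, .sub 15 1 6] r' 15 = 1 - r' 6 := by
        simp [evalOps, Instr.eval]
      have hS' : r' 6 = 0 ↔ SatBy m (l) fun i => y (1 + i) ≠ 0 := by
        rw [hS]
        refine satBy_congr (n := n) (fun k hk => ?_) hlits fun i hi => by
          rw [hbs i hi]
        rw [hlits k hk]
        exact hV k hk
      rw [e15, ← hS', h1, h2, h3, h4]
      clear hE₁0 hE₂0 hbits
      omega
    · refine ⟨r₈, (Frag.quiet_ifLt_false (by omega) (Frag.quiet_ops_bound [] (by simp) r₈ 0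
        le_rfl)).mono (by omega), ?_⟩
      rw [e8.2.2]
      constructor
      · intro h
        obtain ⟨h1, h2, h3⟩ := hE₁0.1 (by omega)
        exact ⟨h3, Or.inl ⟨h1, h2⟩⟩
      · rintro ⟨h1, h | h⟩
        · rw [hE₁0.2 ⟨h.1, h.2, h1⟩]; exact one_ne_zero
        · exact absurd (hE₂0.2 ⟨h.1, h.2.1, h1, h.2.2.1⟩) h0
  have hQ₁₀ := Frag.quiet_ops_bound [.copy 0 15] (by simp [Instr.Writes]) r₉ 1 (by simp [boundOps])
  refine ⟨_, ((((hQ₆.append hQ₇).append hQ₈).append hQ₉).append hQ₁₀).mono ?_, ?_⟩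
  · have h2 : (6 * K + 1) ^ 2 ≤ _ := sq_le_of_le_mul (a := 6) (K := K) (by omega)
    have h3 : (8 * K + 1) ^ 2 ≤ _ := sq_le_of_le_mul (a := 8) (K := K) (by omega)
    have h4 : K + 1 ≤ (K + 1) ^ 2 := Nat.le_self_pow two_ne_zero _
    linarith
  · rw [← ha, ← hbits, ← h9]
    simp only [evalOps, Instr.eval, Function.update_self]

/-- The fragment that tests solutions. The length of the input, which gives the length of `y`, is
recovered by division from `P`. -/
def Frag.test (u v : ℕ) : Frag :=
  Frag.relocate ++ Frag.ops [.copy 3 20, .const 1 0, .const 2 32] ++ Frag.divide ++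
    Frag.ops [.const 5 1, .sub 21 4 5, .load 22 20, .sub 21 21 22, .add 1 20 5, .add 23 1 22,
      .add 1 1 5, .sub 5 22 5] ++ Frag.parse u v ++
    Frag.judge

theorem Frag.quiet_test (q u v : ℕ) (x y : Word q) :
    ∃ r', (Frag.test u v).Quiet (init (pairCode x y)).reg
        (1000000 * (100 * (u + v + q + 1) * (x.length + y.length + 1) + 1) ^ 2) r' ∧
      (r' 0 ≠ 0 ↔ IsSolution u v (Word.code x).tail (Word.code y)) := by
  obtain ⟨N, hN⟩ : ∃ N, N = x.length + y.length + 1 := ⟨_, rfl⟩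
  obtain ⟨X, hX⟩ : ∃ X, X = x.length := ⟨_, rfl⟩
  obtain ⟨Y, hY⟩ : ∃ Y, Y = y.length := ⟨_, rfl⟩
  obtain ⟨K, hK⟩ : ∃ K, K = 100 * (u + v + q + 1) * N := ⟨_, rfl⟩
  obtain ⟨P, hP⟩ : ∃ P, P = 32 * N := ⟨_, rfl⟩
  obtain ⟨r, hr⟩ : ∃ r, r = (init (pairCode x y)).reg := ⟨_, rfl⟩
  obtain ⟨w, hw⟩ : ∃ w, w = (Word.code x).tail := ⟨_, rfl⟩
  obtain ⟨y', hy'⟩ : ∃ y', y' = Word.code y := ⟨_, rfl⟩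
  have hxl : (Word.code x).length = X := by simp [Word.code, hX]
  have hyl : y'.length = Y := by simp [Word.code, hY, hy']
  have hwl : w.length = X - 1 := by rw [hw, List.length_tail, hxl]
  have hlen : (pairCode x y).length = N := by
    simp [pairCode, Word.code, hN]
  have hN1 : 1 ≤ N := by omega
  have hPK : P ≤ K := by rw [hP, hK]; exact Nat.mul_le_mul_right N (by omega)
  have huP : u * P ≤ K := by rw [hP, hK]; rw [← mul_assoc]; exact Nat.mul_le_mul_right N (by omega)
  have hvP : v * P ≤ K := by rw [hP, hK]; rw [← mul_assoc]; exact Nat.mul_le_mul_right N (by omega)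
  have huqK : u + v + q + N ≤ K := by
    have := Nat.mul_le_mul_left (u + v + q) hN1
    have h2 : (u + v + q) * N + 1 * N ≤ K := by
      rw [hK, ← add_mul]; exact Nat.mul_le_mul_right N (by omega)
    omega
  have hr0 : r 0 = N := by rw [hr, init_reg_zero, hlen]
  have hr1 : r 1 = X := by rw [hr, hX]; exact init_reg_succ _ 0
  have hrx : ∀ i < X, r (1 + (1 + i)) = (Word.code x).getD i 0 := by
    intro i hi
    rw [hr, init_reg_succ, pairCode, add_comm 1 i, List.getD_cons_succ,
      List.getD_append _ _ _ _ (by omega)]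
  have hry : ∀ i, r (1 + (1 + X + i)) = y'.getD i 0 := by
    intro i
    rw [hr, init_reg_succ, pairCode, show 1 + X + i = X + i + 1 by ring, List.getD_cons_succ,
      List.getD_append_right _ _ _ _ (by omega), hxl, Nat.add_sub_cancel_left, hy']
  have hz : ∀ i, N < i → r i = 0 := fun i hi => by
    rw [hr]; exact init_reg_eq_zero _ (by omega)
  have hcode : ∀ (z : Word q) i, (Word.code z).getD i 0 ≤ q := by
    intro z i
    rcases Nat.lt_or_ge i (Word.code z).length with h | h
    · rw [List.getD_eq_getElem _ _ h]
      simp only [Word.code, List.getElem_map]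
      exact (Fin.is_lt _).le
    · rw [List.getD_eq_default _ _ h]; omega
  have hrq : ∀ i, 1 ≤ i → r i ≤ N + q := by
    intro i hi
    rcases Nat.lt_or_ge i 2 with h | h
    · rw [show i = 1 by omega, hr1]; omega
    obtain ⟨k, rfl⟩ : ∃ k, i = 1 + (1 + k) := ⟨i - 2, by omega⟩
    rcases Nat.lt_or_ge k X with h | h
    · rw [hrx k h]; have := hcode x k; omega
    · obtain ⟨j, rfl⟩ : ∃ j, k = X + j := ⟨k - X, by omega⟩
      rw [← add_assoc 1 X j, hry, hy']; have := hcode y j; omega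
  rw [← hr, ← hw, ← hy', ← hN, ← hK]
  obtain ⟨r₁, hQ₁, e20, hmv⟩ := Frag.quiet_relocate r (2 * K) P (by omega) (by omega)
    (by intro i hi; exact hz i (by omega)) (by omega)
    (fun i hi => by have := hrq i hi; omega)
  have hQ₂ := Frag.quiet_ops_bound [.copy 3 20, .const 1 0, .const 2 32] (by simp [Instr.Writes]) r₁
    3 (by simp [boundOps])
  obtain ⟨r₂, hr₂⟩ : ∃ r₂, r₂ = evalOps [.copy 3 20, .const 1 0, .const 2 32] r₁ := ⟨_, rfl⟩
  rw [← hr₂] at hQ₂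
  have e2 : r₂ 3 = P ∧ r₂ 1 = 0 ∧ r₂ 2 = 32 := by
    rw [hr₂]
    simp only [evalOps, Instr.eval, Function.update_apply, reduceIte, Nat.reduceEqDiff,
      Nat.reduceLT, e20, and_self]
  have hF₂ : ∀ j, 6 ≤ j → r₂ j = r₁ j := by
    intro j hj
    rw [hr₂]
    simp only [evalOps, Instr.eval, Function.update_apply, reduceIte, Nat.reduceEqDiff,
      Nat.reduceLT, addr_ne hj]
  obtain ⟨r₃, hQ₃, hF₃, hd1, hd2, hd3⟩ := Frag.quiet_divide r₂ K (by omega) (by omega)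
    (by omega) (by omega)
  have e4 : r₃ 4 = N := by
    by_contra hne
    rw [e2.2.1, e2.1] at hd2 hd3
    rw [e2.2.2] at hd2 hd3
    rcases Nat.lt_or_gt_of_ne hne with h | h
    · omega
    · have := hd3 N h; omega
  have f20 : r₃ 20 = P := by rw [hF₃ 20 (by omega), hF₂ 20 (by omega), e20]
  have hmv₃ : ∀ i, r₃ (P + i) = r (1 + i) := fun i => by
    rw [hF₃ _ (by omega), hF₂ _ (by omega), hmv]
  have f0 : r₃ P = X := by simpa [hr1] using hmv₃ 0
  have hQ₄ := Frag.quiet_ops_bound [.const 5 1, .sub 21 4 5, .load 22 20, .sub 21 21 22, .add 1 20 5,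
    .add 23 1 22, .add 1 1 5, .sub 5 22 5] (by simp [Instr.Writes]) r₃ (100 * (K + 1)) (by
      have h30 : 30 ≤ P := by omega
      simp only [boundOps, Instr.eval, Function.update_apply, reduceIte, Nat.reduceEqDiff,
        Nat.reduceLT, f20, f0, e4, addr_ne h30]
      omega)
  obtain ⟨r₄, hr₄⟩ : ∃ r₄, r₄ = evalOps [.const 5 1, .sub 21 4 5, .load 22 20, .sub 21 21 22,
    .add 1 20 5, .add 23 1 22, .add 1 1 5, .sub 5 22 5] r₃ := ⟨_, rfl⟩
  rw [← hr₄] at hQ₄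
  have e5 : r₄ 21 = Y ∧ r₄ 22 = X ∧ r₄ 1 = P + 2 ∧ r₄ 23 = P + 1 + X ∧ r₄ 5 = X - 1 ∧ r₄ 20 = P := by
    have h30 : 30 ≤ P := by omega
    rw [hr₄]
    simp only [evalOps, Instr.eval, Function.update_apply, reduceIte, Nat.reduceEqDiff,
      Nat.reduceLT, f20, f0, e4, addr_ne h30, true_and, and_true]
    omega
  have hmv₄ : ∀ i, r₄ (P + i) = r (1 + i) := by
    intro i
    have h30 : 30 ≤ P + i := by omega
    rw [hr₄]
    simp only [evalOps, Instr.eval, Function.update_apply, reduceIte, Nat.reduceEqDiff,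
      Nat.reduceLT, addr_ne h30]
    exact hmv₃ i
  obtain ⟨r₅, hQ₅, hF₅, hnum, g10, g11, g12, g14, g26, g27, g18, g18'⟩ := Frag.quiet_parse u v r₄ K P
    (P + 2) (X - 1) w e5.2.2.2.2.2 e5.2.2.1 e5.2.2.2.2.1 (by
      refine List.ext_getElem (by rw [hwl]; simp) fun i h1 h2 => ?_
      simp only [List.length_map, List.length_range] at h1
      rw [List.getElem_map, List.getElem_range, add_assoc, hmv₄,
        show 1 + (2 + i) = 1 + (1 + (1 + i)) by ring, hrx _ (by omega), add_comm 1 i,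
        List.getD_eq_getElem _ _ (by omega)]
      simp only [hw, List.getElem_tail]) (by omega)
    (by omega) (by omega) (fun j hj => by
      obtain ⟨i, rfl⟩ : ∃ i, j = P + i := ⟨j - P, by omega⟩
      rw [hmv₄, hz _ (by omega)]) (by omega) (by omega) (by omega) huP hvP
    (fun i hi => by rw [add_assoc, hmv₄]; have := hrq (1 + (2 + i)) (by omega); omega)
  have hy₅ : ∀ i ≤ Y, r₅ (P + 1 + X + i) = y'.getD i 0 := by
    intro i hi
    rw [hF₅ _ (by omega) (by omega), show P + 1 + X + i = P + (1 + X + i) by ring, hmv₄, hry]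
  have g21 : r₅ 21 = Y := by rw [hF₅ 21 (by omega) (by omega), e5.1]
  have g23 : r₅ 23 = P + 1 + X := by rw [hF₅ 23 (by omega) (by omega), e5.2.2.2.1]
  have hnP : ∀ j, numAt w j ≤ X := fun j => (numAt_le w j).trans (by omega)
  obtain ⟨n, hn⟩ : ∃ n, n = v * numAt w 0 := ⟨_, rfl⟩
  obtain ⟨tt, htt⟩ : ∃ tt, tt = u * numAt w 0 := ⟨_, rfl⟩
  obtain ⟨m, hm⟩ : ∃ m, m = numAt w 1 := ⟨_, rfl⟩
  have hnK : n ≤ K := by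
    rw [hn]; exact (Nat.mul_le_mul_left _ ((hnP 0).trans (by omega))).trans hvP
  have htK : tt ≤ K := by
    rw [htt]; exact (Nat.mul_le_mul_left _ ((hnP 0).trans (by omega))).trans huP
  have hmX : m ≤ X := by rw [hm]; exact hnP 1
  rw [← hn] at g10 g27
  rw [← hm] at g12 g18
  rw [← htt] at g26
  obtain ⟨r₆, hQ₆, h⟩ := Frag.quiet_judge r₅ K (P + 1 + X) Y (2 * P + 2) m n tt (6 * P) (r₅ 18)
    (fun k => numAt w (2 + k)) (fun i => y'.getD i 0) g10 g11 g12 g14 rfl g21 g23 g26 g27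
    (by omega) (by omega) (by omega) (by omega) hnK htK (by omega) g18
    (fun k _ => by rw [add_assoc, hnum]) hy₅
    (fun i => by rw [hy']; exact (hcode y i).trans (by omega))
    (fun h => by rw [hn, hm]; exact g18'.1 h)
  refine ⟨r₆, (((((hQ₁.append hQ₂).append hQ₃).append hQ₄).append hQ₅).append hQ₆).mono ?_, ?_⟩
  · have h1 : (2 * K + 1) ^ 2 ≤ _ := sq_le_of_le_mul (a := 2) (K := K) (by omega)
    have h4 : K + 1 ≤ (K + 1) ^ 2 := Nat.le_self_pow two_ne_zero _
    linarith
  · rw [h, IsSolution, hyl, ← hn, ← htt, ← hm, g18']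

theorem Word.code_injective {q : ℕ} : Function.Injective (Word.code (q := q)) :=
  List.map_injective_iff.2 Fin.val_injective

theorem padded_mem_enumP (q u v : ℕ) : padded q u v ∈ EnumP q := by
  refine ⟨⟨Polynomial.C (u + 2 * v) * Polynomial.X + 1, fun x y hy => ?_⟩, (Frag.test u v).code 0,
    Polynomial.C 1000000 * (Polynomial.C (100 * (u + v + q + 1)) * (Polynomial.X + 1) + 1) ^ 2,
    fun x y => ?_⟩
  · have h := (numAt_le (Word.code x).tail 0).trans (by simp : _ ≤ (Word.code x).length)
    simp only [Word.code, List.length_map] at h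
    have h1 := Nat.mul_le_mul_left u h
    have h2 := Nat.mul_le_mul_left v h
    have hl : (Word.code y).length = y.length := by simp [Word.code]
    simp only [Polynomial.eval_add, Polynomial.eval_mul, Polynomial.eval_C, Polynomial.eval_X,
      Polynomial.eval_one, add_mul, mul_assoc]
    rcases hy.2 with ⟨h, -⟩ | ⟨h, -⟩ <;> rw [hl] at h <;> rw [h] <;> simp only [Word.code] <;> omega
  · obtain ⟨r', hQ, h⟩ := Frag.quiet_test q u v x y
    obtain ⟨c, hc, rfl, ht⟩ := hQ.haltsWith
    refine ⟨c, hc, h, ht.trans (le_of_eq ?_)⟩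
    simp

/-! ### Writing an instance of the padded problem -/

theorem length_ofRunLengths_le (l : List ℕ) (K : ℕ) (h : ∀ a ∈ l, a + 1 ≤ K) :
    (ofRunLengths l).length ≤ l.length * K := by
  induction l with
  | nil => simp [ofRunLengths]
  | cons a l ih =>
    have h1 := ih fun a ha => h a (by simp [ha])
    have h2 := h a (by simp)
    simp only [ofRunLengths, List.flatMap_cons, List.length_append, List.length_replicate,
      List.length_cons, List.length_nil] at h1 ⊢
    nlinarith

theorem ofRunLengths_append (l : List ℕ) (k : ℕ) :
    ofRunLengths (l ++ [k]) = ofRunLengths l ++ (List.replicate k 0 ++ [1]) := by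
  simp [ofRunLengths]

theorem length_ofRunLengths_append (l : List ℕ) (k : ℕ) :
    (ofRunLengths (l ++ [k])).length = (ofRunLengths l).length + k + 1 := by
  simp [ofRunLengths_append, add_assoc]

/-- Appending a number to the encoded list changes one register. -/
theorem rep_ofRunLengths_append (B : ℕ) (l : List ℕ) (k i : ℕ) :
    (if i = (ofRunLengths l).length + k then B + 1 else rep B ((ofRunLengths l).getD i 0)) =
      rep B ((ofRunLengths (l ++ [k])).getD i 0) := by
  rw [ofRunLengths_append]
  rcases Nat.lt_or_ge i (ofRunLengths l).length with h | h
  · rw [if_neg (by omega), List.getD_append _ _ _ _ h]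
  · obtain ⟨j, rfl⟩ : ∃ j, i = (ofRunLengths l).length + j := ⟨i - (ofRunLengths l).length, by omega⟩
    rw [List.getD_append_right _ _ _ _ (by omega), Nat.add_sub_cancel_left,
      List.getD_eq_default _ _ (by omega)]
    rcases Nat.lt_trichotomy j k with h | rfl | h
    · rw [if_neg (by omega), List.getD_append _ _ _ _ (by simpa using h)]
      simp [h]
    · rw [if_pos rfl, List.getD_append_right _ _ _ _ (by simp)]
      simp [rep, add_comm]
    · rw [if_neg (by omega), List.getD_eq_default _ _ (by simp; omega)]

/-- Write, in the form in which `Frag.sim` expects its input, an instance of the padded problem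
for a formula with `R_10` variables. The number `ρ` is `R_10 / v`, rounded up, so there may be
variables that do not occur in the formula. -/
def Frag.encode (v : ℕ) : Frag :=
  Frag.ops [.const 1 0, .const 2 v, .copy 3 10] ++ Frag.divide ++
    Frag.ops [.const 5 1, .add 6 13 5, .add 7 6 5, .add 7 7 4, .store 7 6, .add 7 7 5, .add 7 7 12,
      .store 7 6, .add 7 7 5, .copy 1 11, .const 2 0, .const 3 3, .mul 3 3 12] ++
    Frag.whileLt 2 3 (Frag.ops [.load 4 1, .add 7 7 4, .store 7 6, .add 7 7 5, .add 1 1 5,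
      .add 2 2 5]) ++ Frag.ops [.sub 0 7 5]

theorem Frag.quiet_encode (v : ℕ) (hv : 1 ≤ v) (r : ℕ → ℕ) (n L m B : ℕ) (l : ℕ → ℕ)
    (h10 : r 10 = n) (h11 : r 11 = L) (h12 : r 12 = m) (h13 : r 13 = B) (hL : 32 ≤ L)
    (hLB : L + 3 * m ≤ B) (hnB : n ≤ B) (hz : ∀ j, B ≤ j → r j = 0)
    (hl : ∀ k < 3 * m, r (L + k) = l k) (hlit : ∀ k < 3 * m, l k < 2 * n) :
    ∃ r' ρ nums, (Frag.encode v).Quiet r (20000 * (B + v + 1) ^ 4) r' ∧ n ≤ v * ρ ∧ ρ ≤ n ∧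
      v * ρ ≤ n + v ∧ nums = ρ :: m :: (List.range (3 * m)).map l ∧
      (ofRunLengths nums).length ≤ 4 * (B + 1) ^ 2 ∧ (∀ j, 10 ≤ j → j < B + 2 → r' j = r j) ∧
      r' 0 = B + 1 + (ofRunLengths nums).length ∧
      ∀ i, r' (B + 2 + i) = rep B ((ofRunLengths nums).getD i 0) := by
  have hQ₁ := Frag.quiet_ops_bound [.const 1 0, .const 2 v, .copy 3 10] (by simp [Instr.Writes]) r
    3 (by simp [boundOps])
  obtain ⟨r₁, hr₁⟩ : ∃ r₁, r₁ = evalOps [.const 1 0, .const 2 v, .copy 3 10] r := ⟨_, rfl⟩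
  rw [← hr₁] at hQ₁
  have e1 : r₁ 1 = 0 ∧ r₁ 2 = v ∧ r₁ 3 = n := by
    rw [hr₁]
    simp only [evalOps, Instr.eval, Function.update_apply, reduceIte, Nat.reduceEqDiff,
      Nat.reduceLT, h10, and_self]
  have hF₁ : ∀ j, 10 ≤ j → r₁ j = r j := by
    intro j hj
    rw [hr₁]
    simp only [evalOps, Instr.eval, Function.update_apply, reduceIte, Nat.reduceEqDiff,
      Nat.reduceLT, addr_ne hj]
  obtain ⟨r₂, hQ₂, hF₂, -, hd2, hd3⟩ := Frag.quiet_divide r₁ (B + v) (by omega) (by omega)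
    (by omega) (by omega)
  obtain ⟨ρ, hρ⟩ : ∃ ρ, ρ = r₂ 4 := ⟨_, rfl⟩
  have hF₂' : ∀ j, 10 ≤ j → r₂ j = r j := fun j hj => by rw [hF₂ j (by omega), hF₁ j hj]
  rw [e1.1, e1.2.1, e1.2.2, ← hρ, zero_add, mul_comm] at hd2
  have hρv : v * ρ ≤ n + v ∧ ρ ≤ n := by
    rcases ρ with _ | ρ
    · omega
    · have h := hd3 ρ (by omega)
      rw [e1.1, e1.2.1, e1.2.2, zero_add, mul_comm] at h
      have h2 : ρ ≤ v * ρ := Nat.le_mul_of_pos_left _ (by omega)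
      rw [mul_add]
      omega
  have hB2 : B + 1 ≤ (B + 1) ^ 2 := Nat.le_self_pow two_ne_zero _
  obtain ⟨M, hM⟩ : ∃ M, M = 6 * (B + 1) ^ 2 := ⟨_, rfl⟩
  have hQ₃ := Frag.quiet_ops_bound [.const 5 1, .add 6 13 5, .add 7 6 5, .add 7 7 4, .store 7 6,
    .add 7 7 5, .add 7 7 12, .store 7 6, .add 7 7 5, .copy 1 11, .const 2 0, .const 3 3, .mul 3 3 12]
    (by simp [Instr.Writes]) r₂ (100 * (M + 1)) (by
      have a1 : 20 ≤ B + 1 + 1 + ρ := by omega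
      have a2 : 20 ≤ B + 1 + 1 + ρ + 1 + m := by omega
      simp only [boundOps, Instr.eval, Function.update_apply, reduceIte, Nat.reduceEqDiff,
        Nat.reduceLT, hF₂' 13 (by omega), hF₂' 12 (by omega), h13, h12, ← hρ,
        addr_ne a1, addr_ne a2]
      have h1 := hρv.2
      linarith)
  obtain ⟨r₃, hr₃⟩ : ∃ r₃, r₃ = evalOps [.const 5 1, .add 6 13 5, .add 7 6 5, .add 7 7 4,
    .store 7 6, .add 7 7 5, .add 7 7 12, .store 7 6, .add 7 7 5, .copy 1 11, .const 2 0, .const 3 3,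
    .mul 3 3 12] r₂ := ⟨_, rfl⟩
  rw [← hr₃] at hQ₃
  have e3 : r₃ 1 = L ∧ r₃ 2 = 0 ∧ r₃ 3 = 3 * m ∧ r₃ 5 = 1 ∧ r₃ 6 = B + 1 ∧
      r₃ 7 = B + 2 + (ρ + 1 + m + 1) := by
    have a1 : 20 ≤ B + 1 + 1 + ρ := by omega
    have a2 : 20 ≤ B + 1 + 1 + ρ + 1 + m := by omega
    rw [hr₃]
    simp only [evalOps, Instr.eval, Function.update_apply, reduceIte, Nat.reduceEqDiff,
      Nat.reduceLT, hF₂' 13 (by omega), hF₂' 12 (by omega),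
      hF₂' 11 (by omega), h13, h12, h11, ← hρ, addr_ne a1, addr_ne a2, true_and]
    omega
  have hF₃ : ∀ j, 10 ≤ j →
      r₃ j = if j = B + 1 + 1 + ρ + 1 + m then B + 1 else if j = B + 1 + 1 + ρ then B + 1 else r j := by
    intro j hj
    have a1 : 20 ≤ B + 1 + 1 + ρ := by omega
    rw [hr₃]
    simp only [evalOps, Instr.eval, Function.update_apply, reduceIte, Nat.reduceEqDiff,
      Nat.reduceLT, hF₂' 13 (by omega), hF₂' 12 (by omega),
      h13, h12, ← hρ, addr_ne hj, addr_ne a1, hF₂' j hj]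
  obtain ⟨d, hd⟩ : ∃ d : ℕ → List ℕ, d = fun k => ρ :: m :: (List.range k).map l := ⟨_, rfl⟩
  have hd0 : d 0 = [] ++ [ρ] ++ [m] := by rw [hd]; rfl
  have hds : ∀ k, d (k + 1) = d k ++ [l k] := by
    intro k; rw [hd]; simp [List.range_succ]
  have hdl : ∀ k ≤ 3 * m, (ofRunLengths (d k)).length ≤ 4 * (B + 1) ^ 2 := by
    intro k hk
    have h1 := length_ofRunLengths_le (d k) (2 * (B + 1)) (by
      intro a ha
      rw [hd] at ha
      simp only [List.mem_cons, List.mem_map, List.mem_range] at ha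
      rcases ha with rfl | rfl | ⟨i, hi, rfl⟩
      · omega
      · omega
      · have := hlit i (by omega); omega)
    have h2 : (d k).length = k + 2 := by rw [hd]; simp
    rw [h2] at h1
    have h3 : (k + 2) * (2 * (B + 1)) ≤ (2 * (B + 1)) * (2 * (B + 1)) :=
      Nat.mul_le_mul_right _ (by omega)
    linarith
  have hE₃ : ∀ i, r₃ (B + 2 + i) = rep B ((ofRunLengths (d 0)).getD i 0) := by
    intro i
    rw [hF₃ _ (by omega), hd0, ← rep_ofRunLengths_append, ← rep_ofRunLengths_append,
      length_ofRunLengths_append, hz _ (by omega)]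
    simp only [ofRunLengths, List.flatMap_nil, List.length_nil, List.getD_nil, rep, zero_add,
      reduceIte]
    congr 1
    · simp only [eq_iff_iff]; omega
    · congr 1
      simp only [eq_iff_iff]; omega
  obtain ⟨r₄, ⟨i1, i2, i3, i5, i6, i7, hF₄, hE₄⟩, hQ₄⟩ := Frag.quiet_forLt (i := 2) (n := 3)
    (l := [.load 4 1, .add 7 7 4, .store 7 6, .add 7 7 5, .add 1 1 5, .add 2 2 5])
    (by simp [Instr.Writes]) (3 * m) (100 * (M + 1))
    (fun k r' => r' 1 = L + k ∧ r' 2 = k ∧ r' 3 = 3 * m ∧ r' 5 = 1 ∧ r' 6 = B + 1 ∧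
      r' 7 = B + 2 + (ofRunLengths (d k)).length ∧ (∀ j, 10 ≤ j → j < B + 2 → r' j = r j) ∧
      ∀ i, r' (B + 2 + i) = rep B ((ofRunLengths (d k)).getD i 0))
    (by rintro k r' ⟨e1, e2, e3, -⟩; exact ⟨e2, e3⟩)
    (by
      rintro k r' hk ⟨e1, e2, e3, e5, e6, e7, hF, hE⟩
      have hlk : r' (L + k) = l k := by rw [hF _ (by omega) (by omega), hl k hk]
      have h1 := hdl k (by omega)
      have h2 := hlit k hk
      have h3 := length_ofRunLengths_append (d k) (l k)
      have h4 := fun i => rep_ofRunLengths_append B (d k) (l k) i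
      rw [← hds] at h3
      simp only [← hds] at h4
      have a1 : 10 ≤ L + k := by omega
      have a2 : 10 ≤ B + 2 + (ofRunLengths (d k)).length + l k := by omega
      generalize (ofRunLengths (d k)).length = D at *
      constructor
      · simp only [boundOps, Instr.eval, Function.update_apply, reduceIte, Nat.reduceEqDiff,
          Nat.reduceLT, addr_ne a1, addr_ne a2, e1, e2, e3, e5, e6, e7, hlk]
        linarith
      · simp only [evalOps, Instr.eval, Function.update_apply, reduceIte, Nat.reduceEqDiff,
          Nat.reduceLT, addr_ne a1, addr_ne a2, e1, e2, e3, e5, e6, e7, hlk]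
        refine ⟨by omega, trivial, trivial, trivial, trivial, by omega, fun j hj hj' => ?_,
          fun i => ?_⟩
        · simp only [addr_ne hj, reduceIte, Nat.reduceLT]
          rw [if_neg (by omega)]
          exact hF j hj hj'
        · simp only [addr_ne (show 10 ≤ B + 2 + i by omega), reduceIte, Nat.reduceLT]
          rw [← h4, hE]
          congr 1
          simp only [eq_iff_iff]; omega)
    r₃ ⟨e3.1, e3.2.1, e3.2.2.1, e3.2.2.2.1, e3.2.2.2.2.1, by
      rw [e3.2.2.2.2.2, hd0, length_ofRunLengths_append, length_ofRunLengths_append]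
      simp [ofRunLengths], fun j hj hj' => by
        rw [hF₃ j hj, if_neg (by omega), if_neg (by omega)], hE₃⟩
  have hdm := hdl (3 * m) le_rfl
  have hQ₅ := Frag.quiet_ops_bound [.sub 0 7 5] (by simp [Instr.Writes]) r₄ (2 * M) (by
    simp only [boundOps, Instr.eval, Function.update_apply, reduceIte, Nat.reduceEqDiff,
      Nat.reduceLT, i7, i5]; omega)
  have hF₅ : ∀ j, 10 ≤ j → evalOps [.sub 0 7 5] r₄ j = r₄ j := by
    intro j hj
    simp only [evalOps, Instr.eval, Function.update_apply, reduceIte, Nat.reduceEqDiff,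
      Nat.reduceLT, addr_ne hj]
  refine ⟨_, ρ, d (3 * m), ((((hQ₁.append hQ₂).append hQ₃).append hQ₄).append hQ₅).mono ?_, hd2,
    hρv.2, hρv.1, by rw [hd], hdm, fun j hj hj' => by rw [hF₅ j hj, hF₄ j hj hj'], ?_, fun i => by
      rw [hF₅ _ (by omega), hE₄ i]⟩
  · have h1 : (B + 1) ^ 2 ≤ (B + v + 1) ^ 2 := Nat.pow_le_pow_left (by omega) 2
    have h2 : 1 ≤ (B + v + 1) ^ 2 := Nat.one_le_pow _ _ (by omega)
    have h3 : 3 * m ≤ (B + v + 1) ^ 2 := by omega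
    rw [show (B + v + 1) ^ 4 = (B + v + 1) ^ 2 * (B + v + 1) ^ 2 by ring]
    generalize (B + v + 1) ^ 2 = s at *
    have h4 : 3 * m * (100 * (M + 1) + 2 * (3 * m) + 1) ≤ s * (100 * (6 * s + s) + 2 * s + s) :=
      Nat.mul_le_mul h3 (by omega)
    have h5 : s ≤ s * s := Nat.le_mul_of_pos_left _ h2
    linarith
  · simp only [evalOps, Instr.eval, Function.update_apply, reduceIte, Nat.reduceEqDiff,
      Nat.reduceLT, i7, i5]
    omega

/-! ### Searching with the help of an enumeration algorithm -/

/-- The numbers in the registers are at most exponential in the time; hence one operation on an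
address of the simulated machine takes time linear in its running time. -/
theorem reg_lt_of_reaches {Q : Program} {S K : ℕ} {w : List ℕ} {c : Config}
    (hS : ∀ i ∈ Q, i.ArgsLe S) (hK : S < 2 ^ K) (h0 : ∀ i, (init w).reg i < 2 ^ K)
    (h : StateTransition.Reaches (step Q) (init w) c) : ∀ i, c.reg i < 2 ^ (2 * c.time + K) := by
  have key : ∀ c c' : Config, (∀ i, c.reg i < 2 ^ (2 * c.time + K)) → step Q c = some c' →
      ∀ i, c'.reg i < 2 ^ (2 * c'.time + K) := by
    intro c c' hc hs
    have hw : ∀ d x t, x < 2 ^ (2 * (c.time + t) + K) →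
        ∀ i, (c.write d x t).reg i < 2 ^ (2 * (c.write d x t).time + K) := by
      intro d x t hx i
      simp only [Config.write, Function.update_apply]
      split
      · exact hx
      · exact (hc i).trans_le (Nat.pow_le_pow_right (by norm_num) (by omega))
    have hs1 : ∀ s, c.reg s < 2 ^ (2 * (c.time + 1) + K) := fun s =>
      (hc s).trans_le (Nat.pow_le_pow_right (by norm_num) (by omega))
    have hlog : ∀ x y, x + y < 2 ^ logCost x y := fun x y => by
      rw [logCost, add_comm 1]
      exact Nat.lt_pow_succ_log_self Nat.one_lt_two _
    rw [step] at hs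
    cases hi : Q[c.pc]? with
    | none => simp [hi] at hs
    | some i =>
      have hA := hS i (List.mem_of_getElem? hi)
      rw [hi] at hs
      cases i with
      | halt => simp at hs
      | const d n =>
        simp only [Option.some.injEq] at hs
        subst hs
        exact hw _ _ _ ((hA.2.trans_lt hK).trans_le (Nat.pow_le_pow_right (by norm_num) (by omega)))
      | copy d s => simp only [Option.some.injEq] at hs; subst hs; exact hw _ _ _ (hs1 _)
      | load d s => simp only [Option.some.injEq] at hs; subst hs; exact hw _ _ _ (hs1 _)
      | store d s => simp only [Option.some.injEq] at hs; subst hs; exact hw _ _ _ (hs1 _)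
      | add d s t =>
        simp only [Option.some.injEq] at hs
        subst hs
        exact hw _ _ _ ((hlog _ _).trans_le (Nat.pow_le_pow_right (by norm_num) (by omega)))
      | sub d s t =>
        simp only [Option.some.injEq] at hs
        subst hs
        refine hw _ _ _ ((Nat.sub_le _ _).trans_lt ?_)
        exact (hc s).trans_le (Nat.pow_le_pow_right (by norm_num) (by omega))
      | mul d s t =>
        simp only [Option.some.injEq] at hs
        subst hs
        have h := hlog (c.reg s) (c.reg t)
        have h1 : c.reg s * c.reg t < 2 ^ logCost (c.reg s) (c.reg t) * 2 ^ logCost (c.reg s) (c.reg t) :=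
          Nat.mul_lt_mul'' (by omega) (by omega)
        rw [← pow_add] at h1
        exact hw _ _ _ (h1.trans_le (Nat.pow_le_pow_right (by norm_num) (by omega)))
      | jump l =>
        simp only [Option.some.injEq] at hs
        subst hs
        exact hs1
      | jlt s t l =>
        simp only [Option.some.injEq] at hs
        subst hs
        exact fun i => (hc i).trans_le (Nat.pow_le_pow_right (by norm_num) (by dsimp only; omega))
      | output s t =>
        simp only [Option.some.injEq] at hs
        subst hs
        exact hs1
  induction h with
  | refl => intro i; simpa [init] using h0 i
  | tail _ hs ih => exact key _ _ ih hs

theorem exists_eval_le (p : Polynomial ℕ) : ∃ D d : ℕ, ∀ s, p.eval s ≤ D * (s + 1) ^ d := by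
  induction p using Polynomial.induction_on' with
  | add p q hp hq =>
    obtain ⟨D, d, h⟩ := hp
    obtain ⟨D', d', h'⟩ := hq
    refine ⟨D + D', d + d', fun s => ?_⟩
    rw [Polynomial.eval_add, add_mul]
    exact add_le_add
      ((h s).trans (Nat.mul_le_mul_left _ (Nat.pow_le_pow_right (by omega) (by omega))))
      ((h' s).trans (Nat.mul_le_mul_left _ (Nat.pow_le_pow_right (by omega) (by omega))))
  | monomial n a =>
    refine ⟨a, n, fun s => ?_⟩
    rw [Polynomial.eval_monomial]
    exact Nat.mul_le_mul_left _ (Nat.pow_le_pow_left (by omega) _)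

theorem exists_code_eq {q : ℕ} (l : List ℕ) (h : ∀ a ∈ l, a < q) : ∃ x : Word q, Word.code x = l := by
  induction l with
  | nil => exact ⟨[], rfl⟩
  | cons a l ih =>
    obtain ⟨x, hx⟩ := ih fun a ha => h a (by simp [ha])
    exact ⟨⟨a, h a (by simp)⟩ :: x, by simp [Word.code, ← hx]⟩

theorem ofRunLengths_lt_two (l : List ℕ) : ∀ a ∈ ofRunLengths l, a < 2 := by
  intro a ha
  simp only [ofRunLengths, List.mem_flatMap, List.mem_append, List.mem_replicate,
    List.mem_singleton] at ha
  obtain ⟨k, -, ⟨-, rfl⟩ | rfl⟩ := ha <;> norm_num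

/-- There are at most `2 ^ (u * numAt w 0)` trivial solutions. -/
theorem length_le_of_trivial {q u v : ℕ} {w : List ℕ} (zs : List (Word q)) (hnd : zs.Nodup)
    (h : ∀ z ∈ zs, IsSolution u v w (Word.code z) ∧ (Word.code z).getD 0 0 = 0) :
    zs.length ≤ 2 ^ (u * numAt w 0) := by
  obtain ⟨t, ht⟩ : ∃ t, t = u * numAt w 0 := ⟨_, rfl⟩
  rw [← ht]
  have hz : ∀ z ∈ zs, (Word.code z).length = t + 1 ∧ (Word.code z).getD 0 0 = 0 ∧
      ∀ i < t, (Word.code z).getD (1 + i) 0 ≤ 1 := by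
    intro z hz
    obtain ⟨⟨h1, h2⟩, h3⟩ := h z hz
    rw [← ht] at h2
    rcases h2 with ⟨h2, -⟩ | ⟨-, h2, -⟩
    · exact ⟨h2, h3, fun i hi => by have := h1 (1 + i) (by omega); omega⟩
    · omega
  have hinj : ∀ z ∈ zs, ∀ z' ∈ zs, binVal (fun i => (Word.code z).getD (1 + i) 0) t =
      binVal (fun i => (Word.code z').getD (1 + i) 0) t → z = z' := by
    intro z h1 z' h2 he
    obtain ⟨a1, a2, a3⟩ := hz z h1
    obtain ⟨b1, b2, b3⟩ := hz z' h2
    have h3 := binVal_inj a3 b3 he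
    refine Word.code_injective (List.ext_getElem (by rw [a1, b1]) fun i hi hi' => ?_)
    rw [← List.getD_eq_getElem _ 0 hi, ← List.getD_eq_getElem _ 0 hi']
    rcases i with _ | i
    · rw [a2, b2]
    · rw [add_comm]
      exact h3 i (by omega)
  have hnd' := List.Nodup.map_on hinj hnd
  have hsub : (zs.map fun z => binVal (fun i => (Word.code z).getD (1 + i) 0) t) ⊆
      List.range (2 ^ t) := by
    intro x hx
    simp only [List.mem_map] at hx
    obtain ⟨z, h1, rfl⟩ := hx
    exact List.mem_range.2 (binVal_lt (hz z h1).2.2)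
  simpa using (hnd'.subperm hsub).length_le

/-- A run outputs at most `2 ^ (u * numAt w 0)` trivial solutions before the first nontrivial one. -/
theorem prefix_length_le {q u v : ℕ} {w : List ℕ} {e : Config} {ys : List (Word q)}
    {g : List (List ℕ × ℕ)} (hlog : e.log.map Prod.fst = ys.map Word.code) (hnd : ys.Nodup)
    (hsol : ∀ y ∈ ys, IsSolution u v w (Word.code y)) (hg : g <+: e.log) (hn : NoHit g) :
    g.length ≤ 2 ^ (u * numAt w 0) := by
  obtain ⟨g', hg'⟩ := hg
  have h1 : g.map Prod.fst = (ys.take g.length).map Word.code := by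
    rw [List.map_take, ← hlog, ← hg', List.map_append, List.take_left' (by simp)]
  have h2 : (ys.take g.length).length = g.length := by
    have := congrArg List.length h1
    simpa using this.symm
  rw [← h2]
  refine length_le_of_trivial (v := v) _ (hnd.sublist (List.take_sublist _ _)) fun z hz =>
    ⟨hsol z (List.mem_of_mem_take hz), ?_⟩
  have hm : Word.code z ∈ g.map Prod.fst := by rw [h1]; exact List.mem_map_of_mem hz
  obtain ⟨x, hx, hxz⟩ := List.mem_map.1 hm
  obtain ⟨l, hl⟩ := hn x hx
  rw [← hxz, hl]
  rfl

/-- If all solutions are trivial, the formula is unsatisfiable: a satisfying assignment could be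
completed to a solution by zeros. -/
theorem not_satBy_of_trivial {q u v : ℕ} (hq : 2 ≤ q) {w : List ℕ} (hV : ValidFormula v w)
    (h : ∀ y : Word q, IsSolution u v w (Word.code y) → (Word.code y).getD 0 0 = 0) (p : ℕ → Prop) :
    ¬ SatBy (numAt w 1) (fun k => numAt w (2 + k)) p := by
  classical
  intro hp
  obtain ⟨n, hn⟩ : ∃ n, n = v * numAt w 0 := ⟨_, rfl⟩
  obtain ⟨y, hy⟩ := exists_code_eq (q := q)
    (1 :: ((List.range (n + n)).map fun i => if p i then 1 else 0)) (by
      intro a ha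
      simp only [List.mem_cons, List.mem_map] at ha
      rcases ha with rfl | ⟨i, -, rfl⟩
      · omega
      · split <;> omega)
  have hb : ∀ i < n + n, (Word.code y).getD (1 + i) 0 = if p i then 1 else 0 := by
    intro i hi
    rw [hy, add_comm 1 i, List.getD_cons_succ, List.getD_eq_getElem _ _ (by simpa using hi)]
    simp
  have h0 : (Word.code y).getD 0 0 = 1 := by rw [hy]; rfl
  have hl : (Word.code y).length = 2 * n + 1 := by rw [hy]; simp; omega
  have := h y ⟨fun i hi => ?_, Or.inr ⟨by rw [hl, hn], h0, hV, ?_⟩⟩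
  · omega
  · rcases i with _ | i
    · omega
    · rw [add_comm, hb i (by omega)]; split <;> omega
  · refine (satBy_congr (n := n) (fun k hk => by rw [hn]; exact hV k hk) (fun _ _ => rfl)
      fun i hi => ?_).1 hp
    rw [hb i (by omega)]
    split <;> simp_all

theorem outTime_of_prefix {e : Config} {g : List (List ℕ × ℕ)} {w : List ℕ} {t : ℕ}
    (h : g ++ [(w, t)] <+: e.log) : outTime e (g.length + 1) = t ∧ g.length + 1 ≤ e.log.length := by
  obtain ⟨g', hg⟩ := h
  constructor
  · simp [outTime, ← hg]
  · simp [← hg]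

theorem outTime_length {e : Config} (h : ∀ x ∈ e.log.getLast?, x.2 = e.time) :
    outTime e e.log.length = e.time := by
  unfold outTime
  cases hl : e.log.getLast? with
  | none =>
    rw [List.getLast?_eq_none_iff.1 hl]; rfl
  | some x =>
    have := h x (by rw [hl]; rfl)
    rw [List.getElem?_map, ← List.getLast?_eq_getElem?, hl]
    simpa using this

/-- If the simulation found a nontrivial solution, copy the bits of the assignment from the output
block of the simulated machine; the address and the bits are converted from their representation. -/
def Frag.extract : Frag :=
  Frag.ops [.const 2 0] ++ Frag.ifLt 2 15 (Frag.ops [.sub 1 1 13, .add 1 1 13, .const 2 1, .add 1 1 2,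
    .copy 3 14, .copy 5 10, .copy 8 13] ++ Frag.copySub) (Frag.ops [])

theorem Frag.quiet_extract (r : ℕ → ℕ) (n B W M p : ℕ) (h10 : r 10 = n) (h13 : r 13 = B)
    (h14 : r 14 = W) (h15 : r 15 = 1) (h1 : r 1 = rep B p) (hW : 32 ≤ W) (hWB : W + n ≤ B)
    (hp : p + 2 * B + n + 2 < 2 ^ M) (hM : 2 * B + 2 ≤ M)
    (hbit : ∀ i < n, r (rep B (p + 1 + i)) ≤ rep B 1) :
    ∃ r', Frag.extract.Quiet r (200 * (n + 1) * (M + 1)) r' ∧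
      (∀ j, 10 ≤ j → (j < W ∨ W + n ≤ j) → r' j = r j) ∧
      ∀ i < n, r' (W + i) = r (rep B (p + 1 + i)) - B := by
  have hQ₁ := Frag.quiet_ops_bound [.const 2 0] (by simp [Instr.Writes]) r 1 (by simp [boundOps])
  obtain ⟨r₁, hr₁⟩ : ∃ r₁, r₁ = evalOps [.const 2 0] r := ⟨_, rfl⟩
  rw [← hr₁] at hQ₁
  have hF₁ : ∀ j, j ≠ 2 → r₁ j = r j := by
    intro j hj
    rw [hr₁]
    simp only [evalOps, Instr.eval, Function.update_apply, reduceIte, Nat.reduceEqDiff,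
      Nat.reduceLT, hj]
  have e2 : r₁ 2 = 0 := by rw [hr₁]; rfl
  have hrep : ∀ i, rep B (p + 1 + i) = p + B + 1 + i := by
    intro i; rw [rep, if_neg (by omega)]; ring
  have hc : ∀ a b, a + b < 2 ^ M → logCost a b ≤ 1 + M := by
    intro a b hab
    rcases Nat.eq_zero_or_pos (a + b) with h | h
    · simp [logCost, h]
    · have : Nat.log 2 (a + b) < M := Nat.log_lt_of_lt_pow (by omega) hab
      unfold logCost
      omega
  have hrp := rep_le B p
  have f1 : r₁ 1 = rep B p := by rw [hF₁ 1 (by omega), h1]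
  have f13 : r₁ 13 = B := by rw [hF₁ 13 (by omega), h13]
  have f14 : r₁ 14 = W := by rw [hF₁ 14 (by omega), h14]
  have f10 : r₁ 10 = n := by rw [hF₁ 10 (by omega), h10]
  have hQ₂ := (Frag.quiet_ops [.sub 1 1 13, .add 1 1 13, .const 2 1, .add 1 1 2, .copy 3 14,
    .copy 5 10, .copy 8 13] (by simp [Instr.Writes]) r₁).mono (t' := 10 * (M + 1)) (by
      simp only [costOps, Instr.cost, Instr.eval, Function.update_apply, reduceIte,
        Nat.reduceEqDiff, Nat.reduceLT, f1, f13, f14, f10, rep_sub]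
      have c1 := hc (rep B p) B (by omega)
      have c2 := hc p B (by omega)
      have c3 := hc (p + B) 1 (by omega)
      linarith)
  obtain ⟨r₂, hr₂⟩ : ∃ r₂, r₂ = evalOps [.sub 1 1 13, .add 1 1 13, .const 2 1, .add 1 1 2, .copy 3 14,
    .copy 5 10, .copy 8 13] r₁ := ⟨_, rfl⟩
  rw [← hr₂] at hQ₂
  have e3 : r₂ 1 = p + B + 1 ∧ r₂ 3 = W ∧ r₂ 5 = n ∧ r₂ 8 = B := by
    rw [hr₂]
    simp only [evalOps, Instr.eval, Function.update_apply, reduceIte, Nat.reduceEqDiff,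
      Nat.reduceLT, f1, f13, f14, f10, rep_sub, and_self]
  have hF₂ : ∀ j, 10 ≤ j → r₂ j = r j := by
    intro j hj
    rw [hr₂]
    simp only [evalOps, Instr.eval, Function.update_apply, reduceIte, Nat.reduceEqDiff,
      Nat.reduceLT, addr_ne hj]
    exact hF₁ j (by omega)
  obtain ⟨r₃, hQ₃, hF₃, hC⟩ := Frag.quiet_copySub r₂ M W (p + B + 1) n B e3.2.2.1 e3.1 e3.2.1 e3.2.2.2
    (by omega) (by omega) (by omega) (by omega) (by omega) (by omega) (fun i hi => by
      rw [hF₂ _ (by omega), ← hrep]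
      have := hbit i hi
      have := rep_le B 1
      omega)
  have h15' : r₁ 15 = 1 := by rw [hF₁ 15 (by omega), h15]
  refine ⟨r₃, (hQ₁.append (Frag.quiet_ifLt_true (by rw [e2, h15']; omega) (hQ₂.append hQ₃))).mono ?_,
    fun j hj hj' => by rw [hF₃ j hj hj', hF₂ j hj], fun i hi => by
      rw [hC i hi, hF₂ _ (by omega), hrep]⟩
  rw [e2, h15']
  nlinarith [Nat.zero_le (n * M)]

theorem add_lt_two_pow_add {x y X Y : ℕ} (hx : x < 2 ^ X) (hy : y ≤ Y) : x + y < 2 ^ (X + Y) := by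
  have h1 : y + 1 ≤ 2 ^ Y := Nat.lt_of_le_of_lt hy Nat.lt_two_pow_self
  rw [pow_add]
  calc x + y < (x + 1) * (y + 1) := by nlinarith [Nat.zero_le (x * y)]
    _ ≤ _ := Nat.mul_le_mul hx h1

theorem searchBy_time {v S B T n t M : ℕ} (hM : M = 2 * T + (S + 6 * (B + 1) ^ 2 + 1) + (4 * B + 4))
    (hn : n ≤ B) (ht : t ≤ 40 * (B + S + 1) * (T + 1) + 2) :
    20000 * (B + v + 1) ^ 4 + t + 200 * (n + 1) * (M + 1) ≤
      (20000 * (v + 1) ^ 4 + 10000 * (S + 1)) * (B + 1) ^ 4 * (T + 1 + 1) := by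
  obtain ⟨s, hs⟩ : ∃ s, s = (B + 1) ^ 2 := ⟨_, rfl⟩
  have hv4 : (B + v + 1) ^ 4 ≤ (v + 1) ^ 4 * (B + 1) ^ 4 := by
    rw [← mul_pow]; exact Nat.pow_le_pow_left (by nlinarith) 4
  have hB4 : B + 1 ≤ (B + 1) ^ 4 := Nat.le_self_pow (by norm_num) _
  have hB3 : (B + 1) ^ 3 ≤ (B + 1) ^ 4 := Nat.pow_le_pow_right (by omega) (by norm_num)
  have hBs : B + 1 ≤ s := by rw [hs]; exact Nat.le_self_pow two_ne_zero _
  have h1 : M + 1 ≤ (S + 20) * s * (T + 1 + 1) := by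
    have e1 : S ≤ S * s := Nat.le_mul_of_pos_right _ (by omega)
    have e2 : T ≤ s * T := Nat.le_mul_of_pos_left _ (by omega)
    rw [← hs] at hM
    have e3 : (S + 20) * s * (T + 1 + 1) = S * s * T + 20 * (s * T) + 2 * (S * s) + 40 * s := by ring
    rw [e3]
    have := Nat.zero_le (S * s * T)
    linarith
  have h2 : 200 * (n + 1) * (M + 1) ≤ 200 * (B + 1) * ((S + 20) * s * (T + 1 + 1)) :=
    Nat.mul_le_mul (by omega) h1
  have h3 : 200 * (B + 1) * ((S + 20) * s * (T + 1 + 1)) ≤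
      (200 * S + 4000) * (B + 1) ^ 4 * (T + 1 + 1) := by
    calc _ = (200 * S + 4000) * (B + 1) ^ 3 * (T + 1 + 1) := by rw [hs]; ring
      _ ≤ _ := Nat.mul_le_mul_right _ (Nat.mul_le_mul_left _ hB3)
  have h4 : t ≤ 50 * (S + 1) * (B + 1) ^ 4 * (T + 1 + 1) := by
    refine ht.trans ?_
    have h5 : B + S + 1 ≤ (S + 1) * (B + 1) ^ 4 := by nlinarith [Nat.mul_le_mul_left S hB4]
    have h6 : 40 * (B + S + 1) * (T + 1) ≤ 40 * ((S + 1) * (B + 1) ^ 4) * (T + 1) := by gcongr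
    have h7 : 0 ≤ (S + 1) * (B + 1) ^ 4 * T := Nat.zero_le _
    have h8 : 50 * (S + 1) * (B + 1) ^ 4 * (T + 1 + 1) = 50 * ((S + 1) * (B + 1) ^ 4 * T) +
      100 * ((S + 1) * (B + 1) ^ 4) := by ring
    have h9 : 1 ≤ (S + 1) * (B + 1) ^ 4 := by omega
    rw [h8]
    linarith
  have h5 : 20000 * (B + v + 1) ^ 4 ≤ 20000 * (v + 1) ^ 4 * (B + 1) ^ 4 * (T + 1 + 1) := by
    rw [mul_assoc 20000 ((v + 1) ^ 4)]
    refine (Nat.mul_le_mul_left 20000 hv4).trans (Nat.le_mul_of_pos_right _ (by omega))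
  refine (add_le_add (add_le_add h5 h4) (h2.trans h3)).trans ?_
  rw [← add_mul, ← add_mul, ← add_mul, ← add_mul]
  exact Nat.mul_le_mul_right _ (Nat.mul_le_mul_right _ (by omega))

/-- The fragment that finds a satisfying assignment with the help of the enumeration algorithm
`Q`. -/
def Frag.searchBy (v : ℕ) (Q : Program) : Frag := Frag.encode v ++ Frag.sim Q ++ Frag.extract

set_option maxHeartbeats 1000000 in
/-- The search takes about as long as `Q` does until its `k`-th output, where `k ≤ 2 ^ (u ρ) + 1`: that
output is the first nontrivial one or, if there is none, the last one. -/
theorem Frag.quiet_searchBy {q u v : ℕ} (hq : 2 ≤ q) (hv : 1 ≤ v) {Q : Program}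
    (hQ : Solves Q (padded q u v)) :
    ∃ c₀ : ℕ, ∀ (r : ℕ → ℕ) (n L m B W : ℕ), r 10 = n → r 11 = L → r 12 = m → r 13 = B → r 14 = W →
    32 ≤ L → L + 3 * m ≤ W → W + n ≤ B → (∀ j, B ≤ j → r j = 0) →
    (∀ k < 3 * m, r (L + k) < 2 * n) → (∀ i < n, r (W + i) = 0) →
    ∃ (x : Word q) (e : Config) (r' : ℕ → ℕ) (t k ρ : ℕ), HaltsWith Q (Word.code x) e ∧
      1 ≤ k ∧ k ≤ e.log.length ∧ k ≤ 2 ^ (u * ρ) + 1 ∧ v * ρ ≤ n + v ∧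
      x.length + 1 ≤ 6 * (B + 1) ^ 2 ∧
      (Frag.searchBy v Q).Quiet r t r' ∧ t ≤ c₀ * (B + 1) ^ 4 * (outTime e k + 2) ∧
      (∀ j, 10 ≤ j → j < B → (j < 15 ∨ 20 ≤ j) → (j < W ∨ W + n ≤ j) → r' j = r j) ∧
      ((r' 15 = 1 ∧ (∀ i < n, r' (W + i) ≤ 1) ∧
          SatBy m (fun k => r (L + k)) fun i => r' (W + i) ≠ 0) ∨
        (r' 15 = 0 ∧ ∀ p, ¬ SatBy m (fun k => r (L + k)) p)) := by
  obtain ⟨S', hS'⟩ := exists_argsLe Q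
  obtain ⟨S, hS1, hS⟩ : ∃ S, 1 ≤ S ∧ ∀ i ∈ Q, i.ArgsLe S :=
    ⟨S' + 1, by omega, fun i hi => (hS' i hi).mono (by omega)⟩
  refine ⟨20000 * (v + 1) ^ 4 + 10000 * (S + 1), fun r n L m B W h10 h11 h12 h13 h14 hL hLW hWB hz
    hlit hW0 => ?_⟩
  obtain ⟨l, hl⟩ : ∃ l : ℕ → ℕ, l = fun k => r (L + k) := ⟨_, rfl⟩
  have hl' : ∀ k, l k = r (L + k) := fun k => by rw [hl]
  obtain ⟨r₁, ρ, nums, hQ₁, hρ1, hρ2, hρ3, hnums, hlen, hF₁, h0, hE⟩ := Frag.quiet_encode v hv r n L m B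
    l h10 h11 h12 h13 hL (by omega) (by omega) hz (fun k _ => (hl' k).symm)
    (fun k hk => by rw [hl']; exact hlit k hk)
  obtain ⟨w, hw⟩ : ∃ w, w = ofRunLengths nums := ⟨_, rfl⟩
  rw [← hw] at hlen h0 hE
  have hnum : ∀ j, numAt w j = nums.getD j 0 := fun j => by rw [numAt, hw, runLengths_ofRunLengths]
  have hn0 : numAt w 0 = ρ := by rw [hnum, hnums]; rfl
  have hn1 : numAt w 1 = m := by rw [hnum, hnums]; rfl
  have hn2 : ∀ k < 3 * m, numAt w (2 + k) = r (L + k) := by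
    intro k hk
    rw [hnum, hnums, add_comm 2 k, List.getD_cons_succ, List.getD_cons_succ,
      List.getD_eq_getElem _ _ (by simpa using hk)]
    simp [hl]
  have hV : ValidFormula v w := by
    intro k hk
    rw [hn1] at hk
    rw [hn2 k hk, hn0]
    have := hlit k hk
    omega
  obtain ⟨x, hx⟩ := exists_code_eq (q := q) (0 :: w) (by
    intro a ha
    rcases List.mem_cons.1 ha with rfl | ha
    · omega
    · rw [hw] at ha
      have := ofRunLengths_lt_two _ a ha
      omega)
  have hxl : x.length = w.length + 1 := by
    have := congrArg List.length hx
    simpa [Word.code] using this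
  obtain ⟨e, ys, hHalt, hlog, hnd, hmem, hlast⟩ := hQ x
  have hmem' : ∀ y, y ∈ ys ↔ IsSolution u v w (Word.code y) := by
    intro y
    rw [hmem]
    change IsSolution u v (Word.code x).tail (Word.code y) ↔ _
    rw [hx, List.tail_cons]
  have hpre : ∀ g, g <+: e.log → NoHit g → g.length ≤ 2 ^ (u * ρ) := by
    intro g hg hn
    have := prefix_length_le hlog hnd (fun y hy => (hmem' y).1 hy) hg hn
    rwa [hn0] at this
  have hword : ∀ z ∈ e.log, ∃ y : Word q, Word.code y = z.1 ∧ IsSolution u v w (Word.code y) := by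
    intro z hz
    have : z.1 ∈ ys.map Word.code := by rw [← hlog]; exact List.mem_map_of_mem hz
    obtain ⟨y, hy, hyz⟩ := List.mem_map.1 this
    exact ⟨y, hyz, (hmem' y).1 hy⟩
  have hlogS : ∀ z ∈ e.log, ∃ a l, z.1 = a :: l ∧ a ≤ S := by
    intro z hz
    obtain ⟨y, hy, hs⟩ := hword z hz
    rw [hy] at hs
    rcases hz' : z.1 with _ | ⟨a, t⟩
    · rw [hz'] at hs
      rcases hs.2 with ⟨h, -⟩ | ⟨h, -⟩ <;> simp at h
    · refine ⟨a, t, rfl, ?_⟩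
      rw [hz'] at hs
      rcases hs.2 with ⟨-, h⟩ | ⟨-, h, -⟩ <;> simp at h <;> omega
  have hinit : ∀ i, r₁ (rep B i) = rep B ((init (Word.code x)).reg i) := by
    intro i
    rw [hx]
    rcases i with _ | _ | i
    · simp [rep, init, h0]
      ring
    · rw [rep, if_neg (by omega), hF₁ _ (by omega) (by omega), hz _ (by omega)]
      simp [init, rep]
    · rw [show rep B (i + 1 + 1) = B + 2 + i by rw [rep, if_neg (by omega)]; ring, hE,
        show i + 1 + 1 = 1 + (i + 1) by ring, init_reg_succ, List.getD_cons_succ]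
  obtain ⟨r₂, t₂, hQ₂, hF₂, hcase⟩ := Frag.quiet_sim hS (B := B) (by omega) hHalt hlogS r₁ hinit
    (by rw [hF₁ 13 (by omega) (by omega), h13])
  have hF₂' : ∀ j, 10 ≤ j → j < B → j ≠ 15 → r₂ j = r j := fun j h1 h2 h3 => by
    rw [hF₂ j h1 h2 h3, hF₁ j h1 (by omega)]
  have hB1 : 1 ≤ (B + 1) ^ 2 := Nat.one_le_pow _ _ (by omega)
  have hxB : x.length + 1 ≤ 6 * (B + 1) ^ 2 := by omega
  rcases hcase with ⟨h15, c, s, k, hR₁, hR₂, hins, hne, hnh, hr1, hrep, ht⟩ | ⟨h15, hnh, ht⟩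
  · have hstep : step Q c = some { c with
        pc := c.pc + 1
        time := c.time + 1
        log := c.log ++ [(block c.reg (c.reg s) (c.reg k), c.time + 1)] } := by
      simp [step, hins]
    have hpfx : c.log ++ [(block c.reg (c.reg s) (c.reg k), c.time + 1)] <+: e.log := by
      rcases Relation.ReflTransGen.cases_head hR₂ with h | ⟨c', h1, h2⟩
      · rw [h, hHalt.2] at hstep; cases hstep
      · have h3 : step Q c = some c' := h1
        rw [hstep, Option.some.injEq] at h3
        rw [← h3] at h2
        exact log_prefix_of_reaches h2
    obtain ⟨hot, hol⟩ := outTime_of_prefix hpfx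
    have hcl := hpre c.log ((List.prefix_append _ _).trans hpfx) hnh
    obtain ⟨y, hy, hsol⟩ := hword (block c.reg (c.reg s) (c.reg k), c.time + 1)
      (hpfx.subset (by simp))
    simp only at hy
    have hyl : 1 ≤ (Word.code y).length := by rcases hsol.2 with ⟨h, -⟩ | ⟨h, -⟩ <;> omega
    have hblk : ∀ j < (Word.code y).length, (Word.code y).getD j 0 = c.reg (c.reg s + j) := by
      intro j hj
      rw [List.getD_eq_getElem _ _ hj]
      simp only [hy, block, List.getElem_map, List.getElem_range', one_mul]
    have hy0 : (Word.code y).getD 0 0 ≠ 0 := by rw [hblk 0 (by omega)]; exact hne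
    obtain ⟨hbits, ⟨-, h⟩ | ⟨hlen', hy1, -, hsat⟩⟩ := hsol
    · exact absurd h hy0
    rw [hn0] at hlen'
    rw [hn1] at hsat
    have hval : ∀ i < n, r₂ (rep B (c.reg s + 1 + i)) = rep B ((Word.code y).getD (1 + i) 0) := by
      intro i hi
      rw [hrep, hblk (1 + i) (by omega), add_assoc]
    have hbit : ∀ i < n, (Word.code y).getD (1 + i) 0 ≤ 1 := by
      intro i hi
      have := hbits (1 + i) (by omega)
      omega
    -- The address of the output block must be bounded, since `extract` computes with it: a machine
    -- adds at most two binary digits to its numbers per unit of time.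
    obtain ⟨K, hK⟩ : ∃ K, K = S + 6 * (B + 1) ^ 2 + 1 := ⟨_, rfl⟩
    have hlt := reg_lt_of_reaches (K := K) hS ((show S ≤ K by omega).trans_lt Nat.lt_two_pow_self)
      (fun i => by
        refine (show (init (Word.code x)).reg i ≤ K from ?_).trans_lt Nat.lt_two_pow_self
        rw [hx]
        rcases i with _ | i
        · rw [init_reg_zero, List.length_cons]; omega
        · rw [add_comm, init_reg_succ]
          rcases Nat.lt_or_ge i (0 :: w).length with h | h
          · rw [List.getD_eq_getElem _ _ h]
            have h2 : ∀ a ∈ 0 :: w, a ≤ 1 := by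
              intro a ha
              rcases List.mem_cons.1 ha with rfl | ha
              · omega
              · rw [hw] at ha; have := ofRunLengths_lt_two _ _ ha; omega
            exact (h2 _ (List.getElem_mem h)).trans (by omega)
          · rw [List.getD_eq_default _ _ h]; omega) hR₁ s
    obtain ⟨M, hM⟩ : ∃ M, M = 2 * c.time + K + (4 * B + 4) := ⟨_, rfl⟩
    have hp : c.reg s + 2 * B + n + 2 < 2 ^ M := by
      rw [hM, add_assoc, add_assoc]
      exact add_lt_two_pow_add hlt (by omega)
    obtain ⟨r₃, hQ₃, hF₃, hW₃⟩ := Frag.quiet_extract r₂ n B W M (c.reg s)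
      (by rw [hF₂' 10 (by omega) (by omega) (by omega), h10])
      (by rw [hF₂' 13 (by omega) (by omega) (by omega), h13])
      (by rw [hF₂' 14 (by omega) (by omega) (by omega), h14]) h15 hr1 (by omega) (by omega) hp
      (by omega) (fun i hi => by
        rw [hval i hi]
        have := hbit i hi
        rw [← not_lt, rep_lt]
        omega)
    have hW₃' : ∀ i < n, r₃ (W + i) = (Word.code y).getD (1 + i) 0 := by
      intro i hi
      rw [hW₃ i hi, hval i hi, rep_sub]
    refine ⟨x, e, r₃, _, c.log.length + 1, ρ, hHalt, by omega, hol, by omega, hρ3, hxB,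
      (hQ₁.append hQ₂).append hQ₃, ?_, ?_, Or.inl ⟨?_, ?_, ?_⟩⟩
    · rw [hot]
      refine (searchBy_time (by rw [hM, hK]) (by omega) ht).trans (Nat.mul_le_mul_left _ (by omega))
    · intro j hj hjB hj' hjW
      rw [hF₃ j hj hjW, hF₂' j hj hjB (by omega)]
    · rw [hF₃ 15 (by omega) (by omega), h15]
    · intro i hi
      rw [hW₃' i hi]
      exact hbit i hi
    · refine (satBy_congr (n := n) (fun k hk => by rw [hn2 k hk]; exact hlit k hk) hn2
        fun i hi => ?_).1 hsat
      rw [hW₃' i hi]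
  · have hQ₃ : Frag.extract.Quiet r₂ 3 (evalOps [.const 2 0] r₂) := by
      refine ((Frag.quiet_ops_bound [.const 2 0] (by simp [Instr.Writes]) r₂ 1
        (by simp [boundOps])).append (Frag.quiet_ifLt_false ?_
        (Frag.quiet_ops_bound [] (by simp) _ 0 le_rfl))).mono ?_
      · simp [evalOps, Instr.eval, h15]
      · simp [evalOps, Instr.eval, h15]
    have hF₃ : ∀ j, 10 ≤ j → evalOps [.const 2 0] r₂ j = r₂ j := by
      intro j hj
      simp only [evalOps, Instr.eval, Function.update_apply, reduceIte, Nat.reduceEqDiff,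
        Nat.reduceLT, addr_ne hj]
    have hallz : ∀ y : Word q, IsSolution u v w (Word.code y) → (Word.code y).getD 0 0 = 0 := by
      intro y hy
      have h1 : Word.code y ∈ e.log.map Prod.fst := by
        rw [hlog]; exact List.mem_map_of_mem ((hmem' y).2 hy)
      obtain ⟨z, hz, hzy⟩ := List.mem_map.1 h1
      obtain ⟨l, hl⟩ := hnh z hz
      rw [← hzy, hl]
      rfl
    have hunsat := not_satBy_of_trivial hq hV hallz
    -- There is always a trivial solution, so the time of the last output is the running time.
    have hpos : 1 ≤ e.log.length := by
      obtain ⟨y, hy⟩ := exists_code_eq (q := q) (List.replicate (u * ρ + 1) 0) (by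
        intro a ha
        rw [List.mem_replicate] at ha
        omega)
      have h1 : y ∈ ys := by
        rw [hmem', hy]
        refine ⟨fun i hi => ?_, Or.inl ⟨by rw [hn0]; simp, by simp⟩⟩
        rw [List.getD_eq_getElem _ _ hi, List.getElem_replicate]
        omega
      have h2 := congrArg List.length hlog
      simp only [List.length_map] at h2
      rw [h2]
      exact List.length_pos_of_mem h1
    refine ⟨x, e, _, _, e.log.length, ρ, hHalt, hpos, le_rfl, (hpre _ List.prefix_rfl hnh).trans
      (by omega), hρ3, hxB, (hQ₁.append hQ₂).append hQ₃, ?_, ?_, Or.inr ⟨?_, ?_⟩⟩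
    · rw [outTime_length hlast]
      refine (Nat.add_le_add_left (show 3 ≤ 200 * (0 + 1) * (2 * e.time + (S + 6 * (B + 1) ^ 2 + 1) +
        (4 * B + 4) + 1) by omega) _).trans (searchBy_time rfl (by omega) ht)
    · intro j hj hjB hj' hjW
      rw [hF₃ j hj, hF₂' j hj hjB (by omega)]
    · rw [hF₃ 15 (by omega), h15]
    · intro p hp
      refine hunsat p ?_
      rw [hn1]
      exact (satBy_congr hlit (fun k hk => (hn2 k hk).symm) fun i hi => Iff.rfl).1 hp

/-- An incremental algorithm of exponent `a` for the padded problem yields a search algorithm. -/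
theorem search_of_mem_incP {q u v : ℕ} (hq : 2 ≤ q) (hv : 1 ≤ v) {a : ℝ} (ha : 0 ≤ a)
    (h : padded q u v ∈ IncP q a) : Search (a * u / v) := by
  obtain ⟨-, Q, p, C, b, hQ, hT⟩ := h
  obtain ⟨c₀, hF⟩ := Frag.quiet_searchBy hq hv hQ
  obtain ⟨D, d, hD⟩ := exists_eval_le p
  obtain ⟨Z, hZ⟩ := exists_nat_ge ((2 : ℝ) ^ a * 2 ^ (a * u))
  refine ⟨Frag.searchBy v Q, c₀ * (D * 6 ^ d + C * Z * 6 ^ b + 2), 4 + 2 * d + 2 * b, ?_⟩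
  intro r n L m B W h10 h11 h12 h13 h14 hL hLW hWB hz hlit hW0
  obtain ⟨x, e, r', t, k, ρ, hHalt, hk1, hk2, hk, hρ, hx, hQt, ht, hfr, hres⟩ := hF r n L m B W h10 h11
    h12 h13 h14 hL hLW hWB hz hlit hW0
  refine ⟨r', t, hQt, ?_, hfr, hres⟩
  obtain ⟨hT1, hT2⟩ := hT x e hHalt
  have hT3 := hT2 k hk1 hk2
  have hv0 : (0 : ℝ) < v := by exact_mod_cast hv
  obtain ⟨s, hs⟩ : ∃ s : ℝ, s = (B : ℝ) + 1 := ⟨_, rfl⟩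
  have hs1 : 1 ≤ s := by rw [hs]; linarith [Nat.cast_nonneg (α := ℝ) B]
  obtain ⟨E, hE⟩ : ∃ E : ℝ, E = 2 ^ (a * u / v * n) := ⟨_, rfl⟩
  have hE1 : 1 ≤ E := by rw [hE]; exact Real.one_le_rpow (by norm_num) (by positivity)
  -- The rounding of `n` up to a multiple of `v` costs only the constant factor `2 ^ (a u)`.
  have hka : (k : ℝ) ^ a ≤ Z * E := by
    have h1 : (k : ℝ) ≤ 2 * 2 ^ ((u * ρ : ℕ) : ℝ) := by
      rw [Real.rpow_natCast]
      have : k ≤ 2 * 2 ^ (u * ρ) := by have := Nat.one_le_two_pow (n := u * ρ); omega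
      exact_mod_cast this
    have h2 : (ρ : ℝ) ≤ n / v + 1 := by
      rw [← sub_le_iff_le_add, le_div_iff₀ hv0]
      have : (v : ℝ) * ρ ≤ n + v := by exact_mod_cast hρ
      linarith
    calc (k : ℝ) ^ a ≤ (2 * 2 ^ ((u * ρ : ℕ) : ℝ)) ^ a := Real.rpow_le_rpow (by positivity) h1 ha
      _ = 2 ^ a * 2 ^ (a * u * ρ) := by
          rw [Real.mul_rpow (by norm_num) (by positivity), ← Real.rpow_mul (by norm_num)]
          rw [show ((u * ρ : ℕ) : ℝ) * a = a * u * ρ by push_cast; ring]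
      _ ≤ 2 ^ a * 2 ^ (a * u * (n / v + 1)) := by gcongr; norm_num
      _ = 2 ^ a * 2 ^ (a * u) * E := by
          rw [show a * u * (n / v + 1) = a * u + a * u / v * n by ring,
            Real.rpow_add (by norm_num), hE, mul_assoc]
      _ ≤ Z * E := by gcongr
  have hxs : (x.length : ℝ) + 1 ≤ 6 * s ^ 2 := by rw [hs]; exact_mod_cast hx
  have hp : (outTime e 1 : ℝ) ≤ D * (6 * s ^ 2) ^ d := by
    have h1 : (outTime e 1 : ℝ) ≤ D * ((x.length : ℝ) + 1) ^ d := by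
      exact_mod_cast hT1.trans (hD _)
    exact h1.trans (by gcongr)
  have ho : (outTime e k : ℝ) + 2 ≤ (D * 6 ^ d + C * Z * 6 ^ b + 2) * E * s ^ (2 * d + 2 * b) := by
    have h1 : (C : ℝ) * (k : ℝ) ^ a * ((x.length : ℝ) + 1) ^ b ≤ C * (Z * E) * (6 * s ^ 2) ^ b := by
      gcongr
    have h2 : s ^ (2 * d) ≤ s ^ (2 * d + 2 * b) := pow_le_pow_right₀ hs1 (by omega)
    have h3 : s ^ (2 * b) ≤ s ^ (2 * d + 2 * b) := pow_le_pow_right₀ hs1 (by omega)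
    have h4 : 1 ≤ s ^ (2 * d + 2 * b) := one_le_pow₀ hs1
    calc (outTime e k : ℝ) + 2 ≤ D * (6 * s ^ 2) ^ d + C * (Z * E) * (6 * s ^ 2) ^ b + 2 := by linarith
      _ = D * 6 ^ d * 1 * s ^ (2 * d) + C * Z * 6 ^ b * E * s ^ (2 * b) + 2 * 1 * 1 := by
          rw [mul_pow, mul_pow, ← pow_mul, ← pow_mul]; ring
      _ ≤ D * 6 ^ d * E * s ^ (2 * d + 2 * b) + C * Z * 6 ^ b * E * s ^ (2 * d + 2 * b) +
          2 * E * s ^ (2 * d + 2 * b) := by gcongr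
      _ = _ := by ring
  have ht' : (t : ℝ) ≤ c₀ * s ^ 4 * (outTime e k + 2) := by rw [hs]; exact_mod_cast ht
  rw [← hE, ← hs]
  push_cast
  calc (t : ℝ) ≤ c₀ * s ^ 4 * (outTime e k + 2) := ht'
    _ ≤ c₀ * s ^ 4 * ((D * 6 ^ d + C * Z * 6 ^ b + 2) * E * s ^ (2 * d + 2 * b)) := by gcongr
    _ = _ := by rw [show 4 + 2 * d + 2 * b = 4 + (2 * d + 2 * b) by ring, pow_add]; ring

/-! ### Counting and output -/

/-- The `n` lowest binary digits of `k`, the lowest one first. -/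
def bits (n k : ℕ) : List ℕ := (List.range n).map fun i => k / 2 ^ i % 2

theorem length_bits (n k : ℕ) : (bits n k).length = n := by simp [bits]

theorem bits_lt (n k : ℕ) : ∀ a ∈ bits n k, a < 2 := by
  intro a ha
  simp only [bits, List.mem_map] at ha
  obtain ⟨i, -, rfl⟩ := ha
  exact Nat.mod_lt _ (by norm_num)

theorem binVal_bits (n : ℕ) : ∀ k < 2 ^ n, binVal (fun i => k / 2 ^ i % 2) n = k := by
  induction n with
  | zero => intro k hk; simp at hk; simp [binVal, hk]
  | succ n ih =>
    intro k hk
    have h := ih (k / 2) (by rw [pow_succ] at hk; omega)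
    unfold binVal at h ⊢
    rw [Finset.sum_range_succ']
    have h2 : ∀ i, k / 2 ^ (i + 1) % 2 * 2 ^ (i + 1) = 2 * (k / 2 / 2 ^ i % 2 * 2 ^ i) := by
      intro i
      rw [pow_succ' 2 i, ← Nat.div_div_eq_div_mul]
      ring
    simp only [h2, ← Finset.mul_sum, h, pow_zero, Nat.div_one, mul_one]
    omega

theorem map_eq_bits {f : ℕ → ℕ} {n k : ℕ} (hf : ∀ i < n, f i ≤ 1) (h : binVal f n = k) :
    (List.range n).map f = bits n k := by
  have hk : k < 2 ^ n := h ▸ binVal_lt hf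
  have := binVal_inj hf (g := fun i => k / 2 ^ i % 2)
    (fun i _ => by have := Nat.mod_lt (k / 2 ^ i) (y := 2) (by norm_num); omega)
    (h.trans (binVal_bits n k hk).symm)
  exact List.map_congr_left fun i hi => this i (List.mem_range.1 hi)

theorem bits_inj {n k k' : ℕ} (hk : k < 2 ^ n) (hk' : k' < 2 ^ n) (h : bits n k = bits n k') :
    k = k' := by
  rw [← binVal_bits n k hk, ← binVal_bits n k' hk']
  refine Finset.sum_congr rfl fun i hi => ?_
  have := List.map_inj_left.1 h i (by simpa using hi)
  exact congrArg (· * 2 ^ i) this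

/-- The fragment that outputs a block. -/
def Frag.output (s t : ℕ) : Frag := ⟨1, fun _ => [.output s t], fun _ => rfl⟩

theorem Frag.exec_output (s t : ℕ) (σ : Store) :
    (Frag.output s t).Exec σ ⟨σ.reg, σ.time + 1,
      σ.log ++ [(block σ.reg (σ.reg s) (σ.reg t), σ.time + 1)]⟩ := by
  intro P o h
  refine Relation.ReflTransGen.single ?_
  have := CodeAt.head (l := []) h
  simp [step, Store.config, this, Frag.output]

/-- Let the counter in the registers that `R_17` and `R_18` describe run; the fragment `G` is executed
before each increment. The register `fl` is the overflow flag, and `R_30 = 1`. -/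
def Frag.counterLoop (fl : ℕ) (G : Frag) : Frag :=
  Frag.whileLt fl 30 (G ++ Frag.inc ++ Frag.ops [.copy fl 6])

/-- The rule for `Frag.counterLoop`, where the counter has `n` digits from `A` on. `Inv k` holds when
the counter shows `k` and the round for `k` is about to start; the premise `hG` describes one round
up to the increment, whose effect is the change from `σ'.reg` to `r`. Up to `5` units of time are
left for the jumps and comparisons of the loop. -/
theorem Frag.exec_counterLoop {fl : ℕ} {G : Frag} {n A M : ℕ} (hflA : fl < A) (hA : 32 ≤ A)
    (hM : A + n ≤ M)
    (Inv : ℕ → Store → Prop) (h30 : ∀ k σ, Inv k σ → σ.reg 30 = 1)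
    (hG : ∀ k σ, k < 2 ^ n → Inv k σ → ∀ δ ≤ 5, ∃ σ' : Store, G.Exec (σ.tick δ) σ' ∧
      σ'.reg 17 = A ∧ σ'.reg 18 = n ∧ (∀ i < n, σ'.reg (A + i) ≤ 1) ∧
      binVal (fun i => σ'.reg (A + i)) n = k ∧
      ∀ r t, (∀ j, 10 ≤ j → j ≠ fl → (j < A ∨ A + n ≤ j) → r j = σ'.reg j) →
        t ≤ 100 * (M + 1) ^ 2 + 1 → (∀ i < n, r (A + i) ≤ 1) →
        binVal (fun i => r (A + i)) n = (k + 1) % 2 ^ n →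
        Inv (k + 1) ⟨r, σ'.time + t, σ'.log⟩)
    (k₀ : ℕ) (hk₀ : k₀ ≤ 2 ^ n) (σ : Store) (hσ : Inv k₀ σ)
    (hσf : σ.reg fl = if k₀ < 2 ^ n then 0 else 1) :
    ∃ σ', Inv (2 ^ n) σ' ∧ ∃ δ ≤ 5, (Frag.counterLoop fl G).Exec σ (σ'.tick δ) := by
  obtain ⟨k, σ', ⟨hkn, σ₁, δ, hδ, hI, rfl, hf⟩, hlt, hE⟩ := Frag.exec_whileLt (s := fl) (t := 30)
    (F := G ++ Frag.inc ++ Frag.ops [.copy fl 6]) (2 ^ n)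
    (fun k σ => k₀ + k ≤ 2 ^ n ∧ ∃ σ₁ δ, δ ≤ 1 ∧ Inv (k₀ + k) σ₁ ∧ σ = σ₁.tick δ ∧
      σ₁.reg fl = if k₀ + k < 2 ^ n then 0 else 1)
    (by
      rintro k σ ⟨hk, σ₁, δ, hδ, hI, rfl, hf⟩ hlt
      have h1 := h30 _ _ hI
      simp only [Store.tick] at hlt
      rw [h1, hf] at hlt
      split at hlt <;> omega)
    (by
      rintro k σ ⟨hk, σ₁, δ, hδ, hI, rfl, hf⟩ hlt
      have h1 := h30 _ _ hI
      simp only [Store.tick] at hlt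
      rw [h1, hf] at hlt
      have hkn : k₀ + k < 2 ^ n := by
        by_contra hc
        rw [if_neg hc] at hlt
        omega
      rw [if_pos hkn] at hf
      have hc := logCost_le ((σ₁.tick δ).reg fl) ((σ₁.tick δ).reg 30)
      simp only [Store.tick, hf, h1] at hc
      obtain ⟨σ₂, hE, h17, h18, hb, hv, hnext⟩ := hG _ _ hkn hI (δ + logCost 0 1) (by omega)
      obtain ⟨r₃, hQ₃, hF₃, hb₃, h6, hv₃⟩ := Frag.quiet_inc σ₂.reg M A n h17 h18 (by omega) hM hb
      have hQ₄ := Frag.quiet_ops_bound [.copy fl 6] (by simp [Instr.Writes]) r₃ 1 (by simp [boundOps])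
      obtain ⟨t, ht, hE'⟩ := (hQ₃.append hQ₄).exec (σ := σ₂) rfl
      have hF₄ : ∀ j, j ≠ fl → evalOps [.copy fl 6] r₃ j = r₃ j := by
        intro j hj
        simp only [evalOps, Instr.eval, Function.update_apply, reduceIte, Nat.reduceEqDiff,
          Nat.reduceLT, hj]
      have hb₄ : ∀ i < n, evalOps [.copy fl 6] r₃ (A + i) ≤ 1 := fun i hi => by
        rw [hF₄ _ (by omega)]; exact hb₃ i hi
      have hv₄ : binVal (fun i => evalOps [.copy fl 6] r₃ (A + i)) n =
          binVal (fun i => r₃ (A + i)) n :=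
        Finset.sum_congr rfl fun i _ => by simp only; rw [hF₄ _ (by omega)]
      have hlt₃ := binVal_lt hb₃
      -- The counter overflows exactly in the last round, when it returns to `0`.
      have hcase : r₃ 6 = (if k₀ + k + 1 < 2 ^ n then 0 else 1) ∧
          binVal (fun i => r₃ (A + i)) n = (k₀ + k + 1) % 2 ^ n := by
        rw [hv] at hv₃
        rcases Nat.le_one_iff_eq_zero_or_eq_one.1 h6 with h6 | h6
        · rw [h6] at hv₃ ⊢
          have : k₀ + k + 1 < 2 ^ n := by omega
          rw [if_pos this, Nat.mod_eq_of_lt this]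
          omega
        · rw [h6] at hv₃ ⊢
          have h2 : k₀ + k + 1 = 2 ^ n := by omega
          rw [h2, if_neg (by omega), Nat.mod_self]
          omega
      refine ⟨_, ?_, by omega, _, 0, by omega, hnext (evalOps [.copy fl 6] r₃) t
        (fun j hj hj' hjA => by rw [hF₄ j hj', hF₃ j hj hjA]) ht hb₄ (by rw [hv₄, hcase.2]), rfl, ?_⟩
      · have h3 : (Store.tick (σ₁.tick δ) (logCost ((σ₁.tick δ).reg fl) ((σ₁.tick δ).reg 30))) =
            σ₁.tick (δ + logCost 0 1) := by
          simp only [Store.tick, hf, h1, add_assoc]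
        rw [h3]
        have h5 := hE.append hE'
        intro P o hP
        have h6 := h5 P o (by
          change CodeAt P o (G.code o ++ (Frag.inc.code (o + G.len) ++ _))
          rw [← List.append_assoc]
          have : CodeAt P o ((G.code o ++ Frag.inc.code (o + G.len)) ++
            (Frag.ops [.copy fl 6]).code (o + (G.len + Frag.inc.len))) := hP
          exact this)
        have h7 : o + (G ++ Frag.inc ++ Frag.ops [.copy fl 6]).len =
            o + (G ++ (Frag.inc ++ Frag.ops [.copy fl 6])).len := by
          change o + (G.len + Frag.inc.len + (Frag.ops [.copy fl 6]).len) =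
            o + (G.len + (Frag.inc.len + (Frag.ops [.copy fl 6]).len))
          ring
        rw [h7]
        exact h6
      · change evalOps [.copy fl 6] r₃ fl = _
        rw [← add_assoc, ← hcase.1]
        simp [evalOps, Instr.eval]) σ
    ⟨hk₀, σ, 1, le_rfl, hσ, rfl, hσf⟩
  have h1 := h30 _ _ hI
  have hk : k₀ + k = 2 ^ n := by
    by_contra hc
    rw [if_pos (by omega)] at hf
    simp only [Store.tick, hf, h1] at hlt
    omega
  rw [hk] at hI hf
  rw [if_neg (by omega)] at hf
  refine ⟨σ₁, hI, δ + logCost 1 1, ?_, ?_⟩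
  · have := logCost_le 1 1
    omega
  · have h3 : (Store.tick (σ₁.tick δ) (logCost ((σ₁.tick δ).reg fl) ((σ₁.tick δ).reg 30))) =
        σ₁.tick (δ + logCost 1 1) := by
      simp only [Store.tick, hf, h1, add_assoc]
    rw [← h3]
    exact hE

/-- The entry with number `i` of the log is made at time `β i` or earlier. -/
def TimedLog (β : ℕ → ℕ) (g : List (List ℕ × ℕ)) : Prop :=
  ∀ i (h : i < g.length), (g[i]).2 ≤ β i

theorem TimedLog.append {β β' : ℕ → ℕ} {g g' : List (List ℕ × ℕ)} (h : TimedLog β g)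
    (h' : TimedLog β' g') (hβ : ∀ i < g'.length, β' i ≤ β (g.length + i)) :
    TimedLog β (g ++ g') := by
  intro i hi
  rcases Nat.lt_or_ge i g.length with h1 | h1
  · rw [List.getElem_append_left h1]
    exact h i h1
  · rw [List.getElem_append_right h1]
    rw [List.length_append] at hi
    refine (h' _ (by omega)).trans ((hβ _ (by omega)).trans_eq ?_)
    rw [Nat.add_sub_cancel' h1]

theorem TimedLog.mono {β β' : ℕ → ℕ} {g : List (List ℕ × ℕ)} (h : TimedLog β g)
    (hβ : ∀ i, β i ≤ β' i) : TimedLog β' g := fun i hi => (h i hi).trans (hβ i)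

theorem timedLog_singleton {β : ℕ → ℕ} {w : List ℕ} {t : ℕ} (h : t ≤ β 0) :
    TimedLog β [(w, t)] := by
  intro i hi
  simp only [List.length_singleton, Nat.lt_one_iff] at hi
  subst hi
  exact h

/-- Output the block between the positions in `s` and `t` for all values of the counter that starts
at the position in `a` and has as many digits as the number in `b`. -/
def Frag.outputLoop (fl s t a b : ℕ) : Frag :=
  Frag.counterLoop fl (Frag.output s t ++ Frag.ops [.copy 17 a, .copy 18 b])

/-- The words that are output consist of the `p` registers from `X` on, which do not change, and the
digits of the counter, which runs from `k₀` to `2 ^ n - 1`. -/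
theorem Frag.exec_outputLoop {fl s t a b X p n M k₀ : ℕ} (σ : Store) (hfl : 19 ≤ fl ∧ fl ≤ 31)
    (hs : 10 ≤ s ∧ s < 32 ∧ s ≠ 17 ∧ s ≠ 18 ∧ s ≠ fl) (ht : 10 ≤ t ∧ t < 32 ∧ t ≠ 17 ∧ t ≠ 18 ∧ t ≠ fl)
    (ha : 10 ≤ a ∧ a < 32 ∧ a ≠ 17 ∧ a ≠ 18 ∧ a ≠ fl) (hb : 10 ≤ b ∧ b < 32 ∧ b ≠ 17 ∧ b ≠ 18 ∧ b ≠ fl)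
    (hfl3 : fl ≠ 30) (es : σ.reg s = X) (et : σ.reg t + 1 = X + p + n) (ea : σ.reg a = X + p)
    (eb : σ.reg b = n) (e30 : σ.reg 30 = 1) (hX : 32 ≤ X) (hM : X + p + n ≤ M) (hk₀ : k₀ ≤ 2 ^ n)
    (efl : σ.reg fl = if k₀ < 2 ^ n then 0 else 1) (hbit : ∀ i < n, σ.reg (X + p + i) ≤ 1)
    (hval : binVal (fun i => σ.reg (X + p + i)) n = k₀ % 2 ^ n) :
    ∃ (σ' : Store) (g : List (List ℕ × ℕ)), (Frag.outputLoop fl s t a b).Exec σ σ' ∧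
      (∀ j, 10 ≤ j → j ≠ 17 → j ≠ 18 → j ≠ fl → (j < X + p ∨ X + p + n ≤ j) →
        σ'.reg j = σ.reg j) ∧
      (∀ i < n, σ'.reg (X + p + i) = 0) ∧ σ'.log = σ.log ++ g ∧
      g.map Prod.fst = (List.range' k₀ (2 ^ n - k₀)).map
        (fun k => (List.range p).map (fun i => σ.reg (X + i)) ++ bits n k) ∧
      TimedLog (fun i => σ.time + 200 * (M + 1) ^ 2 * (i + 1)) g ∧
      σ'.time ≤ σ.time + 200 * (M + 1) ^ 2 * (2 ^ n - k₀ + 1) := by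
  obtain ⟨τ, hτ⟩ : ∃ τ, τ = 200 * (M + 1) ^ 2 := ⟨_, rfl⟩
  have hM2 : M + 1 ≤ (M + 1) ^ 2 := Nat.le_self_pow two_ne_zero _
  obtain ⟨σ₁, ⟨hk₁, e30', hF, hb₁, hv, g, hlog, hwords, htl, htime⟩, δ, hδ, hE⟩ :=
    Frag.exec_counterLoop (fl := fl)
    (G := Frag.output s t ++ Frag.ops [.copy 17 a, .copy 18 b]) (n := n) (A := X + p) (M := M)
    (by omega) (by omega) (by omega)
    (fun k σ₁ => k₀ ≤ k ∧ σ₁.reg 30 = 1 ∧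
      (∀ j, 10 ≤ j → j ≠ 17 → j ≠ 18 → j ≠ fl → (j < X + p ∨ X + p + n ≤ j) → σ₁.reg j = σ.reg j) ∧
      (∀ i < n, σ₁.reg (X + p + i) ≤ 1) ∧ binVal (fun i => σ₁.reg (X + p + i)) n = k % 2 ^ n ∧
      ∃ g, σ₁.log = σ.log ++ g ∧ g.map Prod.fst = (List.range' k₀ (k - k₀)).map
        (fun k => (List.range p).map (fun i => σ.reg (X + i)) ++ bits n k) ∧
      TimedLog (fun i => σ.time + τ * (i + 1)) g ∧ σ₁.time ≤ σ.time + τ * (k - k₀))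
    (fun k σ₁ h => h.2.1)
    (by
      rintro k σ₁ hk ⟨hk₁, e30', hF, hb₁, hv, g, hlog, hwords, htl, htime⟩ δ hδ
      have f : ∀ j, 10 ≤ j → j < 32 → j ≠ 17 → j ≠ 18 → j ≠ fl → σ₁.reg j = σ.reg j :=
        fun j h1 h2 h3 h4 h5 => hF j h1 h3 h4 h5 (by omega)
      have hsa := f s hs.1 hs.2.1 hs.2.2.1 hs.2.2.2.1 hs.2.2.2.2
      have hta := f t ht.1 ht.2.1 ht.2.2.1 ht.2.2.2.1 ht.2.2.2.2
      have haa := f a ha.1 ha.2.1 ha.2.2.1 ha.2.2.2.1 ha.2.2.2.2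
      have hba := f b hb.1 hb.2.1 hb.2.2.1 hb.2.2.2.1 hb.2.2.2.2
      have hE₁ := Frag.exec_output s t (σ₁.tick δ)
      have hQ := Frag.quiet_ops_bound [.copy 17 a, .copy 18 b] (by simp [Instr.Writes]) σ₁.reg 2
        (by simp [boundOps])
      obtain ⟨t₂, ht₂, hE₂⟩ := hQ.exec (σ := ⟨σ₁.reg, (σ₁.tick δ).time + 1,
        σ₁.log ++ [(block σ₁.reg (σ₁.reg s) (σ₁.reg t), (σ₁.tick δ).time + 1)]⟩) rfl
      have hblk : block σ₁.reg (σ₁.reg s) (σ₁.reg t) =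
          (List.range p).map (fun i => σ.reg (X + i)) ++ bits n k := by
        rw [block, hsa, hta, es, show σ.reg t + 1 - X = p + n by omega, List.range'_eq_map_range,
          List.map_map, List.range_add, List.map_append, List.map_map]
        congr 1
        · refine List.map_congr_left fun i hi => ?_
          have := List.mem_range.1 hi
          exact hF (X + i) (by omega) (by omega) (by omega) (by omega) (by omega)
        · rw [Nat.mod_eq_of_lt hk] at hv
          rw [← map_eq_bits hb₁ hv]
          refine List.map_congr_left fun i _ => ?_
          simp [add_assoc]
      have e17 : evalOps [.copy 17 a, .copy 18 b] σ₁.reg 17 = X + p := by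
        simp only [evalOps, Instr.eval, Function.update_apply, reduceIte, Nat.reduceEqDiff,
          Nat.reduceLT, haa, ea]
      have e18 : evalOps [.copy 17 a, .copy 18 b] σ₁.reg 18 = n := by
        simp only [evalOps, Instr.eval, Function.update_apply, reduceIte, Nat.reduceEqDiff,
          Nat.reduceLT, hb.2.2.1, hba, eb]
      have hF₂ : ∀ j, j ≠ 17 → j ≠ 18 → evalOps [.copy 17 a, .copy 18 b] σ₁.reg j = σ₁.reg j := by
        intro j h1 h2
        simp only [evalOps, Instr.eval, Function.update_apply, reduceIte, Nat.reduceEqDiff,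
          Nat.reduceLT, h1, h2]
      refine ⟨_, hE₁.append hE₂, e17, e18, fun i hi => by
        simp only; rw [hF₂ _ (by omega) (by omega)]; exact hb₁ i hi, ?_, ?_⟩
      · rw [Nat.mod_eq_of_lt hk] at hv
        rw [← hv]
        exact Finset.sum_congr rfl fun i _ => by simp only; rw [hF₂ _ (by omega) (by omega)]
      · intro r t' hr ht' hb' hv'
        have hkk : k + 1 - k₀ = k - k₀ + 1 := by omega
        have hgl : g.length = k - k₀ := by
          have := congrArg List.length hwords
          simpa using this
        have hbound : σ₁.time + δ + 1 ≤ σ.time + τ * (k - k₀ + 1) := by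
          rw [mul_add]; omega
        refine ⟨by omega, ?_, ?_, hb', hv', g ++ [(block σ₁.reg (σ₁.reg s) (σ₁.reg t),
          (σ₁.tick δ).time + 1)], ?_, ?_, ?_, ?_⟩
        · exact (hr 30 (by omega) hfl3.symm (by omega)).trans ((hF₂ 30 (by omega) (by omega)).trans e30')
        · intro j h1 h2 h3 h4 h5
          exact (hr j h1 h4 h5).trans ((hF₂ j h2 h3).trans (hF j h1 h2 h3 h4 h5))
        · simp only [hlog, List.append_assoc]
        · rw [List.map_append, hwords, hkk, List.range'_concat, List.map_append]
          simp only [List.map_cons, List.map_nil, hblk, one_mul, Nat.add_sub_cancel' hk₁]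
        · refine htl.append (timedLog_singleton (β := fun _ => σ.time + τ * (k - k₀ + 1)) hbound)
            fun i hi => ?_
          simp only [List.length_singleton, Nat.lt_one_iff] at hi
          rw [hi, hgl, add_zero]
        · rw [hkk, mul_add]
          simp only [Store.tick] at ht₂ ⊢
          omega)
    k₀ hk₀ σ ⟨le_rfl, e30, fun _ _ _ _ _ _ => rfl, hbit, hval, [], by simp, by simp,
      fun i hi => by simp at hi, by simp⟩ efl
  rw [← hτ]
  refine ⟨σ₁.tick δ, g, hE, hF, fun i hi => ?_, hlog, hwords, htl, ?_⟩
  · refine binVal_inj (g := fun _ => 0) hb₁ (fun _ _ => by omega) ?_ i hi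
    rw [hv, Nat.mod_self, binVal_eq_zero fun _ _ => rfl]
  · rw [mul_add]
    simp only [Store.tick]
    omega

/-! ### Listing the satisfying assignments -/

/-- The assignment that differs from `V` at the digits `1` of `j`. -/
def flipBits (V : ℕ → ℕ) (j i : ℕ) : ℕ := V i - j / 2 ^ i % 2 + (j / 2 ^ i % 2 - V i)

open Classical in
/-- The nontrivial solutions whose first half is the assignment `flipBits V j`, if it satisfies the
formula. -/
noncomputable def solutionsAt (n m : ℕ) (l V : ℕ → ℕ) (j : ℕ) : List (List ℕ) :=
  if SatBy m l (fun i => flipBits V j i ≠ 0) then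
    (List.range' 0 (2 ^ n - 0)).map fun k => (1 :: (List.range n).map (flipBits V j)) ++ bits n k
  else []

/-- For all values of the counter at `R_21`, flip the assignment at `R_14` accordingly, and if the
result satisfies the formula, output all the solutions that contain it. -/
def Frag.listSolutions : Frag :=
  Frag.counterLoop 25 (Frag.ops [.add 1 22 30, .copy 3 14, .copy 5 21] ++ Frag.xor ++
    Frag.ops [.add 16 22 30] ++ Frag.check ++ Frag.ops [.const 24 0] ++
    Frag.ifLt 6 30 (Frag.outputLoop 24 22 29 20 10) (Frag.ops []) ++
    Frag.ops [.copy 17 21, .copy 18 10])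

/-- One round of `Frag.listSolutions`. The assignment found is at `W`, the counter at `U`; the solution
is put together from the letter `1` at `Y`, the assignment, and the counter for the second half at
`Y + 1 + n`, which is `0` before and after. -/
theorem Frag.exec_flip (r : ℕ → ℕ) (n m L W U Y B M : ℕ) (T : ℕ) (lg : List (List ℕ × ℕ))
    (V : ℕ → ℕ) (j : ℕ) (h10 : r 10 = n)
    (h11 : r 11 = L) (h12 : r 12 = m) (h13 : r 13 = B) (h14 : r 14 = W) (h20 : r 20 = Y + 1 + n)
    (h21 : r 21 = U) (h22 : r 22 = Y) (h29 : r 29 = Y + n + n) (h30 : r 30 = 1) (hL : 32 ≤ L)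
    (hLW : L + 3 * m ≤ W) (hWU : W + n ≤ U) (hUY : U + n ≤ Y) (hYB : Y + 1 + n + n ≤ B)
    (hM : B + 2 * n ≤ M) (hlit : ∀ k < 3 * m, r (L + k) < 2 * n) (hV : ∀ i < n, r (W + i) = V i)
    (hV1 : ∀ i < n, V i ≤ 1) (hY : r Y = 1) (hZ : ∀ i < n, r (Y + 1 + n + i) = 0)
    (hU : ∀ i < n, r (U + i) = j / 2 ^ i % 2) :
    ∃ (σ' : Store) (g : List (List ℕ × ℕ)), (Frag.ops [.add 1 22 30, .copy 3 14, .copy 5 21] ++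
      Frag.xor ++ Frag.ops [.add 16 22 30] ++ Frag.check ++ Frag.ops [.const 24 0] ++
      Frag.ifLt 6 30 (Frag.outputLoop 24 22 29 20 10) (Frag.ops []) ++
      Frag.ops [.copy 17 21, .copy 18 10]).Exec ⟨r, T, lg⟩ σ' ∧
      σ'.reg 17 = U ∧ σ'.reg 18 = n ∧ (∀ i < n, σ'.reg (Y + 1 + n + i) = 0) ∧
      (∀ i, 10 ≤ i → i < B → i ≠ 16 → i ≠ 17 → i ≠ 18 → i ≠ 24 →
        (i ≤ Y ∨ Y + 1 + n + n ≤ i) → σ'.reg i = r i) ∧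
      σ'.log = lg ++ g ∧
      g.map Prod.fst = solutionsAt n m (fun k => r (L + k)) V j ∧
      TimedLog (fun i => T + 700 * (M + 1) ^ 2 + 200 * (M + 1) ^ 2 * (i + 1)) g ∧
      σ'.time ≤ T + 1000 * (M + 1) ^ 2 + 200 * (M + 1) ^ 2 * g.length := by
  have hM2 : M + 1 ≤ (M + 1) ^ 2 := Nat.le_self_pow two_ne_zero _
  have hQ₁ := Frag.quiet_ops_bound [.add 1 22 30, .copy 3 14, .copy 5 21] (by simp [Instr.Writes]) r
    (4 + M) (by simp only [boundOps, Instr.eval, Function.update_apply, reduceIte,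
      Nat.reduceEqDiff, Nat.reduceLT, h22, h30]; omega)
  obtain ⟨r₁, hr₁⟩ : ∃ r₁, r₁ = evalOps [.add 1 22 30, .copy 3 14, .copy 5 21] r := ⟨_, rfl⟩
  rw [← hr₁] at hQ₁
  have e1 : r₁ 1 = Y + 1 ∧ r₁ 3 = W ∧ r₁ 5 = U := by
    rw [hr₁]
    simp only [evalOps, Instr.eval, Function.update_apply, reduceIte, Nat.reduceEqDiff,
      Nat.reduceLT, h22, h30, h14, h21, and_self]
  have hF₁ : ∀ i, 10 ≤ i → r₁ i = r i := by
    intro i hi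
    rw [hr₁]
    simp only [evalOps, Instr.eval, Function.update_apply, reduceIte, Nat.reduceEqDiff,
      Nat.reduceLT, addr_ne hi]
  have hbit : ∀ i, j / 2 ^ i % 2 ≤ 1 := fun i => by omega
  obtain ⟨r₂, hQ₂, hF₂, hX⟩ := Frag.quiet_xor r₁ M (Y + 1) W U n (by rw [hF₁ 10 (by omega), h10])
    e1.1 e1.2.1 e1.2.2 (by omega) (by omega) (by omega) (by omega) (by omega) (by omega) (by omega)
    (by omega) (fun i hi => by rw [hF₁ _ (by omega), hV i hi]; exact hV1 i hi)
    (fun i hi => by rw [hF₁ _ (by omega), hU i hi]; exact hbit i)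
  have hX' : ∀ i < n, r₂ (Y + 1 + i) = flipBits V j i := fun i hi => by
    rw [hX i hi, hF₁ _ (by omega), hF₁ _ (by omega), hV i hi, hU i hi, flipBits]
  have hQ₃ := Frag.quiet_ops_bound [.add 16 22 30] (by simp [Instr.Writes]) r₂ (2 + M) (by
    simp only [boundOps, Instr.eval, Function.update_apply, reduceIte, Nat.reduceEqDiff,
      Nat.reduceLT, hF₂ 22 (by omega) (by omega),
      hF₂ 30 (by omega) (by omega), hF₁ 22 (by omega), hF₁ 30 (by omega), h22, h30]
    omega)
  obtain ⟨r₃, hr₃⟩ : ∃ r₃, r₃ = evalOps [.add 16 22 30] r₂ := ⟨_, rfl⟩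
  rw [← hr₃] at hQ₃
  have e16 : r₃ 16 = Y + 1 := by
    rw [hr₃]
    simp only [evalOps, Instr.eval, Function.update_apply, reduceIte, Nat.reduceEqDiff,
      Nat.reduceLT, hF₂ 22 (by omega) (by omega),
      hF₂ 30 (by omega) (by omega), hF₁ 22 (by omega), hF₁ 30 (by omega), h22, h30]
  have hF₃ : ∀ i, 10 ≤ i → i ≠ 16 → r₃ i = r₂ i := by
    intro i hi h16
    rw [hr₃]
    simp only [evalOps, Instr.eval, Function.update_apply, reduceIte, Nat.reduceEqDiff,
      Nat.reduceLT, h16]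
  have hF₃' : ∀ i, 10 ≤ i → i ≠ 16 → (i < Y + 1 ∨ Y + 1 + n ≤ i) → r₃ i = r i :=
    fun i h1 h2 h3 => by rw [hF₃ i h1 h2, hF₂ i h1 h3, hF₁ i h1]
  have hX₃ : ∀ i < n, r₃ (Y + 1 + i) = flipBits V j i := fun i hi => by
    rw [hF₃ _ (by omega) (by omega), hX' i hi]
  have hlits : ∀ k < 3 * m, r₃ (L + k) = r (L + k) := fun k hk =>
    hF₃' _ (by omega) (by omega) (by omega)
  have hflip : ∀ i < n, flipBits V j i ≤ 1 := fun i hi => by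
    have h1 := hV1 i hi
    have h2 := hbit i
    unfold flipBits
    omega
  obtain ⟨r₄, hQ₄, hF₄, h6m, h6⟩ := Frag.quiet_check r₃ M n L m (Y + 1) B
    (by rw [hF₃' 10 (by omega) (by omega) (by omega), h10])
    (by rw [hF₃' 11 (by omega) (by omega) (by omega), h11])
    (by rw [hF₃' 12 (by omega) (by omega) (by omega), h12])
    (by rw [hF₃' 13 (by omega) (by omega) (by omega), h13]) e16 (by omega) (by omega) (by omega)
    (by omega) hM (fun k hk => by rw [hlits k hk]; exact hlit k hk)
    (fun i hi => by rw [hX₃ i hi]; exact hflip i hi)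
  have hS : r₄ 6 = 0 ↔ SatBy m (fun k => r (L + k)) fun i => flipBits V j i ≠ 0 := by
    rw [h6]
    exact satBy_congr (n := n) (fun k hk => by rw [hlits k hk]; exact hlit k hk) hlits
      fun i hi => by rw [hX₃ i hi]
  have hQ₅ := Frag.quiet_ops_bound [.const 24 0] (by simp [Instr.Writes]) r₄ 1 (by simp [boundOps])
  obtain ⟨r₅, hr₅⟩ : ∃ r₅, r₅ = evalOps [.const 24 0] r₄ := ⟨_, rfl⟩
  rw [← hr₅] at hQ₅
  have e24 : r₅ 24 = 0 := by rw [hr₅]; rfl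
  have hF₅ : ∀ i, i ≠ 24 → r₅ i = r₄ i := by
    intro i hi
    rw [hr₅]
    simp only [evalOps, Instr.eval, Function.update_apply, reduceIte, Nat.reduceEqDiff,
      Nat.reduceLT, hi]
  have hF₅' : ∀ i, 10 ≤ i → i < B → i ≠ 16 → i ≠ 24 → (i < Y + 1 ∨ Y + 1 + n ≤ i) → r₅ i = r i :=
    fun i h1 h2 h3 h4 h5 => by rw [hF₅ i h4, hF₄ i h1 (Or.inl h2), hF₃' i h1 h3 h5]
  have e6 : r₅ 6 = r₄ 6 := hF₅ 6 (by omega)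
  have e30 : r₅ 30 = 1 := by
    rw [hF₅' 30 (by omega) (by omega) (by omega) (by omega) (by omega), h30]
  obtain ⟨t, ht, hE⟩ := ((((hQ₁.append hQ₂).append hQ₃).append hQ₄).append hQ₅).exec
    (σ := ⟨r, T, lg⟩) rfl
  simp only at hE
  have ht' : t ≤ 500 * (M + 1) ^ 2 := by omega
  have hlast : ∀ r' : ℕ → ℕ, r' 21 = U → r' 10 = n → (Frag.ops [.copy 17 21, .copy 18 10]).Quiet r' 2
      (evalOps [.copy 17 21, .copy 18 10] r') ∧ evalOps [.copy 17 21, .copy 18 10] r' 17 = U ∧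
      evalOps [.copy 17 21, .copy 18 10] r' 18 = n ∧
      ∀ i, i ≠ 17 → i ≠ 18 → evalOps [.copy 17 21, .copy 18 10] r' i = r' i := by
    intro r' h1 h2
    refine ⟨Frag.quiet_ops_bound _ (by simp [Instr.Writes]) _ _ (by simp [boundOps]), ?_, ?_, ?_⟩
    · simp only [evalOps, Instr.eval, Function.update_apply, reduceIte, Nat.reduceEqDiff,
        Nat.reduceLT, h1]
    · simp only [evalOps, Instr.eval, Function.update_apply, reduceIte, Nat.reduceEqDiff,
        Nat.reduceLT, h2]
    · intro i h3 h4
      simp only [evalOps, Instr.eval, Function.update_apply, reduceIte, Nat.reduceEqDiff,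
        Nat.reduceLT, h3, h4]
  by_cases hsat : SatBy m (fun k => r (L + k)) fun i => flipBits V j i ≠ 0
  · have h60 : r₅ 6 = 0 := by rw [e6]; exact hS.2 hsat
    obtain ⟨c, hc⟩ : ∃ c, c = logCost (r₅ 6) (r₅ 30) := ⟨_, rfl⟩
    have hc2 : c ≤ 2 := by rw [hc, h60, e30]; exact logCost_le 0 1
    obtain ⟨σ₆, g, hE₆, hF₆, hZ₆, hlog, hwords, htl, htime⟩ := Frag.exec_outputLoop (fl := 24) (s := 22)
      (t := 29) (a := 20) (b := 10) (X := Y) (p := 1 + n) (n := n) (M := M) (k₀ := 0)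
      ⟨r₅, T + t + c, lg⟩
      (by omega) (by omega) (by omega) (by omega) (by omega) (by omega)
      (by simp only; rw [hF₅' 22 (by omega) (by omega) (by omega) (by omega) (by omega), h22])
      (by simp only; rw [hF₅' 29 (by omega) (by omega) (by omega) (by omega) (by omega), h29]; ring)
      (by simp only; rw [hF₅' 20 (by omega) (by omega) (by omega) (by omega) (by omega), h20]; ring)
      (by simp only; rw [hF₅' 10 (by omega) (by omega) (by omega) (by omega) (by omega), h10])
      e30 (by omega) (by omega) (Nat.zero_le _)
      (by simp only; rw [e24, if_pos (Nat.pow_pos (by norm_num))])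
      (fun i hi => by
        simp only
        rw [← add_assoc, hF₅' _ (by omega) (by omega) (by omega) (by omega) (by omega), hZ i hi]
        omega)
      (by
        rw [Nat.zero_mod]
        refine binVal_eq_zero fun i hi => ?_
        simp only
        rw [← add_assoc, hF₅' _ (by omega) (by omega) (by omega) (by omega) (by omega), hZ i hi])
    have hgl : g.length = 2 ^ n := by
      have := congrArg List.length hwords
      simpa using this
    obtain ⟨hQ₇, e17, e18, hF₇⟩ := hlast σ₆.reg
      (by rw [hF₆ 21 (by omega) (by omega) (by omega) (by omega) (by omega)]
          simp only
          rw [hF₅' 21 (by omega) (by omega) (by omega) (by omega) (by omega), h21])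
      (by rw [hF₆ 10 (by omega) (by omega) (by omega) (by omega) (by omega)]
          simp only
          rw [hF₅' 10 (by omega) (by omega) (by omega) (by omega) (by omega), h10])
    obtain ⟨t₇, ht₇, hE₇⟩ := hQ₇.exec (σ := σ₆) rfl
    have hE₈ := Frag.exec_ifLt_true (s := 6) (t := 30) (F := Frag.outputLoop 24 22 29 20 10)
      (G := Frag.ops []) (σ := ⟨r₅, T + t, lg⟩) (σ' := σ₆) (by simp only; omega) (by
        simp only [Store.tick, ← hc]; exact hE₆)
    refine ⟨_, g, (hE.append hE₈).append hE₇, e17, e18, fun i hi => ?_, fun i h1 h2 h3 h4 h5 h6 h7 => ?_,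
      hlog, ?_, ?_, ?_⟩
    · simp only
      rw [hF₇ _ (by omega) (by omega)]
      have := hZ₆ i hi
      rwa [← add_assoc] at this
    · simp only
      rw [hF₇ i h4 h5, hF₆ i h1 h4 h5 h6 (by omega)]
      exact hF₅' i h1 h2 h3 h6 (by omega)
    · rw [hwords, solutionsAt, if_pos hsat]
      refine List.map_congr_left fun k _ => ?_
      congr 1
      rw [add_comm 1 n, List.range_succ_eq_map, List.map_cons, List.map_map]
      congr 1
      · simp only [add_zero]
        rw [hF₅' Y (by omega) (by omega) (by omega) (by omega) (by omega), hY]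
      · refine List.map_congr_left fun i hi => ?_
        have := List.mem_range.1 hi
        simp only [Function.comp_apply]
        rw [show Y + (i + 1) = Y + 1 + i by ring, hF₅ _ (by omega), hF₄ _ (by omega) (by omega),
          hX₃ i this]
    · refine htl.mono fun i => ?_
      simp only
      omega
    · simp only at htime ⊢
      rw [hgl]
      rw [Nat.sub_zero, mul_add] at htime
      omega
  · have h60 : r₅ 6 ≠ 0 := by rw [e6]; exact fun h => hsat (hS.1 h)
    have hQ₆ := Frag.quiet_ifLt_false (s := 6) (t := 30) (F := Frag.outputLoop 24 22 29 20 10)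
      (r := r₅) (by omega) (Frag.quiet_ops_bound [] (by simp) r₅ 0 le_rfl)
    obtain ⟨hQ₇, e17, e18, hF₇⟩ := hlast r₅
      (by rw [hF₅' 21 (by omega) (by omega) (by omega) (by omega) (by omega), h21])
      (by rw [hF₅' 10 (by omega) (by omega) (by omega) (by omega) (by omega), h10])
    obtain ⟨t₈, ht₈, hE₈⟩ := hQ₆.exec (σ := ⟨r₅, T + t, lg⟩) rfl
    obtain ⟨t₇, ht₇, hE₇⟩ := hQ₇.exec (σ := ⟨r₅, T + t + t₈, lg⟩) rfl
    refine ⟨_, [], (hE.append hE₈).append hE₇, e17, e18, fun i hi => ?_,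
      fun i h1 h2 h3 h4 h5 h6 h7 => ?_, by simp, ?_, fun i hi => by simp at hi, ?_⟩
    · simp only
      rw [hF₇ _ (by omega) (by omega),
        hF₅' _ (by omega) (by omega) (by omega) (by omega) (by omega), hZ i hi]
    · simp only
      rw [hF₇ i h4 h5]
      exact hF₅' i h1 h2 h3 h6 (by omega)
    · rw [solutionsAt, if_neg hsat, List.map_nil]
    · simp only [List.length_nil, mul_zero, add_zero]
      omega

theorem flipBits_zero (V : ℕ → ℕ) : flipBits V 0 = V := by
  funext i
  simp [flipBits]

theorem solutionsAt_congr {n m : ℕ} {l l' : ℕ → ℕ} (V : ℕ → ℕ) (j : ℕ)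
    (hl : ∀ k < 3 * m, l k < 2 * n) (h : ∀ k < 3 * m, l' k = l k) :
    solutionsAt n m l' V j = solutionsAt n m l V j := by
  have : SatBy m l' (fun i => flipBits V j i ≠ 0) ↔ SatBy m l fun i => flipBits V j i ≠ 0 :=
    (satBy_congr (n := n) hl (fun k hk => (h k hk).symm) fun i _ => Iff.rfl).symm
  unfold solutionsAt
  by_cases h1 : SatBy m l fun i => flipBits V j i ≠ 0
  · rw [if_pos h1, if_pos (this.2 h1)]
  · rw [if_neg h1, if_neg fun h2 => h1 (this.1 h2)]

theorem length_solutionsAt_zero {n m : ℕ} {l V : ℕ → ℕ} (h : SatBy m l fun i => V i ≠ 0) :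
    (solutionsAt n m l V 0).length = 2 ^ n := by
  rw [solutionsAt, flipBits_zero, if_pos h]
  simp

/-- Once the first assignment is output, at least `2 ^ n` solutions are known, as many as there are
rounds in total; so the rounds without output do no harm. -/
theorem Frag.exec_listSolutions (σ : Store) (n m L W U Y B M : ℕ) (V : ℕ → ℕ)
    (h10 : σ.reg 10 = n) (h11 : σ.reg 11 = L) (h12 : σ.reg 12 = m) (h13 : σ.reg 13 = B)
    (h14 : σ.reg 14 = W) (h20 : σ.reg 20 = Y + 1 + n) (h21 : σ.reg 21 = U) (h22 : σ.reg 22 = Y)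
    (h29 : σ.reg 29 = Y + n + n) (h30 : σ.reg 30 = 1) (h25 : σ.reg 25 = 0) (hL : 32 ≤ L)
    (hLW : L + 3 * m ≤ W) (hWU : W + n ≤ U) (hUY : U + n ≤ Y) (hYB : Y + 1 + n + n ≤ B)
    (hM : B + 2 * n ≤ M) (hlit : ∀ k < 3 * m, σ.reg (L + k) < 2 * n)
    (hV : ∀ i < n, σ.reg (W + i) = V i) (hV1 : ∀ i < n, V i ≤ 1) (hY : σ.reg Y = 1)
    (hZ : ∀ i < n, σ.reg (Y + 1 + n + i) = 0) (hU : ∀ i < n, σ.reg (U + i) = 0)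
    (hsat : SatBy m (fun k => σ.reg (L + k)) fun i => V i ≠ 0) :
    ∃ (σ' : Store) (g : List (List ℕ × ℕ)), Frag.listSolutions.Exec σ σ' ∧
      (∀ i, 26 ≤ i → i < B → (i < U ∨ Y + 1 + n + n ≤ i) → σ'.reg i = σ.reg i) ∧
      (∀ i, 19 ≤ i → i < 24 → σ'.reg i = σ.reg i) ∧
      σ'.log = σ.log ++ g ∧
      g.map Prod.fst =
        (List.range (2 ^ n)).flatMap (solutionsAt n m (fun k => σ.reg (L + k)) V) ∧
      TimedLog (fun i => σ.time + 2000 * (M + 1) ^ 2 * (2 * i + 4)) g ∧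
      σ'.time ≤ σ.time + 2000 * (M + 1) ^ 2 * (2 * g.length + 1) := by
  obtain ⟨τ, hτ⟩ : ∃ τ, τ = 2000 * (M + 1) ^ 2 := ⟨_, rfl⟩
  have hM2 : M + 1 ≤ (M + 1) ^ 2 := Nat.le_self_pow two_ne_zero _
  obtain ⟨l, hl⟩ : ∃ l, l = fun k => σ.reg (L + k) := ⟨_, rfl⟩
  have hlk : ∀ k, l k = σ.reg (L + k) := fun k => by rw [hl]
  rw [← hl] at hsat ⊢
  obtain ⟨σ₁, ⟨hF, hb₁, hv, hZ₁, g, hlog, hwords, htl, htime, hlen⟩, δ, hδ, hE⟩ :=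
    Frag.exec_counterLoop (fl := 25) (G := Frag.ops [.add 1 22 30, .copy 3 14, .copy 5 21] ++
      Frag.xor ++ Frag.ops [.add 16 22 30] ++ Frag.check ++ Frag.ops [.const 24 0] ++
      Frag.ifLt 6 30 (Frag.outputLoop 24 22 29 20 10) (Frag.ops []) ++
      Frag.ops [.copy 17 21, .copy 18 10]) (n := n) (A := U) (M := M)
    (by omega) (by omega) (by omega)
    (fun j σ₁ => (∀ i, 10 ≤ i → i < B → i ≠ 16 → i ≠ 17 → i ≠ 18 → i ≠ 24 → i ≠ 25 →
        (i < U ∨ U + n ≤ i) → (i ≤ Y ∨ Y + 1 + n + n ≤ i) → σ₁.reg i = σ.reg i) ∧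
      (∀ i < n, σ₁.reg (U + i) ≤ 1) ∧ binVal (fun i => σ₁.reg (U + i)) n = j % 2 ^ n ∧
      (∀ i < n, σ₁.reg (Y + 1 + n + i) = 0) ∧
      ∃ g, σ₁.log = σ.log ++ g ∧ g.map Prod.fst = (List.range j).flatMap (solutionsAt n m l V) ∧
        TimedLog (fun i => σ.time + τ * (2 * i + 4)) g ∧ σ₁.time ≤ σ.time + τ * (j + g.length) ∧
        (j = 0 ∨ 2 ^ n ≤ g.length))
    (fun j σ₁ h => (h.1 30 (by omega) (by omega) (by omega) (by omega) (by omega) (by omega)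
      (by omega) (by omega) (by omega)).trans h30)
    (by
      rintro j σ₁ hj ⟨hF, hb₁, hv, hZ₁, g, hlog, hwords, htl, htime, hlen⟩ δ hδ
      rw [Nat.mod_eq_of_lt hj] at hv
      have hU₁ : ∀ i < n, σ₁.reg (U + i) = j / 2 ^ i % 2 :=
        binVal_inj hb₁ (fun i _ => by omega) (hv.trans (binVal_bits n j hj).symm)
      have f : ∀ i, 10 ≤ i → i < 32 → i ≠ 16 → i ≠ 17 → i ≠ 18 → i ≠ 24 → i ≠ 25 →
          σ₁.reg i = σ.reg i := fun i h1 h2 h3 h4 h5 h6 h7 =>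
        hF i h1 (by omega) h3 h4 h5 h6 h7 (by omega) (by omega)
      have hlit₁ : ∀ k < 3 * m, σ₁.reg (L + k) = l k := fun k hk => by
        rw [hlk]
        exact hF (L + k) (by omega) (by omega) (by omega) (by omega) (by omega) (by omega) (by omega)
          (by omega) (by omega)
      obtain ⟨σ₂, g₂, hE, e17, e18, hZ₂, hF₂, hlog₂, hwords₂, htl₂, htime₂⟩ :=
        Frag.exec_flip σ₁.reg n m L W U Y B M (σ₁.time + δ) σ₁.log V j
        ((f 10 (by omega) (by omega) (by omega) (by omega) (by omega) (by omega) (by omega)).trans h10)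
        ((f 11 (by omega) (by omega) (by omega) (by omega) (by omega) (by omega) (by omega)).trans h11)
        ((f 12 (by omega) (by omega) (by omega) (by omega) (by omega) (by omega) (by omega)).trans h12)
        ((f 13 (by omega) (by omega) (by omega) (by omega) (by omega) (by omega) (by omega)).trans h13)
        ((f 14 (by omega) (by omega) (by omega) (by omega) (by omega) (by omega) (by omega)).trans h14)
        ((f 20 (by omega) (by omega) (by omega) (by omega) (by omega) (by omega) (by omega)).trans h20)
        ((f 21 (by omega) (by omega) (by omega) (by omega) (by omega) (by omega) (by omega)).trans h21)
        ((f 22 (by omega) (by omega) (by omega) (by omega) (by omega) (by omega) (by omega)).trans h22)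
        ((f 29 (by omega) (by omega) (by omega) (by omega) (by omega) (by omega) (by omega)).trans h29)
        ((f 30 (by omega) (by omega) (by omega) (by omega) (by omega) (by omega) (by omega)).trans h30)
        hL hLW hWU hUY hYB hM (fun k hk => by rw [hlit₁ k hk, hlk]; exact hlit k hk)
        (fun i hi => (hF (W + i) (by omega) (by omega) (by omega) (by omega) (by omega) (by omega)
          (by omega) (by omega) (by omega)).trans (hV i hi)) hV1
        ((hF Y (by omega) (by omega) (by omega) (by omega) (by omega) (by omega)
          (by omega) (by omega) (by omega)).trans hY) hZ₁ hU₁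
      rw [solutionsAt_congr V j (fun k hk => by rw [hlk]; exact hlit k hk) hlit₁] at hwords₂
      have hU₂ : ∀ i < n, σ₂.reg (U + i) = σ₁.reg (U + i) := fun i hi =>
        hF₂ (U + i) (by omega) (by omega) (by omega) (by omega) (by omega) (by omega) (by omega)
      refine ⟨σ₂, hE, e17, e18, fun i hi => by rw [hU₂ i hi]; exact hb₁ i hi, ?_, ?_⟩
      · rw [← hv]
        exact Finset.sum_congr rfl fun i hi => by simp only; rw [hU₂ i (Finset.mem_range.1 hi)]
      · intro r t hr ht hb hv'
        have hg : j ≤ g.length := by omega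
        refine ⟨fun i h1 h2 h3 h4 h5 h6 h7 h8 h9 => ?_, hb, hv', fun i hi => ?_, g ++ g₂, ?_, ?_, ?_,
          ?_, ?_⟩
        · exact (hr i h1 h7 h8).trans ((hF₂ i h1 h2 h3 h4 h5 h6 h9).trans
            (hF i h1 h2 h3 h4 h5 h6 h7 h8 h9))
        · exact (hr (Y + 1 + n + i) (by omega) (by omega) (by omega)).trans (hZ₂ i hi)
        · simp only [hlog₂, hlog, List.append_assoc]
        · rw [List.map_append, hwords, hwords₂, List.range_succ, List.flatMap_append]
          simp
        · refine htl.append htl₂ fun i hi => ?_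
          have h1 : τ * (j + g.length) ≤ τ * (2 * g.length) := Nat.mul_le_mul_left _ (by omega)
          have h2 : τ * (2 * (g.length + i) + 4) = τ * (2 * g.length) + 2 * (τ * i) + 4 * τ := by ring
          have h3 : 200 * (M + 1) ^ 2 * (i + 1) ≤ τ * i + τ := by
            rw [← mul_add_one, hτ]
            exact Nat.mul_le_mul_right _ (by omega)
          omega
        · have h1 : τ * (j + 1 + (g ++ g₂).length) = τ * (j + g.length) + τ + τ * g₂.length := by
            rw [List.length_append]; ring
          have h3 : 200 * (M + 1) ^ 2 * g₂.length ≤ τ * g₂.length := by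
            rw [hτ]
            exact Nat.mul_le_mul_right _ (by omega)
          simp only
          omega
        · right
          rw [List.length_append]
          rcases hlen with rfl | hlen
          · have := congrArg List.length hwords₂
            rw [length_solutionsAt_zero hsat, List.length_map] at this
            omega
          · omega)
    0 (Nat.zero_le _) σ ⟨fun _ _ _ _ _ _ _ _ _ _ => rfl, fun i hi => by rw [hU i hi]; omega, by
      rw [Nat.zero_mod]
      exact binVal_eq_zero hU, hZ, [], by simp, by simp, fun i hi => by simp at hi, by simp,
      Or.inl rfl⟩
    (by rw [h25, if_pos (Nat.pow_pos (by norm_num))])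
  have hlen' : 2 ^ n ≤ g.length := hlen.resolve_left (by positivity)
  rw [← hτ]
  refine ⟨σ₁.tick δ, g, hE, fun i h1 h2 h3 => ?_, fun i h1 h2 => ?_, hlog, hwords, htl, ?_⟩
  · exact hF i (by omega) h2 (by omega) (by omega) (by omega) (by omega) (by omega) (by omega)
      (by omega)
  · exact hF i (by omega) (by omega) (by omega) (by omega) (by omega) (by omega) (by omega)
      (by omega) (by omega)
  · have h1 : τ * (2 ^ n + g.length) ≤ τ * (2 * g.length) := Nat.mul_le_mul_left _ (by omega)
    rw [mul_add_one]
    simp only [Store.tick]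
    omega

/-! ### The enumeration algorithm -/

/-- Parse an instance of the padded problem and lay out the working area behind it: the assignment
at `R_14`, a counter at `R_21`, and two buffers for solutions at `R_22` and `R_23`. The buffer for
trivial solutions contains the word `0 1 0 … 0`, if there is room for it; otherwise `R_25` is set.
The first letter of the instance is overwritten, which makes the empty instance unexceptional. -/
def Frag.prepare (u v : ℕ) : Frag :=
  Frag.ops [.const 1 1, .add 0 0 1] ++ Frag.relocate ++
    Frag.ops [.const 2 1, .add 1 20 2, .sub 5 20 2] ++ Frag.parse u v ++
    Frag.ops [.const 30 1, .copy 31 18, .add 21 14 10, .add 22 21 10, .add 20 22 30, .add 20 20 10,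
      .add 29 22 10, .add 29 29 10, .add 23 29 30, .add 27 23 30, .add 28 23 26, .add 13 28 30,
      .store 22 30, .copy 17 27, .copy 18 26] ++ Frag.inc ++ Frag.ops [.copy 25 6]

set_option maxHeartbeats 1000000 in
theorem Frag.quiet_prepare (q u v : ℕ) (x : Word q) (w : List ℕ) (hw : w = (Word.code x).tail)
    (P n m tt K Y : ℕ) (hP : P = 32 * (x.length + 1)) (hn : n = v * numAt w 0)
    (hm : m = numAt w 1) (htt : tt = u * numAt w 0) (hK : K = (u + v + q + 1) * P)
    (hY : Y = 6 * P + n + n) :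
    ∃ r', (Frag.prepare u v).Quiet (init (Word.code x)).reg (40000 * (K + 1) ^ 2) r' ∧
      n ≤ K ∧ tt ≤ K ∧ m ≤ P ∧ P ≤ K ∧
      r' 10 = n ∧ r' 11 = 2 * P + 2 ∧ r' 12 = m ∧ r' 13 = Y + n + n + 1 + tt + 1 ∧ r' 14 = 6 * P ∧
      r' 20 = Y + 1 + n ∧ r' 21 = 6 * P + n ∧ r' 22 = Y ∧ r' 23 = Y + n + n + 1 ∧
      r' 25 = (if 1 < 2 ^ tt then 0 else 1) ∧ r' 26 = tt ∧ r' 27 = Y + n + n + 1 + 1 ∧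
      r' 28 = Y + n + n + 1 + tt ∧ r' 29 = Y + n + n ∧ r' 30 = 1 ∧ r' 31 ≤ 3 * m ∧
      (r' 31 = 0 ↔ ValidFormula v w) ∧ (∀ k < 3 * m, r' (2 * P + 2 + k) = numAt w (2 + k)) ∧
      r' Y = 1 ∧ (∀ j, 6 * P ≤ j → j ≠ Y →
        (j < Y + n + n + 1 + 1 ∨ Y + n + n + 1 + 1 + tt ≤ j) → r' j = 0) ∧
      (∀ i < tt, r' (Y + n + n + 1 + 1 + i) ≤ 1) ∧
      binVal (fun i => r' (Y + n + n + 1 + 1 + i)) tt = 1 % 2 ^ tt := by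
  obtain ⟨s, hs⟩ : ∃ s, s = x.length := ⟨_, rfl⟩
  rw [← hs] at hP
  have hxl : (Word.code x).length = s := by simp [Word.code, hs]
  have hwl : w.length = s - 1 := by rw [hw, List.length_tail, hxl]
  have hPK : P ≤ K := by rw [hK]; exact Nat.le_mul_of_pos_left _ (by omega)
  have huP : u * P ≤ K := by rw [hK]; exact Nat.mul_le_mul_right _ (by omega)
  have hvP : v * P ≤ K := by rw [hK]; exact Nat.mul_le_mul_right _ (by omega)
  have hqP : q * P ≤ K := by rw [hK]; exact Nat.mul_le_mul_right _ (by omega)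
  have hu : u ≤ K := (Nat.le_mul_of_pos_right _ (by omega)).trans huP
  have hv : v ≤ K := (Nat.le_mul_of_pos_right _ (by omega)).trans hvP
  have hqK : q ≤ K := (Nat.le_mul_of_pos_right _ (by omega)).trans hqP
  have hnP : ∀ j, numAt w j ≤ P := fun j => (numAt_le w j).trans (by omega)
  have hnK : n ≤ K := by rw [hn]; exact (Nat.mul_le_mul_left _ (hnP 0)).trans hvP
  have htK : tt ≤ K := by rw [htt]; exact (Nat.mul_le_mul_left _ (hnP 0)).trans huP
  have hmP : m ≤ P := hm ▸ hnP 1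
  have hcode : ∀ i, (Word.code x).getD i 0 ≤ q := by
    intro i
    rcases Nat.lt_or_ge i (Word.code x).length with h | h
    · rw [List.getD_eq_getElem _ _ h]
      simp only [Word.code, List.getElem_map]
      exact (Fin.is_lt _).le
    · rw [List.getD_eq_default _ _ h]; omega
  obtain ⟨r, hr⟩ : ∃ r, r = (init (Word.code x)).reg := ⟨_, rfl⟩
  have hr0 : r 0 = s := by rw [hr, init_reg_zero, hxl]
  have hrx : ∀ i, r (1 + i) = (Word.code x).getD i 0 := fun i => by rw [hr, init_reg_succ]
  have hrz : ∀ i, s < i → r i = 0 := fun i hi => by rw [hr]; exact init_reg_eq_zero _ (by omega)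
  rw [← hr]
  have hQ₁ := Frag.quiet_ops_bound [.const 1 1, .add 0 0 1] (by simp [Instr.Writes]) r (3 + K) (by
    simp only [boundOps, Instr.eval, Function.update_apply, reduceIte, Nat.reduceEqDiff,
      Nat.reduceLT, hr0]; omega)
  obtain ⟨r₁, hr₁⟩ : ∃ r₁, r₁ = evalOps [.const 1 1, .add 0 0 1] r := ⟨_, rfl⟩
  rw [← hr₁] at hQ₁
  have e1 : r₁ 0 = s + 1 ∧ r₁ 1 = 1 := by
    rw [hr₁]
    simp only [evalOps, Instr.eval, Function.update_apply, reduceIte, Nat.reduceEqDiff,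
      Nat.reduceLT, hr0, and_self]
  have hF₁ : ∀ i, 2 ≤ i → r₁ i = r i := by
    intro i hi
    rw [hr₁]
    simp only [evalOps, Instr.eval, Function.update_apply, reduceIte, Nat.reduceEqDiff,
      Nat.reduceLT, show i ≠ 0 by omega, show i ≠ 1 by omega]
  obtain ⟨r₂, hQ₂, e20, hmv⟩ := Frag.quiet_relocate r₁ (2 * K) P (by omega) (by omega)
    (fun i hi => by rw [hF₁ i (by omega), hrz i (by omega)]) (by omega) (fun i hi => by
      rcases Nat.lt_or_ge i 2 with h | h
      · rw [show i = 1 by omega, e1.2]; omega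
      · obtain ⟨j, rfl⟩ : ∃ j, i = 1 + j := ⟨i - 1, by omega⟩
        rw [hF₁ _ h, hrx]
        have := hcode j
        omega)
  have hQ₃ := Frag.quiet_ops_bound [.const 2 1, .add 1 20 2, .sub 5 20 2] (by simp [Instr.Writes]) r₂
    (10 * (K + 1)) (by simp only [boundOps, Instr.eval, Function.update_apply, reduceIte,
      Nat.reduceEqDiff, Nat.reduceLT, e20]; omega)
  obtain ⟨r₃, hr₃⟩ : ∃ r₃, r₃ = evalOps [.const 2 1, .add 1 20 2, .sub 5 20 2] r₂ := ⟨_, rfl⟩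
  rw [← hr₃] at hQ₃
  have e3 : r₃ 1 = P + 1 ∧ r₃ 5 = P - 1 := by
    rw [hr₃]
    simp only [evalOps, Instr.eval, Function.update_apply, reduceIte, Nat.reduceEqDiff,
      Nat.reduceLT, e20, and_self]
  have hF₃ : ∀ i, 10 ≤ i → r₃ i = r₂ i := by
    intro i hi
    rw [hr₃]
    simp only [evalOps, Instr.eval, Function.update_apply, reduceIte, Nat.reduceEqDiff,
      Nat.reduceLT, addr_ne hi]
  have hmem : ∀ i, r₃ (P + 1 + i) = (Word.code x).getD (1 + i) 0 := by
    intro i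
    rw [hF₃ _ (by omega), add_assoc, hmv, hF₁ _ (by omega), hrx]
  obtain ⟨r₄, hQ₄, hF₄, hnum, g10, g11, g12, g14, g26, -, g18, g18'⟩ := Frag.quiet_parse u v r₃ K P
    (P + 1) (P - 1) (w ++ List.replicate (P - 1 - w.length) 0)
    (by rw [hF₃ 20 (by omega), e20]) e3.1 e3.2 (by
      refine List.ext_getElem (by simp; omega) fun i h1 h2 => ?_
      rw [List.getElem_map, List.getElem_range, hmem]
      rcases Nat.lt_or_ge i w.length with h | h
      · rw [List.getElem_append_left h, add_comm 1 i, List.getD_eq_getElem _ _ (by omega)]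
        simp only [hw, List.getElem_tail]
      · rw [List.getElem_append_right h, List.getElem_replicate, add_comm 1 i,
          List.getD_eq_default _ _ (by omega)])
    (by omega) (by omega) (by omega) (fun j hj => by
      obtain ⟨i, rfl⟩ : ∃ i, j = P + 1 + i := ⟨j - (P + 1), by omega⟩
      rw [hmem, List.getD_eq_default _ _ (by omega)])
    hPK hu hv huP hvP (fun i hi => by rw [hmem]; exact (hcode _).trans hqK)
  have hnw : ∀ j, numAt (w ++ List.replicate (P - 1 - w.length) 0) j = numAt w j := fun j => by
    rw [numAt, runLengths_append_zeros, numAt]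
  have hval : ValidFormula v (w ++ List.replicate (P - 1 - w.length) 0) ↔ ValidFormula v w := by
    simp only [ValidFormula, hnw]
  rw [hval] at g18'
  simp only [hnw, ← hn, ← hm, ← htt] at hnum g10 g11 g12 g14 g26 g18
  have hz₄ : ∀ j, 6 * P ≤ j → r₄ j = 0 := by
    intro j hj
    obtain ⟨i, rfl⟩ : ∃ i, j = 2 * P + i := ⟨j - 2 * P, by omega⟩
    rw [hnum, numAt_eq_zero (by omega)]
  have hYn : 40 ≤ 6 * P + n + n := by omega
  have hQ₅ := Frag.quiet_ops_bound [.const 30 1, .copy 31 18, .add 21 14 10, .add 22 21 10,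
    .add 20 22 30, .add 20 20 10, .add 29 22 10, .add 29 29 10, .add 23 29 30, .add 27 23 30,
    .add 28 23 26, .add 13 28 30, .store 22 30, .copy 17 27, .copy 18 26] (by simp [Instr.Writes]) r₄
    (1000 * (K + 1)) (by
      simp only [boundOps, Instr.eval, Function.update_apply, reduceIte, Nat.reduceEqDiff,
        Nat.reduceLT, g10, g14, g26, addr_ne hYn]
      linarith)
  obtain ⟨r₅, hr₅⟩ : ∃ r₅, r₅ = evalOps [.const 30 1, .copy 31 18, .add 21 14 10, .add 22 21 10,
    .add 20 22 30, .add 20 20 10, .add 29 22 10, .add 29 29 10, .add 23 29 30, .add 27 23 30,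
    .add 28 23 26, .add 13 28 30, .store 22 30, .copy 17 27, .copy 18 26] r₄ := ⟨_, rfl⟩
  rw [← hr₅] at hQ₅
  have e5 : r₅ 10 = n ∧ r₅ 11 = 2 * P + 2 ∧ r₅ 12 = m ∧ r₅ 13 = Y + n + n + 1 + tt + 1 ∧
      r₅ 14 = 6 * P ∧ r₅ 20 = Y + 1 + n ∧ r₅ 21 = 6 * P + n ∧ r₅ 22 = Y ∧ r₅ 23 = Y + n + n + 1 ∧
      r₅ 26 = tt ∧ r₅ 27 = Y + n + n + 1 + 1 ∧
      r₅ 28 = Y + n + n + 1 + tt ∧ r₅ 29 = Y + n + n ∧ r₅ 30 = 1 ∧ r₅ 31 = r₄ 18 ∧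
      r₅ 17 = Y + n + n + 1 + 1 ∧ r₅ 18 = tt := by
    rw [hr₅, hY]
    simp only [evalOps, Instr.eval, Function.update_apply, reduceIte, Nat.reduceEqDiff,
      Nat.reduceLT, g10, g11, g12, g14, g26, addr_ne hYn, and_self]
  have hF₅ : ∀ j, 32 ≤ j → r₅ j = if j = Y then 1 else r₄ j := by
    intro j hj
    rw [hr₅, hY]
    simp only [evalOps, Instr.eval, Function.update_apply, reduceIte, Nat.reduceEqDiff,
      Nat.reduceLT, g10, g14, g26, addr_ne hj]
  obtain ⟨e10, e11, e12, e13, e14, e20', e21, e22, e23, e26, e27, e28, e29, e30, e31, e17, e18⟩ := e5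
  have hc0 : ∀ i, r₅ (Y + n + n + 1 + 1 + i) = 0 := fun i => by
    rw [hF₅ _ (by omega), if_neg (by omega), hz₄ _ (by omega)]
  obtain ⟨r₆, hQ₆, hF₆, hb₆, h6, hv₆⟩ := Frag.quiet_inc r₅ (12 * K + 11) (Y + n + n + 1 + 1) tt e17 e18
    (by omega) (by omega) (fun i hi => by rw [hc0]; omega)
  rw [binVal_eq_zero fun i _ => hc0 i] at hv₆
  have hQ₇ := Frag.quiet_ops_bound [.copy 25 6] (by simp [Instr.Writes]) r₆ 1 (by simp [boundOps])
  have hF₇ : ∀ j, j ≠ 25 → evalOps [.copy 25 6] r₆ j = r₆ j := by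
    intro j hj
    simp only [evalOps, Instr.eval, Function.update_apply, reduceIte, Nat.reduceEqDiff,
      Nat.reduceLT, hj]
  have e25 : evalOps [.copy 25 6] r₆ 25 = r₆ 6 := rfl
  have hcase : r₆ 6 = (if 1 < 2 ^ tt then 0 else 1) ∧
      binVal (fun i => r₆ (Y + n + n + 1 + 1 + i)) tt = 1 % 2 ^ tt := by
    have hlt := binVal_lt hb₆
    rcases Nat.le_one_iff_eq_zero_or_eq_one.1 h6 with h | h
    · rw [h] at hv₆ ⊢
      rw [if_pos (by omega), Nat.mod_eq_of_lt (by omega)]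
      omega
    · rw [h] at hv₆ ⊢
      have h2 : 2 ^ tt = 1 := by omega
      rw [h2, if_neg (by omega)]
      omega
  have hF : ∀ j, 10 ≤ j → j ≠ 25 → (j < Y + n + n + 1 + 1 ∨ Y + n + n + 1 + 1 + tt ≤ j) →
      evalOps [.copy 25 6] r₆ j = r₅ j := fun j h1 h2 h3 => by rw [hF₇ j h2, hF₆ j h1 h3]
  have f : ∀ j, 10 ≤ j → j < 32 → j ≠ 25 → evalOps [.copy 25 6] r₆ j = r₅ j :=
    fun j h1 h2 h3 => hF j h1 h3 (by omega)
  refine ⟨_, ((((((hQ₁.append hQ₂).append hQ₃).append hQ₄).append hQ₅).append hQ₆).append hQ₇).mono ?_,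
    hnK, htK, hmP, hPK, (f 10 (by omega) (by omega) (by omega)).trans e10,
    (f 11 (by omega) (by omega) (by omega)).trans e11,
    (f 12 (by omega) (by omega) (by omega)).trans e12,
    (f 13 (by omega) (by omega) (by omega)).trans e13,
    (f 14 (by omega) (by omega) (by omega)).trans e14,
    (f 20 (by omega) (by omega) (by omega)).trans e20',
    (f 21 (by omega) (by omega) (by omega)).trans e21,
    (f 22 (by omega) (by omega) (by omega)).trans e22,
    (f 23 (by omega) (by omega) (by omega)).trans e23, e25.trans hcase.1,
    (f 26 (by omega) (by omega) (by omega)).trans e26,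
    (f 27 (by omega) (by omega) (by omega)).trans e27,
    (f 28 (by omega) (by omega) (by omega)).trans e28,
    (f 29 (by omega) (by omega) (by omega)).trans e29,
    (f 30 (by omega) (by omega) (by omega)).trans e30, ?_, ?_, ?_, ?_, ?_, ?_, ?_⟩
  · have h1 : (2 * K + 1) ^ 2 ≤ _ := sq_le_of_le_mul (a := 2) (K := K) (by omega)
    have h2 : (12 * K + 11 + 1) ^ 2 ≤ _ := sq_le_of_le_mul (a := 12) (K := K) (by omega)
    have h3 : K + 1 ≤ (K + 1) ^ 2 := Nat.le_self_pow two_ne_zero _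
    linarith
  · rw [f 31 (by omega) (by omega) (by omega), e31]; exact g18
  · rw [f 31 (by omega) (by omega) (by omega), e31]; exact g18'
  · intro k hk
    rw [hF _ (by omega) (by omega) (by omega), hF₅ _ (by omega), if_neg (by omega), add_assoc, hnum]
  · rw [hF _ (by omega) (by omega) (by omega), hF₅ _ (by omega), if_pos rfl]
  · intro j h1 h2 h3
    rw [hF _ (by omega) (by omega) h3, hF₅ _ (by omega), if_neg h2, hz₄ j h1]
  · intro i hi
    rw [hF₇ _ (by omega)]
    exact hb₆ i hi
  · rw [← hcase.2]
    exact Finset.sum_congr rfl fun i _ => by simp only; rw [hF₇ _ (by omega)]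

/-- The enumeration algorithm that uses `F` to search for satisfying assignments. One trivial
solution is kept for the end, so that the algorithm stops with an output. -/
def Frag.enumerate (u v : ℕ) (F : Frag) : Frag :=
  Frag.prepare u v ++ Frag.outputLoop 25 23 28 27 26 ++
    Frag.ifLt 31 30 (F ++ Frag.ops [.const 2 0] ++
      Frag.ifLt 2 15 (Frag.ops [.const 25 0] ++ Frag.listSolutions) (Frag.ops [])) (Frag.ops []) ++
    Frag.output 23 28

/-- The nontrivial solutions, in the order in which they are found. -/
def IsListing (n m : ℕ) (w : List ℕ) (v : ℕ) (L : List (List ℕ)) : Prop :=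
  (L = [] ∧ (ValidFormula v w → ∀ p, ¬ SatBy m (fun k => numAt w (2 + k)) p)) ∨
    (ValidFormula v w ∧ ∃ V : ℕ → ℕ, (∀ i < n, V i ≤ 1) ∧
      SatBy m (fun k => numAt w (2 + k)) (fun i => V i ≠ 0) ∧
      L = (List.range (2 ^ n)).flatMap (solutionsAt n m (fun k => numAt w (2 + k)) V))

/-- The search phase, followed by the enumeration of the nontrivial solutions. -/
theorem Frag.exec_searchList {F : Frag} {δ : ℝ} {C d : ℕ} (hF : F.Searches δ C d) (σ : Store)
    (v : ℕ) (w : List ℕ) (P n m Y B : ℕ) (hP : 32 ≤ P) (hm : m ≤ P) (hn : n = v * numAt w 0)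
    (hmw : m = numAt w 1) (hY : Y = 6 * P + n + n) (hYB : Y + n + n + 1 < B)
    (h10 : σ.reg 10 = n) (h11 : σ.reg 11 = 2 * P + 2) (h12 : σ.reg 12 = m) (h13 : σ.reg 13 = B)
    (h14 : σ.reg 14 = 6 * P) (h20 : σ.reg 20 = Y + 1 + n) (h21 : σ.reg 21 = 6 * P + n)
    (h22 : σ.reg 22 = Y) (h29 : σ.reg 29 = Y + n + n) (h30 : σ.reg 30 = 1)
    (h31 : σ.reg 31 ≤ 3 * m) (h31' : σ.reg 31 = 0 ↔ ValidFormula v w)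
    (hl : ∀ k < 3 * m, σ.reg (2 * P + 2 + k) = numAt w (2 + k)) (hY1 : σ.reg Y = 1)
    (hz : ∀ j, 6 * P ≤ j → j ≠ Y → σ.reg j = 0) :
    ∃ (σ' : Store) (g : List (List ℕ × ℕ)) (tF : ℕ), (Frag.ifLt 31 30 (F ++ Frag.ops [.const 2 0] ++
      Frag.ifLt 2 15 (Frag.ops [.const 25 0] ++ Frag.listSolutions) (Frag.ops []))
        (Frag.ops [])).Exec σ σ' ∧
      (tF : ℝ) ≤ C * (2 : ℝ) ^ (δ * n) * ((B : ℝ) + 1) ^ d ∧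
      (∀ i, Y + n + n + 1 ≤ i → i < B → σ'.reg i = 0) ∧
      (σ'.reg 23 = σ.reg 23 ∧ σ'.reg 28 = σ.reg 28) ∧
      σ'.log = σ.log ++ g ∧
      IsListing n m w v (g.map Prod.fst) ∧
      TimedLog (fun i => σ.time + tF + 2000 * (B + 2 * n + 1) ^ 2 * (2 * i + 5)) g ∧
      σ'.time ≤ σ.time + tF + 2000 * (B + 2 * n + 1) ^ 2 * (2 * g.length + 2) := by
  obtain ⟨τ, hτ⟩ : ∃ τ, τ = 2000 * (B + 2 * n + 1) ^ 2 := ⟨_, rfl⟩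
  have hτ1 : 2000 * (B + 2 * n + 1) ≤ τ := by
    rw [hτ]; exact Nat.mul_le_mul_left _ (Nat.le_self_pow two_ne_zero _)
  have hcost := logCost_le (σ.reg 31) (σ.reg 30)
  rw [← hτ]
  by_cases hval : ValidFormula v w
  · have e31 : σ.reg 31 = 0 := h31'.2 hval
    have hlit : ∀ k < 3 * m, σ.reg (2 * P + 2 + k) < 2 * n := fun k hk => by
      rw [hl k hk, hn]; exact hval k (by omega)
    obtain ⟨r₁, tF, hQ₁, htF, hF₁, hres⟩ := hF σ.reg n (2 * P + 2) m B (6 * P) h10 h11 h12 h13 h14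
      (by omega) (by omega) (by omega) (fun j hj => hz j (by omega) (by omega)) hlit
      (fun i hi => hz _ (by omega) (by omega))
    have hQ₂ := Frag.quiet_ops_bound [.const 2 0] (by simp [Instr.Writes]) r₁ 1 (by simp [boundOps])
    obtain ⟨r₂, hr₂⟩ : ∃ r₂, r₂ = evalOps [.const 2 0] r₁ := ⟨_, rfl⟩
    rw [← hr₂] at hQ₂
    have e2 : r₂ 2 = 0 := by rw [hr₂]; rfl
    have hF₂ : ∀ j, 10 ≤ j → r₂ j = r₁ j := by
      intro j hj
      rw [hr₂]
      simp only [evalOps, Instr.eval, Function.update_apply, reduceIte, Nat.reduceEqDiff,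
        Nat.reduceLT, addr_ne hj]
    have e15 : r₂ 15 = r₁ 15 := hF₂ 15 (by omega)
    have hF₂' : ∀ j, 10 ≤ j → j < B → (j < 15 ∨ 20 ≤ j) → (j < 6 * P ∨ 6 * P + n ≤ j) →
        r₂ j = σ.reg j := fun j h1 h2 h3 h4 => by rw [hF₂ j h1, hF₁ j h1 h2 h3 h4]
    have hFT : ∀ j, Y + n + n + 1 ≤ j → j < B → r₂ j = 0 := fun j h1 h2 => by
      rw [hF₂' j (by omega) h2 (by omega) (by omega), hz j (by omega) (by omega)]
    obtain ⟨t₂, ht₂, hE₂⟩ := (hQ₁.append hQ₂).exec (σ := σ.tick (logCost (σ.reg 31) (σ.reg 30))) rfl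
    have hlt : σ.reg 31 < σ.reg 30 := by omega
    have hcost2 := logCost_le (r₂ 2) (r₂ 15)
    rcases hres with ⟨h1, hbit, hsat⟩ | ⟨h0, hunsat⟩
    · have hF₂l : ∀ k < 3 * m, r₂ (2 * P + 2 + k) = σ.reg (2 * P + 2 + k) := fun k hk =>
        hF₂' _ (by omega) (by omega) (by omega) (by omega)
      obtain ⟨c, hc⟩ : ∃ c, c = logCost (r₂ 2) (r₂ 15) := ⟨_, rfl⟩
      rw [← hc] at hcost2
      have hQ₃ := Frag.quiet_ops_bound [.const 25 0] (by simp [Instr.Writes]) r₂ 1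
        (by simp [boundOps])
      obtain ⟨r₃, hr₃⟩ : ∃ r₃, r₃ = evalOps [.const 25 0] r₂ := ⟨_, rfl⟩
      rw [← hr₃] at hQ₃
      have e25 : r₃ 25 = 0 := by rw [hr₃]; rfl
      have hF₃ : ∀ j, j ≠ 25 → r₃ j = r₂ j := by
        intro j hj
        rw [hr₃]
        simp only [evalOps, Instr.eval, Function.update_apply, reduceIte, Nat.reduceEqDiff,
          Nat.reduceLT, hj]
      have hF₃' : ∀ j, 10 ≤ j → j < B → j ≠ 25 → (j < 15 ∨ 20 ≤ j) → (j < 6 * P ∨ 6 * P + n ≤ j) →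
          r₃ j = σ.reg j := fun j h1 h2 h3 h4 h5 => by rw [hF₃ j h3, hF₂' j h1 h2 h4 h5]
      have f : ∀ j, 10 ≤ j → j < 32 → j ≠ 25 → (j < 15 ∨ 20 ≤ j) → r₃ j = σ.reg j :=
        fun j h1 h2 h3 h4 => hF₃' j h1 (by omega) h3 h4 (by omega)
      obtain ⟨t₃, ht₃, hE₃⟩ := hQ₃.exec
        (σ := ⟨r₂, (σ.tick (logCost (σ.reg 31) (σ.reg 30))).time + t₂ + c, σ.log⟩) rfl
      have hlits : ∀ k < 3 * m, r₃ (2 * P + 2 + k) = σ.reg (2 * P + 2 + k) := fun k hk => by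
        rw [hF₃ _ (by omega), hF₂l k hk]
      have hsat₃ : SatBy m (fun k => r₃ (2 * P + 2 + k)) fun i => r₁ (6 * P + i) ≠ 0 :=
        (satBy_congr (n := n) hlit (fun k hk => (hlits k hk).symm) fun i _ => Iff.rfl).1 hsat
      obtain ⟨σ₄, g, hE₄, hF₄, hF₄', hlog, hwords, htl, htime⟩ := Frag.exec_listSolutions
        ⟨r₃, (σ.tick (logCost (σ.reg 31) (σ.reg 30))).time + t₂ + c + t₃, σ.log⟩ n m (2 * P + 2) (6 * P)
        (6 * P + n) Y B (B + 2 * n) (fun i => r₁ (6 * P + i))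
        ((f 10 (by omega) (by omega) (by omega) (by omega)).trans h10)
        ((f 11 (by omega) (by omega) (by omega) (by omega)).trans h11)
        ((f 12 (by omega) (by omega) (by omega) (by omega)).trans h12)
        ((f 13 (by omega) (by omega) (by omega) (by omega)).trans h13)
        ((f 14 (by omega) (by omega) (by omega) (by omega)).trans h14)
        ((f 20 (by omega) (by omega) (by omega) (by omega)).trans h20)
        ((f 21 (by omega) (by omega) (by omega) (by omega)).trans h21)
        ((f 22 (by omega) (by omega) (by omega) (by omega)).trans h22)
        ((f 29 (by omega) (by omega) (by omega) (by omega)).trans h29)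
        ((f 30 (by omega) (by omega) (by omega) (by omega)).trans h30) e25 (by omega) (by omega)
        (by omega) (by omega) (by omega) le_rfl
        (fun k hk => by simp only; rw [hlits k hk]; exact hlit k hk)
        (fun i hi => by simp only; rw [hF₃ _ (by omega), hF₂ _ (by omega)]) hbit
        ((hF₃' Y (by omega) (by omega) (by omega) (by omega) (by omega)).trans hY1)
        (fun i hi => (hF₃' (Y + 1 + n + i) (by omega) (by omega) (by omega) (by omega)
          (by omega)).trans (hz _ (by omega) (by omega)))
        (fun i hi => (hF₃' (6 * P + n + i) (by omega) (by omega) (by omega) (by omega)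
          (by omega)).trans (hz _ (by omega) (by omega))) hsat₃
      rw [← hτ] at htl htime
      have hE₅ := Frag.exec_ifLt_true (s := 2) (t := 15) (G := Frag.ops [])
        (σ := ⟨r₂, (σ.tick (logCost (σ.reg 31) (σ.reg 30))).time + t₂, σ.log⟩)
        (by simp only; omega) (by simp only [Store.tick, ← hc]; exact hE₃.append hE₄)
      have hE₆ := Frag.exec_ifLt_true (s := 31) (t := 30) (G := Frag.ops []) hlt (hE₂.append hE₅)
      simp only [Store.tick] at htl htime
      refine ⟨σ₄, g, tF, hE₆, htF, fun i h2 h3 => ?_, ⟨?_, ?_⟩, hlog, Or.inr ⟨hval, _, hbit, ?_, ?_⟩,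
        htl.mono fun i => ?_, ?_⟩
      · exact (hF₄ i (by omega) h3 (by omega)).trans ((hF₃ i (by omega)).trans (hFT i h2 h3))
      · exact (hF₄' 23 (by omega) (by omega)).trans
          (f 23 (by omega) (by omega) (by omega) (by omega))
      · exact (hF₄ 28 (by omega) (by omega) (by omega)).trans
          (f 28 (by omega) (by omega) (by omega) (by omega))
      · exact (satBy_congr (n := n) hlit hl fun i _ => Iff.rfl).1 hsat
      · rw [hwords]
        refine List.flatMap_congr fun j _ => ?_
        exact (solutionsAt_congr _ j hlit hlits).trans (solutionsAt_congr _ j hlit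
          fun k hk => (hl k hk).symm).symm
      · have h2 : τ * (2 * i + 5) = τ * (2 * i + 4) + τ := by ring
        rw [h2]
        omega
      · have h2 : τ * (2 * g.length + 2) = τ * (2 * g.length + 1) + τ := by ring
        rw [h2]
        omega
    · have hQ₃ := Frag.quiet_ifLt_false (s := 2) (t := 15)
        (F := Frag.ops [.const 25 0] ++ Frag.listSolutions) (r := r₂) (by omega)
        (Frag.quiet_ops_bound [] (by simp) r₂ 0 le_rfl)
      obtain ⟨t₃, ht₃, hE₃⟩ := hQ₃.exec
        (σ := ⟨r₂, (σ.tick (logCost (σ.reg 31) (σ.reg 30))).time + t₂, σ.log⟩) rfl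
      have hE₆ := Frag.exec_ifLt_true (s := 31) (t := 30) (G := Frag.ops []) hlt (hE₂.append hE₃)
      refine ⟨_, [], tF, hE₆, htF, hFT, ⟨?_, ?_⟩, (List.append_nil _).symm, Or.inl ⟨rfl, fun _ p hp => ?_⟩,
        fun i hi => by simp at hi, ?_⟩
      · exact hF₂' 23 (by omega) (by omega) (by omega) (by omega)
      · exact hF₂' 28 (by omega) (by omega) (by omega) (by omega)
      · exact hunsat p ((satBy_congr (n := n) hlit hl fun i _ => Iff.rfl).2 hp)
      · simp only [Store.tick, List.length_nil]
        omega
  · have hQ₃ := Frag.quiet_ifLt_false (s := 31) (t := 30) (F := F ++ Frag.ops [.const 2 0] ++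
      Frag.ifLt 2 15 (Frag.ops [.const 25 0] ++ Frag.listSolutions) (Frag.ops []))
      (r := σ.reg) (by rw [← h31'] at hval; omega) (Frag.quiet_ops_bound [] (by simp) σ.reg 0 le_rfl)
    obtain ⟨t₃, ht₃, hE₃⟩ := hQ₃.exec (σ := σ) rfl
    refine ⟨_, [], 0, hE₃, by simp only [Nat.cast_zero]; positivity, fun i h1 _ => hz i (by omega) (by omega),
      ⟨rfl, rfl⟩, (List.append_nil _).symm, Or.inl ⟨rfl, fun h => absurd h hval⟩,
      fun i hi => by simp at hi, ?_⟩
    simp only [List.length_nil]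
    omega

/-- The result of the enumeration algorithm. The time of the search, `tF`, delays only the outputs from
number `2 ^ tt` on. -/
theorem Frag.exec_enumerate {F : Frag} {δ : ℝ} {C d : ℕ} (hF : F.Searches δ C d) (q u v : ℕ)
    (x : Word q) (w : List ℕ) (hw : w = (Word.code x).tail) (n m tt K : ℕ) (hn : n = v * numAt w 0)
    (hm : m = numAt w 1) (htt : tt = u * numAt w 0)
    (hK : K = (u + v + q + 1) * (32 * (x.length + 1))) :
    ∃ (c : Config) (L : List (List ℕ)) (tF : ℕ),
      HaltsWith ((Frag.enumerate u v F).code 0) (Word.code x) c ∧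
      (tF : ℝ) ≤ C * (2 : ℝ) ^ (δ * n) * ((20 * (K + 1) : ℕ) : ℝ) ^ d ∧
      IsListing n m w v L ∧
      c.log.map Prod.fst =
        (List.range' 1 (2 ^ tt - 1)).map (fun k => 0 :: bits tt k) ++ L ++ [0 :: bits tt 0] ∧
      (∀ e ∈ c.log.getLast?, e.2 = c.time) ∧
      TimedLog (fun i => 2000000 * (K + 1) ^ 2 * (2 * i + 12) + if i + 1 < 2 ^ tt then 0 else tF)
        c.log := by
  obtain ⟨P, hP⟩ : ∃ P, P = 32 * (x.length + 1) := ⟨_, rfl⟩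
  obtain ⟨Y, hY⟩ : ∃ Y, Y = 6 * P + n + n := ⟨_, rfl⟩
  rw [← hP] at hK
  obtain ⟨r₁, hQ₁, hnK, htK, hmP, hPK, e10, e11, e12, e13, e14, e20, e21, e22, e23, e25, e26, e27, e28,
    e29, e30, e31, e31', hlit, eY, hz, hb, hv⟩ := Frag.quiet_prepare q u v x w hw P n m tt K Y hP hn hm
    htt hK hY
  obtain ⟨t₁, ht₁, hE₁⟩ := hQ₁ 0 []
  obtain ⟨θ, hθ⟩ : ∃ θ, θ = 2000000 * (K + 1) ^ 2 := ⟨_, rfl⟩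
  have h2t : 1 ≤ 2 ^ tt := Nat.one_le_two_pow
  obtain ⟨σ₂, g₁, hE₂, hF₂, hZ₂, hlog₂, hwords₂, htl₂, htime₂⟩ := Frag.exec_outputLoop (fl := 25)
    (s := 23) (t := 28) (a := 27) (b := 26) (X := Y + n + n + 1) (p := 1) (n := tt)
    (M := 13 * K + 12) (k₀ := 1) ⟨r₁, 0 + t₁, []⟩ (by omega) (by omega) (by omega) (by omega) (by omega)
    (by omega) e23 (by simp only; omega) e27 e26 e30 (by omega) (by omega) h2t e25 hb hv
  have hg₁ : g₁.length = 2 ^ tt - 1 := by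
    have := congrArg List.length hwords₂
    simpa using this
  have f : ∀ j, 10 ≤ j → j < 32 → j ≠ 17 → j ≠ 18 → j ≠ 25 → σ₂.reg j = r₁ j :=
    fun j h1 h2 h3 h4 h5 => hF₂ j h1 h3 h4 h5 (by omega)
  obtain ⟨σ₃, g₂, tF, hE₃, htF, hT₃, ⟨e23', e28'⟩, hlog₃, hL, htl₃, htime₃⟩ :=
    Frag.exec_searchList hF σ₂ v w P n m Y (Y + n + n + 1 + tt + 1) (by omega) hmP hn hm hY (by omega)
    ((f 10 (by omega) (by omega) (by omega) (by omega) (by omega)).trans e10)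
    ((f 11 (by omega) (by omega) (by omega) (by omega) (by omega)).trans e11)
    ((f 12 (by omega) (by omega) (by omega) (by omega) (by omega)).trans e12)
    ((f 13 (by omega) (by omega) (by omega) (by omega) (by omega)).trans e13)
    ((f 14 (by omega) (by omega) (by omega) (by omega) (by omega)).trans e14)
    ((f 20 (by omega) (by omega) (by omega) (by omega) (by omega)).trans e20)
    ((f 21 (by omega) (by omega) (by omega) (by omega) (by omega)).trans e21)
    ((f 22 (by omega) (by omega) (by omega) (by omega) (by omega)).trans e22)
    ((f 29 (by omega) (by omega) (by omega) (by omega) (by omega)).trans e29)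
    ((f 30 (by omega) (by omega) (by omega) (by omega) (by omega)).trans e30)
    (by rw [f 31 (by omega) (by omega) (by omega) (by omega) (by omega)]; exact e31)
    (by rw [f 31 (by omega) (by omega) (by omega) (by omega) (by omega)]; exact e31')
    (fun k hk => (hF₂ (2 * P + 2 + k) (by omega) (by omega) (by omega) (by omega) (by omega)).trans
      (hlit k hk))
    ((hF₂ Y (by omega) (by omega) (by omega) (by omega) (by omega)).trans eY)
    (fun j h1 h2 => by
      by_cases h : j < Y + n + n + 1 + 1 ∨ Y + n + n + 1 + 1 + tt ≤ j
      · exact (hF₂ j (by omega) (by omega) (by omega) (by omega) h).trans (hz j h1 h2 h)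
      · obtain ⟨i, rfl⟩ : ∃ i, j = Y + n + n + 1 + 1 + i := ⟨j - (Y + n + n + 1 + 1), by omega⟩
        exact hZ₂ i (by omega))
  have hE₄ := Frag.exec_output 23 28 σ₃
  -- The digits of the trivial solution are all `0` once its counter has overflowed.
  have hblk : block σ₃.reg (σ₃.reg 23) (σ₃.reg 28) = 0 :: bits tt 0 := by
    rw [e23', e28', f 23 (by omega) (by omega) (by omega) (by omega) (by omega),
      f 28 (by omega) (by omega) (by omega) (by omega) (by omega), e23, e28, block,
      show Y + n + n + 1 + tt + 1 - (Y + n + n + 1) = tt + 1 by omega]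
    refine List.ext_getElem (by simp [bits]) fun i h1 h2 => ?_
    simp only [List.length_map, List.length_range'] at h1
    rw [List.getElem_map, List.getElem_range', one_mul, hT₃ _ (by omega) (by omega)]
    rcases i with _ | i
    · rfl
    · simp [bits]
  rw [hblk] at hE₄
  have hlog : σ₃.log = g₁ ++ g₂ := by rw [hlog₃, hlog₂, List.nil_append]
  rw [hlog] at hE₄
  have hE : (Frag.enumerate u v F).Exec ⟨(init (Word.code x)).reg, 0, []⟩ _ :=
    ((hE₁.append hE₂).append hE₃).append hE₄
  simp only [zero_add] at htl₂ htime₂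
  have hM : (13 * K + 12 + 1) ^ 2 ≤ _ := sq_le_of_le_mul (a := 13) (K := K) (by omega)
  have hB : (Y + n + n + 1 + tt + 1 + 2 * n + 1) ^ 2 ≤ _ :=
    sq_le_of_le_mul (a := 20) (K := K) (by omega)
  have hθ₁ : 200 * (13 * K + 12 + 1) ^ 2 ≤ θ := by omega
  have hθ₂ : 2000 * (Y + n + n + 1 + tt + 1 + 2 * n + 1) ^ 2 ≤ θ := by omega
  have hT₂ : σ₂.time ≤ θ + θ * 2 ^ tt := by
    have h1 := Nat.mul_le_mul_right (2 ^ tt - 1 + 1) hθ₁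
    rw [Nat.sub_add_cancel h2t] at h1 htime₂
    omega
  refine ⟨_, g₂.map Prod.fst, tF, hE.haltsWith, htF.trans ?_, hL, ?_, ?_, ?_⟩
  · have h1 : ((Y + n + n + 1 + tt + 1 : ℕ) : ℝ) + 1 ≤ ((20 * (K + 1) : ℕ) : ℝ) := by
      exact_mod_cast (show Y + n + n + 1 + tt + 1 + 1 ≤ 20 * (K + 1) by omega)
    gcongr
  · simp only [Store.config, List.map_append, hwords₂, List.map_cons, List.map_nil]
    congr 2
    refine List.map_congr_left fun k _ => ?_
    have h1 := hz (Y + n + n + 1) (by omega) (by omega) (Or.inl (by omega))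
    simp [h1]
  · simp [Store.config]
  · rw [← hθ]
    simp only [Store.config]
    refine TimedLog.append (TimedLog.append (g := g₁) ?_ htl₃ fun i hi => ?_)
      (timedLog_singleton (β := fun _ => σ₃.time + 1) le_rfl) fun i hi => ?_
    · intro i hi
      have h1 := Nat.mul_le_mul_right (i + 1) hθ₁
      have h2 := htl₂ i hi
      have h3 : θ * (2 * i + 12) = θ * (i + 1) + θ * i + 11 * θ := by ring
      simp only at h2
      exact le_add_right (by omega)
    · rw [hg₁, if_neg (by omega)]
      have h1 := Nat.mul_le_mul_right (2 * i + 5) hθ₂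
      have h3 : θ * (2 * (2 ^ tt - 1 + i) + 12) = θ * (2 ^ tt - 1 + 1) + θ * (2 ^ tt - 1) +
        θ * (2 * i + 5) + 6 * θ := by ring
      rw [Nat.sub_add_cancel h2t] at h3
      omega
    · simp only [List.length_singleton, Nat.lt_one_iff] at hi
      rw [hi, List.length_append, hg₁, if_neg (by omega)]
      have h1 := Nat.mul_le_mul_right (2 * g₂.length + 2) hθ₂
      have h3 : θ * (2 * (2 ^ tt - 1 + g₂.length + 0) + 12) = θ * (2 ^ tt - 1 + 1) +
        θ * (2 ^ tt - 1) + θ * (2 * g₂.length + 2) + 9 * θ := by ring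
      rw [Nat.sub_add_cancel h2t] at h3
      have h4 : 1 ≤ (K + 1) ^ 2 := Nat.one_le_pow _ _ (by omega)
      omega

theorem exists_eq_bits {z : List ℕ} (hz : ∀ a ∈ z, a < 2) : ∃ k < 2 ^ z.length, z = bits z.length k := by
  have h1 : ∀ i < z.length, z.getD i 0 ≤ 1 := by
    intro i hi
    rw [List.getD_eq_getElem _ _ hi]
    exact Nat.lt_succ_iff.1 (hz _ (List.getElem_mem hi))
  refine ⟨_, binVal_lt h1, ?_⟩
  rw [← map_eq_bits h1 rfl]
  refine List.ext_getElem (by simp) fun i hi _ => ?_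
  rw [List.getElem_map, List.getElem_range, List.getD_eq_getElem _ _ hi]

theorem flipBits_le_one {V : ℕ → ℕ} {i : ℕ} (hV : V i ≤ 1) (j : ℕ) : flipBits V j i ≤ 1 := by
  have : j / 2 ^ i % 2 < 2 := Nat.mod_lt _ (by norm_num)
  unfold flipBits
  omega

theorem exists_flipBits_eq {n : ℕ} {V f : ℕ → ℕ} (hV : ∀ i < n, V i ≤ 1) (hf : ∀ i < n, f i ≤ 1) :
    ∃ j < 2 ^ n, ∀ i < n, flipBits V j i = f i := by
  -- In truncated subtraction, `V i - f i + (f i - V i)` is the exclusive or of two bits: the digits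
  -- of the required `j`.
  have h1 : ∀ i < n, V i - f i + (f i - V i) ≤ 1 := fun i hi => by
    have := hV i hi; have := hf i hi; omega
  refine ⟨_, binVal_lt h1, fun i hi => ?_⟩
  have h2 := binVal_inj (g := fun i => binVal (fun i => V i - f i + (f i - V i)) n / 2 ^ i % 2) h1
    (fun i _ => by have := Nat.mod_lt (binVal (fun i => V i - f i + (f i - V i)) n / 2 ^ i)
                    (y := 2) (by norm_num); omega)
    (binVal_bits n _ (binVal_lt h1)).symm i hi
  have := hV i hi
  have := hf i hi
  rw [flipBits, ← h2]
  omega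

theorem flipBits_inj {n : ℕ} {V : ℕ → ℕ} (hV : ∀ i < n, V i ≤ 1) {j j' : ℕ} (hj : j < 2 ^ n)
    (hj' : j' < 2 ^ n) (h : ∀ i < n, flipBits V j i = flipBits V j' i) : j = j' := by
  refine bits_inj hj hj' (List.map_congr_left fun i hi => ?_)
  have h1 := h i (List.mem_range.1 hi)
  have h2 := hV i (List.mem_range.1 hi)
  have h3 : j / 2 ^ i % 2 < 2 := Nat.mod_lt _ (by norm_num)
  have h4 : j' / 2 ^ i % 2 < 2 := Nat.mod_lt _ (by norm_num)
  unfold flipBits at h1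
  omega

theorem mem_solutionsAt {n m : ℕ} {l V : ℕ → ℕ} {j : ℕ} {y : List ℕ} :
    y ∈ solutionsAt n m l V j ↔ SatBy m l (fun i => flipBits V j i ≠ 0) ∧
      ∃ k < 2 ^ n, (1 :: (List.range n).map (flipBits V j)) ++ bits n k = y := by
  unfold solutionsAt
  split_ifs with h
  · simp only [h, true_and, List.mem_map, List.mem_range'_1, zero_le, Nat.sub_zero, zero_add]
  · simp [h]

theorem nodup_flatMap_solutionsAt {n m : ℕ} {l V : ℕ → ℕ} (hV : ∀ i < n, V i ≤ 1) :
    ((List.range (2 ^ n)).flatMap (solutionsAt n m l V)).Nodup := by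
  rw [List.nodup_flatMap]
  constructor
  · intro j _
    unfold solutionsAt
    split_ifs
    · refine List.Nodup.map_on (fun k hk k' hk' h => ?_) List.nodup_range'
      simp only [List.mem_range'_1, Nat.sub_zero, zero_add] at hk hk'
      exact bits_inj hk.2 hk'.2 (List.append_cancel_left h)
    · exact List.nodup_nil
  · refine List.Pairwise.imp_of_mem (fun {j j'} hj hj' hne => ?_) List.nodup_range
    intro y hy hy'
    obtain ⟨-, k, -, h⟩ := mem_solutionsAt.1 hy
    obtain ⟨-, k', -, h'⟩ := mem_solutionsAt.1 hy'
    refine hne (flipBits_inj hV (List.mem_range.1 hj) (List.mem_range.1 hj') ?_)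
    have h2 := (List.append_inj (h.trans h'.symm) (by simp)).1
    simpa using h2

theorem IsListing.nodup {n m v : ℕ} {w : List ℕ} {L : List (List ℕ)} (h : IsListing n m w v L) :
    L.Nodup := by
  rcases h with ⟨rfl, -⟩ | ⟨-, V, hV, -, rfl⟩
  · exact List.nodup_nil
  · exact nodup_flatMap_solutionsAt hV

theorem IsListing.mem_iff {n m v : ℕ} {w : List ℕ} {L : List (List ℕ)} (h : IsListing n m w v L)
    (hn : n = v * numAt w 0) (hm : m = numAt w 1) (y : List ℕ) :
    y ∈ L ↔ (∀ a ∈ y, a < 2) ∧ y.length = 2 * n + 1 ∧ y.getD 0 0 = 1 ∧ ValidFormula v w ∧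
      SatBy m (fun k => numAt w (2 + k)) fun i => y.getD (1 + i) 0 ≠ 0 := by
  rcases h with ⟨rfl, h⟩ | ⟨hval, V, hV, -, rfl⟩
  · simp only [List.not_mem_nil, false_iff]
    rintro ⟨-, -, -, h1, h2⟩
    exact h h1 _ h2
  · have hlit : ∀ k < 3 * m, numAt w (2 + k) < 2 * n := fun k hk => by
      rw [hn]; exact hval k (by omega)
    rw [List.mem_flatMap]
    constructor
    · rintro ⟨j, -, hy⟩
      obtain ⟨hsat, k, hk, rfl⟩ := mem_solutionsAt.1 hy
      refine ⟨?_, by simp [length_bits]; ring, rfl, hval,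
        (satBy_congr (n := n) hlit (fun _ _ => rfl) fun i hi => ?_).1 hsat⟩
      · intro a ha
        rcases List.mem_append.1 ha with ha | ha
        · rcases List.mem_cons.1 ha with rfl | ha
          · norm_num
          · obtain ⟨i, hi, rfl⟩ := List.mem_map.1 ha
            exact Nat.lt_succ_iff.2 (flipBits_le_one (hV i (List.mem_range.1 hi)) j)
        · exact bits_lt n k a ha
      · rw [add_comm 1 i, List.getD_append _ _ _ _ (by simpa using hi), List.getD_cons_succ,
          List.getD_eq_getElem _ _ (by simpa using hi), List.getElem_map, List.getElem_range]
    · rintro ⟨hb, hlen, h1, -, hsat⟩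
      obtain ⟨a, z, rfl⟩ : ∃ a z, y = a :: z := by
        cases y with
        | nil => simp at hlen
        | cons a z => exact ⟨a, z, rfl⟩
      rw [List.getD_cons_zero] at h1
      subst h1
      have hz : z.length = n + n := by simp at hlen; omega
      have hzb : ∀ i < n + n, z.getD i 0 ≤ 1 := fun i hi => by
        rw [List.getD_eq_getElem _ _ (by omega)]
        exact Nat.lt_succ_iff.1 (hb _ (List.mem_cons_of_mem _ (List.getElem_mem _)))
      obtain ⟨j, hj, hjf⟩ := exists_flipBits_eq hV (f := fun i => z.getD i 0)
        fun i hi => hzb i (by omega)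
      obtain ⟨k, hk, hkz⟩ := exists_eq_bits (z := z.drop n)
        fun a ha => hb a (List.mem_cons_of_mem _ (List.mem_of_mem_drop ha))
      rw [List.length_drop, hz, Nat.add_sub_cancel] at hk hkz
      refine ⟨j, List.mem_range.2 hj, mem_solutionsAt.2 ⟨?_, k, hk, ?_⟩⟩
      · refine (satBy_congr (n := n) hlit (fun _ _ => rfl) fun i hi => ?_).1 hsat
        rw [hjf i hi, add_comm 1 i, List.getD_cons_succ]
      · rw [← hkz, List.cons_append]
        congr 1
        conv_rhs => rw [← List.take_append_drop n z]
        congr 1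
        refine List.ext_getElem (by simp [hz]) fun i h1 h2 => ?_
        have hi : i < n := by simpa using h1
        rw [List.getElem_map, List.getElem_range, List.getElem_take, hjf i hi,
          List.getD_eq_getElem]

/-- The output of `Frag.enumerate` consists of all the solutions, without repetitions. -/
theorem IsListing.nodup_and_mem {u v n m tt : ℕ} {w : List ℕ} {L : List (List ℕ)}
    (h : IsListing n m w v L) (hn : n = v * numAt w 0) (hm : m = numAt w 1) (htt : tt = u * numAt w 0) :
    ((List.range' 1 (2 ^ tt - 1)).map (fun k => 0 :: bits tt k) ++ L ++ [0 :: bits tt 0]).Nodup ∧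
    ∀ y, y ∈ (List.range' 1 (2 ^ tt - 1)).map (fun k => 0 :: bits tt k) ++ L ++ [0 :: bits tt 0] ↔
      IsSolution u v w y := by
  have h2t : 1 ≤ 2 ^ tt := Nat.one_le_two_pow
  have hL0 : ∀ z, 0 :: z ∉ L := fun z hz => by
    have := ((h.mem_iff hn hm _).1 hz).2.2.1
    simp at this
  have hr : ∀ k, k ∈ List.range' 1 (2 ^ tt - 1) ↔ 1 ≤ k ∧ k < 2 ^ tt := fun k => by
    rw [List.mem_range'_1, Nat.add_sub_cancel' h2t]
  constructor
  · refine List.Nodup.append (List.Nodup.append ?_ h.nodup ?_) (List.nodup_singleton _) ?_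
    · refine List.Nodup.map_on (fun k hk k' hk' h => ?_) List.nodup_range'
      exact bits_inj ((hr k).1 hk).2 ((hr k').1 hk').2 (List.cons_injective h)
    · intro y hy hy'
      obtain ⟨k, -, rfl⟩ := List.mem_map.1 hy
      exact hL0 _ hy'
    · intro y hy hy'
      rw [List.mem_singleton] at hy'
      subst hy'
      rcases List.mem_append.1 hy with hy | hy
      · obtain ⟨k, hk, h⟩ := List.mem_map.1 hy
        have := bits_inj ((hr k).1 hk).2 h2t (List.cons_injective h)
        have := ((hr k).1 hk).1
        omega
      · exact hL0 _ hy
  · intro y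
    have hbits : (∀ i < y.length, y.getD i 0 < 2) ↔ ∀ a ∈ y, a < 2 := by
      rw [List.forall_mem_iff_getElem]
      exact forall_congr' fun i => forall_congr' fun hi => by rw [List.getD_eq_getElem _ _ hi]
    rw [IsSolution, hbits, ← hn, ← hm, ← htt, List.mem_append, List.mem_append, h.mem_iff hn hm,
      List.mem_singleton, List.mem_map]
    constructor
    · have h0 : ∀ k, (∀ a ∈ 0 :: bits tt k, a < 2) ∧
          (0 :: bits tt k).length = tt + 1 ∧ (0 :: bits tt k).getD 0 0 = 0 := by
        refine fun k => ⟨fun a ha => ?_, by simp [length_bits], rfl⟩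
        rcases List.mem_cons.1 ha with rfl | ha
        · norm_num
        · exact bits_lt _ _ _ ha
      rintro ((⟨k, -, rfl⟩ | ⟨h1, h2⟩) | rfl)
      · exact ⟨(h0 k).1, Or.inl (h0 k).2⟩
      · exact ⟨h1, Or.inr h2⟩
      · exact ⟨(h0 0).1, Or.inl (h0 0).2⟩
    · rintro ⟨hb, ⟨hlen, h0⟩ | h2⟩
      · obtain ⟨a, z, rfl⟩ : ∃ a z, y = a :: z := by
          cases y with
          | nil => simp at hlen
          | cons a z => exact ⟨a, z, rfl⟩
        rw [List.getD_cons_zero] at h0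
        subst h0
        obtain ⟨k, hk, hkz⟩ := exists_eq_bits fun a ha => hb a (List.mem_cons_of_mem _ ha)
        have hz : z.length = tt := by simpa using hlen
        rw [hz] at hk hkz
        rcases Nat.eq_zero_or_pos k with rfl | hk1
        · exact Or.inr (by rw [hkz])
        · exact Or.inl (Or.inl ⟨k, (hr k).2 ⟨hk1, hk⟩, by rw [hkz]⟩)
      · exact Or.inl (Or.inr ⟨hb, h2⟩)

/-- Machines are deterministic. -/
theorem HaltsWith.unique {Q : Program} {w : List ℕ} {c c' : Config} (h : HaltsWith Q w c)
    (h' : HaltsWith Q w c') : c = c' :=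
  Part.mem_unique (StateTransition.mem_eval.2 h) (StateTransition.mem_eval.2 h')

theorem exists_map_code_eq {q : ℕ} (L : List (List ℕ)) (h : ∀ l ∈ L, ∀ a ∈ l, a < q) :
    ∃ ys : List (Word q), ys.map Word.code = L := by
  induction L with
  | nil => exact ⟨[], rfl⟩
  | cons l L ih =>
    obtain ⟨ys, hys⟩ := ih fun l hl => h l (by simp [hl])
    obtain ⟨y, hy⟩ := exists_code_eq l (h l (by simp))
    exact ⟨y :: ys, by rw [List.map_cons, hys, hy]⟩

theorem solves_enumerate {F : Frag} {δ : ℝ} {C d : ℕ} (hF : F.Searches δ C d) {q : ℕ} (hq : 2 ≤ q)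
    (u v : ℕ) : Solves ((Frag.enumerate u v F).code 0) (padded q u v) := by
  intro x
  obtain ⟨c, L, tF, hH, -, hL, hlog, hlast, -⟩ := Frag.exec_enumerate hF q u v x _ rfl _ _ _ _ rfl rfl
    rfl rfl
  obtain ⟨hnd, hmem⟩ := hL.nodup_and_mem (u := u) rfl rfl rfl
  rw [← hlog] at hnd hmem
  obtain ⟨ys, hys⟩ := exists_map_code_eq (q := q) (c.log.map Prod.fst) (by
    intro l hl a ha
    obtain ⟨i, hi, rfl⟩ := List.getElem_of_mem ha
    have := ((hmem l).1 hl).1 i hi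
    rw [List.getD_eq_getElem _ _ hi] at this
    omega)
  rw [← hys] at hnd hmem
  refine ⟨c, ys, hH, hys.symm, List.Nodup.of_map _ hnd, fun y => ?_, hlast⟩
  have := hmem (Word.code y)
  rwa [List.mem_map_of_injective Word.code_injective] at this

/-- The time until the `k`-th output. The search is over before the output number `2 ^ (u ρ)`, where
`v ρ` is the number of variables, and it takes time about `2 ^ (δ v ρ)`, which is at most `k ^ b` by
the choice of `u` and `v`. -/
theorem outTime_enumerate {F : Frag} {δ : ℝ} {C d : ℕ} (hF : F.Searches δ C d) (q : ℕ) {u v : ℕ}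
    {b : ℝ} (hb : 1 ≤ b) (hδ : δ * v ≤ b * u) :
    ∃ E : ℕ, ∀ (x : Word q) (c : Config), HaltsWith ((Frag.enumerate u v F).code 0) (Word.code x) c →
      1 ≤ c.log.length ∧ ∀ k, 1 ≤ k → k ≤ c.log.length →
        (outTime c k : ℝ) ≤ E * (k : ℝ) ^ b * ((x.length : ℝ) + 1) ^ (d + 2) := by
  obtain ⟨κ, hκ⟩ : ∃ κ, κ = 32 * (u + v + q + 1) + 1 := ⟨_, rfl⟩
  refine ⟨24000000 * κ ^ 2 + C * (20 * κ) ^ d, fun x c' hc' => ?_⟩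
  obtain ⟨ρ, hρ⟩ : ∃ ρ, ρ = numAt (Word.code x).tail 0 := ⟨_, rfl⟩
  obtain ⟨K, hK⟩ : ∃ K, K = (u + v + q + 1) * (32 * (x.length + 1)) := ⟨_, rfl⟩
  obtain ⟨c, L, tF, hH, htF, -, hlog, -, htl⟩ := Frag.exec_enumerate hF q u v x _ rfl (v * ρ) _ (u * ρ) K
    (by rw [hρ]) rfl (by rw [hρ]) hK
  rw [hc'.unique hH]
  refine ⟨by have := congrArg List.length hlog; simp at this; omega, fun k hk1 hk => ?_⟩
  obtain ⟨s, hs⟩ : ∃ s : ℝ, s = (x.length : ℝ) + 1 := ⟨_, rfl⟩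
  have hs1 : 1 ≤ s := by rw [hs]; linarith [Nat.cast_nonneg (α := ℝ) x.length]
  have hK' : ((K + 1 : ℕ) : ℝ) ≤ κ * s := by
    rw [hs]
    exact_mod_cast (show K + 1 ≤ κ * (x.length + 1) by rw [hK, hκ]; nlinarith)
  have hot : outTime c k = (c.log[k - 1]).2 := by
    simp [outTime, List.getElem?_eq_getElem (show k - 1 < c.log.length by omega)]
  have hT := htl (k - 1) (by omega)
  simp only [← hot, Nat.sub_add_cancel hk1] at hT
  have hk1' : (1 : ℝ) ≤ k := by exact_mod_cast hk1
  have hkb : (k : ℝ) ≤ (k : ℝ) ^ b := Real.self_le_rpow_of_one_le hk1' hb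
  obtain ⟨κb, hκb⟩ : ∃ z, z = (k : ℝ) ^ b := ⟨_, rfl⟩
  rw [← hκb] at hkb
  -- If the search precedes output `k`, then `2 ^ (u ρ) ≤ k`, and `k ^ b` pays for it.
  have hsearch : ((if k < 2 ^ (u * ρ) then 0 else tF : ℕ) : ℝ) ≤ C * κb * (20 * (κ * s)) ^ d := by
    split_ifs with h
    · rw [Nat.cast_zero]
      have : 0 ≤ κb := by linarith
      positivity
    · refine htF.trans ?_
      have h1 : (2 : ℝ) ^ (δ * (v * ρ : ℕ)) ≤ κb := by
        calc (2 : ℝ) ^ (δ * (v * ρ : ℕ)) ≤ 2 ^ (((u * ρ : ℕ) : ℝ) * b) := by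
              refine Real.rpow_le_rpow_of_exponent_le (by norm_num) ?_
              push_cast
              have := mul_le_mul_of_nonneg_right hδ (Nat.cast_nonneg (α := ℝ) ρ)
              linarith
          _ = ((2 : ℝ) ^ (u * ρ)) ^ b := by rw [Real.rpow_mul (by norm_num), Real.rpow_natCast]
          _ ≤ κb := by
              rw [hκb]
              refine Real.rpow_le_rpow (by positivity) ?_ (by linarith)
              exact_mod_cast Nat.le_of_not_lt h
      have h2 : ((20 * (K + 1) : ℕ) : ℝ) ≤ 20 * (κ * s) := by
        rw [Nat.cast_mul]
        exact mul_le_mul_of_nonneg_left hK' (by norm_num)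
      have h3 : 0 ≤ κb := by linarith
      gcongr
  have hT' : (outTime c k : ℝ) ≤ 2000000 * ((K + 1 : ℕ) : ℝ) ^ 2 * (12 * k) +
      ((if k < 2 ^ (u * ρ) then 0 else tF : ℕ) : ℝ) := by
    refine le_trans (Nat.cast_le.2 hT) ?_
    rw [Nat.cast_add]
    refine add_le_add_left ?_ _
    exact_mod_cast Nat.mul_le_mul_left _ (show 2 * (k - 1) + 12 ≤ 12 * k by omega)
  have h3 : s ^ 2 ≤ s ^ (d + 2) := pow_le_pow_right₀ hs1 (by omega)
  have h4 : s ^ d ≤ s ^ (d + 2) := pow_le_pow_right₀ hs1 (by omega)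
  rw [← hs, ← hκb]
  push_cast
  calc (outTime c k : ℝ) ≤ 2000000 * (κ * s) ^ 2 * (12 * κb) + C * κb * (20 * (κ * s)) ^ d := by
        refine hT'.trans (add_le_add ?_ hsearch)
        gcongr
    _ = 24000000 * κ ^ 2 * κb * s ^ 2 + C * (20 * κ) ^ d * κb * s ^ d := by
        rw [← mul_assoc 20, mul_pow _ s, mul_pow _ s]; ring
    _ ≤ 24000000 * κ ^ 2 * κb * s ^ (d + 2) + C * (20 * κ) ^ d * κb * s ^ (d + 2) := by
        have : 0 ≤ κb := by linarith
        gcongr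
    _ = _ := by ring

/-- A search algorithm yields an incremental algorithm for the padded problem. -/
theorem padded_mem_incP {q u v : ℕ} (hq : 2 ≤ q) {δ b : ℝ} (hb : 1 ≤ b) (hδ : δ * v ≤ b * u)
    (h : Search δ) : padded q u v ∈ IncP q b := by
  obtain ⟨F, C, d, hF⟩ := h
  obtain ⟨E, hE⟩ := outTime_enumerate hF q hb hδ
  refine ⟨padded_mem_enumP q u v, (Frag.enumerate u v F).code 0,
    Polynomial.C E * (Polynomial.X + 1) ^ (d + 2), E, d + 2, solves_enumerate hF hq u v,
    fun x c hc => ?_⟩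
  obtain ⟨h1, hT⟩ := hE x c hc
  refine ⟨?_, fun k hk1 hk => ?_⟩
  · have := hT 1 le_rfl h1
    rw [Nat.cast_one, Real.one_rpow, mul_one] at this
    simp only [Polynomial.eval_mul, Polynomial.eval_C, Polynomial.eval_pow, Polynomial.eval_add,
      Polynomial.eval_X, Polynomial.eval_one]
    exact_mod_cast this
  · have := hT k hk1 hk
    linarith [Nat.cast_nonneg (α := ℝ) (outTime c 1)]

theorem incP_mono (q : ℕ) {a b : ℝ} (hab : a ≤ b) : IncP q a ⊆ IncP q b := by
  rintro A ⟨hA, P, p, C, d, hP, hT⟩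
  refine ⟨hA, P, p, C, d, hP, fun x c hc => ⟨(hT x c hc).1, fun k hk1 hk => ?_⟩⟩
  refine ((hT x c hc).2 k hk1 hk).trans ?_
  have : (1 : ℝ) ≤ k := by exact_mod_cast hk1
  gcongr

/-- With `s` the infimum of the exponents of search algorithms, which is positive by the hypothesis,
the padding is chosen such that the exponent `a` would permit a search below `s`, while `b` permits
one slightly above `s`. -/
theorem incP_ssubset_incP (hETH : ETH) {q : ℕ} (hq : 2 ≤ q) {a b : ℝ} (ha : 1 ≤ a) (hab : a < b) :
    IncP q a ⊂ IncP q b := by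
  obtain ⟨ε, hε, hsat⟩ := hETH
  have hlow : ∀ δ, Search δ → ε < δ := fun δ hδ =>
    lt_of_not_ge fun hle => hsat ((hδ.mono hle).sat3InTime hε.le)
  have hbdd : BddBelow {δ | Search δ} := ⟨ε, fun δ hδ => (hlow δ hδ).le⟩
  have hne : {δ | Search δ}.Nonempty := ⟨1, Frag.bruteForce, _, _, Frag.searches_bruteForce⟩
  obtain ⟨s, hs⟩ : ∃ s, s = sInf {δ | Search δ} := ⟨_, rfl⟩
  have hs0 : 0 < s := hε.trans_le (hs ▸ le_csInf hne fun δ hδ => (hlow δ hδ).le)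
  have ha0 : 0 < a := by linarith
  have hb0 : 0 < b := by linarith
  -- The strict inequality `s < s b / a` leaves room for `δ` and then for the rational `r`.
  obtain ⟨δ, hδ, hδs⟩ : ∃ δ, Search δ ∧ δ < s * b / a := by
    refine (csInf_lt_iff hbdd hne).1 ?_
    rw [← hs, lt_div_iff₀ ha0]
    exact mul_lt_mul_of_pos_left hab hs0
  have hδ0 : 0 < δ := hε.trans (hlow δ hδ)
  obtain ⟨r, hr1, hr2⟩ := exists_rat_btwn (show δ / b < s / a by
    rw [div_lt_iff₀ hb0]
    calc δ < s * b / a := hδs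
      _ = s / a * b := by ring)
  have hr0 : 0 < r := by exact_mod_cast (div_pos hδ0 hb0).trans hr1
  obtain ⟨u, hu⟩ : ∃ u : ℕ, (u : ℤ) = r.num := ⟨_, Int.toNat_of_nonneg (Rat.num_pos.2 hr0).le⟩
  have hv0 : (0 : ℝ) < r.den := by exact_mod_cast r.den_pos
  have hr : (r : ℝ) = u / r.den := by
    rw [Rat.cast_def, ← hu, Int.cast_natCast]
  rw [hr] at hr1 hr2
  -- With `r = u / v`: from `δ / b < r` follows `δ v ≤ b u`, and from `r < s / a` follows `a u / v < s`.
  refine (Set.ssubset_iff_of_subset (incP_mono q hab.le)).2 ⟨padded q u r.den,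
    padded_mem_incP hq (by linarith) ?_ hδ, fun h => ?_⟩
  · rw [div_lt_div_iff₀ hb0 hv0] at hr1
    linarith
  · have h1 := csInf_le hbdd (search_of_mem_incP hq r.den_pos ha0.le h)
    rw [← hs, mul_div_assoc] at h1
    rw [lt_div_iff₀ ha0] at hr2
    linarith

end EnumComplexity

theorem mainTheorem1 (hETH : EnumComplexity.ETH) (q : ℕ) (hq : 2 ≤ q) (a b : ℝ)
    (ha : 1 ≤ a) (hab : a < b) :
    EnumComplexity.IncP q a ⊂ EnumComplexity.IncP q b :=
  EnumComplexity.incP_ssubset_incP hETH hq ha hab
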